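/- Write $\langle x\rangle=(1+x^2)^{1/2}$ and $\Delta=\partial_x^2$ on $\mathbb R$, and let $e^{-it\Delta}$ be the unitary group on $L^2(\mathbb R)$ for which $w(t)=e^{-it\Delta}w_0$ solves $i\partial_t w-\Delta w=0$, $w(0)=w_0$. All $x$-derivatives are weak derivatives. Theorem 1.1. Let $\sigma>2$, and let $V:[0,\infty)\times\mathbb R\to\mathbb C$, $(t,x)\mapsto V(x,t)$, be a measurable time-dependent potential such that, for some constant $C$, $$|V(x,t)|+|\langle x\rangle\,\partial_xV(x,t)|\le C\langle x\rangle^{-\sigma}\qquad\text{for almost all } t\ge 0,\ x\in\mathbb R .$$ Let $u\in C([0,\infty);L^2(\mathbb R))$ be a solution, in the sense of distributions, of $$i\partial_tu-\Delta u+Vu=0 \quad\text{on } [0,\infty)\times\mathbb R,\qquad\text{with}\quad \sup_{t\ge 0}\|u(t)\|_{H^1}<\infty ,$$ and let $\theta\in(0,1)$. Then there is $u_+\in H^1(\mathbb R)$ with the following two properties. (a) There is $u_{\mathrm{loc}}:[0,\infty)\to L^2(\mathbb R)$ such that $$u(t)=e^{-it\Delta}u_++u_{\mathrm{loc}}(t)+r(t)\quad(t\ge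 0),\qquad \lim_{t\to\infty}\|\partial_x r(t)\|_{L^2}=0,\qquad (*)$$ where $\partial_x r(t)\in L^2(\mathbb R)$ for every $t\ge0$, and $$\langle x\rangle^{\theta}\,\partial_xu_{\mathrm{loc}}\in L^\infty\big([0,\infty);L^2(\mathbb R)\big).$$ (b) If $n\ge 2$ is an integer and, for some constant $C'$, $$|\langle x\rangle^{k}\,\partial_x^kV(x,t)|\le C'\langle x\rangle^{-\sigma}\qquad\text{for } 1\le k\le n \text{ and almost all } t\ge 0,\ x\in\mathbb R,$$ then $u_{\mathrm{loc}}$ can be chosen, with the same $u_+$, so that $(*)$ holds and $$\langle x\rangle^{\theta k}\,\partial_x^ku_{\mathrm{loc}}\in L^\infty\big([0,\infty);L^2(\mathbb R)\big)\qquad\text{for } 1\le k\le n .$$ -/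

import Mathlib

open MeasureTheory Filter Topology Set
open scoped ENNReal FourierTransform ContDiff

namespace WeaklyBound

/-- The Japanese bracket `⟨x⟩ = (1 + x²)^{1/2}`. -/
noncomputable def jap (x : ℝ) : ℝ := √(1 + x ^ 2)

/-- The Hilbert space `L²(ℝ; ℂ)`. -/
abbrev L2 : Type := Lp ℂ 2 (volume : Measure ℝ)

/-- Lebesgue measure on the time half-line `[0, ∞)`. -/
noncomputable def timeMeasure : Measure ℝ := volume.restrict (Ici 0)

/-- `g` is the weak (distributional) derivative of order `k` of `f` on `ℝ`. -/
def HasWeakDeriv (k : ℕ) (f g : ℝ → ℂ) : Prop :=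
  LocallyIntegrable f ∧ LocallyIntegrable g ∧
    ∀ φ : ℝ → ℂ, ContDiff ℝ ∞ φ → HasCompactSupport φ →
      ∫ x, f x * iteratedDeriv k φ x = (-1) ^ k * ∫ x, g x * φ x

/-- `f ∈ H¹(ℝ)` and `‖f‖_{H¹} = (‖f‖² + ‖∂ₓf‖²)^{1/2} ≤ C`. -/
def H1NormLE (f : L2) (C : ℝ) : Prop :=
  ∃ g : L2, HasWeakDeriv 1 f g ∧ √(‖f‖ ^ 2 + ‖g‖ ^ 2) ≤ C

/-- `f ∈ H¹(ℝ)`. -/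
def MemH1 (f : L2) : Prop := ∃ C : ℝ, H1NormLE f C

/-- The Fourier symbol of `e^{-itΔ}`. With the normalisation `𝓕 f ξ = ∫ e^{-2πixξ} f x dx`, the
operator `Δ` has symbol `-4π²ξ²`. -/
noncomputable def freeSymbol (t ξ : ℝ) : ℂ :=
  Complex.exp (4 * (Real.pi : ℂ) ^ 2 * Complex.I * t * (ξ : ℂ) ^ 2)

theorem norm_freeSymbol (t ξ : ℝ) : ‖freeSymbol t ξ‖ = 1 := by
  have h : (4 * (Real.pi : ℂ) ^ 2 * Complex.I * t * (ξ : ℂ) ^ 2)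
      = ((4 * Real.pi ^ 2 * t * ξ ^ 2 : ℝ) : ℂ) * Complex.I := by
    push_cast; ring
  rw [freeSymbol, h, Complex.norm_exp_ofReal_mul_I]

theorem continuous_freeSymbol (t : ℝ) : Continuous (freeSymbol t) := by
  unfold freeSymbol
  fun_prop

theorem memLp_freeSymbol_mul (t : ℝ) (h : L2) :
    MemLp (fun ξ => freeSymbol t ξ * h ξ) 2 (volume : Measure ℝ) := by
  refine (Lp.memLp h).of_le
    ((continuous_freeSymbol t).aestronglyMeasurable.mul (Lp.aestronglyMeasurable h)) ?_
  filter_upwards with ξ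
  rw [norm_mul, norm_freeSymbol, one_mul]

/-- The free Schrödinger propagator `e^{-itΔ}` on `L²(ℝ)`, as a Fourier multiplier. -/
noncomputable def freeProp (t : ℝ) (f : L2) : L2 :=
  𝓕⁻ ((memLp_freeSymbol_mul t (𝓕 f : L2)).toLp _)

/-- `u ∈ C([0, ∞); L²)` solves `i ∂ₜu - Δu + V u = 0` on `[0, ∞) × ℝ` in the sense of
distributions: the equation is tested against functions of `x` and integrated in time. -/
def IsSolution (V : ℝ → ℝ → ℂ) (u : ℝ → L2) : Prop :=
  ContinuousOn u (Ici 0) ∧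
    ∀ φ : ℝ → ℂ, ContDiff ℝ ∞ φ → HasCompactSupport φ → ∀ t : ℝ, 0 ≤ t →
      Complex.I * ((∫ x, u t x * φ x) - ∫ x, u 0 x * φ x)
        = ∫ s in (0 : ℝ)..t,
            ((∫ x, u s x * iteratedDeriv 2 φ x) - ∫ x, V s x * u s x * φ x)

/-- `|V(x,t)| + |⟨x⟩ ∂ₓV(x,t)| ≤ C ⟨x⟩^{-σ}` for some constant `C`, for almost all `t ≥ 0` and
almost all `x`, with the weak derivative `∂ₓV`. Here and below `V t x` stands for `V(x,t)`. -/
def PotentialDecay (σ : ℝ) (V : ℝ → ℝ → ℂ) : Prop :=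
  ∃ (C : ℝ) (V' : ℝ → ℝ → ℂ), ∀ᵐ t ∂timeMeasure, HasWeakDeriv 1 (V t) (V' t) ∧
    ∀ᵐ x, ‖V t x‖ + jap x * ‖V' t x‖ ≤ C * jap x ^ (-σ)

/-- `|⟨x⟩^k ∂ₓ^k V(x,t)| ≤ C ⟨x⟩^{-σ}` for `1 ≤ k ≤ n`, with one constant `C`. -/
def SymbolBounds (σ : ℝ) (n : ℕ) (V : ℝ → ℝ → ℂ) : Prop :=
  ∃ C : ℝ, ∀ k : ℕ, 1 ≤ k → k ≤ n → ∃ W : ℝ → ℝ → ℂ, ∀ᵐ t ∂timeMeasure,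
    HasWeakDeriv k (V t) (W t) ∧ ∀ᵐ x, jap x ^ k * ‖W t x‖ ≤ C * jap x ^ (-σ)

/-- `⟨x⟩^{a} ∂ₓ^k w ∈ L^∞_t L²_x` over `t ∈ [0, ∞)`: the weak derivative `D t = ∂ₓ^k w(t)` exists
and `t ↦ ⟨x⟩^{a} D t` is an essentially bounded, strongly measurable map into `L²`. -/
def WeightedDerivBounded (a : ℝ) (k : ℕ) (w : ℝ → L2) : Prop :=
  ∃ (D : ℝ → ℝ → ℂ) (G : ℝ → L2),
    (∀ t : ℝ, 0 ≤ t → HasWeakDeriv k (w t) (D t) ∧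
      ∀ᵐ x, G t x = ((jap x ^ a : ℝ) : ℂ) * D t x) ∧
    MemLp G ∞ timeMeasure

/-- `r(t) = o_{Ḣ¹}(1)`: the weak derivative `∂ₓ r(t)` is in `L²` for `t ≥ 0` and its `L²` norm
tends to `0` as `t → ∞`. -/
def IsLittleOHdot1 (r : ℝ → L2) : Prop :=
  ∃ r' : ℝ → L2, (∀ t : ℝ, 0 ≤ t → HasWeakDeriv 1 (r t) (r' t)) ∧
    Tendsto (fun t => ‖r' t‖) atTop (𝓝 0)

end WeaklyBound

namespace WeaklyBound
open scoped Real

/-- The `L²` norm of a function as a real number. -/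
noncomputable def n2 (f : ℝ → ℂ) : ℝ := (eLpNorm f 2 volume).toReal

theorem n2_nonneg (f : ℝ → ℂ) : 0 ≤ n2 f := ENNReal.toReal_nonneg

theorem norm_toLp_eq_n2 {f : ℝ → ℂ} (hf : MemLp f 2 volume) :
    ‖hf.toLp f‖ = n2 f := Lp.norm_toLp f hf

theorem n2_coe (z : L2) : n2 z = ‖z‖ := (Lp.norm_def z).symm

theorem n2_congr {f g : ℝ → ℂ} (h : f =ᵐ[volume] g) : n2 f = n2 g := by
  rw [n2, n2, eLpNorm_congr_ae h]

theorem n2_zero : n2 (fun _ => 0) = 0 := by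
  simp [n2]

theorem n2_le_of_ae_le {f g : ℝ → ℂ} {c : ℝ} (hg : MemLp g 2 volume) (hc : 0 ≤ c)
    (h : ∀ᵐ x, ‖f x‖ ≤ c * ‖g x‖) : n2 f ≤ c * n2 g := by
  have h1 := eLpNorm_le_mul_eLpNorm_of_ae_le_mul h 2
  have h2 := ENNReal.toReal_mono (ENNReal.mul_ne_top ENNReal.ofReal_ne_top hg.eLpNorm_ne_top) h1
  rwa [ENNReal.toReal_mul, ENNReal.toReal_ofReal hc] at h2

theorem n2_mono {f g : ℝ → ℂ} (hg : MemLp g 2 volume)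
    (h : ∀ᵐ x, ‖f x‖ ≤ ‖g x‖) : n2 f ≤ n2 g := by
  simpa using n2_le_of_ae_le hg zero_le_one (by simpa using h)

theorem n2_add_le {f g : ℝ → ℂ} (hf : MemLp f 2 volume)
    (hg : MemLp g 2 volume) : n2 (fun x => f x + g x) ≤ n2 f + n2 g := by
  have h1 := eLpNorm_add_le hf.1 hg.1 (p := 2) (by norm_num)
  have h2 := ENNReal.toReal_mono (ENNReal.add_ne_top.2 ⟨hf.eLpNorm_ne_top, hg.eLpNorm_ne_top⟩) h1
  rwa [ENNReal.toReal_add hf.eLpNorm_ne_top hg.eLpNorm_ne_top] at h2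

theorem n2_const_mul (c : ℂ) (f : ℝ → ℂ) : n2 (fun x => c * f x) = ‖c‖ * n2 f := by
  have := eLpNorm_const_smul (μ := (volume : Measure ℝ)) (p := 2) c f
  have h : (fun x => c * f x) = c • f := rfl
  rw [n2, h, this, ENNReal.toReal_mul]; simp [n2]

theorem integrable_mul_of_memLp {f g : ℝ → ℂ} (hf : MemLp f 2 volume)
    (hg : MemLp g 2 volume) : Integrable (fun x => f x * g x) :=
  hf.integrable_mul hg

theorem integral_norm_mul_le {f g : ℝ → ℂ} (hf : MemLp f 2 volume)
    (hg : MemLp g 2 volume) : ∫ x, ‖f x * g x‖ ≤ n2 f * n2 g := by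
  have h1 : eLpNorm (f • g) 1 volume ≤ eLpNorm f 2 volume * eLpNorm g 2 volume :=
    eLpNorm_smul_le_mul_eLpNorm hg.1 hf.1
  have h2 := ENNReal.toReal_mono (ENNReal.mul_ne_top hf.eLpNorm_ne_top hg.eLpNorm_ne_top) h1
  rw [ENNReal.toReal_mul] at h2
  rw [integral_norm_eq_lintegral_enorm (integrable_mul_of_memLp hf hg).1, ← eLpNorm_one_eq_lintegral_enorm]
  exact h2

theorem norm_integral_mul_le {f g : ℝ → ℂ} (hf : MemLp f 2 volume)
    (hg : MemLp g 2 volume) : ‖∫ x, f x * g x‖ ≤ n2 f * n2 g :=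
  (norm_integral_le_integral_norm _).trans (integral_norm_mul_le hf hg)

theorem n2_sq {f : ℝ → ℂ} (hf : MemLp f 2 volume) : n2 f ^ 2 = ∫ x, ‖f x‖ ^ 2 := by
  have h := hf.eLpNorm_eq_integral_rpow_norm (by norm_num) (by norm_num)
  have h0 : (0 : ℝ) ≤ ∫ x, ‖f x‖ ^ 2 := integral_nonneg fun x => by positivity
  rw [n2, h]
  simp only [ENNReal.toReal_ofNat, Real.rpow_ofNat]
  rw [ENNReal.toReal_ofReal (by positivity), ← Real.rpow_natCast, ← Real.rpow_mul h0]
  norm_num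

/-- Continuous functions decaying faster than any power. -/
structure RapidDecay (ρ : ℝ → ℂ) : Prop where
  continuous : Continuous ρ
  decay : ∀ m : ℕ, ∃ C : ℝ, ∀ ξ : ℝ, (1 + |ξ|) ^ m * ‖ρ ξ‖ ≤ C

theorem RapidDecay.bdd {ρ : ℝ → ℂ} (h : RapidDecay ρ) : ∃ C, ∀ ξ, ‖ρ ξ‖ ≤ C := by
  simpa using h.decay 0

theorem RapidDecay.integrable {ρ : ℝ → ℂ} (h : RapidDecay ρ) : Integrable ρ := by
  obtain ⟨C, hC⟩ := h.decay 2
  have h1 : Integrable (fun ξ : ℝ => C * (1 + ‖ξ‖) ^ (-2 : ℝ)) :=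
    (integrable_one_add_norm (by simp)).const_mul C
  refine h1.mono' h.continuous.aestronglyMeasurable (ae_of_all _ fun ξ => ?_)
  have hp : 0 < (1 + |ξ|) := by positivity
  rw [Real.rpow_neg (by positivity), Real.norm_eq_abs, ← div_eq_mul_inv, le_div_iff₀ (by positivity)]
  have := hC ξ
  rw [show ((2 : ℝ)) = ((2 : ℕ) : ℝ) by norm_num, Real.rpow_natCast]
  linarith

theorem RapidDecay.memLp {ρ : ℝ → ℂ} (h : RapidDecay ρ) : MemLp ρ 2 volume := by
  obtain ⟨C, hC⟩ := h.bdd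
  rw [memLp_two_iff_integrable_sq_norm h.continuous.aestronglyMeasurable]
  refine (h.integrable.norm.const_mul C).mono' (by have := h.continuous; fun_prop)
    (ae_of_all _ fun ξ => ?_)
  rw [Real.norm_eq_abs, abs_of_nonneg (by positivity), sq]
  exact mul_le_mul_of_nonneg_right (hC ξ) (norm_nonneg _)

theorem RapidDecay.mul_growth {ρ g : ℝ → ℂ} (h : RapidDecay ρ) (hg : Continuous g) {K : ℝ} {p : ℕ}
    (hK : ∀ ξ, ‖g ξ‖ ≤ K * (1 + |ξ|) ^ p) : RapidDecay (fun ξ => g ξ * ρ ξ) := by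
  refine ⟨hg.mul h.continuous, fun m => ?_⟩
  obtain ⟨C, hC⟩ := h.decay (m + p)
  refine ⟨K * C, fun ξ => ?_⟩
  have hK0 : 0 ≤ K := by
    have := (norm_nonneg _).trans (hK 0)
    simpa using this
  calc (1 + |ξ|) ^ m * ‖g ξ * ρ ξ‖ = (1 + |ξ|) ^ m * (‖g ξ‖ * ‖ρ ξ‖) := by rw [norm_mul]
    _ ≤ (1 + |ξ|) ^ m * (K * (1 + |ξ|) ^ p * ‖ρ ξ‖) := by gcongr; exact hK ξ
    _ = K * ((1 + |ξ|) ^ (m + p) * ‖ρ ξ‖) := by rw [pow_add]; ring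
    _ ≤ K * C := by gcongr; exact hC ξ

theorem RapidDecay.mul_bdd {ρ g : ℝ → ℂ} (h : RapidDecay ρ) (hg : Continuous g) {K : ℝ}
    (hK : ∀ ξ, ‖g ξ‖ ≤ K) : RapidDecay (fun ξ => g ξ * ρ ξ) :=
  h.mul_growth hg (K := K) (p := 0) (by simpa using hK)

theorem RapidDecay.freeSymbol_mul {ρ : ℝ → ℂ} (h : RapidDecay ρ) (t : ℝ) :
    RapidDecay (fun ξ => freeSymbol t ξ * ρ ξ) :=
  h.mul_bdd (continuous_freeSymbol t) (K := 1) fun ξ => (norm_freeSymbol t ξ).le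

theorem RapidDecay.id_mul {ρ : ℝ → ℂ} (h : RapidDecay ρ) :
    RapidDecay (fun ξ => (ξ : ℂ) * ρ ξ) :=
  h.mul_growth (by fun_prop) (K := 1) (p := 1) fun ξ => by simp

theorem RapidDecay.const_mul {ρ : ℝ → ℂ} (h : RapidDecay ρ) (c : ℂ) :
    RapidDecay (fun ξ => c * ρ ξ) :=
  h.mul_bdd continuous_const (K := ‖c‖) fun _ => le_rfl

theorem RapidDecay.add {ρ η : ℝ → ℂ} (h : RapidDecay ρ) (h' : RapidDecay η) :
    RapidDecay (fun ξ => ρ ξ + η ξ) := by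
  refine ⟨h.continuous.add h'.continuous, fun m => ?_⟩
  obtain ⟨C, hC⟩ := h.decay m
  obtain ⟨C', hC'⟩ := h'.decay m
  refine ⟨C + C', fun ξ => ?_⟩
  calc (1 + |ξ|) ^ m * ‖ρ ξ + η ξ‖ ≤ (1 + |ξ|) ^ m * (‖ρ ξ‖ + ‖η ξ‖) := by
        gcongr; exact norm_add_le _ _
    _ ≤ C + C' := by rw [mul_add]; exact add_le_add (hC ξ) (hC' ξ)

theorem RapidDecay.sub {ρ η : ℝ → ℂ} (h : RapidDecay ρ) (h' : RapidDecay η) :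
    RapidDecay (fun ξ => ρ ξ - η ξ) := by
  simpa [sub_eq_add_neg] using h.add (h'.const_mul (-1))

theorem rapidDecay_schwartz (f : SchwartzMap ℝ ℂ) : RapidDecay f := by
  refine ⟨f.continuous, fun m => ?_⟩
  have := fun ξ => SchwartzMap.one_add_le_sup_seminorm_apply (𝕜 := ℝ) (m := (m, 0)) (k := m) (n := 0)
    le_rfl le_rfl f ξ
  simp only [norm_iteratedFDeriv_zero, Real.norm_eq_abs] at this
  exact ⟨_, this⟩

theorem fourierInv_apply (ρ : ℝ → ℂ) (x : ℝ) :
    𝓕⁻ ρ x = ∫ ξ : ℝ, Complex.exp (2 * π * Complex.I * x * ξ) * ρ ξ := by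
  rw [Real.fourierInv_eq']
  congr 1; ext ξ
  simp only [RCLike.inner_apply, conj_trivial, smul_eq_mul]
  congr 2; push_cast; ring

theorem norm_expI (x ξ : ℝ) : ‖Complex.exp (2 * π * Complex.I * x * ξ)‖ = 1 := by
  have h : (2 * π * Complex.I * x * ξ) = ((2 * π * x * ξ : ℝ) : ℂ) * Complex.I := by
    push_cast; ring
  rw [h, Complex.norm_exp_ofReal_mul_I]

theorem continuous_fourierInv {ρ : ℝ → ℂ} (h : Integrable ρ) : Continuous (𝓕⁻ ρ) := by
  have : Continuous (𝓕 ρ) := VectorFourier.fourierIntegral_continuous Real.continuous_fourierChar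
    (by exact continuous_inner) h
  have h2 : (𝓕⁻ ρ) = fun x => 𝓕 ρ (-x) := by ext x; exact Real.fourierInv_eq_fourier_neg ρ x
  rw [h2]; fun_prop

theorem RapidDecay.hasDerivAt_fourierInv {ρ : ℝ → ℂ} (h : RapidDecay ρ) (x : ℝ) :
    HasDerivAt (𝓕⁻ ρ) (𝓕⁻ (fun ξ : ℝ => 2 * π * Complex.I * ((ξ : ℂ) * ρ ξ)) x) x := by
  have h2 : (𝓕⁻ ρ) = fun x => 𝓕 ρ (-x) := by ext x; exact Real.fourierInv_eq_fourier_neg ρ x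
  have h3 := Real.hasDerivAt_fourier h.integrable
    (by simpa using h.id_mul.integrable) (-x)
  have h4 := h3.scomp x (hasDerivAt_neg x)
  rw [h2]
  refine h4.congr_deriv ?_
  rw [Real.fourierInv_eq_fourier_neg]
  simp only [Real.fourier_eq', neg_smul, one_smul]
  rw [← integral_neg]
  congr 1; ext v
  simp only [smul_eq_mul]
  ring

/-- Bilinear self-adjointness of the inverse Fourier transform on integrable functions. -/
theorem integral_fourierInv_mul_of_integrable {f g : ℝ → ℂ} (hf : Integrable f) (hg : Integrable g) :
    ∫ ξ, 𝓕⁻ f ξ * g ξ = ∫ x, f x * 𝓕⁻ g x := by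
  have key : ∀ {f g : ℝ → ℂ}, Integrable f → Integrable g →
      ∫ ξ, 𝓕 f ξ * g ξ = ∫ x, f x * 𝓕 g x := fun {f g} hf hg => by
    simpa using! VectorFourier.integral_bilin_fourierIntegral_eq_flip (ContinuousLinearMap.mul ℂ ℂ)
      (L := innerₗ ℝ) Real.continuous_fourierChar continuous_inner hf hg
  have h1 := key hf hg.comp_neg
  have e : ∀ f : ℝ → ℂ, ∀ x, 𝓕 (fun y => f (-y)) x = 𝓕⁻ f x := fun f x => by
    rw [Real.fourierInv_eq_fourier_comp_neg]
  calc ∫ ξ, 𝓕⁻ f ξ * g ξ = ∫ ξ, 𝓕⁻ f (-ξ) * g (-ξ) :=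
        (integral_neg_eq_self (fun ξ => 𝓕⁻ f ξ * g ξ) volume).symm
    _ = ∫ ξ, 𝓕 f ξ * g (-ξ) := by
        congr 1; ext ξ; rw [Real.fourierInv_eq_fourier_neg, neg_neg]
    _ = _ := h1
    _ = _ := by congr 1; ext x; rw [← e]

theorem continuous_bilin : Continuous fun p : L2 × L2 => ∫ x, p.1 x * p.2 x := by
  have h : (fun p : L2 × L2 => ∫ x, p.1 x * p.2 x) = fun p => inner ℂ (star p.1) p.2 := by
    ext p
    rw [L2.inner_def]
    refine integral_congr_ae ?_
    filter_upwards [Lp.coeFn_star p.1] with x hx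
    rw [hx]; simp [mul_comm]
  rw [h]
  have hs : Continuous (star : L2 → L2) := by
    refine (Isometry.of_dist_eq fun a b => ?_).continuous
    have h : ∀ᵐ x, ‖(star a - star b : L2) x‖ = ‖(a - b : L2) x‖ := by
      filter_upwards [Lp.coeFn_sub (star a) (star b), Lp.coeFn_sub a b, Lp.coeFn_star a,
        Lp.coeFn_star b] with x h1 h2 h3 h4
      rw [h1, h2, Pi.sub_apply, Pi.sub_apply, h3, h4, Pi.star_apply, Pi.star_apply, ← star_sub,
        norm_star]
    rw [dist_eq_norm, dist_eq_norm]
    exact le_antisymm (Lp.norm_le_norm_of_ae_le (h.mono fun x hx => hx.le))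
      (Lp.norm_le_norm_of_ae_le (h.mono fun x hx => hx.ge))
  exact (hs.comp continuous_fst).inner continuous_snd

/-- Bilinear self-adjointness of the inverse Fourier transform on `L²`. -/
theorem integral_fourierInv_mul_L2 (z w : L2) :
    ∫ ξ, (𝓕⁻ z : L2) ξ * w ξ = ∫ x, z x * (𝓕⁻ w : L2) x := by
  have hc : Continuous (fun z : L2 => (𝓕⁻ z : L2)) :=
    (Lp.fourierTransformₗᵢ ℝ ℂ).symm.continuous
  refine DenseRange.induction_on₂ (p := fun z w : L2 =>
    ∫ ξ, (𝓕⁻ z : L2) ξ * w ξ = ∫ x, z x * (𝓕⁻ w : L2) x)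
    (SchwartzMap.denseRange_toLpCLM (E := ℝ) (F := ℂ) (p := 2) (μ := volume) ENNReal.ofNat_ne_top) ?_ ?_ z w
  · exact isClosed_eq
      (continuous_bilin.comp ((hc.comp continuous_fst).prodMk continuous_snd))
      (continuous_bilin.comp (continuous_fst.prodMk (hc.comp continuous_snd)))
  · intro f g
    simp only [SchwartzMap.toLpCLM_apply, SchwartzMap.toLp_fourierInv_eq]
    calc _ = ∫ x, (𝓕⁻ f) x * g x := integral_congr_ae (by
            filter_upwards [SchwartzMap.coeFn_toLp (𝓕⁻ f) 2 volume, SchwartzMap.coeFn_toLp g 2 volume]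
              with x h1 h2
            rw [h1, h2])
      _ = ∫ x, f x * (𝓕⁻ g) x := SchwartzMap.integral_fourierInv_mul_eq f g
      _ = _ := integral_congr_ae (by
            filter_upwards [SchwartzMap.coeFn_toLp (𝓕⁻ g) 2 volume, SchwartzMap.coeFn_toLp f 2 volume]
              with x h1 h2
            rw [h1, h2])

theorem fourierInv_toLp_ae {ρ : ℝ → ℂ} (h1 : Integrable ρ) (h2 : MemLp ρ 2 volume) :
    (𝓕⁻ (h2.toLp ρ) : L2) =ᵐ[volume] 𝓕⁻ ρ := by
  refine ae_eq_of_integral_contDiff_smul_eq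
    ((Lp.memLp _).locallyIntegrable (by norm_num)) (continuous_fourierInv h1).locallyIntegrable ?_
  intro g hg hgc
  have hg' : ContDiff ℝ ∞ (fun x => (g x : ℂ)) := Complex.ofRealCLM.contDiff.comp hg
  have hgc' : HasCompactSupport (fun x => (g x : ℂ)) := hgc.comp_left (g := fun x : ℝ => (x : ℂ)) (by simp)
  let G : SchwartzMap ℝ ℂ := hgc'.toSchwartzMap hg'
  have hG : ∀ x, G x = (g x : ℂ) := fun x => rfl
  have e1 := integral_fourierInv_mul_L2 (h2.toLp ρ) (G.toLp 2)
  have e2 := integral_fourierInv_mul_of_integrable h1 G.integrable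
  rw [SchwartzMap.toLp_fourierInv_eq] at e1
  have a1 : ∫ x, g x • (𝓕⁻ (h2.toLp ρ) : L2) x = ∫ ξ, (𝓕⁻ (h2.toLp ρ) : L2) ξ * (G.toLp 2) ξ :=
    integral_congr_ae (by
      filter_upwards [SchwartzMap.coeFn_toLp G 2 volume] with x hx
      rw [hx, hG, Complex.real_smul, mul_comm])
  have a2 : ∫ x, (h2.toLp ρ) x * ((𝓕⁻ G).toLp 2 : L2) x = ∫ x, ρ x * 𝓕⁻ (⇑G) x :=
    integral_congr_ae (by
      filter_upwards [SchwartzMap.coeFn_toLp (𝓕⁻ G) 2 volume, h2.coeFn_toLp] with x hx hx2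
      rw [hx, hx2, SchwartzMap.fourierInv_coe])
  rw [a1, e1, a2, ← e2]
  congr 1; ext x; rw [hG, Complex.real_smul, mul_comm]

theorem memLp_fourierInv {ρ : ℝ → ℂ} (h1 : Integrable ρ) (h2 : MemLp ρ 2 volume) :
    MemLp (𝓕⁻ ρ) 2 volume :=
  (memLp_congr_ae (fourierInv_toLp_ae h1 h2)).1 (Lp.memLp _)

theorem n2_fourierInv {ρ : ℝ → ℂ} (h1 : Integrable ρ) (h2 : MemLp ρ 2 volume) :
    n2 (𝓕⁻ ρ) = n2 ρ := by
  rw [← n2_congr (fourierInv_toLp_ae h1 h2), n2_coe, ← norm_toLp_eq_n2 h2]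
  exact (Lp.fourierTransformₗᵢ ℝ ℂ).symm.norm_map _

/-- Parseval's identity in bilinear form. -/
theorem integral_mul_fourierInv (z : L2) {ρ : ℝ → ℂ} (h1 : Integrable ρ)
    (h2 : MemLp ρ 2 volume) :
    ∫ x, z x * 𝓕⁻ ρ x = ∫ ξ, (𝓕⁻ z : L2) ξ * ρ ξ := by
  have := integral_fourierInv_mul_L2 z (h2.toLp ρ)
  calc _ = ∫ x, z x * (𝓕⁻ (h2.toLp ρ) : L2) x := integral_congr_ae (by
          filter_upwards [fourierInv_toLp_ae h1 h2] with x hx; rw [hx])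
    _ = _ := this.symm
    _ = _ := integral_congr_ae (by
          filter_upwards [h2.coeFn_toLp] with x hx; rw [hx])

/-- The bilinear pairing of `F` with the function of Fourier symbol `ρ`. -/
noncomputable def pair (F ρ : ℝ → ℂ) : ℂ := ∫ x, F x * 𝓕⁻ ρ x

theorem norm_pair_le {F ρ : ℝ → ℂ} (hF : MemLp F 2 volume) (h : RapidDecay ρ) :
    ‖pair F ρ‖ ≤ n2 F * n2 ρ := by
  rw [← n2_fourierInv h.integrable h.memLp]
  exact norm_integral_mul_le hF (memLp_fourierInv h.integrable h.memLp)

theorem RapidDecay.contDiff_fourierInv {ρ : ℝ → ℂ} (h : RapidDecay ρ) :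
    ContDiff ℝ ∞ (𝓕⁻ ρ) := by
  have h2 : (𝓕⁻ ρ) = fun x => 𝓕 ρ (-x) := by ext x; exact Real.fourierInv_eq_fourier_neg ρ x
  rw [h2]
  have : ContDiff ℝ ∞ (𝓕 ρ) := by
    refine Real.contDiff_fourier (N := ⊤) fun n _ => ?_
    have h3 : RapidDecay (fun ξ => ((ξ : ℂ) ^ n) * ρ ξ) :=
      h.mul_growth (by fun_prop) (K := 1) (p := n) fun ξ => by
        rw [one_mul, norm_pow, Complex.norm_real, Real.norm_eq_abs]
        exact pow_le_pow_left₀ (abs_nonneg _) (by linarith) _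
    refine h3.integrable.norm.congr (ae_of_all _ fun ξ => ?_)
    simp
  exact this.comp contDiff_neg

theorem RapidDecay.deriv_fourierInv {ρ : ℝ → ℂ} (h : RapidDecay ρ) :
    deriv (𝓕⁻ ρ) = 𝓕⁻ (fun ξ : ℝ => 2 * π * Complex.I * ((ξ : ℂ) * ρ ξ)) :=
  funext fun x => (h.hasDerivAt_fourierInv x).deriv

theorem RapidDecay.memLp_fourierInv {ρ : ℝ → ℂ} (h : RapidDecay ρ) :
    MemLp (𝓕⁻ ρ) 2 volume :=
  WeaklyBound.memLp_fourierInv h.integrable h.memLp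

theorem RapidDecay.n2_fourierInv {ρ : ℝ → ℂ} (h : RapidDecay ρ) : n2 (𝓕⁻ ρ) = n2 ρ :=
  WeaklyBound.n2_fourierInv h.integrable h.memLp

theorem tendsto_n2_zero {f : ℕ → ℝ → ℂ} {G : ℝ → ℝ} (hG : MemLp G 2 volume)
    (hf : ∀ n, AEStronglyMeasurable (f n) (volume : Measure ℝ))
    (hb : ∀ n, ∀ᵐ x, ‖f n x‖ ≤ G x)
    (hl : ∀ᵐ x, Tendsto (fun n => f n x) atTop (𝓝 0)) :
    Tendsto (fun n => n2 (f n)) atTop (𝓝 0) := by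
  have hm : ∀ n, MemLp (f n) 2 volume := fun n =>
    hG.of_le (hf n) ((hb n).mono fun x hx => hx.trans (le_abs_self _))
  have h1 : Tendsto (fun n => ∫ x, ‖f n x‖ ^ 2) atTop (𝓝 (∫ x : ℝ, (0 : ℝ))) := by
    refine tendsto_integral_of_dominated_convergence (fun x => G x ^ 2)
      (fun n => (hf n).norm.pow 2) hG.integrable_sq (fun n => ?_) ?_
    · filter_upwards [hb n] with x hx
      rw [norm_pow, norm_norm]
      exact pow_le_pow_left₀ (norm_nonneg _) hx 2
    · filter_upwards [hl] with x hx
      simpa using (hx.norm.pow 2)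
  have h2 : (fun n => n2 (f n)) = fun n => √(∫ x, ‖f n x‖ ^ 2) := by
    ext n; rw [← n2_sq (hm n), Real.sqrt_sq (n2_nonneg _)]
  rw [h2]
  simpa [Function.comp_def] using (Real.continuous_sqrt.tendsto _).comp h1

theorem iteratedDeriv_two' (φ : ℝ → ℂ) : iteratedDeriv 2 φ = deriv (deriv φ) := by
  rw [iteratedDeriv_succ, iteratedDeriv_one]

/-- Smooth functions whose first two derivatives are in `L²` are limits of test functions. -/
theorem exists_test_approx {φ : ℝ → ℂ} (h : ContDiff ℝ ∞ φ)
    (h0 : MemLp φ 2 volume) (h1 : MemLp (deriv φ) 2 volume)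
    (h2 : MemLp (deriv (deriv φ)) 2 volume) :
    ∃ ψ : ℕ → ℝ → ℂ, (∀ n, ContDiff ℝ ∞ (ψ n)) ∧ (∀ n, HasCompactSupport (ψ n)) ∧
      Tendsto (fun n => n2 (fun x => ψ n x - φ x)) atTop (𝓝 0) ∧
      Tendsto (fun n => n2 (fun x => deriv (ψ n) x - deriv φ x)) atTop (𝓝 0) ∧
      Tendsto (fun n => n2 (fun x => deriv (deriv (ψ n)) x - deriv (deriv φ) x)) atTop (𝓝 0) := by
  let χ : ContDiffBump (0 : ℝ) := ⟨1, 2, one_pos, one_lt_two⟩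
  have hχs : ContDiff ℝ ∞ (χ : ℝ → ℝ) := χ.contDiff
  have hχc : HasCompactSupport (χ : ℝ → ℝ) := χ.hasCompactSupport
  have hd1 : Continuous (deriv (χ : ℝ → ℝ)) := hχs.continuous_deriv (by simp)
  have hχs' : ContDiff ℝ ∞ (deriv (χ : ℝ → ℝ)) := by
    have := (contDiff_succ_iff_deriv (n := ∞) (f := (χ : ℝ → ℝ))).1 (by simpa using hχs)
    exact this.2.2
  have hd2 : Continuous (deriv (deriv (χ : ℝ → ℝ))) := hχs'.continuous_deriv (by simp)
  obtain ⟨C1, hC1⟩ := hχc.deriv.exists_bound_of_continuous hd1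
  obtain ⟨C2, hC2⟩ := hχc.deriv.deriv.exists_bound_of_continuous hd2
  have hC10 : 0 ≤ C1 := (norm_nonneg _).trans (hC1 0)
  have hC20 : 0 ≤ C2 := (norm_nonneg _).trans (hC2 0)
  let c : ℕ → ℝ := fun n => ((n : ℝ) + 1)⁻¹
  have hc0 : ∀ n, 0 < c n := fun n => by positivity
  have hc1 : ∀ n, c n ≤ 1 := fun n => inv_le_one_of_one_le₀ (by linarith [Nat.cast_nonneg (α := ℝ) n])
  have hcl : Tendsto c atTop (𝓝 0) := by
    simpa [c, one_div] using tendsto_one_div_add_atTop_nhds_zero_nat (𝕜 := ℝ)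
  let η : ℕ → ℝ → ℂ := fun n x => ((χ (c n * x) : ℝ) : ℂ)
  let η1 : ℕ → ℝ → ℂ := fun n x => ((c n * deriv χ (c n * x) : ℝ) : ℂ)
  let η2 : ℕ → ℝ → ℂ := fun n x => ((c n * (c n * deriv (deriv χ) (c n * x)) : ℝ) : ℂ)
  have hη : ∀ n x, HasDerivAt (η n) (η1 n x) x := fun n x => by
    have a : HasDerivAt (χ : ℝ → ℝ) (deriv χ (c n * x)) (c n * x) :=
      (hχs.differentiable (by simp) _).hasDerivAt
    have b := (a.comp x ((hasDerivAt_id x).const_mul (c n))).ofReal_comp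
    refine b.congr_deriv ?_
    simp only [η1]; push_cast; ring
  have hη1 : ∀ n x, HasDerivAt (η1 n) (η2 n x) x := fun n x => by
    have a : HasDerivAt (deriv (χ : ℝ → ℝ)) (deriv (deriv χ) (c n * x)) (c n * x) :=
      (hχs'.differentiable (by simp) _).hasDerivAt
    have b := ((a.comp x ((hasDerivAt_id x).const_mul (c n))).const_mul (c n)).ofReal_comp
    refine b.congr_deriv ?_
    simp only [η2]; push_cast; ring
  have hηs : ∀ n, ContDiff ℝ ∞ (η n) := fun n =>
    Complex.ofRealCLM.contDiff.comp (hχs.comp (contDiff_const.mul contDiff_id))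
  have hηb : ∀ n x, ‖η n x‖ ≤ 1 := fun n x => by
    simp only [η, Complex.norm_real, Real.norm_eq_abs, abs_of_nonneg χ.nonneg]
    exact χ.le_one
  have hη1b : ∀ n x, ‖η1 n x‖ ≤ c n * C1 := fun n x => by
    simp only [η1, Complex.norm_real, norm_mul, Real.norm_eq_abs, abs_of_pos (hc0 n)]
    exact mul_le_mul_of_nonneg_left (hC1 _) (hc0 n).le
  have hη2b : ∀ n x, ‖η2 n x‖ ≤ c n * C2 := fun n x => by
    simp only [η2, Complex.norm_real, norm_mul, Real.norm_eq_abs, abs_of_pos (hc0 n)]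
    refine mul_le_mul_of_nonneg_left ?_ (hc0 n).le
    calc c n * _ ≤ 1 * C2 := mul_le_mul (hc1 n) (hC2 _) (norm_nonneg _) zero_le_one
      _ = C2 := one_mul _
  have hηl : ∀ x, Tendsto (fun n => η n x) atTop (𝓝 1) := fun x => by
    have a : Tendsto (fun n => χ (c n * x)) atTop (𝓝 (χ (0 * x))) :=
      (hχs.continuous.tendsto _).comp (hcl.mul_const x)
    have b : χ (0 * x) = 1 := χ.one_of_mem_closedBall (by simp; exact zero_le_one)
    rw [b] at a
    simpa [Function.comp_def, η] using (Complex.continuous_ofReal.tendsto _).comp a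
  have hη1l : ∀ x, Tendsto (fun n => η1 n x) atTop (𝓝 0) := fun x =>
    squeeze_zero_norm (hη1b · x) (by simpa using hcl.mul_const C1)
  have hη2l : ∀ x, Tendsto (fun n => η2 n x) atTop (𝓝 0) := fun x =>
    squeeze_zero_norm (hη2b · x) (by simpa using hcl.mul_const C2)
  have hφd : ∀ x, HasDerivAt φ (deriv φ x) x := fun x => (h.differentiable (by simp) x).hasDerivAt
  have hs' : ContDiff ℝ ∞ (deriv φ) := by
    have := (contDiff_succ_iff_deriv (n := ∞) (f := φ)).1 (by simpa using h)
    exact this.2.2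
  have hφdd : ∀ x, HasDerivAt (deriv φ) (deriv (deriv φ) x) x := fun x =>
    (hs'.differentiable (by simp) x).hasDerivAt
  have hs'' : Continuous (deriv (deriv φ)) := hs'.continuous_deriv (by simp)
  have e1 : ∀ n, deriv (fun x => η n x * φ x) = fun x => η1 n x * φ x + η n x * deriv φ x :=
    fun n => funext fun x => ((hη n x).mul (hφd x)).deriv
  have e2 : ∀ n, deriv (deriv (fun x => η n x * φ x)) = fun x =>
      (η2 n x * φ x + η1 n x * deriv φ x) + (η1 n x * deriv φ x + η n x * deriv (deriv φ) x) :=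
    fun n => by
      rw [e1]
      exact funext fun x => (((hη1 n x).mul (hφd x)).add ((hη n x).mul (hφdd x))).deriv
  have cη : ∀ n, Continuous (η n) := fun n => (hηs n).continuous
  have cη1 : ∀ n, Continuous (η1 n) := fun n =>
    continuous_iff_continuousAt.2 fun x => (hη1 n x).continuousAt
  have cη2 : ∀ n, Continuous (η2 n) := fun n => by
    simp only [η2]; fun_prop
  have cφ := h.continuous
  have cφ' := hs'.continuous
  have hηm : ∀ n x, ‖η n x - 1‖ ≤ 2 := fun n x =>
    (norm_sub_le _ _).trans (by rw [norm_one]; linarith [hηb n x])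
  have hη1b' : ∀ n x, ‖η1 n x‖ ≤ C1 := fun n x => (hη1b n x).trans (by nlinarith [hc1 n])
  have hη2b' : ∀ n x, ‖η2 n x‖ ≤ C2 := fun n x => (hη2b n x).trans (by nlinarith [hc1 n])
  refine ⟨fun n x => η n x * φ x, fun n => (hηs n).mul h, fun n => ?_, ?_, ?_, ?_⟩
  · have a : HasCompactSupport (fun x => χ (c n * x)) :=
      hχc.comp_homeomorph (Homeomorph.mulLeft₀ (c n) (hc0 n).ne')
    have b : HasCompactSupport (η n) := a.comp_left (g := fun x : ℝ => (x : ℂ)) (by simp)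
    exact b.mul_right
  · refine tendsto_n2_zero (h0.norm.const_mul 2) (fun n => by fun_prop)
      (fun n => ae_of_all _ fun x => ?_) (ae_of_all _ fun x => ?_)
    · rw [show η n x * φ x - φ x = (η n x - 1) * φ x by ring, norm_mul]
      exact mul_le_mul_of_nonneg_right (hηm n x) (norm_nonneg _)
    · simpa using ((hηl x).mul_const (φ x)).sub_const (φ x)
  · simp only [e1]
    refine tendsto_n2_zero ((h0.norm.const_mul C1).add (h1.norm.const_mul 2)) (fun n => by fun_prop)
      (fun n => ae_of_all _ fun x => ?_) (ae_of_all _ fun x => ?_)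
    · rw [show η1 n x * φ x + η n x * deriv φ x - deriv φ x
        = η1 n x * φ x + (η n x - 1) * deriv φ x by ring]
      refine (norm_add_le _ _).trans ?_
      rw [norm_mul, norm_mul]
      exact add_le_add (mul_le_mul_of_nonneg_right (hη1b' n x) (norm_nonneg _))
        (mul_le_mul_of_nonneg_right (hηm n x) (norm_nonneg _))
    · simpa using (((hη1l x).mul_const (φ x)).add ((hηl x).mul_const (deriv φ x))).sub_const (deriv φ x)
  · simp only [e2]
    refine tendsto_n2_zero ((h0.norm.const_mul C2).add ((h1.norm.const_mul (C1 + C1)).add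
      (h2.norm.const_mul 2))) (fun n => by fun_prop)
      (fun n => ae_of_all _ fun x => ?_) (ae_of_all _ fun x => ?_)
    · rw [show (η2 n x * φ x + η1 n x * deriv φ x) + (η1 n x * deriv φ x + η n x * deriv (deriv φ) x)
          - deriv (deriv φ) x
        = η2 n x * φ x + ((η1 n x + η1 n x) * deriv φ x + (η n x - 1) * deriv (deriv φ) x) by ring]
      refine (norm_add_le _ _).trans ?_
      refine add_le_add ?_ ((norm_add_le _ _).trans ?_)
      · rw [norm_mul]; exact mul_le_mul_of_nonneg_right (hη2b' n x) (norm_nonneg _)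
      · rw [norm_mul, norm_mul]
        refine add_le_add (mul_le_mul_of_nonneg_right ?_ (norm_nonneg _))
          (mul_le_mul_of_nonneg_right (hηm n x) (norm_nonneg _))
        exact (norm_add_le _ _).trans (add_le_add (hη1b' n x) (hη1b' n x))
    · simpa using ((((hη2l x).mul_const (φ x)).add ((hη1l x).mul_const (deriv φ x))).add
        (((hη1l x).mul_const (deriv φ x)).add ((hηl x).mul_const (deriv (deriv φ) x)))).sub_const
          (deriv (deriv φ) x)

theorem tendsto_integral_mul_of_n2 {z : ℝ → ℂ} (hz : MemLp z 2 volume)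
    {f : ℕ → ℝ → ℂ} {g : ℝ → ℂ} (hf : ∀ n, MemLp (f n) 2 volume)
    (hg : MemLp g 2 volume)
    (h : Tendsto (fun n => n2 (fun x => f n x - g x)) atTop (𝓝 0)) :
    Tendsto (fun n => ∫ x, z x * f n x) atTop (𝓝 (∫ x, z x * g x)) := by
  rw [tendsto_iff_norm_sub_tendsto_zero]
  refine squeeze_zero (fun _ => norm_nonneg _) (fun n => ?_) (by simpa using h.const_mul (n2 z))
  rw [← integral_sub (integrable_mul_of_memLp hz (hf n)) (integrable_mul_of_memLp hz hg)]
  simp_rw [← mul_sub]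
  exact norm_integral_mul_le hz ((hf n).sub hg)

theorem memLp_of_test {φ : ℝ → ℂ} (h : Continuous φ) (hc : HasCompactSupport φ) :
    MemLp φ 2 volume := h.memLp_of_hasCompactSupport hc

/-- Weak derivatives may be tested against smooth functions in `H¹` with two derivatives. -/
theorem HasWeakDeriv.integral_mul_deriv {z z' : L2} (h : HasWeakDeriv 1 z z') {φ : ℝ → ℂ}
    (hs : ContDiff ℝ ∞ φ)
    (h0 : MemLp φ 2 volume) (h1 : MemLp (deriv φ) 2 volume)
    (h2 : MemLp (deriv (deriv φ)) 2 volume) :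
    ∫ x, z x * deriv φ x = - ∫ x, z' x * φ x := by
  obtain ⟨ψ, hψs, hψc, l0, l1, -⟩ := exists_test_approx hs h0 h1 h2
  have a := tendsto_integral_mul_of_n2 (Lp.memLp z)
    (fun n => memLp_of_test ((hψs n).continuous_deriv (by simp)) (hψc n).deriv) h1 l1
  have b := (tendsto_integral_mul_of_n2 (Lp.memLp z')
    (fun n => memLp_of_test (hψs n).continuous (hψc n)) h0 l0).neg
  refine tendsto_nhds_unique a (b.congr fun n => ?_)
  have := h.2.2 (ψ n) (hψs n) (hψc n)
  rw [iteratedDeriv_one] at this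
  rw [this]; ring

theorem pair_weakDeriv {z z' : L2} (h : HasWeakDeriv 1 z z') {ρ : ℝ → ℂ} (hρ : RapidDecay ρ) :
    pair z (fun ξ : ℝ => 2 * π * Complex.I * ((ξ : ℂ) * ρ ξ)) = - pair z' ρ := by
  have d1 := hρ.id_mul.const_mul (2 * π * Complex.I)
  have d2 := d1.id_mul.const_mul (2 * π * Complex.I)
  have := h.integral_mul_deriv hρ.contDiff_fourierInv hρ.memLp_fourierInv
    (by rw [hρ.deriv_fourierInv]; exact d1.memLp_fourierInv)
    (by rw [hρ.deriv_fourierInv, d1.deriv_fourierInv]; exact d2.memLp_fourierInv)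
  rwa [hρ.deriv_fourierInv] at this

theorem fourierInv_fourier_schwartz (f : SchwartzMap ℝ ℂ) : 
    𝓕⁻ ((𝓕 f : SchwartzMap ℝ ℂ) : ℝ → ℂ) = f := by
  rw [← SchwartzMap.fourierInv_coe, FourierTransform.fourierInv_fourier_eq]

/-- Bounded linear functionals on Schwartz functions are represented by elements of `L²`. -/
theorem exists_L2_of_bound (ℓ : SchwartzMap ℝ ℂ →ₗ[ℂ] ℂ) {K : ℝ} (hK : 0 ≤ K)
    (h : ∀ f, ‖ℓ f‖ ≤ K * n2 f) :
    ∃ y : L2, ‖y‖ ≤ K ∧ ∀ f : SchwartzMap ℝ ℂ, ℓ f = ∫ x, y x * f x := by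
  have hd := SchwartzMap.denseRange_toLpCLM (E := ℝ) (F := ℂ) (p := 2) (μ := volume) ENNReal.ofNat_ne_top
  let e : SchwartzMap ℝ ℂ →ₗ[ℂ] L2 := (SchwartzMap.toLpCLM ℂ (E := ℝ) ℂ 2 volume).toLinearMap
  have hn : ∀ f : SchwartzMap ℝ ℂ, ‖ℓ f‖ ≤ K * ‖e f‖ := fun f => by
    have : ‖e f‖ = n2 f := by
      change ‖f.toLp 2 volume‖ = _
      rw [SchwartzMap.norm_toLp]; rfl
    rw [this]; exact h f
  have hd' : DenseRange e := hd
  let T : L2 →L[ℂ] ℂ := ℓ.extendOfNorm e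
  let y := (InnerProductSpace.toDual ℂ L2).symm T
  refine ⟨star y, ?_, fun f => ?_⟩
  · have h1 : ‖(star y : L2)‖ ≤ ‖y‖ := Lp.norm_le_norm_of_ae_le (by
      filter_upwards [Lp.coeFn_star y] with x hx; rw [hx, Pi.star_apply, norm_star])
    have h2 : ‖y‖ = ‖T‖ := LinearIsometryEquiv.norm_map _ _
    exact h1.trans (h2.le.trans (LinearMap.opNorm_extendOfNorm_le hd' hK hn))
  · rw [← LinearMap.extendOfNorm_eq hd' ⟨K, hn⟩ f]
    change T (e f) = _
    rw [← InnerProductSpace.toDual_symm_apply, L2.inner_def]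
    refine integral_congr_ae ?_
    filter_upwards [Lp.coeFn_star y, SchwartzMap.coeFn_toLp f 2 volume] with x hx h2
    have : (e f) x = f x := h2
    rw [hx, this, Pi.star_apply, RCLike.inner_apply, mul_comm]; rfl

/-- A weak derivative in `L²` exists if it is bounded by duality. -/
theorem exists_weakDeriv_of_bound (w : L2) {K : ℝ} (hK : 0 ≤ K)
    (h : ∀ f : SchwartzMap ℝ ℂ, ‖∫ x, w x * deriv f x‖ ≤ K * n2 f) :
    ∃ w' : L2, HasWeakDeriv 1 w w' ∧ ‖w'‖ ≤ K := by
  have hi : ∀ f : SchwartzMap ℝ ℂ, Integrable (fun x => w x * SchwartzMap.derivCLM ℂ ℂ f x) := fun f =>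
    integrable_mul_of_memLp (Lp.memLp w) (SchwartzMap.memLp _ 2 volume)
  let ℓ : SchwartzMap ℝ ℂ →ₗ[ℂ] ℂ :=
    { toFun := fun f => -∫ x, w x * SchwartzMap.derivCLM ℂ ℂ f x
      map_add' := fun f g => by
        rw [map_add, ← neg_add, ← integral_add (hi f) (hi g)]
        congr 2; ext x; rw [add_apply]; ring
      map_smul' := fun c f => by
        rw [map_smul, RingHom.id_apply, smul_eq_mul, mul_neg, ← integral_const_mul]
        congr 2; ext x; rw [smul_apply, smul_eq_mul]; ring }
  obtain ⟨y, hy, hyf⟩ := exists_L2_of_bound ℓ hK (fun f => by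
    change ‖-∫ x, w x * SchwartzMap.derivCLM ℂ ℂ f x‖ ≤ _
    rw [norm_neg]; exact h f)
  refine ⟨y, ⟨(Lp.memLp w).locallyIntegrable (by norm_num), (Lp.memLp y).locallyIntegrable (by norm_num),
    fun φ hφ hc => ?_⟩, hy⟩
  have := hyf (hc.toSchwartzMap hφ)
  change -∫ x, w x * deriv φ x = ∫ x, y x * φ x at this
  rw [iteratedDeriv_one, ← this]; ring

/-- On the Fourier side, weak differentiation is multiplication by `-2πiξ` of `𝓕⁻`. -/
theorem fourierInv_weakDeriv {z z' : L2} (h : HasWeakDeriv 1 z z') :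
    ∀ᵐ ξ : ℝ, (𝓕⁻ z' : L2) ξ = -(2 * π * Complex.I * ξ) * (𝓕⁻ z : L2) ξ := by
  have h1 : LocallyIntegrable (𝓕⁻ z : L2) := (Lp.memLp _).locallyIntegrable (by norm_num)
  refine ae_eq_of_integral_contDiff_smul_eq
    ((Lp.memLp _).locallyIntegrable (by norm_num)) ?_ fun g hg hc => ?_
  · exact h1.continuous_mul (by fun_prop)
  · have hg' : ContDiff ℝ ∞ (fun x => (g x : ℂ)) := Complex.ofRealCLM.contDiff.comp hg
    have hgc' : HasCompactSupport (fun x => (g x : ℂ)) :=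
      hc.comp_left (g := fun x : ℝ => (x : ℂ)) (by simp)
    have hG : RapidDecay (fun x => (g x : ℂ)) := rapidDecay_schwartz (hgc'.toSchwartzMap hg')
    have hG' := hG.id_mul.const_mul (2 * π * Complex.I)
    have e := pair_weakDeriv h hG
    rw [pair, pair, integral_mul_fourierInv z hG'.integrable hG'.memLp,
      integral_mul_fourierInv z' hG.integrable hG.memLp] at e
    calc _ = ∫ ξ, (𝓕⁻ z' : L2) ξ * (g ξ : ℂ) := by
            congr 1; ext ξ; rw [Complex.real_smul, mul_comm]
      _ = -∫ ξ : ℝ, (𝓕⁻ z : L2) ξ * (2 * π * Complex.I * ((ξ : ℂ) * g ξ)) := by rw [e, neg_neg]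
      _ = _ := by
            rw [← integral_neg]; congr 1; ext ξ; rw [Complex.real_smul]; ring

/-- The half-line cut-off `ξ₊ / (ξ₊ + α)`, reflected when `ς = -1`. -/
noncomputable def halfCut (α ς ξ : ℝ) : ℝ := max (ς * ξ) 0 / (max (ς * ξ) 0 + α)

/-- A polynomial in the half-line cut-off. -/
noncomputable def cutPoly (α ς : ℝ) (r : Polynomial ℝ) (ξ : ℝ) : ℂ := ((r.eval (halfCut α ς ξ) : ℝ) : ℂ)

theorem halfCut_nonneg {α : ℝ} (hα : 0 < α) (ς ξ : ℝ) : 0 ≤ halfCut α ς ξ := by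
  unfold halfCut; positivity

theorem halfCut_le_one {α : ℝ} (hα : 0 < α) (ς ξ : ℝ) : halfCut α ς ξ ≤ 1 := by
  unfold halfCut
  have : 0 ≤ max (ς * ξ) 0 := le_max_right _ _
  rw [div_le_one (by positivity)]; linarith

theorem continuous_halfCut {α : ℝ} (hα : 0 < α) (ς : ℝ) : Continuous (halfCut α ς) := by
  unfold halfCut
  refine Continuous.div (by fun_prop) (by fun_prop) fun ξ => ?_
  have : 0 ≤ max (ς * ξ) 0 := le_max_right _ _
  positivity

theorem continuous_cutPoly {α : ℝ} (hα : 0 < α) (ς : ℝ) (r : Polynomial ℝ) :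
    Continuous (cutPoly α ς r) :=
  Complex.continuous_ofReal.comp (r.continuous.comp (continuous_halfCut hα ς))

theorem exists_cutPoly_bound (r : Polynomial ℝ) :
    ∃ C, 0 ≤ C ∧ ∀ α, 0 < α → ∀ ς ξ, ‖cutPoly α ς r ξ‖ ≤ C := by
  obtain ⟨C, hC⟩ := (isCompact_Icc (a := (0 : ℝ)) (b := 1)).exists_bound_of_continuousOn
    r.continuous.continuousOn
  refine ⟨C, (norm_nonneg _).trans (hC 0 (by simp)), fun α hα ς ξ => ?_⟩
  rw [cutPoly, Complex.norm_real]
  exact hC _ ⟨halfCut_nonneg hα ς ξ, halfCut_le_one hα ς ξ⟩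

theorem RapidDecay.cutPoly_mul {ρ : ℝ → ℂ} (h : RapidDecay ρ) {α : ℝ} (hα : 0 < α) (ς : ℝ)
    (r : Polynomial ℝ) : RapidDecay (fun ξ => cutPoly α ς r ξ * ρ ξ) := by
  obtain ⟨C, -, hC⟩ := exists_cutPoly_bound r
  exact h.mul_bdd (continuous_cutPoly hα ς r) (hC α hα ς)

theorem hasDerivAt_cutPoly {α ς : ℝ} (hα : 0 < α) (hς : ς = 1 ∨ ς = -1) (r : Polynomial ℝ) (ξ : ℝ) :
    HasDerivAt (cutPoly α ς (.X ^ 2 * r))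
      ((ς / α : ℝ) * cutPoly α ς (Polynomial.derivative (.X ^ 2 * r) * (1 - .X) ^ 2) ξ) ξ := by
  have hς0 : ς ≠ 0 := by rcases hς with h | h <;> simp [h]
  have hne : ∀ y, y ≠ 0 → HasDerivAt (cutPoly α ς (.X ^ 2 * r))
      ((ς / α : ℝ) * cutPoly α ς (Polynomial.derivative (.X ^ 2 * r) * (1 - .X) ^ 2) y) y := by
    intro y hy
    have hy' : ς * y ≠ 0 := mul_ne_zero hς0 hy
    rcases lt_or_gt_of_ne hy' with hlt | hgt
    · have hev : ∀ᶠ z in 𝓝 y, ς * z < 0 :=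
        (continuous_const.mul continuous_id).continuousAt.eventually_lt continuousAt_const hlt
      have h0 : ∀ z, ς * z < 0 → halfCut α ς z = 0 := fun z hz => by
        simp [halfCut, max_eq_right hz.le]
      have : HasDerivAt (fun _ : ℝ => (0 : ℂ)) 0 y := hasDerivAt_const _ _
      have e : cutPoly α ς (.X ^ 2 * r) =ᶠ[𝓝 y] fun _ => (0 : ℂ) := by
        filter_upwards [hev] with z hz
        simp [cutPoly, h0 z hz]
      refine (this.congr_of_eventuallyEq e).congr_deriv ?_
      simp [cutPoly, h0 y hlt, Polynomial.derivative_mul]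
    · have hev : ∀ᶠ z in 𝓝 y, 0 < ς * z :=
        continuousAt_const.eventually_lt (continuous_const.mul continuous_id).continuousAt hgt
      have hd : HasDerivAt (fun z => ς * z / (ς * z + α)) (ς / α * (1 - halfCut α ς y) ^ 2) y := by
        have a : HasDerivAt (fun z => ς * z) ς y := by
          simpa using (hasDerivAt_id y).const_mul ς
        have hp : ς * y + α ≠ 0 := by positivity
        refine (a.div (a.add_const α) hp).congr_deriv ?_
        rw [halfCut, max_eq_left hgt.le]
        field_simp
        ring
      have e0 : halfCut α ς =ᶠ[𝓝 y] fun z => ς * z / (ς * z + α) := by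
        filter_upwards [hev] with z hz
        simp [halfCut, max_eq_left hz.le]
      have hd' := hd.congr_of_eventuallyEq e0
      have := ((Polynomial.hasDerivAt (.X ^ 2 * r) (halfCut α ς y)).comp y hd').ofReal_comp
      refine this.congr_deriv ?_
      simp only [cutPoly, Polynomial.eval_mul, Polynomial.eval_pow, Polynomial.eval_sub,
        Polynomial.eval_one, Polynomial.eval_X]
      push_cast; ring
  by_cases h : ξ = 0
  · subst h
    exact hasDerivAt_of_hasDerivAt_of_ne hne (continuous_cutPoly hα ς _).continuousAt
      (continuous_const.mul (continuous_cutPoly hα ς _)).continuousAt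
  · exact hne ξ h

theorem cutPoly_div {α ς : ℝ} (hα : 0 < α) (r : Polynomial ℝ) (ξ : ℝ) :
    cutPoly α ς (.X ^ 2 * r) ξ = (ς / α : ℝ) * (ξ * cutPoly α ς (.X * (1 - .X) * r) ξ) := by
  simp only [cutPoly, Polynomial.eval_mul, Polynomial.eval_pow, Polynomial.eval_sub,
        Polynomial.eval_one, Polynomial.eval_X]
  norm_cast
  rcases le_or_gt (ς * ξ) 0 with h | h
  · have : halfCut α ς ξ = 0 := by simp [halfCut, max_eq_right h]
    rw [this]; ring
  · have e : halfCut α ς ξ = ς * ξ / (ς * ξ + α) := by simp [halfCut, max_eq_left h.le]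
    have : ς / α * ξ * (1 - halfCut α ς ξ) = halfCut α ς ξ := by
      rw [e]; field_simp; ring
    linear_combination (-(halfCut α ς ξ) * Polynomial.eval (halfCut α ς ξ) r) * this

theorem RapidDecay.fourierInv_deriv {ψ ψ' : ℝ → ℂ} (h : RapidDecay ψ) (h' : RapidDecay ψ')
    (hd : ∀ ξ, HasDerivAt ψ (ψ' ξ) ξ) (x : ℝ) :
    𝓕⁻ ψ' x = -(2 * π * Complex.I) * (x * 𝓕⁻ ψ x) := by
  have e : deriv ψ = ψ' := funext fun ξ => (hd ξ).deriv
  have := Real.fourier_deriv h.integrable (fun ξ => (hd ξ).differentiableAt) (by rw [e]; exact h'.integrable)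
  rw [e] at this
  rw [Real.fourierInv_eq_fourier_neg, Real.fourierInv_eq_fourier_neg, this]
  simp only [smul_eq_mul]; push_cast; ring

theorem hasDerivAt_freeSymbol (s ξ : ℝ) :
    HasDerivAt (freeSymbol s) (8 * π ^ 2 * Complex.I * s * ξ * freeSymbol s ξ) ξ := by
  have h : HasDerivAt (fun ξ : ℝ => 4 * (π : ℂ) ^ 2 * Complex.I * s * (ξ : ℂ) ^ 2)
      (4 * (π : ℂ) ^ 2 * Complex.I * s * (2 * ξ)) ξ := by
    have a : HasDerivAt (fun ξ : ℝ => (ξ : ℂ)) 1 ξ := (hasDerivAt_id ξ).ofReal_comp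
    simpa using (a.pow 2).const_mul (4 * (π : ℂ) ^ 2 * Complex.I * s)
  refine h.cexp.congr_deriv ?_
  rw [freeSymbol]; ring

theorem pair_const_mul (F ρ : ℝ → ℂ) (c : ℂ) : pair F (fun ξ => c * ρ ξ) = c * pair F ρ := by
  rw [pair, pair, ← integral_const_mul]
  congr 1; ext x
  have : 𝓕⁻ (fun ξ => c * ρ ξ) x = c * 𝓕⁻ ρ x := by
    rw [fourierInv_apply, fourierInv_apply, ← integral_const_mul]
    refine integral_congr_ae (ae_of_all _ fun ξ => ?_)
    ring
  rw [this]; ring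

theorem integrable_exp_mul {ρ : ℝ → ℂ} (h : Integrable ρ) (x : ℝ) :
    Integrable fun ξ : ℝ => Complex.exp (2 * π * Complex.I * x * ξ) * ρ ξ :=
  h.bdd_mul (c := 1) (by fun_prop) (ae_of_all _ fun ξ => (norm_expI x ξ).le)

theorem fourierInv_add' {ρ η : ℝ → ℂ} (h : Integrable ρ) (h' : Integrable η) (x : ℝ) :
    𝓕⁻ (fun ξ => ρ ξ + η ξ) x = 𝓕⁻ ρ x + 𝓕⁻ η x := by
  simp only [fourierInv_apply]
  rw [← integral_add (integrable_exp_mul h x) (integrable_exp_mul h' x)]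
  congr 1; ext ξ; ring

theorem pair_add {F ρ η : ℝ → ℂ} (hF : MemLp F 2 volume) (h : RapidDecay ρ)
    (h' : RapidDecay η) : pair F (fun ξ => ρ ξ + η ξ) = pair F ρ + pair F η := by
  rw [pair, pair, pair, ← integral_add (integrable_mul_of_memLp hF h.memLp_fourierInv)
    (integrable_mul_of_memLp hF h'.memLp_fourierInv)]
  congr 1; ext x
  rw [fourierInv_add' h.integrable h'.integrable]; ring

theorem pair_local_decay {F : ℝ → ℂ} (hF : MemLp F 2 volume)
    {κ κ' : ℝ → ℂ} (hκ : RapidDecay κ) (hκ' : RapidDecay κ') (hd : ∀ ξ, HasDerivAt κ (κ' ξ) ξ)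
    (s : ℝ) :
    8 * π ^ 2 * Complex.I * s * pair F (fun ξ => freeSymbol s ξ * (ξ * κ ξ))
      = -(2 * π * Complex.I) * pair (fun x => x * F x) (fun ξ => freeSymbol s ξ * κ ξ)
        - pair F (fun ξ => freeSymbol s ξ * κ' ξ) := by
  have h1 := (hκ.id_mul.freeSymbol_mul s).const_mul (8 * π ^ 2 * Complex.I * s)
  have h2 := hκ'.freeSymbol_mul s
  have h0 := hκ.freeSymbol_mul s
  have e := (h0.fourierInv_deriv (h1.add h2) fun ξ => by
    refine ((hasDerivAt_freeSymbol s ξ).mul (hd ξ)).congr_deriv ?_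
    ring)
  have e2 := pair_add hF h1 h2
  rw [pair_const_mul] at e2
  have e3 : pair F (fun ξ => 8 * π ^ 2 * Complex.I * s * (freeSymbol s ξ * (ξ * κ ξ))
      + freeSymbol s ξ * κ' ξ)
      = -(2 * π * Complex.I) * pair (fun x => x * F x) (fun ξ => freeSymbol s ξ * κ ξ) := by
    rw [pair, pair, ← integral_const_mul]
    congr 1; ext x
    rw [e x]; ring
  rw [← e3, e2]; ring

/-- The symbol `e_s r(q) η`. -/
noncomputable def sym (s α ς : ℝ) (r : Polynomial ℝ) (η : ℝ → ℂ) (ξ : ℝ) : ℂ :=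
  freeSymbol s ξ * (cutPoly α ς r ξ * η ξ)

/-- The symbol `e_s ξ r(q) η`. -/
noncomputable def symD (s α ς : ℝ) (r : Polynomial ℝ) (η : ℝ → ℂ) (ξ : ℝ) : ℂ :=
  freeSymbol s ξ * (ξ * (cutPoly α ς r ξ * η ξ))

theorem RapidDecay.sym {η : ℝ → ℂ} (h : RapidDecay η) (s : ℝ) {α : ℝ} (hα : 0 < α) (ς : ℝ)
    (r : Polynomial ℝ) : RapidDecay (sym s α ς r η) := (h.cutPoly_mul hα ς r).freeSymbol_mul s

theorem RapidDecay.symD {η : ℝ → ℂ} (h : RapidDecay η) (s : ℝ) {α : ℝ} (hα : 0 < α) (ς : ℝ)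
    (r : Polynomial ℝ) : RapidDecay (symD s α ς r η) := (h.cutPoly_mul hα ς r).id_mul.freeSymbol_mul s

theorem exists_n2_sym_le (r : Polynomial ℝ) : ∃ C, 0 ≤ C ∧ ∀ s α ς, 0 < α → ∀ η : ℝ → ℂ, RapidDecay η →
    n2 (sym s α ς r η) ≤ C * n2 η := by
  obtain ⟨C, hC0, hC⟩ := exists_cutPoly_bound r
  refine ⟨C, hC0, fun s α ς hα η hη => n2_le_of_ae_le hη.memLp hC0 (ae_of_all _ fun ξ => ?_)⟩
  rw [sym, norm_mul, norm_freeSymbol, one_mul, norm_mul]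
  exact mul_le_mul_of_nonneg_right (hC α hα ς ξ) (norm_nonneg _)

theorem norm_pair_sym_le (r : Polynomial ℝ) : ∃ C, 0 ≤ C ∧ ∀ s α ς, 0 < α → ∀ F η : ℝ → ℂ,
    MemLp F 2 volume → RapidDecay η →
    ‖pair F (sym s α ς r η)‖ ≤ C * (n2 F * n2 η) := by
  obtain ⟨C, hC0, hC⟩ := exists_n2_sym_le r
  refine ⟨C, hC0, fun s α ς hα F η hF hη => ?_⟩
  calc _ ≤ n2 F * n2 (sym s α ς r η) := norm_pair_le hF (hη.sym s hα ς r)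
    _ ≤ n2 F * (C * n2 η) := mul_le_mul_of_nonneg_left (hC s α ς hα η hη) (n2_nonneg _)
    _ = _ := by ring

/-- The derivative of a Schwartz function, as a Schwartz function. -/
noncomputable abbrev dS (η : SchwartzMap ℝ ℂ) : SchwartzMap ℝ ℂ := SchwartzMap.derivCLM ℂ ℂ η

theorem hasDerivAt_schwartz (η : SchwartzMap ℝ ℂ) (ξ : ℝ) : HasDerivAt η (dS η ξ) ξ := η.hasDerivAt ξ

theorem pair_symD_eq {F : ℝ → ℂ} (hF : MemLp F 2 volume) (s : ℝ) {α ς : ℝ} (hα : 0 < α)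
    (hς : ς = 1 ∨ ς = -1) (r : Polynomial ℝ) (η : SchwartzMap ℝ ℂ) :
    8 * π ^ 2 * Complex.I * s * pair F (symD s α ς (.X ^ 2 * r) η)
      = -(2 * π * Complex.I) * pair (fun x => x * F x) (sym s α ς (.X ^ 2 * r) η)
        - ((ς / α : ℝ) * pair F (sym s α ς (Polynomial.derivative (.X ^ 2 * r) * (1 - .X) ^ 2) η)
          + pair F (sym s α ς (.X ^ 2 * r) (dS η))) := by
  have hη := rapidDecay_schwartz η
  have hη' := rapidDecay_schwartz (dS η)
  have r1 := (hη.cutPoly_mul hα ς (Polynomial.derivative (.X ^ 2 * r) * (1 - .X) ^ 2)).const_mul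
    ((ς / α : ℝ) : ℂ)
  have r2 := hη'.cutPoly_mul hα ς (.X ^ 2 * r)
  have := pair_local_decay hF (hη.cutPoly_mul hα ς (.X ^ 2 * r)) (r1.add r2)
    (fun ξ => by
      refine ((hasDerivAt_cutPoly hα hς r ξ).mul (hasDerivAt_schwartz η ξ)).congr_deriv ?_
      ring) s
  have e : pair F (fun ξ => freeSymbol s ξ * ((ς / α : ℝ) *
        (cutPoly α ς (Polynomial.derivative (.X ^ 2 * r) * (1 - .X) ^ 2) ξ * η ξ)
        + cutPoly α ς (.X ^ 2 * r) ξ * dS η ξ))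
      = (ς / α : ℝ) * pair F (sym s α ς (Polynomial.derivative (.X ^ 2 * r) * (1 - .X) ^ 2) η)
          + pair F (sym s α ς (.X ^ 2 * r) (dS η)) := by
    rw [← pair_const_mul, ← pair_add hF ((hη.sym s hα ς _).const_mul _) (hη'.sym s hα ς _)]
    congr 1; ext ξ
    simp only [sym]; ring
  rw [← e]
  exact this

theorem sym_div (s : ℝ) {α ς : ℝ} (hα : 0 < α) (r : Polynomial ℝ) (η : ℝ → ℂ) :
    sym s α ς (.X ^ 2 * r) η = fun ξ => ((ς / α : ℝ) : ℂ) * symD s α ς (.X * (1 - .X) * r) η ξ := by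
  ext ξ
  simp only [sym, symD]
  rw [cutPoly_div hα]; ring

theorem pair_sym_div (F : ℝ → ℂ) (s : ℝ) {α ς : ℝ} (hα : 0 < α)
    (r : Polynomial ℝ) (η : ℝ → ℂ) :
    pair F (sym s α ς (.X ^ 2 * r) η) = ((ς / α : ℝ) : ℂ) * pair F (symD s α ς (.X * (1 - .X) * r) η) := by
  rw [sym_div s hα, pair_const_mul]

theorem abs_of_sign {ς : ℝ} (hς : ς = 1 ∨ ς = -1) : |ς| = 1 := by rcases hς with h | h <;> simp [h]

theorem norm_8pi (s : ℝ) : ‖(8 * π ^ 2 * Complex.I * s : ℂ)‖ = 8 * π ^ 2 * |s| := by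
  simp [abs_of_pos Real.pi_pos]

/-- One-step local decay. -/
theorem local_decay_one (r : Polynomial ℝ) : ∃ C, 0 ≤ C ∧ ∀ s α ς, 0 < α → (ς = 1 ∨ ς = -1) →
    ∀ (F : ℝ → ℂ) (η : SchwartzMap ℝ ℂ), MemLp F 2 volume →
    MemLp (fun x => x * F x) 2 volume →
    |s| * ‖pair F (symD s α ς (.X ^ 2 * r) η)‖
      ≤ C * (n2 (fun x => x * F x) * n2 η + n2 F * (α⁻¹ * n2 η + n2 (dS η))) := by
  obtain ⟨C1, hC10, hC1⟩ := norm_pair_sym_le (.X ^ 2 * r)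
  obtain ⟨C2, hC20, hC2⟩ := norm_pair_sym_le (Polynomial.derivative (.X ^ 2 * r) * (1 - .X) ^ 2)
  refine ⟨7 * C1 + C2, by positivity, fun s α ς hα hς F η hF hxF => ?_⟩
  have hη := rapidDecay_schwartz η
  have hη' := rapidDecay_schwartz (dS η)
  have e := congrArg norm (pair_symD_eq hF s hα hς r η)
  rw [norm_mul, norm_8pi] at e
  have hpi : 3 < π := Real.pi_gt_three
  have hpi4 : π < 3.15 := Real.pi_lt_d2
  have b1 := hC1 s α ς hα (fun x => x * F x) η hxF hη
  have b2 := hC2 s α ς hα F η hF hη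
  have b3 := hC1 s α ς hα F (dS η) hF hη'
  have hn : ∀ f, 0 ≤ n2 f := n2_nonneg
  have hς1 := abs_of_sign hς
  have e2 : 8 * π ^ 2 * |s| * ‖pair F (symD s α ς (.X ^ 2 * r) η)‖
      ≤ 2 * π * (C1 * (n2 (fun x => x * F x) * n2 η))
        + (α⁻¹ * (C2 * (n2 F * n2 η)) + C1 * (n2 F * n2 (dS η))) := by
    rw [e]
    refine (norm_sub_le _ _).trans (add_le_add ?_ ((norm_add_le _ _).trans (add_le_add ?_ b3)))
    · rw [norm_mul]
      have : ‖(-(2 * π * Complex.I) : ℂ)‖ = 2 * π := by simp [abs_of_pos Real.pi_pos]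
      rw [this]; gcongr
    · rw [norm_mul, Complex.norm_real, norm_div, Real.norm_eq_abs, hς1, Real.norm_eq_abs, abs_of_pos hα,
        one_div]
      gcongr
  have p0 : 0 ≤ |s| * ‖pair F (symD s α ς (.X ^ 2 * r) η)‖ := by positivity
  have p1 := mul_nonneg (hn (fun x => x * F x)) (hn η)
  have p2 := mul_nonneg (hn F) (hn (dS η))
  have p3 : 0 ≤ α⁻¹ * (n2 F * n2 η) := mul_nonneg (by positivity) (mul_nonneg (hn _) (hn _))
  have p4 : |s| * ‖pair F (symD s α ς (.X ^ 2 * r) η)‖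
      ≤ 8 * π ^ 2 * |s| * ‖pair F (symD s α ς (.X ^ 2 * r) η)‖ := by
    rw [mul_assoc (8 * π ^ 2)]
    exact le_mul_of_one_le_left p0 (by nlinarith)
  have q1 : 2 * π * (C1 * (n2 (fun x => x * F x) * n2 η))
      ≤ 7 * (C1 * (n2 (fun x => x * F x) * n2 η)) :=
    mul_le_mul_of_nonneg_right (by linarith) (mul_nonneg hC10 p1)
  have q2 := mul_nonneg hC10 p2
  have q3 := mul_nonneg hC10 p3
  have q4 := mul_nonneg hC20 p1
  have q5 := mul_nonneg hC20 p2
  nlinarith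

theorem local_decay_two_aux {C1 C2 a x0 x1 x2 y0 y1 y2 : ℝ} (hC1 : 0 ≤ C1) (hC2 : 0 ≤ C2) (ha : 0 ≤ a)
    (hx0 : 0 ≤ x0) (hx1 : 0 ≤ x1) (hx2 : 0 ≤ x2) (hy0 : 0 ≤ y0) (hy1 : 0 ≤ y1) (hy2 : 0 ≤ y2) :
    7 * a * (C1 * (x2 * y0 + x1 * (a * y0 + y1)))
        + (a * a * (C2 * (x1 * y0 + x0 * (a * y0 + y1)))
          + a * (C1 * (x1 * y1 + x0 * (a * y1 + y2))))
      ≤ (8 * C1 + C2) * (a * (x2 * y0 + x1 * (a * y0 + y1)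
        + x0 * (a * (a * y0) + a * y1 + y2))) := by
  have e1 : 0 ≤ x2 * y0 := by positivity
  have e2 : 0 ≤ x1 * y1 := by positivity
  have e3 : 0 ≤ x1 * (a * y0) := by positivity
  have e4 : 0 ≤ x0 * (a * (a * y0)) := by positivity
  have e5 : 0 ≤ x0 * (a * y1) := by positivity
  have e6 : 0 ≤ x0 * y2 := by positivity
  set T := x2 * y0 + x1 * (a * y0 + y1) + x0 * (a * (a * y0) + a * y1 + y2) with hT
  have t1 : x2 * y0 + x1 * (a * y0 + y1) ≤ T := by rw [hT]; linarith
  have t2 : a * (x1 * y0 + x0 * (a * y0 + y1)) ≤ T := by rw [hT]; linarith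
  have t3 : x1 * y1 + x0 * (a * y1 + y2) ≤ T := by rw [hT]; linarith
  have s1 := mul_le_mul_of_nonneg_left t1 (mul_nonneg ha hC1)
  have s2 := mul_le_mul_of_nonneg_left t2 (mul_nonneg ha hC2)
  have s3 := mul_le_mul_of_nonneg_left t3 (mul_nonneg ha hC1)
  linarith

/-- Two-step local decay. -/
theorem local_decay_two (r : Polynomial ℝ) : ∃ C, 0 ≤ C ∧ ∀ s α ς, 0 < α → (ς = 1 ∨ ς = -1) →
    ∀ (F : ℝ → ℂ) (η : SchwartzMap ℝ ℂ), MemLp F 2 volume →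
    MemLp (fun x => x * F x) 2 volume →
    MemLp (fun x => x * (x * F x)) 2 volume →
    s ^ 2 * ‖pair F (symD s α ς (.X ^ 4 * r) η)‖
      ≤ C * (α⁻¹ * (n2 (fun x => x * (x * F x)) * n2 η
        + n2 (fun x => x * F x) * (α⁻¹ * n2 η + n2 (dS η))
        + n2 F * (α⁻¹ * (α⁻¹ * n2 η) + α⁻¹ * n2 (dS η) + n2 (dS (dS η))))) := by
  have d1 : (.X ^ 4 * r : Polynomial ℝ) = .X ^ 2 * (.X ^ 2 * r) := by ring
  let r1 : Polynomial ℝ := .X * (1 - .X) * r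
  let r2 : Polynomial ℝ := (1 - .X) ^ 3 * (4 * r + .X * Polynomial.derivative r)
  have d2 : (.X * (1 - .X) * (.X ^ 2 * r) : Polynomial ℝ) = .X ^ 2 * r1 := by simp only [r1]; ring
  let r3 : Polynomial ℝ := .X * (4 * r + .X * Polynomial.derivative r) * (1 - .X) ^ 2
  have d3 : Polynomial.derivative (.X ^ 2 * (.X ^ 2 * r) : Polynomial ℝ) * (1 - .X) ^ 2
      = .X ^ 2 * r3 := by
    simp only [r3, Polynomial.derivative_mul, Polynomial.derivative_X_pow]
    simp [Polynomial.C_ofNat]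
    ring
  have d4 : (.X * (1 - .X) * r3 : Polynomial ℝ) = .X ^ 2 * r2 := by simp only [r2, r3]; ring
  obtain ⟨C1, hC10, hC1⟩ := local_decay_one r1
  obtain ⟨C2, hC20, hC2⟩ := local_decay_one r2
  refine ⟨8 * C1 + C2, by positivity, fun s α ς hα hς F η hF hxF hxxF => ?_⟩
  have e := congrArg norm (pair_symD_eq hF s hα hς (.X ^ 2 * r) η)
  rw [pair_sym_div _ s hα, pair_sym_div _ s hα, d3, pair_sym_div _ s hα, d2, d4, norm_mul,
    norm_8pi] at e
  rw [d1]
  have hpi : 3 < π := Real.pi_gt_three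
  have hpi4 : π < 3.15 := Real.pi_lt_d2
  have b1 := hC1 s α ς hα hς (fun x => x * F x) η hxF hxxF
  have b2 := hC2 s α ς hα hς F η hF hxF
  have b3 := hC1 s α ς hα hς F (dS η) hF hxF
  have hς1 := abs_of_sign hς
  have hnr : ‖((ς / α : ℝ) : ℂ)‖ = α⁻¹ := by
    rw [Complex.norm_real, norm_div, Real.norm_eq_abs, hς1, Real.norm_eq_abs, abs_of_pos hα, one_div]
  set A := ‖pair F (symD s α ς (.X ^ 2 * (.X ^ 2 * r)) η)‖
  set A1 := ‖pair (fun x => x * F x) (symD s α ς (.X ^ 2 * r1) η)‖ with hA1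
  set A2 := ‖pair F (symD s α ς (.X ^ 2 * r2) η)‖ with hA2
  set A3 := ‖pair F (symD s α ς (.X ^ 2 * r1) (dS η))‖ with hA3
  have e2 : 8 * π ^ 2 * |s| * A
      ≤ 2 * π * (α⁻¹ * A1) + (α⁻¹ * (α⁻¹ * A2) + α⁻¹ * A3) := by
    rw [e]
    refine (norm_sub_le _ _).trans (add_le_add ?_ ((norm_add_le _ _).trans (add_le_add ?_ ?_)))
    · rw [norm_mul, norm_mul, hnr]
      have : ‖(-(2 * π * Complex.I) : ℂ)‖ = 2 * π := by simp [abs_of_pos Real.pi_pos]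
      rw [this]
    · rw [norm_mul, norm_mul, hnr]
    · rw [norm_mul, hnr]
  have hn : ∀ f, 0 ≤ n2 f := n2_nonneg
  set x2 := n2 (fun x => x * (x * F x))
  set x1 := n2 (fun x => x * F x)
  set x0 := n2 F
  set y0 := n2 η
  set y1 := n2 (dS η)
  set y2 := n2 (dS (dS η))
  have hx2 : 0 ≤ x2 := hn _
  have hx1 : 0 ≤ x1 := hn _
  have hx0 : 0 ≤ x0 := hn _
  have hy0 : 0 ≤ y0 := hn _
  have hy1 : 0 ≤ y1 := hn _
  have hy2 : 0 ≤ y2 := hn _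
  have hA1n : 0 ≤ A1 := norm_nonneg _
  have hi : 0 ≤ α⁻¹ := by positivity
  have hs2 : s ^ 2 = |s| * |s| := by rw [← sq, sq_abs]
  have m1 : s ^ 2 * A ≤ |s| * (8 * π ^ 2 * |s| * A) := by
    rw [hs2, mul_assoc, mul_assoc (8 * π ^ 2)]
    refine mul_le_mul_of_nonneg_left ?_ (abs_nonneg _)
    exact le_mul_of_one_le_left (mul_nonneg (abs_nonneg s) (norm_nonneg _)) (by nlinarith only [hpi])
  have m2 : |s| * (8 * π ^ 2 * |s| * A)
      ≤ 2 * π * α⁻¹ * (|s| * A1) + (α⁻¹ * α⁻¹ * (|s| * A2) + α⁻¹ * (|s| * A3)) := by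
    refine (mul_le_mul_of_nonneg_left e2 (abs_nonneg s)).trans (le_of_eq ?_)
    ring
  have m3 : 2 * π * α⁻¹ * (|s| * A1) ≤ 7 * α⁻¹ * (C1 * (x2 * y0 + x1 * (α⁻¹ * y0 + y1))) := by
    exact mul_le_mul (mul_le_mul_of_nonneg_right (by linarith) hi) b1
      (mul_nonneg (abs_nonneg s) hA1n) (mul_nonneg (by norm_num) hi)
  have m4 : α⁻¹ * α⁻¹ * (|s| * A2) ≤ α⁻¹ * α⁻¹ * (C2 * (x1 * y0 + x0 * (α⁻¹ * y0 + y1))) :=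
    mul_le_mul_of_nonneg_left b2 (mul_nonneg hi hi)
  have m5 : α⁻¹ * (|s| * A3) ≤ α⁻¹ * (C1 * (x1 * y1 + x0 * (α⁻¹ * y1 + y2))) :=
    mul_le_mul_of_nonneg_left b3 hi
  refine m1.trans (m2.trans ((add_le_add m3 (add_le_add m4 m5)).trans ?_))
  exact local_decay_two_aux hC10 hC20 hi hx0 hx1 hx2 hy0 hy1 hy2

theorem exp_neg_abs_le (x : ℝ) : Real.exp (-|x|) ≤ 2 * (1 + x ^ 2)⁻¹ := by
  have h := Real.quadratic_le_exp_of_nonneg (abs_nonneg x)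
  rw [sq_abs] at h
  rw [Real.exp_neg, inv_eq_one_div, ← div_eq_mul_inv, div_le_div_iff₀ (Real.exp_pos _) (by positivity)]
  nlinarith [abs_nonneg x]

theorem integral_comp_exp_mul_exp (f : ℝ → ℂ) :
    ∫ x : ℝ, Real.exp x • f (Real.exp x) = ∫ r in Ioi (0 : ℝ), f r := by
  have h := integral_image_eq_integral_abs_deriv_smul (s := (univ : Set ℝ)) (f := Real.exp)
    (f' := Real.exp) MeasurableSet.univ
    (fun x _ => (Real.hasDerivAt_exp x).hasDerivWithinAt) (Real.exp_injective.injOn) f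
  rw [image_univ, Real.range_exp] at h
  simp only [Measure.restrict_univ, abs_of_pos (Real.exp_pos _)] at h
  exact h.symm

/-- Rotation of the half-line of integration by the angle `-π/4`. -/
theorem integral_rotate {F : ℂ → ℂ} {C : ℝ}
    (hd : ∀ ζ : ℂ, 0 < ζ.re → DifferentiableAt ℂ F ζ)
    (h1 : ∀ ζ : ℂ, 0 < ζ.re → ζ.im ≤ 0 → -ζ.re ≤ ζ.im → ‖F ζ‖ ≤ C)
    (h2 : ∀ ζ : ℂ, 0 < ζ.re → ζ.im ≤ 0 → -ζ.re ≤ ζ.im → ‖F ζ‖ * ‖ζ‖ ^ 2 ≤ C) :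
    ∫ r in Ioi (0 : ℝ), F r
      = ∫ r in Ioi (0 : ℝ), Complex.exp (-(π / 4 : ℝ) * Complex.I)
          * F (r * Complex.exp (-(π / 4 : ℝ) * Complex.I)) := by
  have hpi := Real.pi_pos
  set H : ℂ → ℂ := fun τ => Complex.exp τ * F (Complex.exp τ) with hH
  have hre : ∀ τ : ℂ, (Complex.exp τ).re = Real.exp τ.re * Real.cos τ.im := Complex.exp_re
  have him : ∀ τ : ℂ, (Complex.exp τ).im = Real.exp τ.re * Real.sin τ.im := Complex.exp_im
  have hsec : ∀ τ : ℂ, -(π / 4) ≤ τ.im → τ.im ≤ 0 → 0 < (Complex.exp τ).re ∧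
      (Complex.exp τ).im ≤ 0 ∧ -(Complex.exp τ).re ≤ (Complex.exp τ).im := by
    intro τ ha hb
    have hc : 0 < Real.cos τ.im := Real.cos_pos_of_mem_Ioo ⟨by linarith, by linarith⟩
    have hs : Real.sin τ.im ≤ 0 := Real.sin_nonpos_of_nonpos_of_neg_pi_le hb (by linarith)
    have hcs : 0 ≤ Real.cos τ.im + Real.sin τ.im := by
      have h4 : √2 / 2 * (Real.cos τ.im + Real.sin τ.im) = Real.sin (τ.im + π / 4) := by
        rw [Real.sin_add, Real.cos_pi_div_four, Real.sin_pi_div_four]; ring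
      have : 0 ≤ Real.sin (τ.im + π / 4) :=
        Real.sin_nonneg_of_nonneg_of_le_pi (by linarith) (by linarith)
      rw [← h4] at this
      exact nonneg_of_mul_nonneg_right this (by positivity)
    have he := Real.exp_pos τ.re
    rw [hre, him]
    refine ⟨by positivity, mul_nonpos_of_nonneg_of_nonpos he.le hs, ?_⟩
    nlinarith
  have hHd : ∀ τ : ℂ, -(π / 4) ≤ τ.im → τ.im ≤ 0 → DifferentiableAt ℂ H τ := by
    intro τ ha hb
    exact Complex.differentiableAt_exp.mul
      ((hd _ (hsec τ ha hb).1).comp τ Complex.differentiableAt_exp)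
  have hC : 0 ≤ C := (norm_nonneg _).trans (h1 1 (by simp) (by simp) (by simp))
  have hHb : ∀ τ : ℂ, -(π / 4) ≤ τ.im → τ.im ≤ 0 → ‖H τ‖ ≤ C * (2 * (1 + τ.re ^ 2)⁻¹) := by
    intro τ ha hb
    obtain ⟨p, q, r⟩ := hsec τ ha hb
    refine le_trans ?_ (mul_le_mul_of_nonneg_left (exp_neg_abs_le τ.re) hC)
    rw [hH]
    simp only [norm_mul]
    have e1 := h1 _ p q r
    have e2 := h2 _ p q r
    rw [Complex.norm_exp] at *
    have he := Real.exp_pos τ.re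
    rcases le_total 0 τ.re with h | h
    · rw [abs_of_nonneg h, Real.exp_neg, ← div_eq_mul_inv, le_div_iff₀ he]
      calc _ = ‖F (Complex.exp τ)‖ * Real.exp τ.re ^ 2 := by ring
        _ ≤ C := e2
    · rw [abs_of_nonpos h, neg_neg, mul_comm]
      gcongr
  have hline : ∀ y : ℝ, -(π / 4) ≤ y → y ≤ 0 →
      Integrable fun x : ℝ => H (x + y * Complex.I) := by
    intro y ha hb
    refine Integrable.mono' ((integrable_inv_one_add_sq.const_mul 2).const_mul C) ?_ ?_
    · refine Continuous.aestronglyMeasurable ?_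
      rw [continuous_iff_continuousAt]
      intro x
      have := (hHd (x + y * Complex.I) (by simpa using ha) (by simpa using hb)).continuousAt
      exact ContinuousAt.comp (f := fun x : ℝ => (x + y * Complex.I : ℂ)) this (by fun_prop)
    · refine Eventually.of_forall fun x => ?_
      simpa using hHb (x + y * Complex.I) (by simpa using ha) (by simpa using hb)
  have hkey : ∫ x : ℝ, H (x + (-(π / 4) : ℝ) * Complex.I) = ∫ x : ℝ, H (x + (0 : ℝ) * Complex.I) := by
    have l1 := intervalIntegral_tendsto_integral (hline (-(π / 4)) le_rfl (by linarith))
      (tendsto_neg_atTop_atBot.comp tendsto_natCast_atTop_atTop)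
      (tendsto_natCast_atTop_atTop (R := ℝ))
    have l2 := intervalIntegral_tendsto_integral (hline 0 (by linarith) le_rfl)
      (tendsto_neg_atTop_atBot.comp tendsto_natCast_atTop_atTop)
      (tendsto_natCast_atTop_atTop (R := ℝ))
    have hside : ∀ c : ℕ → ℝ, (∀ n, c n ^ 2 = (n : ℝ) ^ 2) →
        Tendsto (fun n : ℕ => Complex.I • ∫ y in (-(π / 4))..0, H (c n + y * Complex.I)) atTop (𝓝 0) := by
      intro c hc
      have hlim : Tendsto (fun n : ℕ => C * (2 * (1 + (n : ℝ) ^ 2)⁻¹) * |0 - -(π / 4)|) atTop (𝓝 0) := by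
        have : Tendsto (fun n : ℕ => (1 + (n : ℝ) ^ 2)⁻¹) atTop (𝓝 0) := by
          refine tendsto_inv_atTop_zero.comp (tendsto_atTop_add_const_left _ _ ?_)
          exact (tendsto_pow_atTop two_ne_zero).comp tendsto_natCast_atTop_atTop
        have := ((this.const_mul 2).const_mul C).mul_const |0 - -(π / 4)|
        simpa using this
      refine squeeze_zero_norm (fun n => ?_) hlim
      rw [norm_smul, Complex.norm_I, one_mul]
      refine intervalIntegral.norm_integral_le_of_norm_le_const fun y hy => ?_
      rw [uIoc_of_le (by linarith)] at hy
      have := hHb (c n + y * Complex.I) (by simpa using hy.1.le) (by simpa using hy.2)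
      simpa [hc n] using this
    have l3 := hside (fun n => n) (fun n => rfl)
    have l4 := hside (fun n => -n) (fun n => by ring)
    have hz := ((l1.sub l2).add l3).sub l4
    have h0 : ∀ n : ℕ, (((∫ x in (-(n : ℝ))..n, H (x + (-(π / 4) : ℝ) * Complex.I))
        - (∫ x in (-(n : ℝ))..n, H (x + (0 : ℝ) * Complex.I)))
        + Complex.I • ∫ y in (-(π / 4))..0, H (((n : ℝ) : ℂ) + y * Complex.I))
        - Complex.I • ∫ y in (-(π / 4))..0, H (((-n : ℝ) : ℂ) + y * Complex.I) = 0 := by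
      intro n
      have := Complex.integral_boundary_rect_eq_zero_of_differentiableOn H
        ⟨-n, -(π / 4)⟩ ⟨n, 0⟩ ?_
      · exact this
      · intro τ hτ
        rw [Complex.mem_reProdIm] at hτ
        have := hτ.2
        simp only [uIcc_of_le (show -(π / 4) ≤ 0 by linarith)] at this
        exact (hHd τ this.1 this.2).differentiableWithinAt
    rw [add_zero, sub_zero] at hz
    exact sub_eq_zero.1 (tendsto_nhds_unique (hz.congr h0) tendsto_const_nhds)
  have hA : ∫ x : ℝ, H (x + (0 : ℝ) * Complex.I) = ∫ r in Ioi (0 : ℝ), F r := by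
    rw [← integral_comp_exp_mul_exp (fun r : ℝ => F r)]
    congr 1; ext x
    simp [hH]
  have hB : ∫ x : ℝ, H (x + (-(π / 4) : ℝ) * Complex.I)
      = ∫ r in Ioi (0 : ℝ), Complex.exp (-(π / 4 : ℝ) * Complex.I)
          * F (r * Complex.exp (-(π / 4 : ℝ) * Complex.I)) := by
    rw [← integral_comp_exp_mul_exp (fun r : ℝ => Complex.exp (-(π / 4 : ℝ) * Complex.I)
          * F (r * Complex.exp (-(π / 4 : ℝ) * Complex.I)))]
    congr 1; ext x
    simp only [hH, Complex.exp_add, Complex.real_smul, Complex.ofReal_exp, Complex.ofReal_neg]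
    ring
  rw [← hA, ← hB, hkey]

/-- The regularised half-line kernel, as a holomorphic function of the frequency. -/
noncomputable def halfKernel (s α ε d : ℝ) (N k : ℕ) (ζ : ℂ) : ℂ :=
  Complex.exp (-(2 * π * Complex.I * d * ζ)) *
    (Complex.exp (-(4 * (π : ℂ) ^ 2 * Complex.I * s * ζ ^ 2)) *
      (Complex.exp (-(ε * ζ)) * (ζ ^ k * (ζ / (ζ + α)) ^ N)))

theorem norm_halfKernel_le {s α ε d : ℝ} (hs : 0 ≤ s) (hα : 0 < α) (hd : 0 ≤ d) (N k : ℕ)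
    {ζ : ℂ} (h0 : 0 < ζ.re) (h1 : ζ.im ≤ 0) :
    ‖halfKernel s α ε d N k ζ‖ ≤ Real.exp (-(ε * ζ.re)) * ‖ζ‖ ^ k := by
  have hpi := Real.pi_pos
  have e1 : ‖Complex.exp (-(2 * π * Complex.I * d * ζ))‖ ≤ 1 := by
    rw [Complex.norm_exp, Real.exp_le_one_iff]
    have : (-(2 * π * Complex.I * d * ζ)).re = 2 * π * d * ζ.im := by simp
    rw [this]
    exact mul_nonpos_of_nonneg_of_nonpos (by positivity) h1
  have e2 : ‖Complex.exp (-(4 * (π : ℂ) ^ 2 * Complex.I * s * ζ ^ 2))‖ ≤ 1 := by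
    rw [Complex.norm_exp, Real.exp_le_one_iff]
    have : (-(4 * (π : ℂ) ^ 2 * Complex.I * s * ζ ^ 2)).re
        = 8 * π ^ 2 * s * ζ.re * ζ.im := by
      have : (4 * (π : ℂ) ^ 2 * Complex.I * s) = ((4 * π ^ 2 * s : ℝ) : ℂ) * Complex.I := by
        push_cast; ring
      rw [this]
      simp only [pow_two, Complex.neg_re, Complex.mul_re, Complex.mul_im, Complex.ofReal_re,
        Complex.ofReal_im, Complex.I_re, Complex.I_im]
      ring
    rw [this]
    exact mul_nonpos_of_nonneg_of_nonpos (by positivity) h1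
  have e3 : ‖(ζ / (ζ + α)) ^ N‖ ≤ 1 := by
    rw [norm_pow, norm_div]
    refine pow_le_one₀ (by positivity) (div_le_one_of_le₀ ?_ (norm_nonneg _))
    rw [Complex.norm_def, Complex.norm_def]
    refine Real.sqrt_le_sqrt ?_
    simp only [Complex.normSq_apply, Complex.add_re, Complex.add_im, Complex.ofReal_re,
      Complex.ofReal_im, add_zero]
    nlinarith
  rw [halfKernel, norm_mul, norm_mul, norm_mul, norm_mul, norm_pow, Complex.norm_exp (-(ε * ζ))]
  have : (-(ε * ζ)).re = -(ε * ζ.re) := by simp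
  rw [this]
  calc _ ≤ 1 * (1 * (Real.exp (-(ε * ζ.re)) * (‖ζ‖ ^ k * 1))) := by gcongr
    _ = _ := by ring

theorem norm_halfKernel_ray_le {s α ε d r : ℝ} (hs : 0 ≤ s) (hα : 0 < α) (hε : 0 ≤ ε) (hd : 0 ≤ d)
    (N k : ℕ) (hr : 0 < r) :
    ‖halfKernel s α ε d N k (r * Complex.exp (-(π / 4 : ℝ) * Complex.I))‖
      ≤ Real.exp (-(d * r)) * (Real.exp (-(s * r ^ 2)) * (r ^ k * (α⁻¹ * r) ^ N)) := by
  have hpi := Real.pi_gt_three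
  set ζ : ℂ := r * Complex.exp (-(π / 4 : ℝ) * Complex.I) with hζ
  have hre : ζ.re = r * (√2 / 2) := by
    rw [hζ, Complex.re_ofReal_mul, ← Complex.ofReal_neg, Complex.exp_ofReal_mul_I_re, Real.cos_neg,
      Real.cos_pi_div_four]
  have him : ζ.im = -(r * (√2 / 2)) := by
    rw [hζ, Complex.im_ofReal_mul, ← Complex.ofReal_neg, Complex.exp_ofReal_mul_I_im, Real.sin_neg,
      Real.sin_pi_div_four]
    ring
  have hn : ‖ζ‖ = r := by
    rw [hζ, norm_mul, ← Complex.ofReal_neg, Complex.norm_exp_ofReal_mul_I, mul_one,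
      Complex.norm_real, Real.norm_of_nonneg hr.le]
  have hsq : √2 * √2 = 2 := Real.mul_self_sqrt (by norm_num)
  have hs1 : 1 ≤ √2 := by rw [Real.one_le_sqrt]; norm_num
  have e1 : ‖Complex.exp (-(2 * π * Complex.I * d * ζ))‖ ≤ Real.exp (-(d * r)) := by
    rw [Complex.norm_exp, Real.exp_le_exp]
    have : (-(2 * π * Complex.I * d * ζ)).re = 2 * π * d * ζ.im := by simp
    rw [this, him]
    have : d * r * 1 ≤ d * r * (π * √2) := by
      gcongr
      nlinarith
    nlinarith
  have e2 : ‖Complex.exp (-(4 * (π : ℂ) ^ 2 * Complex.I * s * ζ ^ 2))‖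
      ≤ Real.exp (-(s * r ^ 2)) := by
    rw [Complex.norm_exp, Real.exp_le_exp]
    have : (-(4 * (π : ℂ) ^ 2 * Complex.I * s * ζ ^ 2)).re
        = 8 * π ^ 2 * s * ζ.re * ζ.im := by
      have : (4 * (π : ℂ) ^ 2 * Complex.I * s) = ((4 * π ^ 2 * s : ℝ) : ℂ) * Complex.I := by
        push_cast; ring
      rw [this]
      simp only [pow_two, Complex.neg_re, Complex.mul_re, Complex.mul_im, Complex.ofReal_re,
        Complex.ofReal_im, Complex.I_re, Complex.I_im]
      ring
    rw [this, hre, him]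
    have h8 : 8 * π ^ 2 * s * (r * (√2 / 2)) * -(r * (√2 / 2))
        = -(4 * π ^ 2 * (s * r ^ 2)) := by
      linear_combination (-(2 * π ^ 2 * s * r ^ 2)) * hsq
    rw [h8, neg_le_neg_iff]
    have : 0 ≤ s * r ^ 2 := by positivity
    calc s * r ^ 2 = 1 * (s * r ^ 2) := (one_mul _).symm
      _ ≤ 4 * π ^ 2 * (s * r ^ 2) := by gcongr; nlinarith
  have e3 : ‖ζ / (ζ + α)‖ ≤ α⁻¹ * r := by
    rw [norm_div, hn, div_eq_inv_mul]
    gcongr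
    refine le_trans ?_ (Complex.re_le_norm _)
    rw [Complex.add_re, hre, Complex.ofReal_re]
    have : 0 ≤ r * (√2 / 2) := by positivity
    linarith
  have e4 : ‖Complex.exp (-(ε * ζ))‖ ≤ 1 := by
    rw [Complex.norm_exp, Real.exp_le_one_iff]
    have : (-(ε * ζ)).re = -(ε * ζ.re) := by simp
    rw [this, hre]
    have : 0 ≤ ε * (r * (√2 / 2)) := by positivity
    linarith
  rw [halfKernel, norm_mul, norm_mul, norm_mul, norm_mul, norm_pow, norm_pow, hn]
  calc _ ≤ Real.exp (-(d * r)) * (Real.exp (-(s * r ^ 2)) * (1 * (r ^ k * (α⁻¹ * r) ^ N))) := by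
        gcongr
    _ = _ := by ring

theorem integral_pow_mul_exp_Ioi {d : ℝ} (hd : 0 < d) (m : ℕ) :
    ∫ r in Ioi (0 : ℝ), r ^ m * Real.exp (-(d * r)) = m.factorial * d⁻¹ ^ (m + 1) := by
  have h := Real.integral_rpow_mul_exp_neg_mul_Ioi (a := m + 1) (r := d) (by positivity) hd
  rw [Real.Gamma_nat_eq_factorial] at h
  simp only [add_sub_cancel_right, Real.rpow_natCast] at h
  rw [h, one_div, mul_comm]
  norm_cast

theorem integrableOn_pow_mul_exp_Ioi {d : ℝ} (hd : 0 < d) (m : ℕ) :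
    IntegrableOn (fun r => r ^ m * Real.exp (-(d * r))) (Ioi (0 : ℝ)) := by
  by_contra h
  have h1 := integral_pow_mul_exp_Ioi hd m
  rw [integral_undef h] at h1
  have : 0 < (m.factorial : ℝ) * d⁻¹ ^ (m + 1) := by positivity
  linarith

theorem exp_neg_mul_sq_le {u : ℝ} (hu : 0 ≤ u) : u ^ 2 * Real.exp (-u) ≤ 2 := by
  have h := Real.quadratic_le_exp_of_nonneg hu
  rw [Real.exp_neg, ← div_eq_mul_inv, div_le_iff₀ (Real.exp_pos _)]
  nlinarith

theorem pow_mul_exp_neg_le {ε x : ℝ} (hε : 0 < ε) (hx : 0 ≤ x) (m : ℕ) :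
    Real.exp (-(ε * x)) * x ^ m ≤ m.factorial / ε ^ m := by
  have h := Real.pow_div_factorial_le_exp (ε * x) (by positivity) m
  rw [Real.exp_neg, inv_mul_le_iff₀ (Real.exp_pos _)]
  rw [mul_pow, div_le_iff₀ (by positivity)] at h
  rw [mul_div_assoc', le_div_iff₀ (by positivity)]
  linarith

theorem integral_halfKernel {s α ε d : ℝ} (hs : 0 ≤ s) (hα : 0 < α) (hε : 0 < ε) (hd : 0 ≤ d)
    (N k : ℕ) :
    ∫ r in Ioi (0 : ℝ), halfKernel s α ε d N k r
      = ∫ r in Ioi (0 : ℝ), Complex.exp (-(π / 4 : ℝ) * Complex.I)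
          * halfKernel s α ε d N k (r * Complex.exp (-(π / 4 : ℝ) * Complex.I)) := by
  have hb : ∀ m : ℕ, ∀ ζ : ℂ, 0 < ζ.re → ζ.im ≤ 0 → -ζ.re ≤ ζ.im →
      Real.exp (-(ε * ζ.re)) * ‖ζ‖ ^ m ≤ 2 ^ m * (m.factorial / ε ^ m) := by
    intro m ζ h0 h1 h2
    have h3 : ‖ζ‖ ≤ 2 * ζ.re := by
      refine (Complex.norm_le_abs_re_add_abs_im ζ).trans ?_
      rw [abs_of_pos h0, abs_of_nonpos h1]
      linarith
    calc _ ≤ Real.exp (-(ε * ζ.re)) * (2 * ζ.re) ^ m := by gcongr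
      _ = 2 ^ m * (Real.exp (-(ε * ζ.re)) * ζ.re ^ m) := by rw [mul_pow]; ring
      _ ≤ _ := by gcongr; exact pow_mul_exp_neg_le hε h0.le m
  refine integral_rotate (C := max (2 ^ k * (k.factorial / ε ^ k))
    (2 ^ (k + 2) * ((k + 2).factorial / ε ^ (k + 2)))) ?_ ?_ ?_
  · intro ζ h0
    have : ζ + α ≠ 0 := by
      intro h
      have := congrArg Complex.re h
      simp only [Complex.add_re, Complex.ofReal_re, Complex.zero_re] at this
      linarith
    unfold halfKernel
    fun_prop (disch := assumption)
  · intro ζ h0 h1 h2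
    exact (norm_halfKernel_le hs hα hd N k h0 h1).trans ((hb k ζ h0 h1 h2).trans (le_max_left _ _))
  · intro ζ h0 h1 h2
    refine le_trans (mul_le_mul_of_nonneg_right (norm_halfKernel_le hs hα hd N k h0 h1)
      (by positivity)) ?_
    rw [mul_assoc, ← pow_add]
    exact (hb (k + 2) ζ h0 h1 h2).trans (le_max_right _ _)

theorem norm_integral_halfKernel_le {s α ε d : ℝ} (hs : 0 ≤ s) (hα : 0 < α) (hε : 0 < ε) (hd : 0 < d)
    (N k p : ℕ) (hp : N + k = p + 4) :
    (1 + s ^ 2) * ‖∫ r in Ioi (0 : ℝ), halfKernel s α ε d N k r‖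
      ≤ α⁻¹ ^ N * ((p + 4).factorial * d⁻¹ ^ (p + 5) + 2 * (p.factorial * d⁻¹ ^ (p + 1))) := by
  rw [integral_halfKernel hs hα hε hd.le]
  have hI := ((integrableOn_pow_mul_exp_Ioi hd (p + 4)).add
    ((integrableOn_pow_mul_exp_Ioi hd p).const_mul 2)).const_mul (α⁻¹ ^ N)
  have h1 : ‖∫ r in Ioi (0 : ℝ), ((1 + s ^ 2 : ℝ) : ℂ) * (Complex.exp (-(π / 4 : ℝ) * Complex.I)
          * halfKernel s α ε d N k (r * Complex.exp (-(π / 4 : ℝ) * Complex.I)))‖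
      ≤ ∫ r in Ioi (0 : ℝ), α⁻¹ ^ N * (r ^ (p + 4) * Real.exp (-(d * r))
          + 2 * (r ^ p * Real.exp (-(d * r)))) := by
    refine norm_integral_le_of_norm_le hI ?_
    refine (ae_restrict_iff' measurableSet_Ioi).2 (Eventually.of_forall fun r hr => ?_)
    have hr : 0 < r := hr
    rw [norm_mul, norm_mul, ← Complex.ofReal_neg, Complex.norm_exp_ofReal_mul_I, one_mul,
      Complex.norm_real, Real.norm_of_nonneg (by positivity), Complex.ofReal_neg]
    refine le_trans (mul_le_mul_of_nonneg_left
      (norm_halfKernel_ray_le hs hα hε.le hd.le N k hr) (by positivity)) ?_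
    have e0 : Real.exp (-(s * r ^ 2)) ≤ 1 := by
      rw [Real.exp_le_one_iff]; have : 0 ≤ s * r ^ 2 := by positivity
      linarith
    have e1 := exp_neg_mul_sq_le (u := s * r ^ 2) (by positivity)
    have e2 : r ^ k * (α⁻¹ * r) ^ N = α⁻¹ ^ N * r ^ (p + 4) := by
      rw [← hp, mul_pow, pow_add]; ring
    rw [e2]
    calc (1 + s ^ 2) * (Real.exp (-(d * r)) * (Real.exp (-(s * r ^ 2)) * (α⁻¹ ^ N * r ^ (p + 4))))
        = α⁻¹ ^ N * (Real.exp (-(s * r ^ 2)) * (r ^ (p + 4) * Real.exp (-(d * r)))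
          + ((s * r ^ 2) ^ 2 * Real.exp (-(s * r ^ 2))) * (r ^ p * Real.exp (-(d * r)))) := by ring
      _ ≤ α⁻¹ ^ N * (1 * (r ^ (p + 4) * Real.exp (-(d * r)))
          + 2 * (r ^ p * Real.exp (-(d * r)))) := by gcongr
      _ = _ := by ring
  rw [integral_const_mul, norm_mul, Complex.norm_real, Real.norm_of_nonneg (by positivity)] at h1
  refine h1.trans_eq ?_
  rw [integral_const_mul, integral_add (integrableOn_pow_mul_exp_Ioi hd (p + 4))
    ((integrableOn_pow_mul_exp_Ioi hd p).const_mul 2), integral_const_mul,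
    integral_pow_mul_exp_Ioi hd, integral_pow_mul_exp_Ioi hd]

theorem fourier_apply (g : ℝ → ℂ) (ξ : ℝ) :
    𝓕 g ξ = ∫ y : ℝ, Complex.exp (-(2 * π * Complex.I * y * ξ)) * g y := by
  rw [Real.fourier_real_eq_integral_exp_smul]
  congr 1; ext y
  rw [smul_eq_mul]
  congr 2
  push_cast; ring

theorem cutPoly_X_pow_of_nonpos {α ς ξ : ℝ} {N : ℕ} (hN : N ≠ 0) (h : ς * ξ ≤ 0) :
    cutPoly α ς (.X ^ N) ξ = 0 := by
  simp [cutPoly, halfCut, max_eq_right h, hN]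

theorem cutPoly_X_pow_of_pos {α ξ : ℝ} (N : ℕ) (h : 0 < ξ) :
    cutPoly α 1 (.X ^ N) ξ = ((ξ : ℂ) / (ξ + α)) ^ N := by
  simp [cutPoly, halfCut, max_eq_left h.le]

theorem norm_regularised_le {s α d : ℝ} (hs : 0 ≤ s) (hα : 0 < α) {N k p : ℕ} (hN : N ≠ 0)
    (hp : N + k = p + 4) {g : ℝ → ℂ} (hg : Integrable g) {x : ℝ} (hd : 0 < d)
    (hsupp : ∀ y, y < x + d → g y = 0) {ε : ℝ} (hε : 0 < ε) :
    (1 + s ^ 2) * ‖∫ ξ : ℝ, Complex.exp (2 * π * Complex.I * x * ξ) * (Complex.exp (-(ε * |ξ| : ℝ)) *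
        (freeSymbol (-s) ξ * (ξ ^ k * (cutPoly α 1 (.X ^ N) ξ * 𝓕 g ξ))))‖
      ≤ α⁻¹ ^ N * ((p + 4).factorial * d⁻¹ ^ (p + 5) + 2 * (p.factorial * d⁻¹ ^ (p + 1))) *
        ∫ y, ‖g y‖ := by
  set m : ℝ → ℂ := fun ξ => Complex.exp (2 * π * Complex.I * x * ξ) * (Complex.exp (-(ε * |ξ| : ℝ)) *
        (freeSymbol (-s) ξ * (ξ ^ k * cutPoly α 1 (.X ^ N) ξ))) with hm
  have hmi : Integrable m := by
    have hmc : Continuous m := by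
      have h1 := continuous_freeSymbol (-s)
      have h2 := continuous_cutPoly hα 1 (.X ^ N)
      rw [hm]; fun_prop
    obtain ⟨C, hC, hCb⟩ := exists_cutPoly_bound (.X ^ N)
    have hb := ((integrable_inv_one_add_sq.const_mul (2 * (C * (k.factorial / (ε / 2) ^ k)))).comp_mul_left'
      (show ε / 2 ≠ 0 by positivity))
    refine hb.mono' hmc.aestronglyMeasurable (Eventually.of_forall fun ξ => ?_)
    rw [hm]
    simp only [norm_mul, norm_expI, norm_freeSymbol, one_mul, norm_pow, Complex.norm_real,
      Real.norm_eq_abs]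
    have e1 : ‖Complex.exp (-(ε * |ξ| : ℝ))‖ = Real.exp (-|ε / 2 * ξ|) * Real.exp (-(ε / 2 * |ξ|)) := by
      rw [← Complex.ofReal_neg, Complex.norm_exp_ofReal, ← Real.exp_add, abs_mul,
        abs_of_pos (show 0 < ε / 2 by positivity)]
      congr 1; ring
    have e2 := pow_mul_exp_neg_le (show 0 < ε / 2 by positivity) (abs_nonneg ξ) k
    have e3 := exp_neg_abs_le (ε / 2 * ξ)
    rw [e1]
    calc _ = Real.exp (-|ε / 2 * ξ|) * ((Real.exp (-(ε / 2 * |ξ|)) * |ξ| ^ k) * ‖cutPoly α 1 (.X ^ N) ξ‖) := by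
          ring
      _ ≤ (2 * (1 + (ε / 2 * ξ) ^ 2)⁻¹) * ((k.factorial / (ε / 2) ^ k) * C) := by
          gcongr
          exact hCb α hα 1 ξ
      _ = _ := by ring
  have key : ∫ ξ, 𝓕 m ξ * g ξ = ∫ ξ, m ξ * 𝓕 g ξ := by
    simpa using! VectorFourier.integral_bilin_fourierIntegral_eq_flip (ContinuousLinearMap.mul ℂ ℂ)
      (L := innerₗ ℝ) Real.continuous_fourierChar continuous_inner hmi hg
  have e1 : (∫ ξ : ℝ, Complex.exp (2 * π * Complex.I * x * ξ) * (Complex.exp (-(ε * |ξ| : ℝ)) *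
        (freeSymbol (-s) ξ * (ξ ^ k * (cutPoly α 1 (.X ^ N) ξ * 𝓕 g ξ))))) = ∫ ξ, m ξ * 𝓕 g ξ := by
    congr 1; ext ξ; rw [hm]; ring
  have e2 : ∀ y, 𝓕 m y = ∫ r in Ioi (0 : ℝ), halfKernel s α ε (y - x) N k r := by
    intro y
    rw [fourier_apply, ← integral_indicator measurableSet_Ioi]
    congr 1; ext ξ
    by_cases h : 0 < ξ
    · rw [indicator_of_mem (show ξ ∈ Ioi (0 : ℝ) from h), hm]
      simp only [halfKernel, cutPoly_X_pow_of_pos N h, abs_of_pos h, freeSymbol]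
      rw [← mul_assoc, ← Complex.exp_add]
      congr 1
      · congr 1; push_cast; ring
      · rw [mul_left_comm]
        congr 1
        · congr 1; push_cast; ring
        · push_cast; ring_nf
    · rw [indicator_of_notMem (show ξ ∉ Ioi (0 : ℝ) from h), hm]
      simp only [cutPoly_X_pow_of_nonpos hN (show 1 * ξ ≤ 0 by linarith), mul_zero]
  rw [e1, ← key]
  set B := α⁻¹ ^ N * ((p + 4).factorial * d⁻¹ ^ (p + 5) + 2 * (p.factorial * d⁻¹ ^ (p + 1))) with hB
  have e3 : ‖∫ y, ((1 + s ^ 2 : ℝ) : ℂ) * (𝓕 m y * g y)‖ ≤ ∫ y, B * ‖g y‖ := by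
    refine norm_integral_le_of_norm_le (hg.norm.const_mul B) (Eventually.of_forall fun y => ?_)
    by_cases hy : y < x + d
    · simp [hsupp y hy]
    · push Not at hy
      have hd' : d ≤ y - x := by linarith
      rw [norm_mul, norm_mul, Complex.norm_real, Real.norm_of_nonneg (by positivity), ← mul_assoc]
      gcongr
      rw [e2]
      refine (norm_integral_halfKernel_le hs hα hε (hd.trans_le hd') N k p hp).trans ?_
      rw [hB]
      have : (y - x)⁻¹ ≤ d⁻¹ := by gcongr
      have : 0 ≤ (y - x)⁻¹ := by rw [inv_nonneg]; linarith
      gcongr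
  rw [integral_const_mul, norm_mul, Complex.norm_real, Real.norm_of_nonneg (by positivity),
    integral_const_mul] at e3
  exact e3

/-- Off-support decay of the half-line propagator applied to data supported far to the right. -/
theorem exists_contour_bound_right {N k : ℕ} (hN : N ≠ 0) (p : ℕ) (hp : N + k = p + 4) :
    ∃ C, 0 ≤ C ∧ ∀ s α d x : ℝ, 0 ≤ s → 0 < α → 1 / 2 ≤ d → ∀ g : ℝ → ℂ, Integrable g →
      RapidDecay (𝓕 g) → (∀ y, y < x + d → g y = 0) →
      (1 + s ^ 2) * ‖𝓕⁻ (fun ξ : ℝ => freeSymbol (-s) ξ * (ξ ^ k * (cutPoly α 1 (.X ^ N) ξ * 𝓕 g ξ))) x‖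
        ≤ C * (α⁻¹ ^ N * d⁻¹ ^ (p + 1)) * ∫ y, ‖g y‖ := by
  refine ⟨(p + 4).factorial * 16 + 2 * p.factorial, by positivity, ?_⟩
  intro s α d x hs hα hd g hg hr hsupp
  have hd0 : 0 < d := by linarith
  have hρ : RapidDecay (fun ξ : ℝ => freeSymbol (-s) ξ * (ξ ^ k * (cutPoly α 1 (.X ^ N) ξ * 𝓕 g ξ))) := by
    refine RapidDecay.freeSymbol_mul ?_ _
    refine RapidDecay.mul_growth (hr.cutPoly_mul hα 1 _) (g := fun ξ : ℝ => (ξ : ℂ) ^ k) (by fun_prop) (K := 1) (p := k)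
      fun ξ => ?_
    rw [norm_pow, Complex.norm_real, Real.norm_eq_abs, one_mul]
    gcongr
    linarith
  rw [fourierInv_apply]
  have hlim : Tendsto (fun n : ℕ => ∫ ξ : ℝ, Complex.exp (2 * π * Complex.I * x * ξ) *
        (Complex.exp (-((1 / ((n : ℝ) + 1)) * |ξ| : ℝ)) *
        (freeSymbol (-s) ξ * (ξ ^ k * (cutPoly α 1 (.X ^ N) ξ * 𝓕 g ξ))))) atTop
      (𝓝 (∫ ξ : ℝ, Complex.exp (2 * π * Complex.I * x * ξ) *
        (freeSymbol (-s) ξ * (ξ ^ k * (cutPoly α 1 (.X ^ N) ξ * 𝓕 g ξ))))) := by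
    refine tendsto_integral_of_dominated_convergence _ (fun n => ?_) hρ.integrable.norm (fun n => ?_) ?_
    · refine AEStronglyMeasurable.mul (by fun_prop) (AEStronglyMeasurable.mul ?_ hρ.integrable.1)
      exact Continuous.aestronglyMeasurable (by fun_prop)
    · refine Eventually.of_forall fun ξ => ?_
      rw [norm_mul, norm_mul, norm_expI, one_mul, ← Complex.ofReal_neg, Complex.norm_exp_ofReal]
      refine mul_le_of_le_one_left (norm_nonneg _) ?_
      rw [Real.exp_le_one_iff, neg_nonpos]
      positivity
    · refine Eventually.of_forall fun ξ => ?_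
      have h1 : Tendsto (fun n : ℕ => Complex.exp (-((1 / ((n : ℝ) + 1)) * |ξ| : ℝ))) atTop (𝓝 1) := by
        have h2 := (tendsto_one_div_add_atTop_nhds_zero_nat (𝕜 := ℝ)).mul_const |ξ|
        rw [zero_mul] at h2
        have h3 : Continuous fun r : ℝ => Complex.exp (-(r : ℂ)) := by fun_prop
        have := (h3.tendsto 0).comp h2
        simpa [Function.comp_def] using this
      have := (h1.mul_const (freeSymbol (-s) ξ * (ξ ^ k * (cutPoly α 1 (.X ^ N) ξ * 𝓕 g ξ)))).const_mul
        (Complex.exp (2 * π * Complex.I * x * ξ))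
      simpa using this
  refine le_of_tendsto (hlim.norm.const_mul (1 + s ^ 2)) (Eventually.of_forall fun n => ?_)
  refine (norm_regularised_le hs hα hN hp hg hd0 hsupp (by positivity)).trans ?_
  have hi : 0 ≤ ∫ y, ‖g y‖ := integral_nonneg fun _ => norm_nonneg _
  have hdi : d⁻¹ ≤ 2 := by
    rw [inv_le_comm₀ hd0 (by norm_num)]; linarith
  have h4 : d⁻¹ ^ 4 ≤ 16 := by
    calc d⁻¹ ^ 4 ≤ 2 ^ 4 := by gcongr
      _ = 16 := by norm_num
  gcongr ?_ * _
  calc _ = α⁻¹ ^ N * ((p + 4).factorial * (d⁻¹ ^ 4) * d⁻¹ ^ (p + 1) + 2 * (p.factorial * d⁻¹ ^ (p + 1))) := by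
        ring
    _ ≤ α⁻¹ ^ N * ((p + 4).factorial * 16 * d⁻¹ ^ (p + 1) + 2 * (p.factorial * d⁻¹ ^ (p + 1))) := by
        gcongr
    _ = _ := by ring

theorem fourierInv_comp_neg (ρ : ℝ → ℂ) (x : ℝ) : 𝓕⁻ (fun ξ => ρ (-ξ)) x = 𝓕⁻ ρ (-x) := by
  rw [fourierInv_apply, fourierInv_apply, ← integral_neg_eq_self]
  congr 1; ext ξ
  rw [neg_neg]
  push_cast
  congr 2; ring

theorem fourier_comp_neg' (g : ℝ → ℂ) (ξ : ℝ) : 𝓕 (fun y => g (-y)) ξ = 𝓕 g (-ξ) := by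
  rw [fourier_apply, fourier_apply, ← integral_neg_eq_self]
  congr 1; ext y
  rw [neg_neg]
  push_cast
  congr 2; ring

theorem conj_fourierInv (ρ : ℝ → ℂ) (x : ℝ) :
    starRingEnd ℂ (𝓕⁻ ρ x) = 𝓕⁻ (fun ξ => starRingEnd ℂ (ρ (-ξ))) x := by
  rw [fourierInv_apply, fourierInv_apply, ← integral_conj, ← integral_neg_eq_self]
  congr 1; ext ξ
  rw [map_mul, ← Complex.exp_conj]
  simp [Complex.conj_ofNat]

theorem conj_fourier (g : ℝ → ℂ) (ξ : ℝ) :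
    𝓕 (fun y => starRingEnd ℂ (g y)) ξ = starRingEnd ℂ (𝓕 g (-ξ)) := by
  rw [fourier_apply, fourier_apply, ← integral_conj]
  congr 1; ext y
  rw [map_mul, ← Complex.exp_conj]
  simp [Complex.conj_ofNat]

theorem conj_freeSymbol (s ξ : ℝ) : starRingEnd ℂ (freeSymbol s ξ) = freeSymbol (-s) ξ := by
  rw [freeSymbol, freeSymbol, ← Complex.exp_conj]
  simp [Complex.conj_ofNat]

theorem freeSymbol_neg_right (s ξ : ℝ) : freeSymbol s (-ξ) = freeSymbol s ξ := by
  simp [freeSymbol]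

theorem cutPoly_neg (α ς : ℝ) (r : Polynomial ℝ) (ξ : ℝ) :
    cutPoly α ς r (-ξ) = cutPoly α (-ς) r ξ := by
  simp [cutPoly, halfCut]

theorem conj_cutPoly (α ς : ℝ) (r : Polynomial ℝ) (ξ : ℝ) :
    starRingEnd ℂ (cutPoly α ς r ξ) = cutPoly α ς r ξ := Complex.conj_ofReal _

theorem RapidDecay.comp_neg {ρ : ℝ → ℂ} (h : RapidDecay ρ) : RapidDecay fun ξ => ρ (-ξ) := by
  refine ⟨h.1.comp continuous_neg, fun m => ?_⟩
  obtain ⟨C, hC⟩ := h.2 m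
  exact ⟨C, fun ξ => by simpa using hC (-ξ)⟩

theorem RapidDecay.conj {ρ : ℝ → ℂ} (h : RapidDecay ρ) : RapidDecay fun ξ => starRingEnd ℂ (ρ ξ) := by
  refine ⟨Complex.continuous_conj.comp h.1, fun m => ?_⟩
  obtain ⟨C, hC⟩ := h.2 m
  exact ⟨C, fun ξ => by simpa using hC ξ⟩

theorem norm_fourierInv_neg_one_pow (k : ℕ) (ρ : ℝ → ℂ) (x : ℝ) :
    ‖𝓕⁻ (fun ξ => (-1) ^ k * ρ ξ) x‖ = ‖𝓕⁻ ρ x‖ := by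
  rw [fourierInv_apply, fourierInv_apply]
  have : (fun ξ : ℝ => Complex.exp (2 * π * Complex.I * x * ξ) * ((-1) ^ k * ρ ξ))
      = fun ξ : ℝ => (-1) ^ k * (Complex.exp (2 * π * Complex.I * x * ξ) * ρ ξ) := by
    ext; ring
  rw [this, integral_const_mul, norm_mul, norm_pow, norm_neg, norm_one, one_pow, one_mul]

/-- Off-support decay on either side `ν`, in either direction of time `τ`. -/
theorem exists_contour_bound {N k : ℕ} (hN : N ≠ 0) (p : ℕ) (hp : N + k = p + 4) :
    ∃ C, 0 ≤ C ∧ ∀ ν τ : ℝ, (ν = 1 ∨ ν = -1) → (τ = 1 ∨ τ = -1) →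
      ∀ s α d x : ℝ, 0 ≤ s → 0 < α → 1 / 2 ≤ d → ∀ g : ℝ → ℂ, Integrable g →
      RapidDecay (𝓕 g) → (∀ y, ν * y < ν * x + d → g y = 0) →
      (1 + s ^ 2) * ‖𝓕⁻ (fun ξ : ℝ => freeSymbol (-τ * s) ξ *
          (ξ ^ k * (cutPoly α (ν * τ) (.X ^ N) ξ * 𝓕 g ξ))) x‖
        ≤ C * (α⁻¹ ^ N * d⁻¹ ^ (p + 1)) * ∫ y, ‖g y‖ := by
  obtain ⟨C, hC, h⟩ := exists_contour_bound_right hN p hp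
  refine ⟨C, hC, ?_⟩
  have h1 : ∀ ν : ℝ, (ν = 1 ∨ ν = -1) →
      ∀ s α d x : ℝ, 0 ≤ s → 0 < α → 1 / 2 ≤ d → ∀ g : ℝ → ℂ, Integrable g →
      RapidDecay (𝓕 g) → (∀ y, ν * y < ν * x + d → g y = 0) →
      (1 + s ^ 2) * ‖𝓕⁻ (fun ξ : ℝ => freeSymbol (-s) ξ *
          (ξ ^ k * (cutPoly α ν (.X ^ N) ξ * 𝓕 g ξ))) x‖
        ≤ C * (α⁻¹ ^ N * d⁻¹ ^ (p + 1)) * ∫ y, ‖g y‖ := by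
    rintro ν (rfl | rfl) s α d x hs hα hd g hg hr hsupp
    · exact h s α d x hs hα hd g hg hr fun y hy => hsupp y (by linarith)
    · have h2 := h s α d (-x) hs hα hd (fun y => g (-y)) hg.comp_neg
        (by simpa only [show 𝓕 (fun y => g (-y)) = fun ξ => 𝓕 g (-ξ) from funext (fourier_comp_neg' g)]
            using hr.comp_neg)
        (fun y hy => hsupp _ (by linarith))
      rw [integral_neg_eq_self (fun y => ‖g y‖), ← fourierInv_comp_neg] at h2
      have e : (fun ξ : ℝ => freeSymbol (-s) (-ξ) * (((-ξ : ℝ) : ℂ) ^ k * (cutPoly α 1 (.X ^ N) (-ξ) * 𝓕 (fun y => g (-y)) (-ξ))))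
          = fun ξ : ℝ => (-1) ^ k * (freeSymbol (-s) ξ * ((ξ : ℂ) ^ k * (cutPoly α (-1) (.X ^ N) ξ * 𝓕 g ξ))) := by
        ext ξ
        rw [freeSymbol_neg_right, cutPoly_neg, fourier_comp_neg', neg_neg, Complex.ofReal_neg, neg_pow]
        ring
      rw [e] at h2
      rw [norm_fourierInv_neg_one_pow] at h2
      exact h2
  rintro ν τ hν (rfl | rfl) s α d x hs hα hd g hg hr hsupp
  · simpa using h1 ν hν s α d x hs hα hd g hg hr hsupp
  · have hgc : Integrable fun y => starRingEnd ℂ (g y) :=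
      ⟨Complex.continuous_conj.comp_aestronglyMeasurable hg.1, by
        simpa [HasFiniteIntegral] using hg.2⟩
    have h2 := h1 ν hν s α d x hs hα hd (fun y => starRingEnd ℂ (g y)) hgc
      (by simpa only [show 𝓕 (fun y => starRingEnd ℂ (g y)) = fun ξ => starRingEnd ℂ (𝓕 g (-ξ))
            from funext (conj_fourier g)] using hr.comp_neg.conj)
      (fun y hy => by simp [hsupp y hy])
    simp only [RCLike.norm_conj] at h2
    refine le_trans (le_of_eq ?_) h2
    rw [← RCLike.norm_conj, conj_fourierInv]
    refine Eq.trans ?_ (congrArg ((1 + s ^ 2) * ·) (norm_fourierInv_neg_one_pow k _ x))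
    refine congrArg (fun ρ : ℝ → ℂ => (1 + s ^ 2) * ‖𝓕⁻ ρ x‖) (funext fun ξ => ?_)
    simp only [map_mul, conj_freeSymbol, freeSymbol_neg_right, conj_cutPoly, cutPoly_neg, conj_fourier,
      map_pow, Complex.conj_ofReal, Complex.ofReal_neg, map_neg]
    rw [neg_pow (ξ : ℂ)]
    ring_nf

/-- Smooth functions with compact support. -/
structure IsTest (g : ℝ → ℂ) : Prop where
  smooth : ContDiff ℝ ∞ g
  compact : HasCompactSupport g

/-- A test function, as a Schwartz function. -/
noncomputable def IsTest.toS {g : ℝ → ℂ} (h : IsTest g) : SchwartzMap ℝ ℂ :=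
  h.compact.toSchwartzMap h.smooth

theorem IsTest.coe_toS {g : ℝ → ℂ} (h : IsTest g) : (h.toS : ℝ → ℂ) = g := rfl

/-- The Fourier transform of a test function, as a Schwartz function. -/
noncomputable def IsTest.hat {g : ℝ → ℂ} (h : IsTest g) : SchwartzMap ℝ ℂ := 𝓕 h.toS

theorem IsTest.coe_hat {g : ℝ → ℂ} (h : IsTest g) : (h.hat : ℝ → ℂ) = 𝓕 g := by
  rw [IsTest.hat, SchwartzMap.fourier_coe, h.coe_toS]

theorem IsTest.rapidDecay {g : ℝ → ℂ} (h : IsTest g) : RapidDecay (𝓕 g) := by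
  rw [← h.coe_hat]; exact rapidDecay_schwartz _

theorem IsTest.fourierInv_fourier {g : ℝ → ℂ} (h : IsTest g) : 𝓕⁻ (𝓕 g) = g := by
  rw [← h.coe_hat, IsTest.hat, fourierInv_fourier_schwartz, h.coe_toS]

theorem IsTest.memLp {g : ℝ → ℂ} (h : IsTest g) : MemLp g 2 volume :=
  memLp_of_test h.smooth.continuous h.compact

theorem IsTest.integrable {g : ℝ → ℂ} (h : IsTest g) : Integrable g :=
  h.smooth.continuous.integrable_of_hasCompactSupport h.compact

theorem IsTest.n2_fourier {g : ℝ → ℂ} (h : IsTest g) : n2 (𝓕 g) = n2 g := by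
  rw [← h.rapidDecay.n2_fourierInv, h.fourierInv_fourier]

theorem IsTest.deriv {g : ℝ → ℂ} (h : IsTest g) : IsTest (deriv g) :=
  ⟨(contDiff_infty_iff_deriv.1 h.smooth).2, h.compact.deriv⟩

theorem IsTest.fourier_deriv {g : ℝ → ℂ} (h : IsTest g) (ξ : ℝ) :
    𝓕 (_root_.deriv g) ξ = 2 * π * Complex.I * (ξ * 𝓕 g ξ) := by
  rw [Real.fourier_deriv h.integrable (h.smooth.differentiable (by simp)) h.deriv.integrable]
  simp only [smul_eq_mul]
  ring

theorem IsTest.add {f g : ℝ → ℂ} (hf : IsTest f) (hg : IsTest g) : IsTest fun x => f x + g x :=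
  ⟨hf.smooth.add hg.smooth, hf.compact.add hg.compact⟩

theorem IsTest.mul_left {f g : ℝ → ℂ} (hg : IsTest g) (hf : ContDiff ℝ ∞ f) :
    IsTest fun x => f x * g x :=
  ⟨hf.mul hg.smooth, hg.compact.mul_left⟩

theorem IsTest.const_mul {g : ℝ → ℂ} (hg : IsTest g) (c : ℂ) : IsTest fun x => c * g x :=
  hg.mul_left contDiff_const

theorem isTest_zero : IsTest fun _ => 0 := ⟨contDiff_const, HasCompactSupport.zero⟩

/-- `g` lives where `R - 5/4 ≤ ν y ≤ 2 R`. -/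
def ShellSupp (ν R : ℝ) (g : ℝ → ℂ) : Prop := ∀ y, g y ≠ 0 → R - 5 / 4 ≤ ν * y ∧ ν * y ≤ 2 * R

theorem ShellSupp.abs_le_two_mul {ν R : ℝ} (hν : ν = 1 ∨ ν = -1) (hR : 1 ≤ R) {g : ℝ → ℂ}
    (h : ShellSupp ν R g) {y : ℝ} (hy : g y ≠ 0) : |y| ≤ 2 * R := by
  obtain ⟨h1, h2⟩ := h y hy
  have : |y| = |ν * y| := by rw [abs_mul, abs_of_sign hν, one_mul]
  rw [this, abs_le]
  constructor <;> linarith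

theorem ShellSupp.integral_norm_le {ν R : ℝ} (hν : ν = 1 ∨ ν = -1) (hR : 1 ≤ R) {g : ℝ → ℂ}
    (hg : IsTest g) (h : ShellSupp ν R g) : ∫ y, ‖g y‖ ≤ 2 * R * n2 g := by
  set χ : ℝ → ℂ := indicator (Icc (-(2 * R)) (2 * R)) fun _ => 1 with hχ
  have hχm : MemLp χ 2 volume :=
    memLp_indicator_const 2 measurableSet_Icc 1 (Or.inr (by simp))
  have h1 : ∀ y, ‖g y‖ = ‖χ y * g y‖ := by
    intro y
    by_cases hy : g y = 0
    · simp [hy]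
    · have := abs_le.1 (h.abs_le_two_mul hν hR hy)
      rw [hχ, indicator_of_mem (show y ∈ Icc (-(2 * R)) (2 * R) from this), one_mul]
  have h2 : n2 χ ≤ 2 * R := by
    refine abs_le_of_sq_le_sq' ?_ (by linarith) |>.2
    rw [n2_sq hχm]
    have : (fun x => ‖χ x‖ ^ 2) = indicator (Icc (-(2 * R)) (2 * R)) fun _ => (1 : ℝ) := by
      ext x
      by_cases hx : x ∈ Icc (-(2 * R)) (2 * R) <;> simp [hχ, hx]
    rw [this, integral_indicator measurableSet_Icc]
    simp only [integral_const, MeasurableSet.univ, measureReal_restrict_apply, univ_inter,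
      Real.volume_real_Icc, smul_eq_mul, mul_one]
    rw [max_eq_left (by linarith)]
    nlinarith
  calc ∫ y, ‖g y‖ = ∫ y, ‖χ y * g y‖ := integral_congr_ae (ae_of_all _ h1)
    _ ≤ n2 χ * n2 g := integral_norm_mul_le hχm hg.memLp
    _ ≤ _ := by gcongr; exact n2_nonneg _

/-- The part of the line well inside the shell. -/
def innerSet (ν R : ℝ) : Set ℝ := {x | ν * x < R / 2 - 5 / 4}

theorem measurableSet_innerSet (ν R : ℝ) : MeasurableSet (innerSet ν R) :=
  measurableSet_lt (by fun_prop) measurable_const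

theorem n2_indicator_le {F : ℝ → ℂ} (hF : MemLp F 2 volume) (s : Set ℝ) :
    n2 (indicator s F) ≤ n2 F :=
  n2_mono hF (ae_of_all _ fun x => norm_indicator_le_norm_self F x)

/-- The part of the source inside the shell contributes little. -/
theorem exists_inner_bound {N k : ℕ} (hN : N ≠ 0) (p : ℕ) (hp : N + k = p + 4) :
    ∃ C, 0 ≤ C ∧ ∀ ν τ : ℝ, (ν = 1 ∨ ν = -1) → (τ = 1 ∨ τ = -1) →
      ∀ s α R : ℝ, 0 ≤ s → 0 < α → 1 ≤ R → ∀ F g : ℝ → ℂ, MemLp F 2 volume →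
      IsTest g → ShellSupp ν R g →
      (1 + s ^ 2) * ‖pair (indicator (innerSet ν R) F) (fun ξ : ℝ => freeSymbol (-τ * s) ξ *
          (ξ ^ k * (cutPoly α (ν * τ) (.X ^ N) ξ * 𝓕 g ξ)))‖
        ≤ C * (R ^ 5 * (α * R)⁻¹ ^ N) * (n2 F * n2 g) := by
  obtain ⟨C, hC, hb⟩ := exists_contour_bound hN p hp
  have hJ : MemLp (fun d : ℝ => ((√((1 + d ^ 2)⁻¹) : ℝ) : ℂ)) 2 volume := by
    rw [memLp_two_iff_integrable_sq_norm (Continuous.aestronglyMeasurable (by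
      have : ∀ x : ℝ, 1 + x ^ 2 ≠ 0 := fun x => by positivity
      fun_prop (disch := assumption)))]
    refine integrable_inv_one_add_sq.congr (ae_of_all _ fun x => ?_)
    simp only [Complex.norm_real, Real.norm_eq_abs, sq_abs]
    rw [Real.sq_sqrt (by positivity)]
  set κ := n2 fun d : ℝ => ((√((1 + d ^ 2)⁻¹) : ℝ) : ℂ) with hκ
  have hκ0 : 0 ≤ κ := n2_nonneg _
  refine ⟨C * 2 ^ p * 3 * κ * 2, by positivity, ?_⟩
  intro ν τ hν hτ s α R hs hα hR F g hF hg hsupp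
  have hR0 : 0 < R := by linarith
  set Θ : ℝ → ℂ := 𝓕⁻ (fun ξ : ℝ => freeSymbol (-τ * s) ξ *
          (ξ ^ k * (cutPoly α (ν * τ) (.X ^ N) ξ * 𝓕 g ξ))) with hΘ
  set g1 := ∫ y, ‖g y‖ with hg1
  have hg10 : 0 ≤ g1 := integral_nonneg fun _ => norm_nonneg _
  have hg1' : g1 ≤ 2 * R * n2 g := hsupp.integral_norm_le hν hR hg
  have hpt : ∀ x ∈ innerSet ν R, (1 + s ^ 2) * ‖Θ x‖
      ≤ (C * 2 ^ p * 3 * (α⁻¹ ^ N * R⁻¹ ^ p) * g1) * √((1 + (R - 5 / 4 - ν * x) ^ 2)⁻¹) := by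
    intro x hx
    have hx : ν * x < R / 2 - 5 / 4 := hx
    set d := R - 5 / 4 - ν * x with hd
    have hdR : R / 2 ≤ d := by linarith
    have hd2 : 1 / 2 ≤ d := by linarith
    have hd0 : 0 < d := by linarith
    have h1 := hb ν τ hν hτ s α d x hs hα hd2 g hg.integrable hg.rapidDecay (fun y hy => by
      by_contra h
      have := (hsupp y h).1
      linarith)
    refine h1.trans ?_
    have e1 : d⁻¹ ≤ 3 * √((1 + d ^ 2)⁻¹) := by
      rw [Real.sqrt_inv, ← div_eq_mul_inv, le_div_iff₀ (by positivity), inv_mul_le_iff₀ hd0]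
      refine Real.sqrt_le_left (by positivity) |>.2 ?_
      nlinarith
    have e2 : d⁻¹ ≤ 2 * R⁻¹ := by
      rw [inv_le_comm₀ hd0 (by positivity), mul_inv, inv_inv]; linarith
    calc C * (α⁻¹ ^ N * d⁻¹ ^ (p + 1)) * g1 = C * (α⁻¹ ^ N * (d⁻¹ ^ p * d⁻¹)) * g1 := by rw [pow_succ]
      _ ≤ C * (α⁻¹ ^ N * ((2 * R⁻¹) ^ p * (3 * √((1 + d ^ 2)⁻¹)))) * g1 := by gcongr
      _ = _ := by rw [mul_pow]; ring
  have hn : (1 + s ^ 2) * n2 (indicator (innerSet ν R) Θ)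
      ≤ (C * 2 ^ p * 3 * (α⁻¹ ^ N * R⁻¹ ^ p) * g1) * κ := by
    have hshift : n2 (fun x : ℝ => ((√((1 + (R - 5 / 4 - ν * x) ^ 2)⁻¹) : ℝ) : ℂ)) = κ ∧
        MemLp (fun x : ℝ => ((√((1 + (R - 5 / 4 - ν * x) ^ 2)⁻¹) : ℝ) : ℂ)) 2 volume := by
      have hmp : MeasurePreserving (fun x : ℝ => R - 5 / 4 - ν * x) volume volume := by
        rcases hν with rfl | rfl
        · simpa using Measure.measurePreserving_sub_left volume (R - 5 / 4)
        · simpa using measurePreserving_add_left volume (R - 5 / 4)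
      refine ⟨?_, hJ.comp_measurePreserving hmp⟩
      rw [hκ, n2, n2, ← eLpNorm_comp_measurePreserving hJ.1 hmp]
      rfl
    have h0 : ((1 + s ^ 2 : ℝ) : ℝ) * n2 (indicator (innerSet ν R) Θ)
        = n2 (fun x => ((1 + s ^ 2 : ℝ) : ℂ) * indicator (innerSet ν R) Θ x) := by
      rw [n2_const_mul, Complex.norm_real, Real.norm_of_nonneg (by positivity)]
    rw [h0, ← hshift.1]
    refine n2_le_of_ae_le hshift.2 (by positivity) (ae_of_all _ fun x => ?_)
    by_cases hx : x ∈ innerSet ν R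
    · rw [indicator_of_mem hx, norm_mul, Complex.norm_real, Real.norm_of_nonneg (by positivity),
        Complex.norm_real, Real.norm_of_nonneg (by positivity)]
      exact hpt x hx
    · rw [indicator_of_notMem hx, mul_zero, norm_zero]
      positivity
  have hρ : RapidDecay (fun ξ : ℝ => freeSymbol (-τ * s) ξ *
      (ξ ^ k * (cutPoly α (ν * τ) (.X ^ N) ξ * 𝓕 g ξ))) := by
    refine RapidDecay.freeSymbol_mul ?_ _
    refine RapidDecay.mul_growth (hg.rapidDecay.cutPoly_mul hα _ _) (g := fun ξ : ℝ => (ξ : ℂ) ^ k)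
      (by fun_prop) (K := 1) (p := k) fun ξ => ?_
    rw [norm_pow, Complex.norm_real, Real.norm_eq_abs, one_mul]
    gcongr
    linarith
  have hpair : pair (indicator (innerSet ν R) F) (fun ξ : ℝ => freeSymbol (-τ * s) ξ *
      (ξ ^ k * (cutPoly α (ν * τ) (.X ^ N) ξ * 𝓕 g ξ))) = ∫ x, F x * indicator (innerSet ν R) Θ x := by
    rw [pair]
    congr 1; ext x
    by_cases hx : x ∈ innerSet ν R <;> simp [hx, hΘ]
  rw [hpair]
  have hΘm : MemLp (indicator (innerSet ν R) Θ) 2 volume :=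
    hρ.memLp_fourierInv.indicator (measurableSet_innerSet ν R)
  have e5 : R⁻¹ ^ p * R ≤ R ^ 5 * R⁻¹ ^ N := by
    have : R⁻¹ ^ (N + k) ≤ R⁻¹ ^ N :=
      pow_le_pow_of_le_one (by positivity) (inv_le_one_of_one_le₀ hR) (by omega)
    calc R⁻¹ ^ p * R = R ^ 5 * R⁻¹ ^ (p + 4) := by
          rw [pow_add, inv_pow R 4]; field_simp
      _ ≤ _ := by rw [← hp]; gcongr
  calc _ ≤ (1 + s ^ 2) * (n2 F * n2 (indicator (innerSet ν R) Θ)) := by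
        gcongr; exact norm_integral_mul_le hF hΘm
    _ = n2 F * ((1 + s ^ 2) * n2 (indicator (innerSet ν R) Θ)) := by ring
    _ ≤ n2 F * ((C * 2 ^ p * 3 * (α⁻¹ ^ N * R⁻¹ ^ p) * (2 * R * n2 g)) * κ) := by
        have := n2_nonneg F
        refine mul_le_mul_of_nonneg_left (hn.trans ?_) this
        gcongr
    _ = (C * 2 ^ p * 3 * κ * 2) * (α⁻¹ ^ N * (R⁻¹ ^ p * R)) * (n2 F * n2 g) := by ring
    _ ≤ (C * 2 ^ p * 3 * κ * 2) * (α⁻¹ ^ N * (R ^ 5 * R⁻¹ ^ N)) * (n2 F * n2 g) := by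
        have := n2_nonneg F
        have := n2_nonneg g
        gcongr
    _ = _ := by rw [mul_inv, mul_pow]; ring

theorem one_le_jap (x : ℝ) : 1 ≤ jap x := by
  rw [jap, Real.one_le_sqrt]; nlinarith [sq_nonneg x]

theorem jap_pos (x : ℝ) : 0 < jap x := zero_lt_one.trans_le (one_le_jap x)

theorem abs_le_jap (x : ℝ) : |x| ≤ jap x := Real.abs_le_sqrt (by linarith)

theorem continuous_jap : Continuous jap := by unfold jap; fun_prop

theorem continuous_jap_rpow (a : ℝ) : Continuous fun x => jap x ^ a :=
  continuous_jap.rpow_const fun x => Or.inl (jap_pos x).ne'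

/-- `⟨x⟩^a F`. -/
noncomputable def wt (a : ℝ) (F : ℝ → ℂ) (x : ℝ) : ℂ := ((jap x ^ a : ℝ) : ℂ) * F x

theorem norm_wt (a : ℝ) (F : ℝ → ℂ) (x : ℝ) : ‖wt a F x‖ = jap x ^ a * ‖F x‖ := by
  rw [wt, norm_mul, Complex.norm_real, Real.norm_of_nonneg (Real.rpow_nonneg (jap_pos x).le _)]

theorem aestronglyMeasurable_of_wt {a : ℝ} {F : ℝ → ℂ}
    (h : AEStronglyMeasurable (wt a F) (volume : Measure ℝ)) :
    AEStronglyMeasurable F (volume : Measure ℝ) := by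
  have h2 : AEStronglyMeasurable (fun x => ((jap x ^ (-a) : ℝ) : ℂ) * wt a F x) volume :=
    ((Complex.continuous_ofReal.comp (continuous_jap_rpow (-a))).aestronglyMeasurable).mul h
  refine h2.congr (ae_of_all _ fun x => ?_)
  simp only [wt]
  rw [← mul_assoc, ← Complex.ofReal_mul, ← Real.rpow_add (jap_pos x)]
  simp

theorem aestronglyMeasurable_wt {F : ℝ → ℂ} (a : ℝ)
    (h : AEStronglyMeasurable F (volume : Measure ℝ)) :
    AEStronglyMeasurable (wt a F) (volume : Measure ℝ) :=
  ((Complex.continuous_ofReal.comp (continuous_jap_rpow a)).aestronglyMeasurable).mul h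

theorem wt_zero (F : ℝ → ℂ) : wt 0 F = F := by ext; simp [wt]

/-- Lower powers of the weight, for a function controlled by `⟨x⟩^j F`. -/
theorem memLp_of_wt {a j : ℝ} (hj : j ≤ a) {F G : ℝ → ℂ} (hF : MemLp (wt a F) 2 volume)
    (hG : AEStronglyMeasurable G (volume : Measure ℝ)) (h : ∀ x, ‖G x‖ ≤ jap x ^ j * ‖F x‖) :
    MemLp G 2 volume := by
  refine hF.of_le hG (ae_of_all _ fun x => (h x).trans ?_)
  rw [norm_wt]
  gcongr
  exact one_le_jap x

theorem memLp_of_wt' {a : ℝ} (ha : 0 ≤ a) {F : ℝ → ℂ} (hF : MemLp (wt a F) 2 volume) :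
    MemLp F 2 volume :=
  memLp_of_wt ha hF (aestronglyMeasurable_of_wt hF.1) fun x => by simp

theorem le_jap_of_notMem_innerSet {ν R x : ℝ} (hν : ν = 1 ∨ ν = -1) (h : x ∉ innerSet ν R) :
    R / 8 ≤ jap x := by
  have h1 : R / 2 - 5 / 4 ≤ ν * x := not_lt.1 h
  have h2 : ν * x ≤ |x| := by
    calc ν * x ≤ |ν * x| := le_abs_self _
      _ = |x| := by rw [abs_mul, abs_of_sign hν, one_mul]
  have h3 := abs_le_jap x
  have h4 := one_le_jap x
  rcases le_total R (10 / 3) with h | h <;> linarith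

theorem n2_outer_le {a j : ℝ} (hj0 : 0 ≤ j) (hj : j ≤ a) {ν R : ℝ} (hν : ν = 1 ∨ ν = -1) (hR : 1 ≤ R)
    {F G : ℝ → ℂ} (hF : MemLp (wt a F) 2 volume)
    (h : ∀ x ∉ innerSet ν R, ‖G x‖ ≤ jap x ^ j * ‖F x‖) (h0 : ∀ x ∈ innerSet ν R, G x = 0) :
    n2 G ≤ 8 ^ a * R ^ (j - a) * n2 (wt a F) := by
  refine n2_le_of_ae_le hF (by positivity) (ae_of_all _ fun x => ?_)
  by_cases hx : x ∈ innerSet ν R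
  · rw [h0 x hx, norm_zero]; positivity
  · refine (h x hx).trans ?_
    rw [norm_wt, ← mul_assoc]
    gcongr
    have h1 := le_jap_of_notMem_innerSet hν hx
    have hR0 : 0 < R := by linarith
    have h2 : (R / 8) ^ (a - j) ≤ jap x ^ (a - j) := by gcongr
    have h3 : jap x ^ a = jap x ^ j * jap x ^ (a - j) := by
      rw [← Real.rpow_add (jap_pos x)]; congr 1; ring
    have h4 : (1 : ℝ) ≤ 8 ^ a * R ^ (j - a) * (R / 8) ^ (a - j) := by
      have e : R ^ (j - a) = (R ^ (a - j))⁻¹ := by rw [← Real.rpow_neg hR0.le]; congr 1; ring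
      rw [Real.div_rpow hR0.le (by norm_num), e]
      have : (8 : ℝ) ^ a * (R ^ (a - j))⁻¹ * (R ^ (a - j) / 8 ^ (a - j)) = 8 ^ a / 8 ^ (a - j) := by
        have : R ^ (a - j) ≠ 0 := by positivity
        field_simp
      rw [this, le_div_iff₀ (by positivity), one_mul]
      exact Real.rpow_le_rpow_of_exponent_le (by norm_num) (by linarith)
    calc jap x ^ j = jap x ^ j * 1 := (mul_one _).symm
      _ ≤ jap x ^ j * (8 ^ a * R ^ (j - a) * jap x ^ (a - j)) := by
          have : 0 ≤ jap x ^ j := Real.rpow_nonneg (jap_pos x).le _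
          gcongr
          refine h4.trans ?_
          gcongr
      _ = _ := by rw [h3]; ring

theorem pair_split {F ρ : ℝ → ℂ} (hF : MemLp F 2 volume) (h : RapidDecay ρ) {s : Set ℝ}
    (hs : MeasurableSet s) :
    pair F ρ = pair (indicator s F) ρ + pair (indicator sᶜ F) ρ := by
  rw [pair, pair, pair, ← integral_add
    (integrable_mul_of_memLp (hF.indicator hs) h.memLp_fourierInv)
    (integrable_mul_of_memLp (hF.indicator hs.compl) h.memLp_fourierInv)]
  congr 1; ext x
  by_cases hx : x ∈ s <;> simp [hx]

/-- The symbol of the source term attached to the test function `g`. -/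
noncomputable def psym (τ s α ς : ℝ) (N : ℕ) (g : ℝ → ℂ) : ℝ → ℂ :=
  sym (-τ * s) α ς (.X ^ N) (𝓕 g)

theorem IsTest.psym {g : ℝ → ℂ} (h : IsTest g) (τ s : ℝ) {α : ℝ} (hα : 0 < α) (ς : ℝ) (N : ℕ) :
    RapidDecay (psym τ s α ς N g) := h.rapidDecay.sym _ hα ς _

theorem psym_deriv {g : ℝ → ℂ} (h : IsTest g) (τ s α ς : ℝ) (N : ℕ) :
    psym τ s α ς N (deriv g)
      = fun ξ => (2 * π * Complex.I) * symD (-τ * s) α ς (.X ^ N) (𝓕 g) ξ := by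
  ext ξ
  rw [psym, sym, symD, h.fourier_deriv]
  ring

/-- Shell estimate without smoothing. -/
theorem exists_shell_bound {a : ℝ} (ha : 0 ≤ a) {N : ℕ} (hN : 4 ≤ N) :
    ∃ C, 0 ≤ C ∧ ∀ ν τ : ℝ, (ν = 1 ∨ ν = -1) → (τ = 1 ∨ τ = -1) →
      ∀ s α R : ℝ, 0 ≤ s → 0 < α → 1 ≤ R → ∀ F g : ℝ → ℂ, MemLp (wt a F) 2 volume →
      IsTest g → ShellSupp ν R g →
      ‖pair F (psym τ s α (ν * τ) N g)‖
        ≤ C * (R ^ (-a) + R ^ 5 * (α * R)⁻¹ ^ N) * (n2 (wt a F) * n2 g) := by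
  obtain ⟨C1, hC1, h1⟩ := exists_inner_bound (N := N) (k := 0) (by omega) (N - 4) (by omega)
  obtain ⟨C2, hC2, h2⟩ := norm_pair_sym_le (.X ^ N)
  refine ⟨C1 + C2 * 8 ^ a, by positivity, ?_⟩
  intro ν τ hν hτ s α R hs hα hR F g hF hg hsupp
  have hF0 := memLp_of_wt' ha hF
  have hR0 : 0 < R := by linarith
  have hn : n2 F ≤ n2 (wt a F) := n2_mono hF (ae_of_all _ fun x => by
    rw [norm_wt]
    exact le_mul_of_one_le_left (norm_nonneg _) (Real.one_le_rpow (one_le_jap x) ha))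
  have i1 := h1 ν τ hν hτ s α R hs hα hR F g hF0 hg hsupp
  simp only [pow_zero, one_mul] at i1
  have i1' : ‖pair (indicator (innerSet ν R) F) (psym τ s α (ν * τ) N g)‖
      ≤ C1 * (R ^ 5 * (α * R)⁻¹ ^ N) * (n2 F * n2 g) :=
    (le_mul_of_one_le_left (norm_nonneg _) (by nlinarith [sq_nonneg s])).trans i1
  have hFo := hF0.indicator (measurableSet_innerSet ν R).compl
  have i2 := h2 (-τ * s) α (ν * τ) hα _ _ hFo hg.rapidDecay
  rw [hg.n2_fourier] at i2
  have i3 := n2_outer_le (G := indicator (innerSet ν R)ᶜ F) le_rfl ha hν hR hF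
    (fun x hx => by simp [hx]) (fun x hx => by simp [hx])
  rw [zero_sub] at i3
  rw [pair_split hF0 (hg.psym τ s hα _ N) (measurableSet_innerSet ν R)]
  have hg0 := n2_nonneg g
  have hw0 := n2_nonneg (wt a F)
  calc _ ≤ C1 * (R ^ 5 * (α * R)⁻¹ ^ N) * (n2 F * n2 g)
        + C2 * (n2 (indicator (innerSet ν R)ᶜ F) * n2 g) := (norm_add_le _ _).trans (add_le_add i1' i2)
    _ ≤ C1 * (R ^ 5 * (α * R)⁻¹ ^ N) * (n2 (wt a F) * n2 g)
        + C2 * ((8 ^ a * R ^ (-a) * n2 (wt a F)) * n2 g) := by gcongr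
    _ ≤ C1 * (R ^ (-a) + R ^ 5 * (α * R)⁻¹ ^ N) * (n2 (wt a F) * n2 g)
        + C2 * 8 ^ a * ((R ^ (-a) + R ^ 5 * (α * R)⁻¹ ^ N) * (n2 (wt a F) * n2 g)) := by
        refine add_le_add ?_ ?_
        · gcongr
          exact le_add_of_nonneg_left (by positivity)
        · rw [show C2 * (8 ^ a * R ^ (-a) * n2 (wt a F) * n2 g)
            = C2 * 8 ^ a * (R ^ (-a) * (n2 (wt a F) * n2 g)) by ring]
          gcongr
          exact le_add_of_nonneg_right (by positivity)
    _ = _ := by ring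

theorem fourierInv_dS (η : SchwartzMap ℝ ℂ) (x : ℝ) :
    𝓕⁻ (dS η : ℝ → ℂ) x = -(2 * π * Complex.I) * (x * 𝓕⁻ (η : ℝ → ℂ) x) :=
  (rapidDecay_schwartz η).fourierInv_deriv (rapidDecay_schwartz (dS η)) (hasDerivAt_schwartz η) x

theorem n2_dS_le (η : SchwartzMap ℝ ℂ) {L : ℝ} (hL : 0 ≤ L)
    (h : ∀ x, 𝓕⁻ (η : ℝ → ℂ) x ≠ 0 → |x| ≤ L) : n2 (dS η) ≤ 2 * π * L * n2 η := by
  rw [← (rapidDecay_schwartz (dS η)).n2_fourierInv, ← (rapidDecay_schwartz η).n2_fourierInv]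
  refine n2_le_of_ae_le (rapidDecay_schwartz η).memLp_fourierInv (by positivity)
    (ae_of_all _ fun x => ?_)
  rw [fourierInv_dS, norm_mul, norm_mul, norm_neg, norm_mul, norm_mul, Complex.norm_I, Complex.norm_real,
    Complex.norm_real, Real.norm_of_nonneg Real.pi_pos.le, Complex.norm_ofNat, mul_one, ← mul_assoc]
  by_cases hx : 𝓕⁻ (η : ℝ → ℂ) x = 0
  · simp [hx]
  · have := h x hx
    rw [← Real.norm_eq_abs] at this
    gcongr

theorem outer_local_decay_bound {C A n x0 x1 x2 y1 y2 β R L : ℝ} (hC : 0 ≤ C) (hβ : 0 ≤ β) (hβR : β ≤ R)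
    (hL : 0 ≤ L) (hn : 0 ≤ n) (hA : 0 ≤ A)
    (h0 : x0 ≤ A) (h1 : x1 ≤ A * R) (h2 : x2 ≤ A * R ^ 2)
    (hy1 : y1 ≤ L * R * n) (hy2 : y2 ≤ L * R * (L * R * n)) (l1 : 0 ≤ y1) (l2 : 0 ≤ y2) :
    C * (x1 * n + x0 * (β * n + y1)) ≤ C * (3 + 2 * L + L ^ 2) * (A * R) * n ∧
    C * (β * (x2 * n + x1 * (β * n + y1) + x0 * (β * (β * n) + β * y1 + y2)))
      ≤ C * (3 + 2 * L + L ^ 2) * (β * (A * R ^ 2)) * n := by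
  have hR : 0 ≤ R := hβ.trans hβR
  constructor
  · calc _ ≤ C * (A * R * n + A * (R * n + L * R * n)) := by gcongr
      _ = C * (2 + L) * (A * R) * n := by ring
      _ ≤ _ := by
        have h := mul_le_mul_of_nonneg_left (by nlinarith : 2 + L ≤ 3 + 2 * L + L ^ 2)
          (by positivity : 0 ≤ C * (A * R) * n)
        linarith
  · calc _ ≤ C * (β * (A * R ^ 2 * n + A * R * (R * n + L * R * n)
          + A * (R * (R * n) + R * (L * R * n) + L * R * (L * R * n)))) := by gcongr
      _ = _ := by ring

/-- Shell estimate with one derivative gained from dispersion. -/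
theorem exists_shell_bound_deriv {a : ℝ} (ha : 2 ≤ a) {N : ℕ} (hN : 4 ≤ N) :
    ∃ C, 0 ≤ C ∧ ∀ ν τ : ℝ, (ν = 1 ∨ ν = -1) → (τ = 1 ∨ τ = -1) →
      ∀ s α R : ℝ, 0 < s → 0 < α → 1 ≤ R → 1 ≤ α * R → ∀ F g : ℝ → ℂ,
      MemLp (wt a F) 2 volume → IsTest g → ShellSupp ν R g →
      ‖pair F (psym τ s α (ν * τ) N (deriv g))‖
        ≤ C * (min (R ^ (1 - a) * s⁻¹) (α⁻¹ * R ^ (2 - a) * (s ^ 2)⁻¹)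
          + R ^ 5 * (α * R)⁻¹ ^ N * (1 + s ^ 2)⁻¹) * (n2 (wt a F) * n2 g) := by
  obtain ⟨C1, hC1, h1⟩ := exists_inner_bound (N := N) (k := 1) (by omega) (N - 3) (by omega)
  obtain ⟨C2, hC2, h2⟩ := local_decay_one (.X ^ (N - 2))
  obtain ⟨C3, hC3, h3⟩ := local_decay_two (.X ^ (N - 4))
  have hX2 : (.X ^ 2 * .X ^ (N - 2) : Polynomial ℝ) = .X ^ N := by rw [← pow_add]; congr 1; omega
  have hX4 : (.X ^ 4 * .X ^ (N - 4) : Polynomial ℝ) = .X ^ N := by rw [← pow_add]; congr 1; omega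
  rw [hX2] at h2
  rw [hX4] at h3
  have hpi := Real.pi_pos
  set L := 4 * π with hL
  set D := 3 + 2 * L + L ^ 2 with hD
  have hD0 : 0 ≤ D := by positivity
  refine ⟨2 * π * (C1 + (C2 + C3) * D * 8 ^ a), by positivity, ?_⟩
  intro ν τ hν hτ s α R hs hα hR hαR F g hF hg hsupp
  have ha0 : 0 ≤ a := by linarith
  have hF0 := memLp_of_wt' ha0 hF
  have hR0 : 0 < R := by linarith
  have hς : ν * τ = 1 ∨ ν * τ = -1 := by
    rcases hν with rfl | rfl <;> rcases hτ with rfl | rfl <;> simp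
  have hn : n2 F ≤ n2 (wt a F) := n2_mono hF (ae_of_all _ fun x => by
    rw [norm_wt]
    exact le_mul_of_one_le_left (norm_nonneg _) (Real.one_le_rpow (one_le_jap x) ha0))
  set W := n2 (wt a F) with hW
  set n := n2 g with hng
  have hn0 : 0 ≤ n := n2_nonneg g
  have hW0 : 0 ≤ W := n2_nonneg _
  have i1 := h1 ν τ hν hτ s α R hs.le hα hR F g hF0 hg hsupp
  simp only [pow_one] at i1
  change _ * ‖pair _ (symD (-τ * s) α (ν * τ) (.X ^ N) (𝓕 g))‖ ≤ _ at i1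
  set Fo := indicator (innerSet ν R)ᶜ F with hFo
  have hFom : MemLp Fo 2 volume := hF0.indicator (measurableSet_innerSet ν R).compl
  have hm1 : AEStronglyMeasurable (fun x : ℝ => (x : ℂ) * Fo x) volume :=
    AEStronglyMeasurable.mul (by fun_prop) hFom.1
  have hm2 : AEStronglyMeasurable (fun x : ℝ => (x : ℂ) * (x * Fo x)) volume :=
    AEStronglyMeasurable.mul (by fun_prop) hm1
  have b0 : ∀ x, ‖Fo x‖ ≤ jap x ^ (0 : ℝ) * ‖F x‖ := fun x => by
    rw [Real.rpow_zero, one_mul]; exact norm_indicator_le_norm_self F x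
  have b1 : ∀ x : ℝ, ‖(x : ℂ) * Fo x‖ ≤ jap x ^ (1 : ℝ) * ‖F x‖ := fun x => by
    rw [Real.rpow_one, norm_mul, Complex.norm_real]
    have := abs_le_jap x
    have := jap_pos x
    gcongr
    · exact abs_le_jap x
    · exact norm_indicator_le_norm_self F x
  have b2 : ∀ x : ℝ, ‖(x : ℂ) * (x * Fo x)‖ ≤ jap x ^ (2 : ℝ) * ‖F x‖ := fun x => by
    rw [Real.rpow_two, norm_mul, norm_mul, Complex.norm_real, ← mul_assoc, ← pow_two]
    have := jap_pos x
    gcongr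
    · exact abs_le_jap x
    · exact norm_indicator_le_norm_self F x
  have z0 : ∀ x ∈ innerSet ν R, Fo x = 0 := fun x hx => by simp [hFo, hx]
  have x0 := n2_outer_le le_rfl ha0 hν hR hF (fun x _ => b0 x) z0
  have x1 := n2_outer_le (G := fun x : ℝ => (x : ℂ) * Fo x) zero_le_one (by linarith) hν hR hF
    (fun x _ => b1 x) (fun x hx => by simp [z0 x hx])
  have x2 := n2_outer_le (G := fun x : ℝ => (x : ℂ) * (x * Fo x)) zero_le_two (by linarith) hν hR hF
    (fun x _ => b2 x) (fun x hx => by simp [z0 x hx])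
  have hx1 : MemLp (fun x : ℝ => (x : ℂ) * Fo x) 2 volume := memLp_of_wt (by linarith) hF hm1 b1
  have hx2 : MemLp (fun x : ℝ => (x : ℂ) * (x * Fo x)) 2 volume := memLp_of_wt (by linarith) hF hm2 b2
  have y0 : n2 hg.hat = n := by rw [hg.coe_hat, hg.n2_fourier]
  have hsup0 : ∀ x, 𝓕⁻ (hg.hat : ℝ → ℂ) x ≠ 0 → |x| ≤ 2 * R := fun x hx => by
    rw [hg.coe_hat, hg.fourierInv_fourier] at hx
    exact hsupp.abs_le_two_mul hν hR hx
  have y1 : n2 (dS hg.hat) ≤ L * R * n := by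
    refine (n2_dS_le _ (by positivity) hsup0).trans_eq ?_
    rw [y0, hL]; ring
  have y2 : n2 (dS (dS hg.hat)) ≤ L * R * (L * R * n) := by
    refine (n2_dS_le _ (L := 2 * R) (by positivity) fun x hx => hsup0 x fun h => hx ?_).trans ?_
    · rw [fourierInv_dS, h]; simp
    · rw [show 2 * π * (2 * R) = L * R by rw [hL]; ring]
      gcongr
  have e1 : R ^ (1 - a) = R ^ (-a) * R := by
    rw [← Real.rpow_add_one hR0.ne']; congr 1; ring
  have e2 : R ^ (2 - a) = R ^ (-a) * R ^ 2 := by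
    rw [← Real.rpow_natCast, ← Real.rpow_add hR0]; congr 1; push_cast; ring
  have hαi : α⁻¹ ≤ R := by
    rw [inv_le_iff_one_le_mul₀ hα, mul_comm]; exact hαR
  set A := 8 ^ a * R ^ (-a) * W with hA
  have hx0' : n2 Fo ≤ A := by rw [zero_sub] at x0; exact x0
  have hx1' : n2 (fun x : ℝ => (x : ℂ) * Fo x) ≤ A * R := x1.trans_eq (by rw [hA, e1]; ring)
  have hx2' : n2 (fun x : ℝ => (x : ℂ) * (x * Fo x)) ≤ A * R ^ 2 := x2.trans_eq (by rw [hA, e2]; ring)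
  have hA0 : 0 ≤ A := by positivity
  have l1 := h2 (-τ * s) α (ν * τ) hα hς Fo hg.hat hFom hx1
  have l2 := h3 (-τ * s) α (ν * τ) hα hς Fo hg.hat hFom hx1 hx2
  rw [y0] at l1 l2
  rw [hg.coe_hat] at l1 l2
  have ob := fun C hC => outer_local_decay_bound (C := C) hC (inv_nonneg.2 hα.le) hαi (by positivity : 0 ≤ L)
    hn0 hA0 hx0' hx1' hx2' y1 y2 (n2_nonneg _) (n2_nonneg _)
  have l1' := l1.trans (ob C2 hC2).1
  have l2' := l2.trans (ob C3 hC3).2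
  have hτs : |-τ * s| = s := by
    rw [abs_mul, abs_neg, abs_of_sign hτ, one_mul, abs_of_pos hs]
  have hτs2 : (-τ * s) ^ 2 = s ^ 2 := by rw [← sq_abs, hτs]
  rw [hτs] at l1'
  rw [hτs2] at l2'
  set P := ‖pair Fo (symD (-τ * s) α (ν * τ) (.X ^ N) (𝓕 g))‖ with hP
  have hs2 : 0 < s ^ 2 := by positivity
  have m1 : P ≤ (C2 + C3) * D * 8 ^ a * (R ^ (1 - a) * s⁻¹) * (W * n) := by
    rw [mul_comm, ← le_div_iff₀ hs] at l1'
    refine l1'.trans ?_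
    rw [e1, div_eq_mul_inv]
    calc C2 * D * (A * R) * n * s⁻¹ = C2 * D * 8 ^ a * (R ^ (-a) * R * s⁻¹) * (W * n) := by rw [hA]; ring
      _ ≤ _ := by gcongr; linarith
  have m2 : P ≤ (C2 + C3) * D * 8 ^ a * (α⁻¹ * R ^ (2 - a) * (s ^ 2)⁻¹) * (W * n) := by
    rw [mul_comm, ← le_div_iff₀ hs2] at l2'
    refine l2'.trans ?_
    rw [e2, div_eq_mul_inv]
    calc C3 * D * (α⁻¹ * (A * R ^ 2)) * n * (s ^ 2)⁻¹
        = C3 * D * 8 ^ a * (α⁻¹ * (R ^ (-a) * R ^ 2) * (s ^ 2)⁻¹) * (W * n) := by rw [hA]; ring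
      _ ≤ _ := by gcongr; linarith
  have m3 : P ≤ (C2 + C3) * D * 8 ^ a * min (R ^ (1 - a) * s⁻¹) (α⁻¹ * R ^ (2 - a) * (s ^ 2)⁻¹) * (W * n) := by
    rcases min_choice (R ^ (1 - a) * s⁻¹) (α⁻¹ * R ^ (2 - a) * (s ^ 2)⁻¹) with h | h <;> rw [h]
    exacts [m1, m2]
  have m4 : ‖pair (indicator (innerSet ν R) F) (symD (-τ * s) α (ν * τ) (.X ^ N) (𝓕 g))‖
      ≤ C1 * (R ^ 5 * (α * R)⁻¹ ^ N * (1 + s ^ 2)⁻¹) * (W * n) := by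
    rw [mul_comm, ← le_div_iff₀ (by positivity), div_eq_mul_inv] at i1
    refine i1.trans ?_
    calc _ = C1 * (R ^ 5 * (α * R)⁻¹ ^ N * (1 + s ^ 2)⁻¹) * (n2 F * n) := by ring
      _ ≤ _ := by gcongr
  rw [psym_deriv hg, pair_const_mul, norm_mul, norm_mul, norm_mul, Complex.norm_I, Complex.norm_real,
    Real.norm_of_nonneg hpi.le, Complex.norm_ofNat, mul_one,
    pair_split hF0 (hg.rapidDecay.symD _ hα _ _) (measurableSet_innerSet ν R)]
  set m := min (R ^ (1 - a) * s⁻¹) (α⁻¹ * R ^ (2 - a) * (s ^ 2)⁻¹) with hm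
  have hm0 : 0 ≤ m := le_min (by positivity) (by positivity)
  set q := R ^ 5 * (α * R)⁻¹ ^ N * (1 + s ^ 2)⁻¹ with hq
  have hq0 : 0 ≤ q := by positivity
  calc _ ≤ 2 * π * (C1 * q * (W * n) + (C2 + C3) * D * 8 ^ a * m * (W * n)) := by
        gcongr
        exact (norm_add_le _ _).trans (add_le_add m4 m3)
    _ ≤ 2 * π * (C1 * (m + q) * (W * n) + (C2 + C3) * D * 8 ^ a * (m + q) * (W * n)) := by
        gcongr <;> linarith
    _ = _ := by ring

/-- The low-frequency complement of the two half-line cut-offs. -/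
noncomputable def lowCut (α : ℝ) (N : ℕ) (ξ : ℝ) : ℂ :=
  1 - cutPoly α 1 (.X ^ N) ξ - cutPoly α (-1) (.X ^ N) ξ

theorem continuous_lowCut {α : ℝ} (hα : 0 < α) (N : ℕ) : Continuous (lowCut α N) :=
  (continuous_const.sub (continuous_cutPoly hα _ _)).sub (continuous_cutPoly hα _ _)

theorem norm_lowCut_le {α : ℝ} (hα : 0 < α) {N : ℕ} (hN : N ≠ 0) (ξ : ℝ) :
    ‖lowCut α N ξ‖ ≤ N * (α / (|ξ| + α)) := by
  have key : ∀ ξ : ℝ, 0 ≤ ξ → ‖lowCut α N ξ‖ ≤ N * (α / (|ξ| + α)) := by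
    intro ξ hξ
    have e : lowCut α N ξ = ((1 - (halfCut α 1 ξ) ^ N : ℝ) : ℂ) := by
      rw [lowCut, cutPoly_X_pow_of_nonpos hN (show -1 * ξ ≤ 0 by linarith)]
      simp [cutPoly]
    have h0 := halfCut_nonneg hα 1 ξ
    have h1 := halfCut_le_one hα 1 ξ
    have h2 : α / (|ξ| + α) = 1 - halfCut α 1 ξ := by
      rw [halfCut, one_mul, max_eq_left hξ, abs_of_nonneg hξ]
      field_simp; ring
    rw [e, Complex.norm_real, Real.norm_of_nonneg (by linarith [pow_le_one₀ h0 h1 (n := N)]), h2]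
    have := one_add_mul_le_pow (a := halfCut α 1 ξ - 1) (by linarith) N
    rw [add_sub_cancel] at this
    linarith
  rcases le_total 0 ξ with h | h
  · exact key ξ h
  · have := key (-ξ) (by linarith)
    rw [abs_neg] at this
    convert this using 2
    simp only [lowCut, cutPoly_neg, neg_neg]
    ring

theorem norm_lowCut_le_nat {α : ℝ} (hα : 0 < α) {N : ℕ} (hN : N ≠ 0) (ξ : ℝ) : ‖lowCut α N ξ‖ ≤ N := by
  refine (norm_lowCut_le hα hN ξ).trans (mul_le_of_le_one_right (by positivity) ?_)
  rw [div_le_one (by positivity)]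
  linarith [abs_nonneg ξ]

theorem norm_id_mul_lowCut_le {α : ℝ} (hα : 0 < α) {N : ℕ} (hN : N ≠ 0) (ξ : ℝ) :
    ‖(ξ : ℂ) * lowCut α N ξ‖ ≤ N * α := by
  rw [norm_mul, Complex.norm_real, Real.norm_eq_abs]
  calc _ ≤ |ξ| * (N * (α / (|ξ| + α))) := by gcongr; exact norm_lowCut_le hα hN ξ
    _ = N * α * (|ξ| / (|ξ| + α)) := by ring
    _ ≤ N * α * 1 := by
        gcongr
        rw [div_le_one (by positivity)]
        linarith
    _ = _ := mul_one _

theorem RapidDecay.lowCut_mul {ρ : ℝ → ℂ} (h : RapidDecay ρ) {α : ℝ} (hα : 0 < α) {N : ℕ} (hN : N ≠ 0) :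
    RapidDecay (fun ξ => lowCut α N ξ * ρ ξ) :=
  h.mul_bdd (continuous_lowCut hα N) (norm_lowCut_le_nat hα hN)

theorem norm_pair_lowCut_deriv_le {α : ℝ} (hα : 0 < α) {N : ℕ} (hN : N ≠ 0) {F g : ℝ → ℂ}
    (hF : MemLp F 2 volume) (hg : IsTest g) :
    ‖pair F (fun ξ => lowCut α N ξ * 𝓕 (deriv g) ξ)‖ ≤ 2 * π * N * α * (n2 F * n2 g) := by
  have hpi := Real.pi_pos
  have h1 : n2 (fun ξ => lowCut α N ξ * 𝓕 (deriv g) ξ) ≤ 2 * π * N * α * n2 g := by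
    rw [← hg.n2_fourier]
    refine n2_le_of_ae_le hg.rapidDecay.memLp (by positivity) (ae_of_all _ fun ξ => ?_)
    rw [hg.fourier_deriv]
    calc _ = 2 * π * (‖(ξ : ℂ) * lowCut α N ξ‖ * ‖𝓕 g ξ‖) := by
          simp only [norm_mul, Complex.norm_I, Complex.norm_real, Complex.norm_ofNat,
            Real.norm_of_nonneg hpi.le]
          ring
      _ ≤ 2 * π * (N * α * ‖𝓕 g ξ‖) := by
          gcongr; exact norm_id_mul_lowCut_le hα hN ξ
      _ = _ := by ring
  calc _ ≤ n2 F * n2 (fun ξ => lowCut α N ξ * 𝓕 (deriv g) ξ) :=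
        norm_pair_le hF (hg.deriv.rapidDecay.lowCut_mul hα hN)
    _ ≤ n2 F * (2 * π * N * α * n2 g) := by gcongr; exact n2_nonneg F
    _ = _ := by ring

theorem freeSymbol_zero (ξ : ℝ) : freeSymbol 0 ξ = 1 := by simp [freeSymbol]

/-- Static shell estimate at low frequency. -/
theorem exists_shell_bound_static {a : ℝ} (ha : 0 ≤ a) {N : ℕ} (hN : 4 ≤ N) :
    ∃ C, 0 ≤ C ∧ ∀ ν : ℝ, (ν = 1 ∨ ν = -1) →
      ∀ α R : ℝ, 0 < α → 1 ≤ R → ∀ F g : ℝ → ℂ,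
      MemLp (wt a F) 2 volume → IsTest g → ShellSupp ν R g →
      ‖pair F (fun ξ => lowCut α N ξ * 𝓕 (deriv g) ξ)‖
        ≤ C * (α * R ^ (-a) + R ^ 5 * (α * R)⁻¹ ^ N) * (n2 (wt a F) * n2 g) := by
  obtain ⟨C1, hC1, h1⟩ := exists_inner_bound (N := N) (k := 1) (by omega) (N - 3) (by omega)
  have hpi := Real.pi_pos
  refine ⟨2 * π * (2 * C1 + N * 8 ^ a), by positivity, ?_⟩
  intro ν hν α R hα hR F g hF hg hsupp
  have hF0 := memLp_of_wt' ha hF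
  have hR0 : 0 < R := by linarith
  have hN0 : N ≠ 0 := by omega
  have hn : n2 F ≤ n2 (wt a F) := n2_mono hF (ae_of_all _ fun x => by
    rw [norm_wt]
    exact le_mul_of_one_le_left (norm_nonneg _) (Real.one_le_rpow (one_le_jap x) ha))
  have hg0 := n2_nonneg g
  have hw0 := n2_nonneg (wt a F)
  set Fi := indicator (innerSet ν R) F with hFi
  set Fo := indicator (innerSet ν R)ᶜ F with hFo
  have hFim : MemLp Fi 2 volume := hF0.indicator (measurableSet_innerSet ν R)
  have hFom : MemLp Fo 2 volume := hF0.indicator (measurableSet_innerSet ν R).compl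
  have hin : ∀ τ : ℝ, (τ = 1 ∨ τ = -1) →
      ‖pair Fi (fun ξ => cutPoly α (ν * τ) (.X ^ N) ξ * 𝓕 (deriv g) ξ)‖
        ≤ 2 * π * (C1 * (R ^ 5 * (α * R)⁻¹ ^ N) * (n2 (wt a F) * n2 g)) := by
    intro τ hτ
    have i := h1 ν τ hν hτ 0 α R le_rfl hα hR F g hF0 hg hsupp
    simp only [pow_one, mul_zero, freeSymbol_zero, one_mul, ne_eq, OfNat.ofNat_ne_zero,
      not_false_eq_true, zero_pow, add_zero] at i
    have e : (fun ξ => cutPoly α (ν * τ) (.X ^ N) ξ * 𝓕 (deriv g) ξ)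
        = fun ξ : ℝ => (2 * π * Complex.I) * (ξ * (cutPoly α (ν * τ) (.X ^ N) ξ * 𝓕 g ξ)) := by
      ext ξ; rw [hg.fourier_deriv]; ring
    rw [e, pair_const_mul, norm_mul, norm_mul, norm_mul, Complex.norm_I, Complex.norm_real,
      Real.norm_of_nonneg hpi.le, Complex.norm_ofNat, mul_one]
    gcongr
    refine i.trans ?_
    gcongr
  have hboth : ‖pair Fi (fun ξ => cutPoly α 1 (.X ^ N) ξ * 𝓕 (deriv g) ξ)‖
        ≤ 2 * π * (C1 * (R ^ 5 * (α * R)⁻¹ ^ N) * (n2 (wt a F) * n2 g)) ∧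
      ‖pair Fi (fun ξ => cutPoly α (-1) (.X ^ N) ξ * 𝓕 (deriv g) ξ)‖
        ≤ 2 * π * (C1 * (R ^ 5 * (α * R)⁻¹ ^ N) * (n2 (wt a F) * n2 g)) := by
    rcases hν with rfl | rfl
    · exact ⟨by simpa using hin 1 (Or.inl rfl), by simpa using hin (-1) (Or.inr rfl)⟩
    · exact ⟨by simpa using hin (-1) (Or.inr rfl), by simpa using hin 1 (Or.inl rfl)⟩
  have hone : pair Fi (𝓕 (deriv g)) = 0 := by
    rw [pair, hg.deriv.fourierInv_fourier]
    refine integral_eq_zero_of_ae (ae_of_all _ fun x => ?_)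
    by_cases hx : x ∈ innerSet ν R
    · have : deriv g x = 0 := by
        have hev : g =ᶠ[𝓝 x] fun _ => 0 := by
          have hopen : IsOpen (innerSet ν R) := isOpen_lt (by fun_prop) continuous_const
          filter_upwards [hopen.mem_nhds hx] with y hy
          by_contra h
          have h1 := (hsupp y h).1
          have h2 : ν * y < R / 2 - 5 / 4 := hy
          linarith
        rw [hev.deriv_eq]; simp
      simp [this]
    · simp [hFi, hx]
  have hsplit : pair Fi (fun ξ => lowCut α N ξ * 𝓕 (deriv g) ξ)
      = pair Fi (𝓕 (deriv g)) + (pair Fi (fun ξ => (-1) * (cutPoly α 1 (.X ^ N) ξ * 𝓕 (deriv g) ξ))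
        + pair Fi (fun ξ => (-1) * (cutPoly α (-1) (.X ^ N) ξ * 𝓕 (deriv g) ξ))) := by
    have r0 := hg.deriv.rapidDecay
    have r1 := (r0.cutPoly_mul hα 1 (.X ^ N)).const_mul (-1)
    have r2 := (r0.cutPoly_mul hα (-1) (.X ^ N)).const_mul (-1)
    rw [← pair_add hFim r1 r2, ← pair_add hFim r0 (r1.add r2)]
    congr 1; ext ξ; rw [lowCut]; ring
  have hinner : ‖pair Fi (fun ξ => lowCut α N ξ * 𝓕 (deriv g) ξ)‖
      ≤ 2 * π * (2 * C1) * (R ^ 5 * (α * R)⁻¹ ^ N) * (n2 (wt a F) * n2 g) := by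
    rw [hsplit, hone, zero_add, pair_const_mul, pair_const_mul]
    refine (norm_add_le _ _).trans ?_
    rw [norm_mul, norm_mul, norm_neg, norm_one, one_mul, one_mul]
    linarith [hboth.1, hboth.2]
  have houter := norm_pair_lowCut_deriv_le hα hN0 hFom hg
  have i3 := n2_outer_le (G := Fo) le_rfl ha hν hR hF
    (fun x hx => by simp [hFo, hx]) (fun x hx => by simp [hFo, hx])
  rw [zero_sub] at i3
  rw [pair_split hF0 (hg.deriv.rapidDecay.lowCut_mul hα hN0) (measurableSet_innerSet ν R)]
  calc _ ≤ 2 * π * (2 * C1) * (R ^ 5 * (α * R)⁻¹ ^ N) * (n2 (wt a F) * n2 g)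
        + 2 * π * N * α * ((8 ^ a * R ^ (-a) * n2 (wt a F)) * n2 g) := by
        refine (norm_add_le _ _).trans (add_le_add hinner (houter.trans ?_))
        gcongr
    _ = 2 * π * (2 * C1) * (R ^ 5 * (α * R)⁻¹ ^ N) * (n2 (wt a F) * n2 g)
        + 2 * π * (N * 8 ^ a) * (α * R ^ (-a)) * (n2 (wt a F) * n2 g) := by ring
    _ ≤ 2 * π * (2 * C1) * (α * R ^ (-a) + R ^ 5 * (α * R)⁻¹ ^ N) * (n2 (wt a F) * n2 g)
        + 2 * π * (N * 8 ^ a) * (α * R ^ (-a) + R ^ 5 * (α * R)⁻¹ ^ N) * (n2 (wt a F) * n2 g) := by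
        have p1 : 0 ≤ α * R ^ (-a) := by positivity
        have p2 : 0 ≤ R ^ 5 * (α * R)⁻¹ ^ N := by positivity
        gcongr <;> linarith
    _ = _ := by ring

theorem exists_bilin_rep (T : L2 →L[ℂ] ℂ) : ∃ y : L2, ‖y‖ ≤ ‖T‖ ∧ ∀ f : L2, T f = ∫ x, y x * f x := by
  let y := (InnerProductSpace.toDual ℂ L2).symm T
  refine ⟨star y, ?_, fun f => ?_⟩
  · have h1 : ‖(star y : L2)‖ ≤ ‖y‖ := Lp.norm_le_norm_of_ae_le (by
      filter_upwards [Lp.coeFn_star y] with x hx; rw [hx, Pi.star_apply, norm_star])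
    have h2 : ‖y‖ = ‖T‖ := LinearIsometryEquiv.norm_map _ _
    exact h1.trans h2.le
  · rw [← InnerProductSpace.toDual_symm_apply, L2.inner_def]
    refine integral_congr_ae ?_
    filter_upwards [Lp.coeFn_star y] with x hx
    rw [hx, Pi.star_apply, RCLike.inner_apply, mul_comm]; rfl

/-- The functional `f ↦ ∫ z f`. -/
noncomputable def bilinL (z : L2) : L2 →L[ℂ] ℂ := InnerProductSpace.toDual ℂ L2 (star z)

theorem bilinL_apply (z f : L2) : bilinL z f = ∫ x, z x * f x := by
  rw [bilinL, InnerProductSpace.toDual_apply_apply, L2.inner_def]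
  refine integral_congr_ae ?_
  filter_upwards [Lp.coeFn_star z] with x hx
  rw [hx, Pi.star_apply, RCLike.inner_apply, mul_comm]
  simp

theorem norm_bilin_le (z f : L2) : ‖∫ x, z x * f x‖ ≤ ‖z‖ * ‖f‖ := by
  rw [← n2_coe, ← n2_coe]
  exact norm_integral_mul_le (Lp.memLp z) (Lp.memLp f)

theorem n2_indicator_le_of_dual (z : L2) {U : Set ℝ} (hU : IsOpen U) {β : ℝ} (hβ : 0 ≤ β)
    (h : ∀ g : ℝ → ℂ, IsTest g → tsupport g ⊆ U → ‖∫ x, z x * g x‖ ≤ β * n2 g) :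
    n2 (indicator U z) ≤ β := by
  let p : Submodule ℂ L2 :=
    { carrier := {f | ∃ g : ℝ → ℂ, IsTest g ∧ tsupport g ⊆ U ∧ f =ᵐ[volume] g}
      zero_mem' := ⟨fun _ => 0, isTest_zero, by simp [tsupport, Function.support], Lp.coeFn_zero _ _ _⟩
      add_mem' := by
        rintro f f' ⟨g, hg, hs, hf⟩ ⟨g', hg', hs', hf'⟩
        refine ⟨_, hg.add hg', (tsupport_add g g').trans (union_subset hs hs'), ?_⟩
        filter_upwards [Lp.coeFn_add f f', hf, hf'] with x h1 h2 h3
        rw [h1, Pi.add_apply, h2, h3]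
      smul_mem' := by
        rintro c f ⟨g, hg, hs, hf⟩
        refine ⟨_, hg.const_mul c, (closure_mono (Function.support_const_smul_subset c g)).trans hs, ?_⟩
        filter_upwards [Lp.coeFn_smul c f, hf] with x h1 h2
        rw [h1, Pi.smul_apply, h2, smul_eq_mul] }
  obtain ⟨T, hT, hTn⟩ := exists_extension_norm_eq p ((bilinL z).comp p.subtypeL)
  have hTβ : ‖T‖ ≤ β := by
    rw [hTn]
    refine ContinuousLinearMap.opNorm_le_bound _ hβ ?_
    rintro ⟨f, g, hg, hs, hf⟩
    change ‖bilinL z f‖ ≤ β * ‖f‖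
    rw [bilinL_apply, ← n2_coe, n2_congr hf]
    refine le_trans (le_of_eq ?_) (h g hg hs)
    congr 1
    exact integral_congr_ae (hf.mono fun x hx => by simp only [hx])
  obtain ⟨y, hy, hyT⟩ := exists_bilin_rep T
  have hzy : ∀ᵐ x, x ∈ U → (z x - y x) = 0 := by
    refine hU.ae_eq_zero_of_integral_contDiff_smul_eq_zero
      ((((Lp.memLp z).sub (Lp.memLp y)).locallyIntegrable (by norm_num)).locallyIntegrableOn U) ?_
    intro g hg hgc hgs
    have hG : IsTest (fun x => (g x : ℂ)) :=
      ⟨Complex.ofRealCLM.contDiff.comp hg, hgc.comp_left (g := fun x : ℝ => (x : ℂ)) (by simp)⟩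
    have hGs : tsupport (fun x => (g x : ℂ)) ⊆ U := by
      have : tsupport (fun x => (g x : ℂ)) = tsupport g := by
        simp [tsupport, Function.support]
      rw [this]; exact hgs
    have hmem : hG.memLp.toLp _ ∈ p := ⟨_, hG, hGs, hG.memLp.coeFn_toLp⟩
    have e1 := hT ⟨_, hmem⟩
    change T (hG.memLp.toLp _) = bilinL z (hG.memLp.toLp _) at e1
    rw [hyT, bilinL_apply] at e1
    have c1 : ∀ w : L2, ∫ x, w x * (hG.memLp.toLp _ : L2) x = ∫ x, w x * (g x : ℂ) := fun w =>
      integral_congr_ae (hG.memLp.coeFn_toLp.mono fun x hx => by simp only [hx])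
    rw [c1, c1] at e1
    calc ∫ x, g x • (z x - y x) = ∫ x, (z x * (g x : ℂ) - y x * (g x : ℂ)) := by
          congr 1; ext x; rw [Complex.real_smul]; ring
      _ = _ := integral_sub (integrable_mul_of_memLp (Lp.memLp z) hG.memLp)
            (integrable_mul_of_memLp (Lp.memLp y) hG.memLp)
      _ = 0 := by rw [e1, sub_self]
  calc n2 (indicator U z) ≤ n2 y := by
        refine n2_mono (Lp.memLp y) ?_
        filter_upwards [hzy] with x hx
        by_cases hxU : x ∈ U
        · rw [indicator_of_mem hxU, sub_eq_zero.1 (hx hxU)]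
        · simp [hxU]
    _ = ‖y‖ := n2_coe y
    _ ≤ β := hy.trans hTβ

/-- The dyadic shell `2^i - 1 < ν y < 2^(i+1) - 1`. -/
def shell (ν : ℝ) (i : ℕ) : Set ℝ := {y | 2 ^ i - 1 < ν * y ∧ ν * y < 2 ^ (i + 1) - 1}

theorem isOpen_shell (ν : ℝ) (i : ℕ) : IsOpen (shell ν i) := by
  rw [shell, ofPred_and]
  exact (isOpen_lt continuous_const (by fun_prop)).inter (isOpen_lt (by fun_prop) continuous_const)

theorem shell_disjoint {ν : ℝ} {i j : ℕ} {x : ℝ} (hi : x ∈ shell ν i) (hj : x ∈ shell ν j) : i = j := by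
  by_contra h
  rcases lt_or_gt_of_ne h with h | h
  · have : (2 : ℝ) ^ (i + 1) ≤ 2 ^ j := pow_le_pow_right₀ (by norm_num) h
    have := hi.2; have := hj.1; linarith
  · have : (2 : ℝ) ^ (j + 1) ≤ 2 ^ i := pow_le_pow_right₀ (by norm_num) h
    have := hj.2; have := hi.1; linarith

theorem ae_mem_shell : ∀ᵐ x : ℝ, ∃ ν : ℝ, (ν = 1 ∨ ν = -1) ∧ ∃ i, x ∈ shell ν i := by
  have hc : (⋃ i : ℕ, ({(2 : ℝ) ^ i - 1, -((2 : ℝ) ^ i - 1)} : Set ℝ)).Countable :=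
    countable_iUnion fun i => Set.Finite.countable (by simp)
  have key : ∀ y : ℝ, 0 ≤ y → (∀ i : ℕ, y ≠ 2 ^ i - 1) → ∃ i : ℕ, (2 : ℝ) ^ i - 1 < y ∧ y < 2 ^ (i + 1) - 1 := by
    intro y hy h
    obtain ⟨n, h1, h2⟩ := exists_nat_pow_near (x := y + 1) (y := (2 : ℝ)) (by linarith) (by norm_num)
    exact ⟨n, lt_of_le_of_ne (by linarith) (Ne.symm (h n)), by linarith⟩
  filter_upwards [(measure_eq_zero_iff_ae_notMem).1 (hc.measure_zero volume)] with x hx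
  simp only [mem_iUnion, mem_insert_iff, mem_singleton_iff, not_exists, not_or] at hx
  rcases le_total 0 x with h | h
  · obtain ⟨i, hi⟩ := key x h fun i => (hx i).1
    exact ⟨1, Or.inl rfl, i, by simpa [shell] using hi⟩
  · obtain ⟨i, hi⟩ := key (-x) (by linarith) fun i hi => (hx i).2 (by linarith)
    exact ⟨-1, Or.inr rfl, i, by simpa [shell] using hi⟩

theorem not_mem_shell_of_mem {i j : ℕ} {x : ℝ} (hi : x ∈ shell 1 i) (hj : x ∈ shell (-1) j) : False := by
  have h1 : (1 : ℝ) ≤ 2 ^ i := one_le_pow₀ (by norm_num)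
  have h2 : (1 : ℝ) ≤ 2 ^ j := one_le_pow₀ (by norm_num)
  have := hi.1; have := hj.1; linarith

theorem n2_le_of_shells {f : ℝ → ℂ} (hf : AEStronglyMeasurable f (volume : Measure ℝ)) {c : ℕ → ℝ}
    (hc : Summable c) (hc0 : ∀ i, 0 ≤ c i)
    (hm : ∀ ν : ℝ, (ν = 1 ∨ ν = -1) → ∀ i, MemLp (indicator (shell ν i) f) 2 volume)
    (h : ∀ ν : ℝ, (ν = 1 ∨ ν = -1) → ∀ i, n2 (indicator (shell ν i) f) ≤ c i) :
    MemLp f 2 volume ∧ n2 f ≤ 2 * ∑' i, c i := by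
  have hms : ∀ ν i, MeasurableSet (shell ν i) := fun ν i => (isOpen_shell ν i).measurableSet
  set S : ℕ → ℝ → ℂ := fun n x => ∑ i ∈ Finset.range n,
    (indicator (shell 1 i) f x + indicator (shell (-1) i) f x) with hS
  have hSm : ∀ n, MemLp (S n) 2 volume ∧ n2 (S n) ≤ 2 * ∑ i ∈ Finset.range n, c i := by
    intro n
    induction n with
    | zero => simp [hS, n2_zero]
    | succ n ih =>
      have e : S (n + 1) = fun x => S n x + (indicator (shell 1 n) f x + indicator (shell (-1) n) f x) := by
        ext x; simp only [hS, Finset.sum_range_succ]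
      have m1 := hm 1 (Or.inl rfl) n
      have m2 := hm (-1) (Or.inr rfl) n
      rw [e, Finset.sum_range_succ]
      refine ⟨ih.1.add (m1.add m2), ?_⟩
      have := n2_add_le ih.1 (m1.add m2)
      have h2 := n2_add_le m1 m2
      have h3 := h 1 (Or.inl rfl) n
      have h4 := h (-1) (Or.inr rfl) n
      have h5 : n2 (indicator (shell 1 n) f + indicator (shell (-1) n) f)
          = n2 (fun x => indicator (shell 1 n) f x + indicator (shell (-1) n) f x) := rfl
      have h6 : n2 (fun x => S n x + (indicator (shell 1 n) f + indicator (shell (-1) n) f) x)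
        = n2 (fun x => S n x + (indicator (shell 1 n) f x + indicator (shell (-1) n) f x)) := rfl
      linarith [ih.2]
  have hlim : ∀ᵐ x, Tendsto (fun n => S n x) atTop (𝓝 (f x)) := by
    filter_upwards [ae_mem_shell] with x hx
    obtain ⟨ν, hν, i, hi⟩ := hx
    refine tendsto_const_nhds.congr' ?_
    filter_upwards [eventually_gt_atTop i] with n hn
    simp only [hS]
    rw [Finset.sum_eq_single_of_mem i (Finset.mem_range.2 hn)]
    · rcases hν with rfl | rfl
      · rw [indicator_of_mem hi, indicator_of_notMem fun h => not_mem_shell_of_mem hi h, add_zero]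
      · rw [indicator_of_notMem fun h => not_mem_shell_of_mem h hi, indicator_of_mem hi, zero_add]
    · intro j _ hj
      rcases hν with rfl | rfl
      · rw [indicator_of_notMem fun h => hj (shell_disjoint h hi),
          indicator_of_notMem fun h => not_mem_shell_of_mem hi h, add_zero]
      · rw [indicator_of_notMem fun h => not_mem_shell_of_mem h hi,
          indicator_of_notMem fun h => hj (shell_disjoint h hi), add_zero]
  have h1 := Lp.eLpNorm_lim_le_liminf_eLpNorm (p := 2) (fun n => (hSm n).1.1) f hlim
  have h0 : 0 ≤ ∑' i, c i := tsum_nonneg hc0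
  have h2 : eLpNorm f 2 volume ≤ ENNReal.ofReal (2 * ∑' i, c i) := by
    refine h1.trans ?_
    refine (Filter.liminf_le_liminf (v := fun _ => ENNReal.ofReal (2 * ∑' i, c i)) (Eventually.of_forall fun n => ?_)).trans_eq
      (Filter.liminf_const _)
    rw [← ENNReal.ofReal_toReal (hSm n).1.eLpNorm_ne_top]
    refine ENNReal.ofReal_le_ofReal ((hSm n).2.trans ?_)
    have := hc.sum_le_tsum (Finset.range n) (fun i _ => hc0 i)
    linarith
  have hmem : MemLp f 2 volume := ⟨hf, h2.trans_lt ENNReal.ofReal_lt_top⟩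
  refine ⟨hmem, ?_⟩
  have := ENNReal.toReal_mono ENNReal.ofReal_ne_top h2
  rwa [ENNReal.toReal_ofReal (by positivity)] at this

theorem shellSupp_of_tsupport {ν : ℝ} {i : ℕ} {g : ℝ → ℂ} (h : tsupport g ⊆ shell ν i) :
    ∀ y, g y ≠ 0 → (2 : ℝ) ^ i - 1 ≤ ν * y ∧ ν * y ≤ 2 * 2 ^ i - 1 := by
  intro y hy
  have := h (subset_tsupport g hy)
  exact ⟨this.1.le, by have := this.2; rw [pow_succ] at this; linarith⟩

theorem jap_le_of_mem_shell {ν : ℝ} (hν : ν = 1 ∨ ν = -1) {i : ℕ} {x : ℝ} (h : x ∈ shell ν i) :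
    jap x ≤ 2 * 2 ^ i := by
  have h1 : |x| ≤ 2 * 2 ^ i - 1 := by
    have e : |x| = |ν * x| := by rw [abs_mul, abs_of_sign hν, one_mul]
    have h2 : (1 : ℝ) ≤ 2 ^ i := one_le_pow₀ (by norm_num)
    have := h.1; have := h.2
    rw [pow_succ] at this
    rw [e, abs_le]
    constructor <;> linarith
  have h2 : (1 : ℝ) ≤ 2 ^ i := one_le_pow₀ (by norm_num)
  rw [jap]
  refine (Real.sqrt_le_left (by positivity)).2 ?_
  rw [← sq_abs x]
  nlinarith [abs_nonneg x]

/-- Weighted membership from shell bounds with a geometric gain. -/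
theorem exists_memLp_wt_of_shells (b : ℝ) (hb : 0 ≤ b) {κ : ℝ} (hκ : 0 < κ) : ∃ C, 0 ≤ C ∧
    ∀ (z : L2) (B : ℝ), 0 ≤ B →
    (∀ ν : ℝ, (ν = 1 ∨ ν = -1) → ∀ i : ℕ, ∀ g : ℝ → ℂ, IsTest g → tsupport g ⊆ shell ν i →
      ‖∫ x, z x * g x‖ ≤ B * ((2 : ℝ) ^ i) ^ (-b - κ) * n2 g) →
    MemLp (wt b z) 2 volume ∧ n2 (wt b z) ≤ C * B := by
  have hr : Summable fun i : ℕ => (((2 : ℝ) ^ (-κ)) ^ i) :=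
    summable_geometric_of_lt_one (by positivity) (Real.rpow_lt_one_of_one_lt_of_neg (by norm_num) (by linarith))
  refine ⟨2 * ∑' i : ℕ, 2 ^ b * ((2 : ℝ) ^ (-κ)) ^ i, by positivity, ?_⟩
  intro z B hB h
  have hz : AEStronglyMeasurable (wt b z) volume := aestronglyMeasurable_wt b (Lp.aestronglyMeasurable z)
  have hle : ∀ ν : ℝ, (ν = 1 ∨ ν = -1) → ∀ i x, ‖indicator (shell ν i) (wt b z) x‖
      ≤ (2 * 2 ^ i) ^ b * ‖indicator (shell ν i) z x‖ := by
    intro ν hν i x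
    by_cases hx : x ∈ shell ν i
    · rw [indicator_of_mem hx, indicator_of_mem hx, norm_wt]
      have := (jap_pos x).le
      gcongr
      exact jap_le_of_mem_shell hν hx
    · simp [hx]
  have hi : ∀ ν i, MemLp (indicator (shell ν i) z) 2 volume := fun ν i =>
    (Lp.memLp z).indicator (isOpen_shell ν i).measurableSet
  have key := n2_le_of_shells hz (c := fun i => B * (2 ^ b * ((2 : ℝ) ^ (-κ)) ^ i))
    ((hr.mul_left _).mul_left _) (fun i => by positivity)
    (fun ν hν i => (hi ν i).of_le_mul (hz.indicator (isOpen_shell ν i).measurableSet)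
      (ae_of_all _ (hle ν hν i)))
    (fun ν hν i => by
      refine (n2_le_of_ae_le (hi ν i) (by positivity) (ae_of_all _ (hle ν hν i))).trans ?_
      have := n2_indicator_le_of_dual z (isOpen_shell ν i) (β := B * ((2 : ℝ) ^ i) ^ (-b - κ)) (by positivity)
        (fun g hg hs => h ν hν i g hg hs)
      calc _ ≤ (2 * 2 ^ i) ^ b * (B * ((2 : ℝ) ^ i) ^ (-b - κ)) := by gcongr
        _ = B * (2 ^ b * (((2 : ℝ) ^ i) ^ b * ((2 : ℝ) ^ i) ^ (-b - κ))) := by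
            rw [Real.mul_rpow (by norm_num) (by positivity)]; ring
        _ = _ := by
            rw [← Real.rpow_add (by positivity), show b + (-b - κ) = -κ by ring,
              ← Real.rpow_natCast, ← Real.rpow_natCast, ← Real.rpow_mul (by norm_num),
              ← Real.rpow_mul (by norm_num), mul_comm (i : ℝ)])
  refine ⟨key.1, key.2.trans_eq ?_⟩
  rw [tsum_mul_left]; ring

theorem measurePreserving_neg_real : MeasurePreserving (fun x : ℝ => -x) volume volume :=
  Measure.measurePreserving_neg volume

/-- Reflection on `L²`. -/
noncomputable def reflL : L2 →L[ℂ] L2 :=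
  (Lp.compMeasurePreservingₗᵢ ℂ _ measurePreserving_neg_real).toContinuousLinearMap

theorem reflL_ae (z : L2) : reflL z =ᵐ[volume] fun x => z (-x) :=
  Lp.coeFn_compMeasurePreserving z measurePreserving_neg_real

theorem fourierInv_fourierInv_L2 (z : L2) : (𝓕⁻ (𝓕⁻ z : L2) : L2) = reflL z := by
  have hc : Continuous (fun z : L2 => (𝓕⁻ z : L2)) := (Lp.fourierTransformₗᵢ ℝ ℂ).symm.continuous
  have hd := SchwartzMap.denseRange_toLpCLM (E := ℝ) (F := ℂ) (p := 2) (μ := volume) ENNReal.ofNat_ne_top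
  refine hd.induction_on (p := fun z : L2 => (𝓕⁻ (𝓕⁻ z : L2) : L2) = reflL z) z
    (isClosed_eq (hc.comp hc) reflL.continuous) fun f => ?_
  simp only [SchwartzMap.toLpCLM_apply, SchwartzMap.toLp_fourierInv_eq]
  refine Lp.ext ?_
  have h1 : ∀ x, (𝓕⁻ (𝓕⁻ f) : SchwartzMap ℝ ℂ) x = f (-x) := by
    intro x
    have h2 : (𝓕 (𝓕⁻ f) : SchwartzMap ℝ ℂ) (-x) = f (-x) := by
      rw [FourierTransform.fourier_fourierInv_eq]
    rw [← h2, SchwartzMap.fourierInv_coe, SchwartzMap.fourier_coe, Real.fourierInv_eq_fourier_neg]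
  have h3 := measurePreserving_neg_real.quasiMeasurePreserving.ae (SchwartzMap.coeFn_toLp f 2 volume)
  filter_upwards [SchwartzMap.coeFn_toLp (𝓕⁻ (𝓕⁻ f)) 2 volume, reflL_ae (f.toLp 2), h3] with x e1 e2 e3
  rw [e1, e2, h1, e3]

theorem fourierInv_freeProp (t : ℝ) (h : L2) :
    (𝓕⁻ (freeProp t h) : L2) =ᵐ[volume] fun ξ => freeSymbol t ξ * (𝓕⁻ h : L2) ξ := by
  rw [freeProp, fourierInv_fourierInv_L2]
  have e : (𝓕⁻ h : L2) = reflL (𝓕 h : L2) := by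
    rw [← fourierInv_fourierInv_L2, FourierTransform.fourierInv_fourier_eq]
  have h3 := measurePreserving_neg_real.quasiMeasurePreserving.ae
    (memLp_freeSymbol_mul t (𝓕 h : L2)).coeFn_toLp
  rw [e]
  filter_upwards [reflL_ae ((memLp_freeSymbol_mul t (𝓕 h : L2)).toLp _), reflL_ae (𝓕 h : L2), h3]
    with ξ e1 e2 e3
  rw [e1, e2, e3, freeSymbol_neg_right]

theorem pair_eq_fourierInv (z : L2) {ρ : ℝ → ℂ} (h : RapidDecay ρ) :
    pair z ρ = ∫ ξ, (𝓕⁻ z : L2) ξ * ρ ξ := integral_mul_fourierInv z h.integrable h.memLp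

theorem pair_freeProp (t : ℝ) (z : L2) {ρ : ℝ → ℂ} (h : RapidDecay ρ) :
    pair (freeProp t z) ρ = pair z (fun ξ => freeSymbol t ξ * ρ ξ) := by
  rw [pair_eq_fourierInv _ h, pair_eq_fourierInv _ (h.freeSymbol_mul t)]
  refine integral_congr_ae ?_
  filter_upwards [fourierInv_freeProp t z] with ξ e
  rw [e]; ring

theorem fourierInv_injective {z w : L2} (h : (𝓕⁻ z : L2) = 𝓕⁻ w) : z = w := by
  have e := congrArg (fun y : L2 => (𝓕 y : L2)) h
  simpa only [FourierTransform.fourier_fourierInv_eq] using e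

theorem norm_fourierInv_L2 (z : L2) : ‖(𝓕⁻ z : L2)‖ = ‖z‖ :=
  (Lp.fourierTransformₗᵢ ℝ ℂ).symm.norm_map z

theorem fourierInv_sub_ae (z w : L2) :
    (𝓕⁻ (z - w) : L2) =ᵐ[volume] fun ξ => (𝓕⁻ z : L2) ξ - (𝓕⁻ w : L2) ξ := by
  have : (𝓕⁻ (z - w) : L2) = 𝓕⁻ z - 𝓕⁻ w := map_sub (Lp.fourierTransformₗᵢ ℝ ℂ).symm z w
  rw [this]
  exact Lp.coeFn_sub _ _

theorem norm_freeProp (t : ℝ) (z : L2) : ‖freeProp t z‖ = ‖z‖ := by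
  rw [← norm_fourierInv_L2, ← norm_fourierInv_L2 z, ← n2_coe, ← n2_coe]
  refine le_antisymm (n2_mono (Lp.memLp _) ?_) (n2_mono (Lp.memLp _) ?_) <;>
  · filter_upwards [fourierInv_freeProp t z] with ξ e
    rw [e, norm_mul, norm_freeSymbol, one_mul]

theorem freeProp_sub (t : ℝ) (z w : L2) : freeProp t (z - w) = freeProp t z - freeProp t w := by
  refine fourierInv_injective (Lp.ext ?_)
  filter_upwards [fourierInv_freeProp t (z - w), fourierInv_freeProp t z, fourierInv_freeProp t w,
    fourierInv_sub_ae z w, fourierInv_sub_ae (freeProp t z) (freeProp t w)] with ξ e1 e2 e3 e4 e5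
  rw [e1, e5, e2, e3, e4]; ring

/-- Weak derivatives in `L²` from the Fourier side. -/
theorem hasWeakDeriv_of_fourierInv {z z' : L2}
    (h : ∀ᵐ ξ : ℝ, (𝓕⁻ z' : L2) ξ = -(2 * π * Complex.I * ξ) * (𝓕⁻ z : L2) ξ) :
    HasWeakDeriv 1 z z' := by
  refine ⟨(Lp.memLp z).locallyIntegrable (by norm_num), (Lp.memLp z').locallyIntegrable (by norm_num),
    fun φ hφ hc => ?_⟩
  have hT : IsTest φ := ⟨hφ, hc⟩
  have e1 : ∫ x, z x * iteratedDeriv 1 φ x = pair z (𝓕 (deriv φ)) := by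
    rw [pair, hT.deriv.fourierInv_fourier, iteratedDeriv_one]
  have e2 : ∫ x, z' x * φ x = pair z' (𝓕 φ) := by rw [pair, hT.fourierInv_fourier]
  rw [e1, e2, pair_eq_fourierInv _ hT.deriv.rapidDecay, pair_eq_fourierInv _ hT.rapidDecay, pow_one,
    neg_one_mul, ← integral_neg]
  refine integral_congr_ae ?_
  filter_upwards [h] with ξ e
  rw [e, hT.fourier_deriv]; ring

theorem HasWeakDeriv.freeProp {z z' : L2} (h : HasWeakDeriv 1 z z') (t : ℝ) :
    HasWeakDeriv 1 (freeProp t z) (WeaklyBound.freeProp t z') := by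
  refine hasWeakDeriv_of_fourierInv ?_
  filter_upwards [fourierInv_weakDeriv h, fourierInv_freeProp t z, fourierInv_freeProp t z']
    with ξ e1 e2 e3
  rw [e3, e1, e2]; ring

theorem HasWeakDeriv.sub {k : ℕ} {z w z' w' : L2} (h : HasWeakDeriv k z z') (h' : HasWeakDeriv k w w') :
    HasWeakDeriv k (z - w : L2) (z' - w' : L2) := by
  refine ⟨(Lp.memLp _).locallyIntegrable (by norm_num), (Lp.memLp _).locallyIntegrable (by norm_num),
    fun φ hφ hc => ?_⟩
  have hk : MemLp (iteratedDeriv k φ) 2 volume := by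
    refine memLp_of_test (hφ.continuous_iteratedDeriv k (by exact_mod_cast le_top)) ?_
    clear h h'
    induction k with
    | zero => simpa using hc
    | succ k ih => rw [iteratedDeriv_succ]; exact ih.deriv
  have h0 := memLp_of_test hφ.continuous hc
  have e : ∀ (a b : L2) (f : ℝ → ℂ), MemLp f 2 volume →
      ∫ x, (a - b : L2) x * f x = (∫ x, a x * f x) - ∫ x, b x * f x := by
    intro a b f hf
    rw [← integral_sub (integrable_mul_of_memLp (Lp.memLp a) hf) (integrable_mul_of_memLp (Lp.memLp b) hf)]
    refine integral_congr_ae ?_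
    filter_upwards [Lp.coeFn_sub a b] with x hx
    rw [hx, Pi.sub_apply]; ring
  rw [e _ _ _ hk, e _ _ _ h0, h.2.2 φ hφ hc, h'.2.2 φ hφ hc]; ring

theorem IsTest.pair_fourier {g : ℝ → ℂ} (hg : IsTest g) (F : ℝ → ℂ) : pair F (𝓕 g) = ∫ x, F x * g x := by
  rw [pair, hg.fourierInv_fourier]

theorem HasWeakDeriv.integral_deriv_test {z z' : ℝ → ℂ} (h : HasWeakDeriv 1 z z') {g : ℝ → ℂ} (hg : IsTest g) :
    ∫ x, z x * deriv g x = -∫ x, z' x * g x := by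
  have := h.2.2 g hg.smooth hg.compact
  rwa [iteratedDeriv_one, pow_one, neg_one_mul] at this

/-- Weak convergence in `L²`, as convergence against test functions along a bounded sequence, is
convergence against all of `L²`. -/
theorem tendsto_bilin_of_test {ι : Type*} {l : Filter ι} {z : ι → L2} {z0 : L2} {M : ℝ}
    (hM : ∀ j, ‖z j‖ ≤ M) (hM0 : ‖z0‖ ≤ M)
    (h : ∀ f : SchwartzMap ℝ ℂ, Tendsto (fun j => ∫ x, z j x * f x) l (𝓝 (∫ x, z0 x * f x))) (f : L2) :
    Tendsto (fun j => ∫ x, z j x * f x) l (𝓝 (∫ x, z0 x * f x)) := by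
  have hd := SchwartzMap.denseRange_toLpCLM (E := ℝ) (F := ℂ) (p := 2) (μ := volume) ENNReal.ofNat_ne_top
  have hM' : 0 ≤ M := (norm_nonneg _).trans hM0
  rw [Metric.tendsto_nhds]
  intro ε hε
  obtain ⟨φ, hφ⟩ := hd.exists_dist_lt f (ε := ε / (3 * (M + 1))) (by positivity)
  set p : L2 := φ.toLp 2 volume with hp
  have hφ' : ‖f - p‖ ≤ ε / (3 * (M + 1)) := by rw [← dist_eq_norm]; exact hφ.le
  have e : ∀ w : L2, (∫ x, w x * f x) = (∫ x, w x * φ x) + ∫ x, w x * (f - p : L2) x := by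
    intro w
    have e1 : ∫ x, w x * φ x = ∫ x, w x * p x := integral_congr_ae (by
      filter_upwards [SchwartzMap.coeFn_toLp φ 2 volume] with x hx; rw [hp, hx])
    rw [e1, ← bilinL_apply, ← bilinL_apply, ← bilinL_apply, ← map_add, add_sub_cancel]
  have hs : ∀ w : L2, ‖w‖ ≤ M → ‖∫ x, w x * (f - p : L2) x‖ ≤ ε / 3 := by
    intro w hw
    refine (norm_bilin_le w _).trans ?_
    calc ‖w‖ * ‖f - p‖ ≤ (M + 1) * (ε / (3 * (M + 1))) := by gcongr; linarith
      _ = ε / 3 := by field_simp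
  filter_upwards [(Metric.tendsto_nhds.1 (h φ)) (ε / 3) (by positivity)] with j hj
  rw [dist_eq_norm] at hj ⊢
  rw [e (z j), e z0]
  have h1 := hs (z j) (hM j)
  have h2 := hs z0 hM0
  calc _ = ‖((∫ x, z j x * φ x) - ∫ x, z0 x * φ x) + (∫ x, z j x * (f - p : L2) x)
        - ∫ x, z0 x * (f - p : L2) x‖ := by congr 1; ring
    _ ≤ ‖(∫ x, z j x * φ x) - ∫ x, z0 x * φ x‖ + ‖∫ x, z j x * (f - p : L2) x‖
        + ‖∫ x, z0 x * (f - p : L2) x‖ := (norm_sub_le _ _).trans (by gcongr; exact norm_add_le _ _)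
    _ < ε := by linarith

theorem pair_eq_bilin (z : L2) {ρ : ℝ → ℂ} (h : RapidDecay ρ) :
    pair z ρ = ∫ x, z x * (h.memLp_fourierInv.toLp _ : L2) x :=
  integral_congr_ae (by
    filter_upwards [h.memLp_fourierInv.coeFn_toLp] with x hx; rw [hx])

theorem pair_sub (z w : L2) {ρ : ℝ → ℂ} (h : RapidDecay ρ) :
    pair (z - w : L2) ρ = pair z ρ - pair w ρ := by
  rw [pair, pair, pair, ← integral_sub (integrable_mul_of_memLp (Lp.memLp z) h.memLp_fourierInv)
    (integrable_mul_of_memLp (Lp.memLp w) h.memLp_fourierInv)]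
  refine integral_congr_ae ?_
  filter_upwards [Lp.coeFn_sub z w] with x hx
  rw [hx, Pi.sub_apply]; ring

theorem norm_pair_le' (z : L2) {ρ : ℝ → ℂ} (h : RapidDecay ρ) : ‖pair z ρ‖ ≤ ‖z‖ * n2 ρ := by
  rw [← n2_coe]; exact norm_pair_le (Lp.memLp z) h

/-- `Z` is controlled, in both directions of time, by the sources in `𝓖`. -/
def Rep (𝓖 : Set L2) (Z : L2) : Prop :=
  ∀ τ : ℝ, (τ = 1 ∨ τ = -1) → ∀ N : ℕ, 6 ≤ N → ∀ α : ℝ, 0 < α → ∀ ς : ℝ, (ς = 1 ∨ ς = -1) →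
    ∀ g : ℝ → ℂ, IsTest g → ∀ b : ℝ → ℝ, IntegrableOn b (Ioi 0) →
    (∀ s, 0 < s → ∀ G ∈ 𝓖, ‖pair G (psym τ s α ς N g)‖ ≤ b s) →
    ‖pair Z (fun ξ => cutPoly α ς (.X ^ N) ξ * 𝓕 g ξ)‖ ≤ ∫ s in Ioi 0, b s

theorem pair_cutPoly_decomp (Z : L2) {ρ : ℝ → ℂ} (h : RapidDecay ρ) {α : ℝ} (hα : 0 < α) {N : ℕ}
    (hN : N ≠ 0) :
    pair Z ρ = pair Z (fun ξ => lowCut α N ξ * ρ ξ) + (pair Z (fun ξ => cutPoly α 1 (.X ^ N) ξ * ρ ξ)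
      + pair Z (fun ξ => cutPoly α (-1) (.X ^ N) ξ * ρ ξ)) := by
  have r1 := h.cutPoly_mul hα 1 (.X ^ N)
  have r2 := h.cutPoly_mul hα (-1) (.X ^ N)
  rw [← pair_add (Lp.memLp Z) r1 r2, ← pair_add (Lp.memLp Z) (h.lowCut_mul hα hN) (r1.add r2)]
  congr 1; ext ξ; rw [lowCut]; ring

theorem integrableOn_tail {δ η : ℝ} (hδ : 0 < δ) (hη : 0 < η) (c d : ℝ) :
    IntegrableOn (fun s : ℝ => c * s ^ (-1 - η) + d * (1 + s ^ 2)⁻¹) (Ioi δ) :=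
  ((integrableOn_Ioi_rpow_of_lt (by linarith) hδ).const_mul c).add
    (integrable_inv_one_add_sq.integrableOn.const_mul d)

theorem integral_tail_le {δ η c d : ℝ} (hδ : 0 < δ) (hδ1 : δ ≤ 1) (hη : 0 < η) (hη1 : η ≤ 1) (hc : 0 ≤ c)
    (hd : 0 ≤ d) :
    ∫ s in Ioi δ, (c * s ^ (-1 - η) + d * (1 + s ^ 2)⁻¹) ≤ (c * η⁻¹ + d * 4) * δ⁻¹ := by
  rw [integral_add ((integrableOn_Ioi_rpow_of_lt (by linarith) hδ).const_mul c)
    (integrable_inv_one_add_sq.integrableOn.const_mul d), integral_const_mul, integral_const_mul,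
    integral_Ioi_rpow_of_lt (by linarith) hδ]
  have h1 : ∫ s in Ioi δ, (1 + s ^ 2)⁻¹ ≤ 4 := by
    calc ∫ s in Ioi δ, (1 + s ^ 2)⁻¹ ≤ ∫ s : ℝ, (1 + s ^ 2)⁻¹ :=
          setIntegral_le_integral integrable_inv_one_add_sq (ae_of_all _ fun s => by positivity)
      _ = π := integral_univ_inv_one_add_sq
      _ ≤ 4 := Real.pi_le_four
  have h2 : δ ^ (-η) ≤ δ⁻¹ := by
    rw [← Real.rpow_neg_one]
    exact Real.rpow_le_rpow_of_exponent_ge hδ hδ1 (by linarith)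
  have h3 : 1 ≤ δ⁻¹ := (one_le_inv₀ hδ).2 hδ1
  have e : -δ ^ (-1 - η + 1) / (-1 - η + 1) = δ ^ (-η) * η⁻¹ := by
    rw [show -1 - η + 1 = -η by ring, neg_div_neg_eq, div_eq_mul_inv]
  rw [e]
  calc c * (δ ^ (-η) * η⁻¹) + d * ∫ s in Ioi δ, (1 + s ^ 2)⁻¹ ≤ c * (δ⁻¹ * η⁻¹) + d * (4 * δ⁻¹) := by
        gcongr
        linarith
    _ = _ := by ring

theorem min_le_rpow {x η : ℝ} (hx : 0 < x) (hη0 : 0 ≤ η) (hη : η ≤ 1) : min 1 x ≤ x ^ η := by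
  rcases le_total 1 x with h | h
  · exact (min_le_left _ _).trans (Real.one_le_rpow h hη0)
  · refine (min_le_right _ _).trans ?_
    calc x = x ^ (1 : ℝ) := (Real.rpow_one x).symm
      _ ≤ x ^ η := Real.rpow_le_rpow_of_exponent_ge hx h hη

theorem combine_le {p q r x y z : ℝ} (hp : 0 ≤ p) (hq : 0 ≤ q) (hr : 0 ≤ r) (hx : 0 ≤ x) (hy : 0 ≤ y)
    (hz : 0 ≤ z) : 2 * q * x + 2 * y + r * z ≤ (2 * p + 2 * q + r + 2) * (x + y + z) := by
  have h1 : 2 * q * x ≤ (2 * p + 2 * q + r + 2) * x := by gcongr; linarith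
  have h2 : 2 * y ≤ (2 * p + 2 * q + r + 2) * y := by gcongr; linarith
  have h3 : r * z ≤ (2 * p + 2 * q + r + 2) * z := by gcongr; linarith
  linarith

/-- The two shell bounds, with the cut-off scale `α = R^{-θ₁}`. -/
theorem exists_gain {a a0 b θ1 : ℝ} (ha : 2 ≤ a) (ha0 : 0 ≤ a0) (hb : 0 ≤ b) (hθ0 : 0 < θ1) (hθ1 : θ1 < 1)
    (hb1 : b < a0 + θ1) (hb2 : b + 1 < a) :
    ∃ (κ : ℝ) (N : ℕ) (C : ℝ), 0 < κ ∧ 6 ≤ N ∧ 0 ≤ C ∧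
      (∀ ν τ : ℝ, (ν = 1 ∨ ν = -1) → (τ = 1 ∨ τ = -1) → ∀ s R : ℝ, 0 ≤ s → 1 ≤ R → ∀ F g : ℝ → ℂ,
        MemLp (wt a F) 2 volume → IsTest g → ShellSupp ν R g →
        ‖pair F (psym τ s (R ^ (-θ1)) (ν * τ) N g)‖ ≤ C * R ^ (-b - κ) * (n2 (wt a F) * n2 g)) ∧
      ∀ (ν R : ℝ), (ν = 1 ∨ ν = -1) → 1 ≤ R → ∀ g : ℝ → ℂ, IsTest g → ShellSupp ν R g →
        ∀ (Z : L2) (𝓖 : Set L2) (A0 A1 A2 δ : ℝ), Rep 𝓖 Z → 0 ≤ A1 → 0 ≤ A2 → 0 < δ → δ ≤ 1 →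
        MemLp (wt a0 Z) 2 volume → n2 (wt a0 Z) ≤ A0 →
        (∀ G ∈ 𝓖, MemLp (wt a G) 2 volume ∧ n2 (wt a G) ≤ A1) →
        (∀ τ : ℝ, (τ = 1 ∨ τ = -1) → ∀ s, 0 < s → ∀ G ∈ 𝓖,
          ‖pair G (psym τ s (R ^ (-θ1)) (ν * τ) N (deriv g))‖ ≤ A2 * R ^ (-b - κ) * n2 g) →
        ‖∫ x, Z x * deriv g x‖ ≤ C * (A0 + δ * A2 + δ⁻¹ * A1) * R ^ (-b - κ) * n2 g := by
  set κ := min (a0 + θ1 - b) ((a - 1 - b) / 2) with hκ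
  have hκ0 : 0 < κ := lt_min (by linarith) (by linarith)
  have hκ1 : κ ≤ a0 + θ1 - b := min_le_left _ _
  have hκ2 : κ ≤ (a - 1 - b) / 2 := min_le_right _ _
  set η := min ((a - 1 - b) / 4) 1 with hη
  have hη0 : 0 < η := lt_min (by linarith) one_pos
  have hη1 : η ≤ 1 := min_le_right _ _
  have hη2 : η ≤ (a - 1 - b) / 4 := min_le_left _ _
  obtain ⟨N0, hN0⟩ := exists_nat_ge ((5 + b + κ) / (1 - θ1))
  set N := max 6 N0 with hN
  have hN6 : 6 ≤ N := le_max_left _ _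
  have hNb : 5 + b + κ ≤ N * (1 - θ1) := by
    have : (N0 : ℝ) ≤ N := by exact_mod_cast le_max_right _ _
    rw [div_le_iff₀ (by linarith)] at hN0
    nlinarith
  obtain ⟨C1, hC1, h1⟩ := exists_shell_bound (a := a) (by linarith) (N := N) (by omega)
  obtain ⟨C2, hC2, h2⟩ := exists_shell_bound_deriv ha (N := N) (by omega)
  obtain ⟨C3, hC3, h3⟩ := exists_shell_bound_static ha0 (N := N) (by omega)
  have hRN : ∀ R : ℝ, 1 ≤ R → R ^ 5 * (R ^ (-θ1) * R)⁻¹ ^ N ≤ R ^ (-b - κ) := by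
    intro R hR
    have hR0 : 0 < R := by linarith
    have e : R ^ 5 * (R ^ (-θ1) * R)⁻¹ ^ N = R ^ (5 - N * (1 - θ1)) := by
      rw [← Real.rpow_add_one hR0.ne', ← Real.rpow_neg hR0.le, ← Real.rpow_natCast,
        ← Real.rpow_natCast (R ^ _), ← Real.rpow_mul hR0.le, ← Real.rpow_add hR0]
      congr 1; push_cast; ring
    rw [e]
    exact Real.rpow_le_rpow_of_exponent_le hR (by linarith)
  refine ⟨κ, N, 2 * C1 + 2 * C3 + 2 * C2 * (η⁻¹ + 4) + 2, hκ0, hN6, by positivity, ?_, ?_⟩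
  · intro ν τ hν hτ s R hs hR F g hF hg hsupp
    have hR0 : 0 < R := by linarith
    refine (h1 ν τ hν hτ s (R ^ (-θ1)) R hs (by positivity) hR F g hF hg hsupp).trans ?_
    have e1 : R ^ (-a) ≤ R ^ (-b - κ) := Real.rpow_le_rpow_of_exponent_le hR (by linarith)
    have := hRN R hR
    have := n2_nonneg (wt a F)
    have := n2_nonneg g
    have h0 : 0 ≤ 2 * C3 + 2 * C2 * (η⁻¹ + 4) + 2 := by positivity
    calc _ ≤ C1 * (R ^ (-b - κ) + R ^ (-b - κ)) * (n2 (wt a F) * n2 g) := by gcongr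
      _ = (2 * C1) * R ^ (-b - κ) * (n2 (wt a F) * n2 g) := by ring
      _ ≤ _ := by gcongr; linarith
  · intro ν R hν hR g hg hsupp Z 𝓖 A0 A1 A2 δ hrep hA1 hA2 hδ hδ1 hZ hZA hG hearly
    have hR0 : 0 < R := by linarith
    set α := R ^ (-θ1) with hαd
    have hα : 0 < α := by positivity
    have hαR : 1 ≤ α * R := by
      rw [hαd, ← Real.rpow_add_one hR0.ne']
      exact Real.one_le_rpow hR (by linarith)
    set Q := R ^ (-b - κ) with hQ
    have hQ0 : 0 < Q := by positivity
    set n := n2 g with hn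
    have hn0 : 0 ≤ n := n2_nonneg g
    have hA0 : 0 ≤ A0 := (n2_nonneg _).trans hZA
    have hlow : ‖pair Z (fun ξ => lowCut α N ξ * 𝓕 (deriv g) ξ)‖ ≤ 2 * C3 * A0 * Q * n := by
      refine (h3 ν hν α R hα hR Z g hZ hg hsupp).trans ?_
      have e1 : α * R ^ (-a0) ≤ Q := by
        rw [hαd, ← Real.rpow_add hR0]
        exact Real.rpow_le_rpow_of_exponent_le hR (by linarith)
      have := hRN R hR
      have := n2_nonneg (wt a0 Z)
      have := n2_nonneg g
      calc _ ≤ C3 * (Q + Q) * (A0 * n) := by gcongr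
        _ = _ := by ring
    have hside : ∀ τ : ℝ, (τ = 1 ∨ τ = -1) →
        ‖pair Z (fun ξ => cutPoly α (ν * τ) (.X ^ N) ξ * 𝓕 (deriv g) ξ)‖
          ≤ (δ * A2 + C2 * (η⁻¹ + 4) * (δ⁻¹ * A1)) * Q * n := by
      intro τ hτ
      have hς : ν * τ = 1 ∨ ν * τ = -1 := by
        rcases hν with rfl | rfl <;> rcases hτ with rfl | rfl <;> simp
      set f1 : ℝ → ℝ := indicator (Ioc 0 δ) fun _ => A2 * Q * n with hf1
      set f2 : ℝ → ℝ := indicator (Ioi δ) fun s => (C2 * Q * A1 * n) * s ^ (-1 - η)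
        + (C2 * Q * A1 * n) * (1 + s ^ 2)⁻¹ with hf2
      have i1 : Integrable f1 := (integrable_indicator_iff measurableSet_Ioc).2
        (integrableOn_const (by simp))
      have i2 : Integrable f2 := (integrable_indicator_iff measurableSet_Ioi).2 (integrableOn_tail hδ hη0 _ _)
      have hb := hrep τ hτ N hN6 α hα (ν * τ) hς (deriv g) hg.deriv (fun s => f1 s + f2 s)
        (i1.add i2).integrableOn (fun s hs G hGm => by
          by_cases hsδ : s ≤ δ
          · rw [hf1, hf2, indicator_of_mem (show s ∈ Ioc 0 δ from ⟨hs, hsδ⟩),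
              indicator_of_notMem (by simpa using hsδ), add_zero]
            exact hearly τ hτ s hs G hGm
          · push Not at hsδ
            rw [hf1, hf2, indicator_of_notMem (by simp [hsδ]), indicator_of_mem (show s ∈ Ioi δ from hsδ),
              zero_add]
            refine (h2 ν τ hν hτ s α R hs hα hR hαR G g (hG G hGm).1 hg hsupp).trans ?_
            have e1 : min (R ^ (1 - a) * s⁻¹) (α⁻¹ * R ^ (2 - a) * (s ^ 2)⁻¹) ≤ Q * s ^ (-1 - η) := by
              have e2 : α⁻¹ = R ^ θ1 := by rw [hαd, ← Real.rpow_neg hR0.le, neg_neg]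
              have e3 : α⁻¹ * R ^ (2 - a) * (s ^ 2)⁻¹
                  = R ^ (1 - a) * s⁻¹ * (R ^ (1 + θ1) * s⁻¹) := by
                have : R ^ (1 - a) * R ^ (1 + θ1) = R ^ θ1 * R ^ (2 - a) := by
                  rw [← Real.rpow_add hR0, ← Real.rpow_add hR0]; congr 1; ring
                rw [e2, ← this]
                field_simp
              have e4 : min (R ^ (1 - a) * s⁻¹) (R ^ (1 - a) * s⁻¹ * (R ^ (1 + θ1) * s⁻¹))
                  = R ^ (1 - a) * s⁻¹ * min 1 (R ^ (1 + θ1) * s⁻¹) := by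
                rw [mul_min_of_nonneg _ _ (by positivity), mul_one]
              rw [e3, e4]
              calc R ^ (1 - a) * s⁻¹ * min 1 (R ^ (1 + θ1) * s⁻¹)
                  ≤ R ^ (1 - a) * s⁻¹ * (R ^ (1 + θ1) * s⁻¹) ^ η := by
                    gcongr
                    exact min_le_rpow (by positivity) hη0.le hη1
                _ = R ^ (1 - a + (1 + θ1) * η) * s ^ (-1 - η) := by
                    rw [Real.mul_rpow (by positivity) (by positivity), ← Real.rpow_mul hR0.le,
                      Real.rpow_add hR0, ← Real.rpow_neg_one s, ← Real.rpow_mul hs.le,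
                      show (-1 - η) = -1 + -1 * η by ring, Real.rpow_add hs]
                    ring
                _ ≤ Q * s ^ (-1 - η) := by
                    gcongr
                    exact Real.rpow_le_rpow_of_exponent_le hR (by nlinarith)
            have e5 := hRN R hR
            calc _ ≤ C2 * (Q * s ^ (-1 - η) + Q * (1 + s ^ 2)⁻¹) * (A1 * n) := by
                  have := n2_nonneg (wt a G)
                  have := (hG G hGm).2
                  gcongr
              _ = _ := by ring)
      refine hb.trans ?_
      rw [integral_add i1.integrableOn i2.integrableOn]
      have j1 : ∫ s in Ioi 0, f1 s = δ * (A2 * Q * n) := by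
        rw [hf1, setIntegral_indicator measurableSet_Ioc,
          show Ioi (0 : ℝ) ∩ Ioc 0 δ = Ioc 0 δ from inter_eq_right.2 fun x hx => hx.1]
        simp [hδ.le]
      have j2 : ∫ s in Ioi 0, f2 s ≤ ((C2 * Q * A1 * n) * η⁻¹ + (C2 * Q * A1 * n) * 4) * δ⁻¹ := by
        rw [hf2, setIntegral_indicator measurableSet_Ioi,
          show Ioi (0 : ℝ) ∩ Ioi δ = Ioi δ from inter_eq_right.2 fun x hx => hδ.trans hx]
        exact integral_tail_le hδ hδ1 hη0 hη1 (by positivity) (by positivity)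
      rw [j1]
      calc _ ≤ δ * (A2 * Q * n) + ((C2 * Q * A1 * n) * η⁻¹ + (C2 * Q * A1 * n) * 4) * δ⁻¹ := by gcongr
        _ = _ := by ring
    have hboth : ‖pair Z (fun ξ => cutPoly α 1 (.X ^ N) ξ * 𝓕 (deriv g) ξ)‖
          ≤ (δ * A2 + C2 * (η⁻¹ + 4) * (δ⁻¹ * A1)) * Q * n ∧
        ‖pair Z (fun ξ => cutPoly α (-1) (.X ^ N) ξ * 𝓕 (deriv g) ξ)‖
          ≤ (δ * A2 + C2 * (η⁻¹ + 4) * (δ⁻¹ * A1)) * Q * n := by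
      rcases hν with rfl | rfl
      · exact ⟨by simpa using hside 1 (Or.inl rfl), by simpa using hside (-1) (Or.inr rfl)⟩
      · exact ⟨by simpa using hside (-1) (Or.inr rfl), by simpa using hside 1 (Or.inl rfl)⟩
    rw [← hg.deriv.pair_fourier, pair_cutPoly_decomp Z hg.deriv.rapidDecay hα (by omega : N ≠ 0)]
    calc _ ≤ 2 * C3 * A0 * Q * n + ((δ * A2 + C2 * (η⁻¹ + 4) * (δ⁻¹ * A1)) * Q * n
          + (δ * A2 + C2 * (η⁻¹ + 4) * (δ⁻¹ * A1)) * Q * n) :=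
          (norm_add_le _ _).trans (add_le_add hlow ((norm_add_le _ _).trans (add_le_add hboth.1 hboth.2)))
      _ = (2 * C3 * A0 + 2 * (δ * A2) + 2 * C2 * (η⁻¹ + 4) * (δ⁻¹ * A1)) * Q * n := by ring
      _ ≤ _ := by
          have p1 : 0 ≤ δ * A2 := by positivity
          have p2 : 0 ≤ δ⁻¹ * A1 := by positivity
          exact mul_le_mul_of_nonneg_right (mul_le_mul_of_nonneg_right
            (combine_le hC1 hC3 (by positivity) hA0 p1 p2) hQ0.le) hn0

theorem HasWeakDeriv.unique {z y y' : L2} (h : HasWeakDeriv 1 z y) (h' : HasWeakDeriv 1 z y') : y = y' := by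
  refine fourierInv_injective (Lp.ext ?_)
  filter_upwards [fourierInv_weakDeriv h, fourierInv_weakDeriv h'] with ξ e1 e2
  rw [e1, e2]

open Classical in
/-- The weak derivative in `L²`, when there is one. -/
noncomputable def wd (z : L2) : L2 := if h : ∃ y : L2, HasWeakDeriv 1 z y then h.choose else 0

theorem HasWeakDeriv.wd_eq {z y : L2} (h : HasWeakDeriv 1 z y) : wd z = y := by
  have hex : ∃ y : L2, HasWeakDeriv 1 z y := ⟨y, h⟩
  rw [wd, dif_pos hex]
  exact hex.choose_spec.unique h

/-- `z` has `k` weak derivatives in `L²`. -/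
def Diff (k : ℕ) (z : L2) : Prop := ∀ i < k, HasWeakDeriv 1 (wd^[i] z) (wd^[i + 1] z)

theorem Diff.mono {k l : ℕ} {z : L2} (h : Diff k z) (hl : l ≤ k) : Diff l z := fun i hi => h i (hi.trans_le hl)

theorem hasWeakDeriv_toLp {f g : ℝ → ℂ} (hf : MemLp f 2 volume)
    (hg : MemLp g 2 volume) (h : HasWeakDeriv 1 f g) :
    HasWeakDeriv 1 (hf.toLp f) (hg.toLp g) := by
  refine ⟨(Lp.memLp _).locallyIntegrable (by norm_num), (Lp.memLp _).locallyIntegrable (by norm_num),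
    fun φ hφ hc => ?_⟩
  have e1 : ∫ x, hf.toLp f x * iteratedDeriv 1 φ x = ∫ x, f x * iteratedDeriv 1 φ x :=
    integral_congr_ae (hf.coeFn_toLp.mono fun x hx => by simp only [hx])
  have e2 : ∫ x, hg.toLp g x * φ x = ∫ x, g x * φ x :=
    integral_congr_ae (hg.coeFn_toLp.mono fun x hx => by simp only [hx])
  rw [e1, e2]
  exact h.2.2 φ hφ hc

theorem RapidDecay.memLp_deriv_fourierInv {ρ : ℝ → ℂ} (h : RapidDecay ρ) :
    MemLp (deriv (𝓕⁻ ρ)) 2 volume := by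
  rw [h.deriv_fourierInv]
  exact (h.id_mul.const_mul _).memLp_fourierInv

theorem n2_sub_comm (f g : ℝ → ℂ) : n2 (fun x => f x - g x) = n2 (fun x => g x - f x) := by
  have : (fun x => f x - g x) = fun x => (-1) * (g x - f x) := by ext; ring
  rw [this, n2_const_mul, norm_neg, norm_one, one_mul]

theorem RapidDecay.hasWeakDeriv_fourierInv {ρ : ℝ → ℂ} (h : RapidDecay ρ) :
    HasWeakDeriv 1 (𝓕⁻ ρ) (deriv (𝓕⁻ ρ)) := by
  have hs := h.contDiff_fourierInv
  have hs' : Continuous (deriv (𝓕⁻ ρ)) := (contDiff_infty_iff_deriv.1 hs).2.continuous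
  refine ⟨hs.continuous.locallyIntegrable, hs'.locallyIntegrable, fun φ hφ hc => ?_⟩
  rw [iteratedDeriv_one, pow_one, neg_one_mul]
  have hφ' : Continuous (deriv φ) := (contDiff_infty_iff_deriv.1 hφ).2.continuous
  refine integral_mul_deriv_eq_deriv_mul_of_integrable
    (fun x _ => (hs.differentiable (by simp) x).hasDerivAt)
    (fun x _ => (hφ.differentiable (by simp) x).hasDerivAt) ?_ ?_ ?_
  · exact (hs.continuous.mul hφ').integrable_of_hasCompactSupport hc.deriv.mul_left
  · exact (hs'.mul hφ.continuous).integrable_of_hasCompactSupport hc.mul_left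
  · exact (hs.continuous.mul hφ.continuous).integrable_of_hasCompactSupport hc.mul_left

theorem n2_sub_coe (z w : L2) : n2 (fun x => z x - w x) = ‖z - w‖ := by
  rw [← n2_coe]
  exact n2_congr ((Lp.coeFn_sub z w).mono fun x hx => by rw [hx, Pi.sub_apply])

/-- Smooth approximation in `H¹`. -/
theorem exists_smooth_approx {z z' : L2} (h : HasWeakDeriv 1 z z') {ε : ℝ} (hε : 0 < ε) :
    ∃ ρ : ℝ → ℂ, RapidDecay ρ ∧ n2 (fun x => 𝓕⁻ ρ x - z x) < ε ∧
      n2 (fun x => deriv (𝓕⁻ ρ) x - z' x) < ε := by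
  have hd := SchwartzMap.denseRange_toLpCLM (E := ℝ) (F := ℂ) (p := 2) (μ := volume) ENNReal.ofNat_ne_top
  obtain ⟨f, hf⟩ := hd.exists_dist_lt (z + z') hε
  have hne : ∀ ξ : ℝ, (1 + 2 * π * Complex.I * ξ : ℂ) ≠ 0 := fun ξ h0 => by
    have := congrArg Complex.re h0
    simp at this
  have hn1 : ∀ ξ : ℝ, 1 ≤ ‖(1 - 2 * π * Complex.I * ξ : ℂ)‖ := fun ξ => by
    refine le_trans (le_of_eq ?_) (Complex.abs_re_le_norm _)
    simp
  have hn1' : ∀ ξ : ℝ, 1 ≤ ‖(1 + 2 * π * Complex.I * ξ : ℂ)‖ := fun ξ => by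
    refine le_trans (le_of_eq ?_) (Complex.abs_re_le_norm _)
    simp
  have hn2 : ∀ ξ : ℝ, ‖(2 * π * Complex.I * ξ : ℂ)‖ ≤ ‖(1 - 2 * π * Complex.I * ξ : ℂ)‖ := fun ξ => by
    have e : ‖(2 * π * Complex.I * ξ : ℂ)‖ = |(1 - 2 * π * Complex.I * ξ : ℂ).im| := by
      simp
    rw [e]
    exact Complex.abs_im_le_norm _
  have hF := rapidDecay_schwartz (𝓕 f)
  have hρ : RapidDecay (fun ξ : ℝ => (1 + 2 * π * Complex.I * ξ)⁻¹ * (𝓕 f : SchwartzMap ℝ ℂ) ξ) :=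
    hF.mul_bdd (Continuous.inv₀ (by fun_prop) hne) (K := 1) fun ξ => by
      rw [norm_inv]; exact inv_le_one_of_one_le₀ (hn1' ξ)
  set ρ := fun ξ : ℝ => (1 + 2 * π * Complex.I * ξ)⁻¹ * (𝓕 f : SchwartzMap ℝ ℂ) ξ with hρd
  have hsum : ∀ x, 𝓕⁻ ρ x + deriv (𝓕⁻ ρ) x = f x := by
    intro x
    rw [hρ.deriv_fourierInv, ← fourierInv_add' hρ.integrable (hρ.id_mul.const_mul _).integrable]
    rw [← congrFun (fourierInv_fourier_schwartz f) x]
    refine congrArg (fun p : ℝ → ℂ => 𝓕⁻ p x) (funext fun ξ => ?_)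
    rw [hρd]
    have := hne ξ
    field_simp
  set u : L2 := hρ.memLp_fourierInv.toLp _ with hu
  set u' : L2 := hρ.memLp_deriv_fourierInv.toLp _ with hu'
  have hw : HasWeakDeriv 1 u u' := hasWeakDeriv_toLp _ _ hρ.hasWeakDeriv_fourierInv
  have he := hw.sub h
  set e := u - z with hedef
  set e' := u' - z' with hedef'
  have hsum2 : e + e' = f.toLp 2 volume - (z + z') := by
    have : u + u' = f.toLp 2 volume := by
      refine Lp.ext ?_
      filter_upwards [Lp.coeFn_add u u', hρ.memLp_fourierInv.coeFn_toLp,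
        hρ.memLp_deriv_fourierInv.coeFn_toLp, SchwartzMap.coeFn_toLp f 2 volume] with x e1 e2 e3 e4
      rw [e1, Pi.add_apply, hu, hu', e2, e3, e4, hsum]
    rw [← this, hedef, hedef']; abel
  have hnorm : ‖e + e'‖ < ε := by
    rw [hsum2, ← dist_eq_norm, dist_comm]; exact hf
  have hadd : (𝓕⁻ (e + e') : L2) =ᵐ[volume] fun ξ => (1 - 2 * π * Complex.I * ξ) * (𝓕⁻ e : L2) ξ := by
    have h1 : (𝓕⁻ (e + e') : L2) = 𝓕⁻ e + 𝓕⁻ e' := map_add (Lp.fourierTransformₗᵢ ℝ ℂ).symm e e'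
    rw [h1]
    filter_upwards [Lp.coeFn_add (𝓕⁻ e : L2) (𝓕⁻ e' : L2), fourierInv_weakDeriv he] with ξ k1 k2
    rw [k1, Pi.add_apply, k2]; ring
  have b1 : ‖e‖ ≤ ‖e + e'‖ := by
    rw [← norm_fourierInv_L2 e, ← norm_fourierInv_L2 (e + e'), ← n2_coe, ← n2_coe]
    refine n2_mono (Lp.memLp _) ?_
    filter_upwards [hadd] with ξ k
    rw [k, norm_mul]
    exact le_mul_of_one_le_left (norm_nonneg _) (hn1 ξ)
  have b2 : ‖e'‖ ≤ ‖e + e'‖ := by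
    rw [← norm_fourierInv_L2 e', ← norm_fourierInv_L2 (e + e'), ← n2_coe, ← n2_coe]
    refine n2_mono (Lp.memLp _) ?_
    filter_upwards [hadd, fourierInv_weakDeriv he] with ξ k k2
    rw [k, k2, norm_mul, norm_mul, norm_neg]
    gcongr
    exact hn2 ξ
  refine ⟨ρ, hρ, ?_, ?_⟩
  · refine lt_of_eq_of_lt ?_ (b1.trans_lt hnorm)
    rw [hedef, ← n2_sub_coe]
    exact n2_congr (hρ.memLp_fourierInv.coeFn_toLp.mono fun x hx => by simp only [hu, hx])
  · refine lt_of_eq_of_lt ?_ (b2.trans_lt hnorm)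
    rw [hedef', ← n2_sub_coe]
    exact n2_congr (hρ.memLp_deriv_fourierInv.coeFn_toLp.mono fun x hx => by simp only [hu', hx])

theorem memLp_bdd_mul {W : ℝ → ℂ} {f : ℝ → ℂ} {C : ℝ} (hW : AEStronglyMeasurable W (volume : Measure ℝ))
    (hC : ∀ᵐ x, ‖W x‖ ≤ C) (hf : MemLp f 2 volume) :
    MemLp (fun x => W x * f x) 2 volume :=
  hf.of_le_mul (c := C) (hW.mul hf.1) (hC.mono fun x hx => by rw [norm_mul]; gcongr)

theorem n2_bdd_mul_le {W : ℝ → ℂ} {f : ℝ → ℂ} {C : ℝ} (hC0 : 0 ≤ C) (hC : ∀ᵐ x, ‖W x‖ ≤ C)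
    (hf : MemLp f 2 volume) : n2 (fun x => W x * f x) ≤ C * n2 f :=
  n2_le_of_ae_le hf hC0 (hC.mono fun x hx => by rw [norm_mul]; gcongr)

/-- Product rule for a bounded function with bounded weak derivative and an `H¹` function. -/
theorem HasWeakDeriv.mul_L2 {W W' : ℝ → ℂ} {C : ℝ} (hW : HasWeakDeriv 1 W W') (hC : ∀ᵐ x, ‖W x‖ ≤ C)
    (hC' : ∀ᵐ x, ‖W' x‖ ≤ C) {z z' : L2} (h : HasWeakDeriv 1 z z') :
    HasWeakDeriv 1 (fun x => W x * z x) (fun x => W' x * z x + W x * z' x) := by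
  have hWm := hW.1.aestronglyMeasurable
  have hWm' := hW.2.1.aestronglyMeasurable
  have hC0 : 0 ≤ C := by
    obtain ⟨x, hx⟩ := hC.exists
    exact (norm_nonneg _).trans hx
  have m1 := memLp_bdd_mul hWm hC (Lp.memLp z)
  have m2 := (memLp_bdd_mul hWm' hC' (Lp.memLp z)).add (memLp_bdd_mul hWm hC (Lp.memLp z'))
  refine ⟨m1.locallyIntegrable (by norm_num), m2.locallyIntegrable (by norm_num), fun φ hφ hc => ?_⟩
  have hT : IsTest φ := ⟨hφ, hc⟩
  rw [iteratedDeriv_one, pow_one, neg_one_mul, eq_neg_iff_add_eq_zero]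
  have hint : ∀ (f f' : ℝ → ℂ), MemLp f 2 volume → MemLp f' 2 volume →
      (∫ x, W x * f x * deriv φ x) + ∫ x, (W' x * f x + W x * f' x) * φ x
        = (∫ x, W x * f x * deriv φ x) + ((∫ x, W' x * f x * φ x) + ∫ x, W x * f' x * φ x) := by
    intro f f' hf hf'
    rw [← integral_add (integrable_mul_of_memLp (memLp_bdd_mul hWm' hC' hf) hT.memLp)
      (integrable_mul_of_memLp (memLp_bdd_mul hWm hC hf') hT.memLp)]
    congr 2; ext x; ring
  have hbound : ∀ (f f' : ℝ → ℂ), MemLp f 2 volume → MemLp f' 2 volume →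
      ‖(∫ x, W x * f x * deriv φ x) + ((∫ x, W' x * f x * φ x) + ∫ x, W x * f' x * φ x)‖
        ≤ C * n2 f * n2 (deriv φ) + (C * n2 f * n2 φ + C * n2 f' * n2 φ) := by
    intro f f' hf hf'
    have k1 := norm_integral_mul_le (memLp_bdd_mul hWm hC hf) hT.deriv.memLp
    have k2 := norm_integral_mul_le (memLp_bdd_mul hWm' hC' hf) hT.memLp
    have k3 := norm_integral_mul_le (memLp_bdd_mul hWm hC hf') hT.memLp
    have l1 := n2_bdd_mul_le hC0 hC hf
    have l2 := n2_bdd_mul_le hC0 hC' hf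
    have l3 := n2_bdd_mul_le hC0 hC hf'
    have p1 := n2_nonneg φ
    have p2 := n2_nonneg (deriv φ)
    refine (norm_add_le _ _).trans (add_le_add ?_ ((norm_add_le _ _).trans (add_le_add ?_ ?_)))
    · exact k1.trans (by gcongr)
    · exact k2.trans (by gcongr)
    · exact k3.trans (by gcongr)
  set K := C * n2 (deriv φ) + (C * n2 φ + C * n2 φ) with hK
  have hK0 : 0 ≤ K := by have := n2_nonneg φ; have := n2_nonneg (deriv φ); positivity
  rw [hint z z' (Lp.memLp z) (Lp.memLp z')]
  refine norm_le_zero_iff.1 (le_of_forall_pos_le_add fun δ hδ => ?_)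
  obtain ⟨ρ, hρ, a1, a2⟩ := exists_smooth_approx h (ε := δ / (K + 1)) (by positivity)
  set f := 𝓕⁻ ρ with hf
  have hfm : MemLp f 2 volume := hρ.memLp_fourierInv
  have hfm' : MemLp (deriv f) 2 volume := hρ.memLp_deriv_fourierInv
  have hfs := hρ.contDiff_fourierInv
  have hzero : (∫ x, W x * f x * deriv φ x) + ((∫ x, W' x * f x * φ x) + ∫ x, W x * deriv f x * φ x) = 0 := by
    have hP : IsTest fun x => f x * φ x := hT.mul_left hfs
    have hder : ∀ x, deriv (fun x => f x * φ x) x = deriv f x * φ x + f x * deriv φ x := fun x =>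
      ((hfs.differentiable (by simp) x).hasDerivAt.mul (hφ.differentiable (by simp) x).hasDerivAt).deriv
    have e := hW.integral_deriv_test hP
    simp only [hder] at e
    have e2 : ∫ x, W x * (deriv f x * φ x + f x * deriv φ x)
        = (∫ x, W x * deriv f x * φ x) + ∫ x, W x * f x * deriv φ x := by
      rw [← integral_add (integrable_mul_of_memLp (memLp_bdd_mul hWm hC hfm') hT.memLp)
        (integrable_mul_of_memLp (memLp_bdd_mul hWm hC hfm) hT.deriv.memLp)]
      congr 1; ext x; ring
    have e3 : ∫ x, W' x * (f x * φ x) = ∫ x, W' x * f x * φ x := by congr 1; ext x; ring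
    rw [e2, e3] at e
    linear_combination e
  have hdiff : (∫ x, W x * z x * deriv φ x) + ((∫ x, W' x * z x * φ x) + ∫ x, W x * z' x * φ x)
      = -((∫ x, W x * (f x - z x) * deriv φ x)
        + ((∫ x, W' x * (f x - z x) * φ x) + ∫ x, W x * (deriv f x - z' x) * φ x)) := by
    have s : ∀ (U : ℝ → ℂ) (hUm : AEStronglyMeasurable U (volume : Measure ℝ)) (hU : ∀ᵐ x, ‖U x‖ ≤ C)
        (p q ψ : ℝ → ℂ), MemLp p 2 volume → MemLp q 2 volume →
        MemLp ψ 2 volume →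
        ∫ x, U x * (p x - q x) * ψ x = (∫ x, U x * p x * ψ x) - ∫ x, U x * q x * ψ x := by
      intro U hUm hU p q ψ hp hq hψ
      rw [← integral_sub (integrable_mul_of_memLp (memLp_bdd_mul hUm hU hp) hψ)
        (integrable_mul_of_memLp (memLp_bdd_mul hUm hU hq) hψ)]
      congr 1; ext x; ring
    rw [s W hWm hC f z _ hfm (Lp.memLp z) hT.deriv.memLp, s W' hWm' hC' f z _ hfm (Lp.memLp z) hT.memLp,
      s W hWm hC (deriv f) z' _ hfm' (Lp.memLp z') hT.memLp]
    linear_combination hzero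
  rw [hdiff, norm_neg, zero_add]
  refine (hbound _ _ (hfm.sub (Lp.memLp z)) (hfm'.sub (Lp.memLp z'))).trans ?_
  have p1 := n2_nonneg φ
  have p2 := n2_nonneg (deriv φ)
  have q1 : n2 (f - z) ≤ δ / (K + 1) := a1.le
  have q2 : n2 (deriv f - z') ≤ δ / (K + 1) := a2.le
  calc _ ≤ C * (δ / (K + 1)) * n2 (deriv φ) + (C * (δ / (K + 1)) * n2 φ + C * (δ / (K + 1)) * n2 φ) := by
        gcongr
    _ = δ * (K / (K + 1)) := by rw [hK]; ring
    _ ≤ δ * 1 := by gcongr; rw [div_le_one (by positivity)]; linarith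
    _ = δ := mul_one δ

/-- A potential with its first `n` weak derivatives and their decay. -/
structure PotChain (σ C : ℝ) (n : ℕ) (W : ℕ → ℝ → ℂ) : Prop where
  meas : ∀ i ≤ n, AEStronglyMeasurable (W i) (volume : Measure ℝ)
  deriv : ∀ i < n, HasWeakDeriv 1 (W i) (W (i + 1))
  bound : ∀ i ≤ n, ∀ᵐ x, ‖W i x‖ ≤ C * jap x ^ (-σ - i)

/-- The `k`-th Leibniz expansion. -/
noncomputable def prodD : ℕ → (ℕ → ℝ → ℂ) → (ℕ → L2) → ℝ → ℂ
  | 0, W, Z => fun x => W 0 x * Z 0 x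
  | k + 1, W, Z => fun x => prodD k (fun i => W (i + 1)) Z x + prodD k W (fun i => Z (i + 1)) x

theorem hasWeakDeriv_prodD (k : ℕ) {C : ℝ} : ∀ {W : ℕ → ℝ → ℂ} {Z : ℕ → L2},
    (∀ i ≤ k, HasWeakDeriv 1 (W i) (W (i + 1))) → (∀ i ≤ k + 1, ∀ᵐ x, ‖W i x‖ ≤ C) →
    (∀ i ≤ k, HasWeakDeriv 1 (Z i) (Z (i + 1))) →
    HasWeakDeriv 1 (prodD k W Z) (prodD (k + 1) W Z) := by
  induction k with
  | zero =>
    intro W Z hW hC hZ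
    exact (hW 0 le_rfl).mul_L2 (hC 0 (by omega)) (hC 1 le_rfl) (hZ 0 le_rfl)
  | succ k ih =>
    intro W Z hW hC hZ
    have h1 := ih (W := fun i => W (i + 1)) (Z := Z) (fun i hi => hW _ (by omega)) (fun i hi => hC _ (by omega))
      (fun i hi => hZ _ (by omega))
    have h2 := ih (W := W) (Z := fun i => Z (i + 1)) (fun i hi => hW _ (by omega)) (fun i hi => hC _ (by omega))
      (fun i hi => hZ _ (by omega))
    refine ⟨h1.1.add h2.1, h1.2.1.add h2.2.1, fun φ hφ hc => ?_⟩
    have i : ∀ {f ψ : ℝ → ℂ}, LocallyIntegrable f → Continuous ψ → HasCompactSupport ψ →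
        Integrable fun x => f x * ψ x := fun {f ψ} hf hψ hψc => by
      simpa [mul_comm] using hf.integrable_smul_left_of_hasCompactSupport hψ hψc
    have hT : IsTest φ := ⟨hφ, hc⟩
    have e1 := h1.2.2 φ hφ hc
    have e2 := h2.2.2 φ hφ hc
    rw [iteratedDeriv_one] at *
    have l : ∫ x, prodD (k + 1) W Z x * _root_.deriv φ x
        = (∫ x, prodD k (fun i => W (i + 1)) Z x * _root_.deriv φ x)
          + ∫ x, prodD k W (fun i => Z (i + 1)) x * _root_.deriv φ x := by
      rw [← integral_add (i h1.1 hT.deriv.smooth.continuous hT.deriv.compact)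
        (i h2.1 hT.deriv.smooth.continuous hT.deriv.compact)]
      congr 1; ext x; rw [prodD]; ring
    have r : ∫ x, prodD (k + 1 + 1) W Z x * φ x
        = (∫ x, prodD (k + 1) (fun i => W (i + 1)) Z x * φ x)
          + ∫ x, prodD (k + 1) W (fun i => Z (i + 1)) x * φ x := by
      rw [← integral_add (i h1.2.1 hφ.continuous hc) (i h2.2.1 hφ.continuous hc)]
      congr 1; ext x; rw [prodD]; ring
    rw [l, r, e1, e2]; ring

theorem wt_prodD_bound (a : ℝ) (k : ℕ) {B : ℝ} : ∀ {W : ℕ → ℝ → ℂ} {Z : ℕ → L2},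
    (∀ i j, i + j = k → MemLp (wt a fun x => W i x * Z j x) 2 volume ∧
      n2 (wt a fun x => W i x * Z j x) ≤ B) →
    MemLp (wt a (prodD k W Z)) 2 volume ∧ n2 (wt a (prodD k W Z)) ≤ 2 ^ k * B := by
  induction k with
  | zero =>
    intro W Z h
    simpa [prodD] using h 0 0 rfl
  | succ k ih =>
    intro W Z h
    have h1 := ih (W := fun i => W (i + 1)) (Z := Z) (fun i j hij => h (i + 1) j (by omega))
    have h2 := ih (W := W) (Z := fun i => Z (i + 1)) (fun i j hij => h i (j + 1) (by omega))
    have e : wt a (prodD (k + 1) W Z) = fun x => wt a (prodD k (fun i => W (i + 1)) Z) x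
        + wt a (prodD k W fun i => Z (i + 1)) x := by
      ext x; simp only [wt, prodD]; ring
    rw [e]
    refine ⟨h1.1.add h2.1, (n2_add_le h1.1 h2.1).trans ?_⟩
    rw [pow_succ]
    linarith [h1.2, h2.2]

theorem wt_mul_bound {σ C a r : ℝ} {i : ℕ} {W : ℝ → ℂ} (hWm : AEStronglyMeasurable W (volume : Measure ℝ))
    (hW : ∀ᵐ x, ‖W x‖ ≤ C * jap x ^ (-σ - i)) (hC : 0 ≤ C) {z : L2} {K : ℝ}
    (hz : MemLp (wt r z) 2 volume) (hK : n2 (wt r z) ≤ K) (ha : a ≤ σ + i + r) :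
    MemLp (wt a fun x => W x * z x) 2 volume ∧ n2 (wt a fun x => W x * z x) ≤ C * K := by
  have hle : ∀ᵐ x, ‖wt a (fun x => W x * z x) x‖ ≤ C * ‖wt r z x‖ := by
    filter_upwards [hW] with x hx
    rw [norm_wt, norm_wt, norm_mul]
    have hj := jap_pos x
    have h0 : 0 ≤ jap x ^ a := by positivity
    calc jap x ^ a * (‖W x‖ * ‖z x‖) ≤ jap x ^ a * (C * jap x ^ (-σ - i) * ‖z x‖) := by gcongr
      _ = C * (jap x ^ (a + (-σ - i)) * ‖z x‖) := by rw [Real.rpow_add hj]; ring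
      _ ≤ C * (jap x ^ r * ‖z x‖) := by
          gcongr
          · exact one_le_jap x
          · linarith
  have hm : AEStronglyMeasurable (wt a fun x => W x * z x) volume :=
    aestronglyMeasurable_wt a (hWm.mul (Lp.aestronglyMeasurable z))
  refine ⟨hz.of_le_mul hm hle, (n2_le_of_ae_le hz hC hle).trans ?_⟩
  gcongr

/-- `k`-th derivatives of the sources `V z`. -/
def sources (σ C : ℝ) (n : ℕ) (𝒮 : Set L2) (k : ℕ) : Set L2 :=
  {G | ∃ W, PotChain σ C n W ∧ ∃ z ∈ 𝒮, G =ᵐ[volume] prodD k W fun j => wd^[j] z}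

theorem pair_weakDeriv_cut {z z' : L2} (h : HasWeakDeriv 1 z z') {m : ℝ → ℂ} {g : ℝ → ℂ} (hg : IsTest g)
    (hr : RapidDecay fun ξ => m ξ * 𝓕 g ξ) :
    pair z (fun ξ => m ξ * 𝓕 (deriv g) ξ) = -pair z' (fun ξ => m ξ * 𝓕 g ξ) := by
  rw [← pair_weakDeriv h hr]
  congr 1; ext ξ; rw [hg.fourier_deriv]; ring

theorem pair_weakDeriv_psym {z z' : L2} (h : HasWeakDeriv 1 z z') {g : ℝ → ℂ} (hg : IsTest g) (τ s : ℝ)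
    {α : ℝ} (hα : 0 < α) (ς : ℝ) (N : ℕ) :
    pair z (psym τ s α ς N (deriv g)) = -pair z' (psym τ s α ς N g) := by
  have e : ∀ f : ℝ → ℂ, psym τ s α ς N f = fun ξ => (freeSymbol (-τ * s) ξ * cutPoly α ς (.X ^ N) ξ) * 𝓕 f ξ := by
    intro f; ext ξ; rw [psym, sym]; ring
  have hr := hg.psym τ s hα ς N
  rw [e] at hr
  rw [e, e, pair_weakDeriv_cut h hg hr]

theorem Rep.deriv {𝓖 𝓖' : Set L2} {z z' : L2} (h : Rep 𝓖 z) (hz : HasWeakDeriv 1 z z')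
    (hG : ∀ G ∈ 𝓖, ∃ G' ∈ 𝓖', HasWeakDeriv 1 G G') : Rep 𝓖' z' := by
  intro τ hτ N hN α hα ς hς g hg b hb hs
  have e := pair_weakDeriv_cut hz (m := cutPoly α ς (.X ^ N)) hg (hg.rapidDecay.cutPoly_mul hα ς _)
  have := h τ hτ N hN α hα ς hς (_root_.deriv g) hg.deriv b hb fun s hs0 G hGm => by
    obtain ⟨G', hG', hd⟩ := hG G hGm
    rw [pair_weakDeriv_psym hd hg τ s hα, norm_neg]
    exact hs s hs0 G' hG'
  rwa [e, norm_neg] at this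

theorem HasWeakDeriv.congr_ae {k : ℕ} {f g f' g' : ℝ → ℂ} (h : HasWeakDeriv k f g) (hf : f =ᵐ[volume] f')
    (hg : g =ᵐ[volume] g') : HasWeakDeriv k f' g' := by
  refine ⟨h.1.congr hf, h.2.1.congr hg, fun φ hφ hc => ?_⟩
  have e1 : ∫ x, f' x * iteratedDeriv k φ x = ∫ x, f x * iteratedDeriv k φ x :=
    integral_congr_ae (hf.mono fun x hx => by simp only [hx])
  have e2 : ∫ x, g' x * φ x = ∫ x, g x * φ x :=
    integral_congr_ae (hg.mono fun x hx => by simp only [hx])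
  rw [e1, e2, h.2.2 φ hφ hc]

theorem PotChain.bound_const {σ C : ℝ} {n : ℕ} {W : ℕ → ℝ → ℂ} (h : PotChain σ C n W) (hσ : 0 ≤ σ)
    (hC : 0 ≤ C) {i : ℕ} (hi : i ≤ n) : ∀ᵐ x, ‖W i x‖ ≤ C := by
  filter_upwards [h.bound i hi] with x hx
  refine hx.trans (mul_le_of_le_one_right hC ?_)
  refine Real.rpow_le_one_of_one_le_of_nonpos (one_le_jap x) ?_
  have : (0 : ℝ) ≤ i := by positivity
  linarith

theorem sources_bound {σ C K a : ℝ} {n k : ℕ} {𝒮 : Set L2} (hC : 0 ≤ C) (hk : k ≤ n) (r : ℕ → ℝ)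
    (hr : ∀ z ∈ 𝒮, ∀ j ≤ k, MemLp (wt (r j) (wd^[j] z)) 2 volume ∧ n2 (wt (r j) (wd^[j] z)) ≤ K)
    (ha : ∀ i j, i + j = k → a ≤ σ + i + r j) {G : L2} (hG : G ∈ sources σ C n 𝒮 k) :
    MemLp (wt a G) 2 volume ∧ n2 (wt a G) ≤ 2 ^ k * (C * K) := by
  obtain ⟨W, hW, z, hz, hGe⟩ := hG
  have := wt_prodD_bound a k (B := C * K) (W := W) (Z := fun j => wd^[j] z) fun i j hij => by
    obtain ⟨h1, h2⟩ := hr z hz j (by omega)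
    exact wt_mul_bound (hW.meas i (by omega)) (hW.bound i (by omega)) hC h1 h2 (ha i j hij)
  have he : wt a (prodD k W fun j => wd^[j] z) =ᵐ[volume] wt a G :=
    hGe.mono fun x hx => by simp only [wt, hx]
  rw [← n2_congr he]
  exact ⟨this.1.ae_eq he, this.2⟩

theorem sources_succ {σ C : ℝ} (hσ : 0 ≤ σ) (hC : 0 ≤ C) {n k : ℕ} {𝒮 : Set L2} (hk : k + 1 ≤ n)
    (hreg : ∀ z ∈ 𝒮, Diff (k + 1) z) {G : L2} (hG : G ∈ sources σ C n 𝒮 k) :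
    ∃ G' ∈ sources σ C n 𝒮 (k + 1), HasWeakDeriv 1 G G' := by
  obtain ⟨W, hW, z, hz, hGe⟩ := hG
  have hmem : MemLp (prodD (k + 1) W fun j => wd^[j] z) 2 volume := by
    obtain ⟨K, hK⟩ : ∃ K, ∀ j ≤ k + 1, ‖wd^[j] z‖ ≤ K := by
      exact ⟨∑ j ∈ Finset.range (k + 2), ‖wd^[j] z‖, fun j hj =>
        Finset.single_le_sum (f := fun j => ‖wd^[j] z‖) (fun _ _ => norm_nonneg _) (Finset.mem_range.2 (by omega))⟩
    have := wt_prodD_bound 0 (k + 1) (B := C * K) (W := W) (Z := fun j => wd^[j] z) fun i j hij => by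
      refine wt_mul_bound (r := 0) (hW.meas i (by omega)) (hW.bound i (by omega)) hC ?_ ?_ (by positivity)
      · rw [wt_zero]; exact Lp.memLp _
      · rw [wt_zero, n2_coe]; exact hK j (by omega)
    rw [wt_zero] at this
    exact this.1
  refine ⟨hmem.toLp _, ⟨W, hW, z, hz, hmem.coeFn_toLp⟩, ?_⟩
  refine HasWeakDeriv.congr_ae ?_ hGe.symm hmem.coeFn_toLp.symm
  exact hasWeakDeriv_prodD k (C := C) (fun i hi => hW.deriv i (by omega))
    (fun i hi => hW.bound_const hσ hC (by omega)) (fun i hi => hreg z hz i (by omega))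

theorem rep_iterate {σ C : ℝ} (hσ : 0 ≤ σ) (hC : 0 ≤ C) {n : ℕ} {𝒮 : Set L2}
    (hrep : ∀ z ∈ 𝒮, Rep (sources σ C n 𝒮 0) z) : ∀ k ≤ n, (∀ z ∈ 𝒮, Diff k z) →
    ∀ z ∈ 𝒮, Rep (sources σ C n 𝒮 k) (wd^[k] z) := by
  intro k
  induction k with
  | zero => intro _ _ z hz; exact hrep z hz
  | succ k ih =>
    intro hk hreg z hz
    have := ih (by omega) (fun z hz => (hreg z hz).mono (by omega)) z hz
    exact this.deriv (hreg z hz k (by omega)) fun G hG => sources_succ hσ hC hk hreg hG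

/-- Weighted regularity of all derivatives, one power of the weight at a time. -/
theorem exists_weighted_bounds {σ C θ : ℝ} (hσ : 2 < σ) (hC : 0 ≤ C) (hθ0 : 0 < θ) (hθ1 : θ < 1) {n : ℕ}
    {𝒮 : Set L2} (hrep : ∀ z ∈ 𝒮, Rep (sources σ C n 𝒮 0) z) {K : ℝ}
    (hreg : ∀ z ∈ 𝒮, Diff n z ∧ ∀ i ≤ n, ‖wd^[i] z‖ ≤ K) (m : ℕ) :
    ∃ K', 0 ≤ K' ∧ ∀ z ∈ 𝒮, ∀ k ≤ n, MemLp (wt (θ * (min k m : ℕ)) (wd^[k] z)) 2 volume ∧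
      n2 (wt (θ * (min k m : ℕ)) (wd^[k] z)) ≤ K' := by
  induction m with
  | zero =>
    refine ⟨max K 0, le_max_right _ _, fun z hz k hk => ?_⟩
    simp only [Nat.min_zero, Nat.cast_zero, mul_zero, wt_zero, n2_coe]
    exact ⟨Lp.memLp _, ((hreg z hz).2 k hk).trans (le_max_left _ _)⟩
  | succ m ih =>
    obtain ⟨K0, hK0, h0⟩ := ih
    obtain ⟨κ, N, Cg, hκ, hN, hCg, hE, hgain⟩ := exists_gain (a := σ + θ * m) (a0 := θ * m) (b := θ * (m + 1))
      (θ1 := (1 + θ) / 2) (by have : 0 ≤ θ * m := by positivity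
                              linarith) (by positivity) (by positivity) (by linarith) (by linarith)
      (by linarith) (by linarith)
    obtain ⟨Cw, hCw, hw⟩ := exists_memLp_wt_of_shells (θ * (m + 1)) (by positivity) hκ
    have hsrc : ∀ k, m ≤ k → k ≤ n → ∀ G ∈ sources σ C n 𝒮 k,
        MemLp (wt (σ + θ * m) G) 2 volume ∧ n2 (wt (σ + θ * m) G) ≤ 2 ^ k * (C * K0) := by
      intro k hmk hk G hG
      refine sources_bound hC hk (fun j => θ * (min j m : ℕ)) (fun z hz j hj => h0 z hz j (hj.trans hk)) ?_ hG
      intro i j hij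
      have h1 : (m : ℝ) ≤ i + (min j m : ℕ) := by
        have : m ≤ i + min j m := by omega
        exact_mod_cast this
      have h2 : θ * m ≤ θ * (i + (min j m : ℕ)) := by gcongr
      have h3 : θ * i ≤ i := mul_le_of_le_one_left (by positivity) hθ1.le
      linarith
    set A := 2 ^ n * (C * K0) with hA
    have hA0 : 0 ≤ A := by positivity
    have hsrcA : ∀ k, m ≤ k → k ≤ n → ∀ G ∈ sources σ C n 𝒮 k,
        MemLp (wt (σ + θ * m) G) 2 volume ∧ n2 (wt (σ + θ * m) G) ≤ A := by
      intro k hmk hk G hG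
      obtain ⟨p, q⟩ := hsrc k hmk hk G hG
      refine ⟨p, q.trans ?_⟩
      rw [hA]
      gcongr
      norm_num
    set B := Cg * (K0 + 1 * (Cg * A) + 1⁻¹ * A) with hB
    have hB0 : 0 ≤ B := by positivity
    refine ⟨max K0 (Cw * B), le_max_of_le_left hK0, fun z hz k hk => ?_⟩
    rcases Nat.lt_or_ge m k with hmk | hmk
    · obtain ⟨k, rfl⟩ : ∃ l, k = l + 1 := ⟨k - 1, by omega⟩
      have hmin : min (k + 1) (m + 1) = m + 1 := by omega
      have hmin' : min k m = m := by omega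
      rw [hmin]
      push_cast
      have hd := (hreg z hz).1 k (by omega)
      have hrk := rep_iterate (by linarith) hC hrep k (by omega) (fun z hz => (hreg z hz).1.mono (by omega)) z hz
      have hz0 := h0 z hz k (by omega)
      rw [hmin'] at hz0
      have := hw (wd^[k + 1] z) B hB0 fun ν hν i g hg hs => by
        have hR : (1 : ℝ) ≤ 2 ^ i := one_le_pow₀ (by norm_num)
        have hsupp : ShellSupp ν (2 ^ i) g := fun y hy => by
          obtain ⟨h1, h2⟩ := shellSupp_of_tsupport hs y hy
          constructor <;> linarith
        have h1 := hgain ν (2 ^ i) hν hR g hg hsupp (wd^[k] z) (sources σ C n 𝒮 k) K0 A (Cg * A) 1 hrk hA0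
          (by positivity) one_pos le_rfl hz0.1 hz0.2 (hsrcA k (by omega) (by omega)) (fun τ hτ s hs G hG => by
            obtain ⟨G', hG', hdG⟩ := sources_succ (by linarith) hC hk (fun z hz => (hreg z hz).1.mono hk) hG
            obtain ⟨p, q⟩ := hsrcA (k + 1) (by omega) hk G' hG'
            rw [pair_weakDeriv_psym hdG hg τ s (by positivity), norm_neg]
            refine (hE ν τ hν hτ s (2 ^ i) hs.le hR G' g p hg hsupp).trans ?_
            have := n2_nonneg g
            calc _ ≤ Cg * (2 ^ i) ^ (-(θ * (m + 1)) - κ) * (A * n2 g) := by gcongr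
              _ = _ := by ring)
        rw [hd.integral_deriv_test hg, norm_neg] at h1
        exact h1
      exact ⟨this.1, this.2.trans (le_max_right _ _)⟩
    · have : min k (m + 1) = min k m := by omega
      rw [this]
      obtain ⟨p, q⟩ := h0 z hz k hk
      exact ⟨p, q.trans (le_max_left _ _)⟩

/-- The forward difference quotient. -/
noncomputable def dq (h : ℝ) (F : ℝ → ℂ) (x : ℝ) : ℂ := (h : ℂ)⁻¹ * (F (x + h) - F x)

theorem memLp_comp_add {F : ℝ → ℂ} (hF : MemLp F 2 volume) (h : ℝ) :
    MemLp (fun x => F (x + h)) 2 volume :=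
  hF.comp_measurePreserving (measurePreserving_add_right volume h)

theorem n2_comp_add {F : ℝ → ℂ} (hF : AEStronglyMeasurable F (volume : Measure ℝ)) (h : ℝ) :
    n2 (fun x => F (x + h)) = n2 F := by
  unfold n2
  rw [← eLpNorm_comp_measurePreserving hF (measurePreserving_add_right volume h)]
  rfl

theorem memLp_dq {F : ℝ → ℂ} (hF : MemLp F 2 volume) (h : ℝ) :
    MemLp (dq h F) 2 volume := ((memLp_comp_add hF h).sub hF).const_mul _

theorem dq_congr {F G : ℝ → ℂ} (h : ℝ) (e : F =ᵐ[volume] G) : dq h F =ᵐ[volume] dq h G := by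
  filter_upwards [e, (measurePreserving_add_right volume h).quasiMeasurePreserving.ae_eq_comp e] with x h1 h2
  simp only [Function.comp] at h2
  simp only [dq, h1, h2]

theorem n2_dq_le {F : ℝ → ℂ} (hF : MemLp F 2 volume) {h : ℝ} (hh : 0 < h) :
    n2 (dq h F) ≤ h⁻¹ * (2 * n2 F) := by
  unfold dq
  rw [n2_const_mul, norm_inv, Complex.norm_real, Real.norm_of_nonneg hh.le]
  gcongr
  have := n2_add_le (memLp_comp_add hF h) (hF.const_mul (-1))
  rw [n2_comp_add hF.1, n2_const_mul] at this
  simp only [norm_neg, norm_one, one_mul, neg_mul, ← sub_eq_add_neg] at this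
  linarith

/-- The mean of `g` over `[x - h, x]`. -/
noncomputable def avg (h : ℝ) (g : ℝ → ℂ) (x : ℝ) : ℂ := (h : ℂ)⁻¹ * ∫ y in (x - h)..x, g y

theorem hasDerivAt_avg {g : ℝ → ℂ} (hg : Continuous g) (h x : ℝ) :
    HasDerivAt (avg h g) ((h : ℂ)⁻¹ * (g x - g (x - h))) x := by
  have h1 : ∀ x, HasDerivAt (fun u => ∫ y in (0 : ℝ)..u, g y) (g x) x := fun x =>
    intervalIntegral.integral_hasDerivAt_right (hg.intervalIntegrable _ _)
      (hg.stronglyMeasurableAtFilter _ _) hg.continuousAt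
  have h2 := ((h1 x).sub ((h1 (x - h)).comp_sub_const x h)).const_mul (h : ℂ)⁻¹
  refine h2.congr_of_eventuallyEq (Eventually.of_forall fun u => ?_)
  simp only [avg, Pi.sub_apply]
  rw [intervalIntegral.integral_interval_sub_left (hg.intervalIntegrable _ _) (hg.intervalIntegrable _ _)]

theorem exists_ne_zero_of_avg {g : ℝ → ℂ} {h x : ℝ} (hh : 0 ≤ h) (hx : avg h g x ≠ 0) :
    ∃ y, g y ≠ 0 ∧ x - h ≤ y ∧ y ≤ x := by
  by_contra! hc
  apply hx
  rw [avg, intervalIntegral.integral_zero_ae, mul_zero]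
  refine Eventually.of_forall fun y hy => ?_
  rw [uIoc_of_le (by linarith)] at hy
  by_contra hne
  linarith [hc y hne hy.1.le, hy.2]

theorem IsTest.avg {g : ℝ → ℂ} (hg : IsTest g) {h : ℝ} (hh : 0 ≤ h) : IsTest (avg h g) := by
  constructor
  · rw [contDiff_infty_iff_deriv]
    refine ⟨fun x => (hasDerivAt_avg hg.smooth.continuous h x).differentiableAt, ?_⟩
    rw [show _root_.deriv (WeaklyBound.avg h g) = fun x => (h : ℂ)⁻¹ * (g x - g (x - h)) from
      funext fun x => (hasDerivAt_avg hg.smooth.continuous h x).deriv]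
    have := hg.smooth
    exact contDiff_const.mul (this.sub (this.comp (contDiff_id.sub contDiff_const)))
  · obtain ⟨L, hL⟩ := hg.compact.isBounded.exists_norm_le
    refine HasCompactSupport.intro (K := Icc (-L - h) (L + h)) isCompact_Icc fun x hx => ?_
    by_contra hne
    obtain ⟨y, hy, h1, h2⟩ := exists_ne_zero_of_avg hh hne
    have := hL y (subset_tsupport _ hy)
    rw [Real.norm_eq_abs, abs_le] at this
    exact hx ⟨by linarith, by linarith⟩

theorem fourier_comp_sub {g : ℝ → ℂ} (h ξ : ℝ) :
    𝓕 (fun x => g (x - h)) ξ = Complex.exp (2 * π * Complex.I * (-h : ℝ) * ξ) * 𝓕 g ξ := by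
  rw [fourier_apply, fourier_apply, ← integral_const_mul]
  rw [← integral_add_right_eq_self _ h]
  refine integral_congr_ae (Eventually.of_forall fun y => ?_)
  simp only [add_sub_cancel_right]
  rw [← mul_assoc, ← Complex.exp_add]
  congr 2
  push_cast
  ring

theorem IsTest.comp_sub {g : ℝ → ℂ} (hg : IsTest g) (h : ℝ) : IsTest fun x => g (x - h) :=
  ⟨hg.smooth.comp (contDiff_id.sub contDiff_const),
    hg.compact.comp_homeomorph (Homeomorph.subRight h)⟩

theorem IsTest.fourier_deriv_avg {g : ℝ → ℂ} (hg : IsTest g) (h : ℝ) (ξ : ℝ) :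
    𝓕 (_root_.deriv (WeaklyBound.avg h g)) ξ
      = (h : ℂ)⁻¹ * ((1 - Complex.exp (2 * π * Complex.I * (-h : ℝ) * ξ)) * 𝓕 g ξ) := by
  rw [show _root_.deriv (WeaklyBound.avg h g) = fun x => (h : ℂ)⁻¹ * (g x - g (x - h)) from
      funext fun x => (hasDerivAt_avg hg.smooth.continuous h x).deriv]
  have hint : ∀ {f : ℝ → ℂ}, Integrable f →
      Integrable fun y : ℝ => Complex.exp (-(2 * π * Complex.I * y * ξ)) * f y := fun hf => by
    refine (integrable_exp_mul hf (-ξ)).congr (Eventually.of_forall fun y => ?_)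
    simp only
    congr 2
    push_cast; ring
  have h1 : 𝓕 (fun x => (h : ℂ)⁻¹ * (g x - g (x - h))) ξ
      = (h : ℂ)⁻¹ * (𝓕 g ξ - 𝓕 (fun x => g (x - h)) ξ) := by
    rw [fourier_apply, fourier_apply, fourier_apply,
      ← integral_sub (hint hg.integrable) (hint (hg.comp_sub h).integrable), ← integral_const_mul]
    congr 1; ext y; ring
  rw [h1, fourier_comp_sub]
  ring

theorem IsTest.n2_avg_le {g : ℝ → ℂ} (hg : IsTest g) {h : ℝ} (hh : 0 < h) : n2 (WeaklyBound.avg h g) ≤ n2 g := by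
  rw [← (hg.avg hh.le).n2_fourier, ← hg.n2_fourier]
  refine n2_mono hg.rapidDecay.memLp ?_
  filter_upwards [compl_mem_ae_iff.2 (measure_singleton (0 : ℝ))] with ξ hξ
  have hξ' : ξ ≠ 0 := hξ
  have h1 := (hg.avg hh.le).fourier_deriv ξ
  rw [hg.fourier_deriv_avg h] at h1
  have h2 := congrArg norm h1
  simp only [norm_mul, norm_inv, Complex.norm_real, Real.norm_eq_abs, Complex.norm_I, abs_of_pos hh,
    Complex.norm_ofNat, abs_of_pos Real.pi_pos, mul_one] at h2
  have h3 : ‖1 - Complex.exp (2 * π * Complex.I * (-h : ℝ) * ξ)‖ ≤ 2 * π * h * |ξ| := by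
    have := Real.norm_exp_I_mul_ofReal_sub_one_le (x := 2 * π * (-h) * ξ)
    rw [norm_sub_rev]
    convert this using 1
    · congr 3; push_cast; ring
    · simp [abs_of_pos Real.pi_pos, abs_of_pos hh]
  have h4 : 2 * π * (|ξ| * ‖𝓕 (WeaklyBound.avg h g) ξ‖) ≤ 2 * π * (|ξ| * ‖𝓕 g ξ‖) := by
    rw [← h2]
    calc _ ≤ h⁻¹ * ((2 * π * h * |ξ|) * ‖𝓕 g ξ‖) := by gcongr
      _ = _ := by field_simp
  have h5 : 0 < |ξ| := abs_pos.2 hξ'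
  exact le_of_mul_le_mul_left (le_of_mul_le_mul_left h4 (by positivity)) h5

theorem integral_dq_mul {F G : ℝ → ℂ} (hF : MemLp F 2 volume) (hG : MemLp G 2 volume)
    (h : ℝ) : ∫ x, dq h F x * G x = -∫ x, F x * ((h : ℂ)⁻¹ * (G x - G (x - h))) := by
  have hG' : MemLp (fun x => G (x - h)) 2 volume := memLp_comp_add hG (-h)
  have e1 : ∫ x, F (x + h) * G x = ∫ x, F x * G (x - h) := by
    rw [← integral_add_right_eq_self (fun x => F x * G (x - h)) h]
    simp
  have e2 : ∫ x, dq h F x * G x = (h : ℂ)⁻¹ * ((∫ x, F (x + h) * G x) - ∫ x, F x * G x) := by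
    rw [← integral_sub (integrable_mul_of_memLp (memLp_comp_add hF h) hG) (integrable_mul_of_memLp hF hG),
      ← integral_const_mul]
    congr 1; ext x; simp only [dq]; ring
  have e3 : ∫ x, F x * ((h : ℂ)⁻¹ * (G x - G (x - h)))
      = (h : ℂ)⁻¹ * ((∫ x, F x * G x) - ∫ x, F x * G (x - h)) := by
    rw [← integral_sub (integrable_mul_of_memLp hF hG) (integrable_mul_of_memLp hF hG'),
      ← integral_const_mul]
    congr 1; ext x; ring
  rw [e2, e3, e1]; ring

theorem fourierInv_exp_mul (ρ : ℝ → ℂ) (h x : ℝ) :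
    𝓕⁻ (fun ξ : ℝ => Complex.exp (2 * π * Complex.I * (-h : ℝ) * ξ) * ρ ξ) x = 𝓕⁻ ρ (x - h) := by
  rw [fourierInv_apply, fourierInv_apply]
  congr 1; ext ξ
  rw [← mul_assoc, ← Complex.exp_add]
  congr 2
  push_cast; ring

theorem pair_psym_deriv_avg {F : ℝ → ℂ} (hF : MemLp F 2 volume) {g : ℝ → ℂ} (hg : IsTest g)
    (h τ s : ℝ) {α : ℝ} (hα : 0 < α) (ς : ℝ) (N : ℕ) :
    pair F (psym τ s α ς N (deriv (avg h g))) = -pair (dq h F) (psym τ s α ς N g) := by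
  have hr := hg.psym τ s hα ς N
  unfold pair
  rw [integral_dq_mul hF hr.memLp_fourierInv, neg_neg]
  have hr' : RapidDecay fun ξ : ℝ => Complex.exp (2 * π * Complex.I * (-h : ℝ) * ξ) * psym τ s α ς N g ξ :=
    hr.mul_bdd (by fun_prop) (K := 1) fun ξ => (norm_expI _ _).le
  congr 1; ext x
  congr 1
  have e : psym τ s α ς N (deriv (avg h g)) = fun ξ => (h : ℂ)⁻¹ * psym τ s α ς N g ξ +
      (-(h : ℂ)⁻¹) * (Complex.exp (2 * π * Complex.I * (-h : ℝ) * ξ) * psym τ s α ς N g ξ) := by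
    ext ξ
    simp only [psym, sym, hg.fourier_deriv_avg]
    ring
  rw [e, fourierInv_add' (hr.const_mul _).integrable (hr'.const_mul _).integrable]
  have hc : ∀ (c : ℂ) (ρ : ℝ → ℂ), 𝓕⁻ (fun ξ => c * ρ ξ) x = c * 𝓕⁻ ρ x := by
    intro c ρ
    rw [fourierInv_apply, fourierInv_apply, ← integral_const_mul]
    congr 1; ext ξ; ring
  rw [hc, hc, fourierInv_exp_mul]
  ring

theorem tendsto_eLpNorm_of_n2 {f : ℕ → ℝ → ℂ} (hf : ∀ n, MemLp (f n) 2 volume)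
    (h : Tendsto (fun n => n2 (f n)) atTop (𝓝 0)) :
    Tendsto (fun n => eLpNorm (f n) 2 volume) atTop (𝓝 0) := by
  rw [← ENNReal.tendsto_toReal_iff (fun n => (hf n).2.ne) ENNReal.zero_ne_top]
  simpa [n2] using h

theorem exists_subseq_ae_tendsto_zero {f : ℕ → ℝ → ℂ} (hf : ∀ n, MemLp (f n) 2 volume)
    (h : Tendsto (fun n => n2 (f n)) atTop (𝓝 0)) :
    ∃ ns : ℕ → ℕ, StrictMono ns ∧ ∀ᵐ x, Tendsto (fun i => f (ns i) x) atTop (𝓝 0) := by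
  have := tendstoInMeasure_of_tendsto_eLpNorm (g := fun _ => (0 : ℂ)) (p := 2) two_ne_zero
    (fun n => (hf n).1) aestronglyMeasurable_const (l := atTop) (f := f) (by
      refine (tendsto_eLpNorm_of_n2 hf h).congr fun n => ?_
      congr 1
      ext x
      simp)
  exact this.exists_seq_tendsto_ae

theorem norm_intervalIntegral_le_n2 {f : ℝ → ℂ} (hf : MemLp f 2 volume) (x : ℝ) {h : ℝ}
    (hh : 0 ≤ h) : ‖∫ y in x..(x + h), f y‖ ≤ √h * n2 f := by
  have hi : MemLp (indicator (Ioc x (x + h)) fun _ => (1 : ℂ)) 2 volume :=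
    memLp_indicator_const 2 measurableSet_Ioc 1 (Or.inr (by simp))
  rw [intervalIntegral.integral_of_le (by linarith), ← integral_indicator measurableSet_Ioc]
  have e : indicator (Ioc x (x + h)) f = fun y => f y * indicator (Ioc x (x + h)) (fun _ => (1 : ℂ)) y := by
    ext y; by_cases hy : y ∈ Ioc x (x + h) <;> simp [hy]
  rw [e]
  refine (norm_integral_mul_le hf hi).trans_eq ?_
  rw [mul_comm]
  congr 1
  rw [n2, eLpNorm_indicator_const measurableSet_Ioc two_ne_zero ENNReal.ofNat_ne_top]
  simp only [enorm_one, Real.volume_Ioc, add_sub_cancel_left, one_mul]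
  rw [← ENNReal.toReal_rpow, ENNReal.toReal_ofReal hh, Real.sqrt_eq_rpow]
  norm_num

theorem HasWeakDeriv.ae_sub_eq_integral {f f' : L2} (hd : HasWeakDeriv 1 f f') {h : ℝ} (hh : 0 ≤ h) :
    ∀ᵐ x, f (x + h) - f x = ∫ y in x..(x + h), f' y := by
  choose ρ hρ h0 h1 using fun n : ℕ => exists_smooth_approx hd (ε := 1 / ((n : ℝ) + 1)) (by positivity)
  have hm0 : ∀ n, MemLp (fun x => 𝓕⁻ (ρ n) x - f x) 2 volume := fun n =>
    (hρ n).memLp_fourierInv.sub (Lp.memLp f)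
  have hm1 : ∀ n, MemLp (fun x => deriv (𝓕⁻ (ρ n)) x - f' x) 2 volume := fun n =>
    (hρ n).memLp_deriv_fourierInv.sub (Lp.memLp f')
  have hlim := tendsto_one_div_add_atTop_nhds_zero_nat (𝕜 := ℝ)
  have t0 : Tendsto (fun n => n2 (fun x => 𝓕⁻ (ρ n) x - f x)) atTop (𝓝 0) :=
    squeeze_zero (fun n => n2_nonneg _) (fun n => (h0 n).le) hlim
  obtain ⟨ns, hns, hae⟩ := exists_subseq_ae_tendsto_zero hm0 t0
  have hae' := (measurePreserving_add_right volume h).quasiMeasurePreserving.ae hae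
  filter_upwards [hae, hae'] with x hx hx'
  have e : ∀ n, f (x + h) - f x - ∫ y in x..(x + h), f' y
      = (∫ y in x..(x + h), (deriv (𝓕⁻ (ρ n)) y - f' y))
        - ((𝓕⁻ (ρ n) (x + h) - f (x + h)) - (𝓕⁻ (ρ n) x - f x)) := by
    intro n
    have hs : ContDiff ℝ ∞ (𝓕⁻ (ρ n)) := (hρ n).contDiff_fourierInv
    have hc : Continuous (deriv (𝓕⁻ (ρ n))) := (hs.continuous_deriv (by norm_num))
    rw [intervalIntegral.integral_sub (hc.intervalIntegrable _ _)
      ((hd.2.1.integrableOn_isCompact isCompact_uIcc).intervalIntegrable),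
      intervalIntegral.integral_deriv_eq_sub (fun y _ => (hs.differentiable (by norm_num)).differentiableAt)
        (hc.intervalIntegrable _ _)]
    ring
  have hJ : Tendsto (fun n => ∫ y in x..(x + h), (deriv (𝓕⁻ (ρ n)) y - f' y)) atTop (𝓝 0) := by
    refine squeeze_zero_norm (fun n => (norm_intervalIntegral_le_n2 (hm1 n) x hh).trans
      (mul_le_mul_of_nonneg_left (h1 n).le (Real.sqrt_nonneg h))) ?_
    simpa using hlim.const_mul (√h)
  have := ((hJ.comp hns.tendsto_atTop).sub (hx'.sub hx))
  simp only [sub_zero] at this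
  refine sub_eq_zero.1 (tendsto_nhds_unique (f := fun _ : ℕ => f (x + h) - f x - ∫ y in x..(x + h), f' y)
    tendsto_const_nhds (this.congr fun i => ?_))
  rw [e (ns i)]
  rfl

theorem jap_le_two_mul {x y : ℝ} (h : |x - y| ≤ 1) : jap x ≤ 2 * jap y := by
  have h1 := abs_le.1 h
  rw [jap, jap, ← Real.sqrt_sq (show (0 : ℝ) ≤ 2 by norm_num), ← Real.sqrt_mul (by positivity)]
  refine Real.sqrt_le_sqrt ?_
  nlinarith [sq_nonneg (x - 2 * y)]

theorem jap_rpow_le_of_near {σ x y : ℝ} (hσ : 0 ≤ σ) {e : ℝ} (he : e ≤ -σ) (h : |x - y| ≤ 1) :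
    jap y ^ e ≤ 2 ^ σ * jap x ^ (-σ) := by
  calc jap y ^ e ≤ jap y ^ (-σ) := Real.rpow_le_rpow_of_exponent_le (one_le_jap y) he
    _ ≤ (jap x / 2) ^ (-σ) := by
        refine Real.rpow_le_rpow_of_nonpos (by have := jap_pos x; positivity) ?_ (by linarith)
        linarith [jap_le_two_mul h]
    _ = 2 ^ σ * jap x ^ (-σ) := by
        rw [Real.div_rpow (jap_pos x).le (by norm_num), Real.rpow_neg (by norm_num : (0:ℝ) ≤ 2), div_inv_eq_mul, mul_comm]

theorem memLp_jap_rpow {σ : ℝ} (hσ : 1 ≤ σ) : MemLp (fun x => jap x ^ (-σ)) 2 volume := by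
  rw [memLp_two_iff_integrable_sq (continuous_jap_rpow _).aestronglyMeasurable]
  refine integrable_inv_one_add_sq.mono' ((continuous_jap_rpow _).pow 2).aestronglyMeasurable
    (Eventually.of_forall fun x => ?_)
  have h0 := jap_pos x
  rw [Real.norm_of_nonneg (by positivity)]
  calc (jap x ^ (-σ)) ^ 2 ≤ (jap x ^ (-1 : ℝ)) ^ 2 := by
        gcongr
        · exact one_le_jap x
    _ = (1 + x ^ 2)⁻¹ := by
        rw [Real.rpow_neg_one, inv_pow, jap, Real.sq_sqrt (by positivity)]

theorem PotChain.memLp {σ C : ℝ} {n : ℕ} {W : ℕ → ℝ → ℂ} (h : PotChain σ C n W) (hσ : 1 ≤ σ) {i : ℕ}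
    (hi : i ≤ n) : MemLp (W i) 2 volume := by
  refine (memLp_jap_rpow hσ).of_le_mul (c := C) (h.meas i hi) ?_
  filter_upwards [h.bound i hi] with x hx
  have h0 := jap_pos x
  have hC : 0 ≤ C := by
    have := (norm_nonneg _).trans hx
    exact nonneg_of_mul_nonneg_left this (by positivity)
  rw [Real.norm_of_nonneg (by positivity)]
  refine hx.trans ?_
  gcongr
  · exact one_le_jap x
  · have : (0 : ℝ) ≤ i := by positivity
    linarith

theorem PotChain.norm_dq_le {σ C : ℝ} {n : ℕ} {W : ℕ → ℝ → ℂ} (hW : PotChain σ C n W) (hσ : 1 ≤ σ)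
    (hC : 0 ≤ C) {i : ℕ} (hi : i < n) {h : ℝ} (hh : 0 < h) (hh1 : h ≤ 1) :
    ∀ᵐ x, ‖dq h (W i) x‖ ≤ C * 2 ^ σ * jap x ^ (-σ) := by
  have m0 := hW.memLp hσ hi.le
  have m1 := hW.memLp hσ hi
  have hd := hasWeakDeriv_toLp m0 m1 (hW.deriv i hi)
  have e0 := m0.coeFn_toLp
  have e0' := (measurePreserving_add_right volume h).quasiMeasurePreserving.ae e0
  have hb := (hW.bound (i + 1) hi)
  have e1 := m1.coeFn_toLp
  filter_upwards [hd.ae_sub_eq_integral hh.le, e0, e0'] with x hx h0 h0'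
  rw [h0', h0] at hx
  rw [dq, hx, norm_mul, norm_inv, Complex.norm_real, Real.norm_of_nonneg hh.le]
  have : ‖∫ y in x..(x + h), m1.toLp (W (i + 1)) y‖ ≤ (C * 2 ^ σ * jap x ^ (-σ)) * |x + h - x| := by
    refine intervalIntegral.norm_integral_le_of_norm_le_const_ae ?_
    filter_upwards [hb, e1] with y hy hy1 hmem
    rw [uIoc_of_le (by linarith)] at hmem
    rw [hy1, mul_assoc]
    refine hy.trans (mul_le_mul_of_nonneg_left (jap_rpow_le_of_near (by linarith) ?_ ?_) hC)
    · have : (0 : ℝ) ≤ ((i + 1 : ℕ) : ℝ) := by positivity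
      linarith
    · rw [abs_le]; constructor <;> linarith [hmem.1, hmem.2]
  rw [add_sub_cancel_left, abs_of_pos hh] at this
  calc _ ≤ h⁻¹ * ((C * 2 ^ σ * jap x ^ (-σ)) * h) := by gcongr
    _ = _ := by field_simp

theorem PotChain.norm_shift_le {σ C : ℝ} {n : ℕ} {W : ℕ → ℝ → ℂ} (hW : PotChain σ C n W) (hσ : 0 ≤ σ)
    (hC : 0 ≤ C) {i : ℕ} (hi : i ≤ n) {h : ℝ} (hh : 0 ≤ h) (hh1 : h ≤ 1) :
    ∀ᵐ x, ‖W i (x + h)‖ ≤ C * 2 ^ σ * jap x ^ (-σ) := by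
  filter_upwards [(measurePreserving_add_right volume h).quasiMeasurePreserving.ae (hW.bound i hi)] with x hx
  rw [mul_assoc]
  refine hx.trans (mul_le_mul_of_nonneg_left (jap_rpow_le_of_near hσ ?_ ?_) hC)
  · have : (0 : ℝ) ≤ (i : ℝ) := by positivity
    linarith
  · rw [abs_le]; constructor <;> linarith

/-- Difference quotients of Leibniz expansions. -/
theorem dq_prodD_bound (a h : ℝ) (k : ℕ) {B : ℝ} : ∀ {W : ℕ → ℝ → ℂ} {Z : ℕ → L2},
    (∀ i j, i + j = k → MemLp (wt a (dq h fun x => W i x * Z j x)) 2 volume ∧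
      n2 (wt a (dq h fun x => W i x * Z j x)) ≤ B) →
    MemLp (wt a (dq h (prodD k W Z))) 2 volume ∧ n2 (wt a (dq h (prodD k W Z))) ≤ 2 ^ k * B := by
  induction k with
  | zero =>
    intro W Z hB
    simpa [prodD] using hB 0 0 rfl
  | succ k ih =>
    intro W Z hB
    obtain ⟨m1, b1⟩ := ih (W := fun i => W (i + 1)) (Z := Z) fun i j hij => hB (i + 1) j (by omega)
    obtain ⟨m2, b2⟩ := ih (W := W) (Z := fun i => Z (i + 1)) fun i j hij => hB i (j + 1) (by omega)
    have e : wt a (dq h (prodD (k + 1) W Z)) = fun x => wt a (dq h (prodD k (fun i => W (i + 1)) Z)) x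
        + wt a (dq h (prodD k W (fun i => Z (i + 1)))) x := by
      ext x; simp only [wt, dq, prodD]; ring
    rw [e]
    refine ⟨m1.add m2, (n2_add_le m1 m2).trans ?_⟩
    calc _ ≤ 2 ^ k * B + 2 ^ k * B := add_le_add b1 b2
      _ = _ := by ring

theorem dq_mul_bound {σ C h : ℝ} {W : ℝ → ℂ} {z : L2} (hC : 0 ≤ C)
    (hWm : AEStronglyMeasurable W (volume : Measure ℝ))
    (h1 : ∀ᵐ x, ‖W (x + h)‖ ≤ C * jap x ^ (-σ)) (h2 : ∀ᵐ x, ‖dq h W x‖ ≤ C * jap x ^ (-σ)) :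
    MemLp (wt σ (dq h fun x => W x * z x)) 2 volume ∧
      n2 (wt σ (dq h fun x => W x * z x)) ≤ C * n2 (dq h z) + C * ‖z‖ := by
  have hz := memLp_dq (Lp.memLp z) h
  have hWs : AEStronglyMeasurable (fun x => W (x + h)) (volume : Measure ℝ) :=
    hWm.comp_quasiMeasurePreserving (measurePreserving_add_right volume h).quasiMeasurePreserving
  have hWd : AEStronglyMeasurable (dq h W) (volume : Measure ℝ) := (hWs.sub hWm).const_mul _
  have e : wt σ (dq h fun x => W x * z x) =ᵐ[volume] fun x =>
      wt σ (fun x => W (x + h) * (hz.toLp _ : L2) x) x + wt σ (fun x => dq h W x * z x) x := by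
    filter_upwards [hz.coeFn_toLp] with x hx
    simp only [wt, hx, dq]; ring
  have b1 := wt_mul_bound (a := σ) (r := 0) (i := 0) (z := hz.toLp _) (K := n2 (dq h z)) hWs
    (by simpa using h1) hC (by rw [wt_zero]; exact Lp.memLp _)
    (by rw [wt_zero, n2_congr hz.coeFn_toLp]) (by simp)
  have b2 := wt_mul_bound (a := σ) (r := 0) (i := 0) (z := z) (K := ‖z‖) hWd
    (by simpa using h2) hC (by rw [wt_zero]; exact Lp.memLp _) (by rw [wt_zero, n2_coe]) (by simp)
  rw [n2_congr e]
  exact ⟨(b1.1.add b2.1).ae_eq e.symm, (n2_add_le b1.1 b2.1).trans (add_le_add b1.2 b2.2)⟩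

/-- Difference quotients are dominated by the derivative. -/
theorem HasWeakDeriv.n2_dq_le {z z' : L2} (hd : HasWeakDeriv 1 z z') {h : ℝ} (hh : 0 < h) :
    n2 (dq h z) ≤ ‖z'‖ := by
  have hz := memLp_dq (Lp.memLp z) h
  have := n2_indicator_le_of_dual (hz.toLp _) isOpen_univ (norm_nonneg z') fun g hg _ => by
    have e : ∫ x, (hz.toLp _ : L2) x * g x = ∫ x, z' x * avg h g x := by
      rw [integral_congr_ae (hz.coeFn_toLp.mono fun x hx => by simp only [hx] : _ =ᵐ[volume] fun x => dq h z x * g x),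
        integral_dq_mul (Lp.memLp z) hg.memLp, ← neg_neg (∫ x, z' x * avg h g x),
        ← hd.integral_deriv_test (hg.avg hh.le)]
      congr 2; ext x
      rw [(hasDerivAt_avg hg.smooth.continuous h x).deriv]
    rw [e]
    refine (norm_integral_mul_le (Lp.memLp z') (hg.avg hh.le).memLp).trans ?_
    rw [n2_coe]
    gcongr
    exact hg.n2_avg_le hh
  rwa [indicator_univ, n2_congr hz.coeFn_toLp] at this

/-- A function with bounded difference quotients has a weak derivative. -/
theorem exists_weakDeriv_of_dq (z : L2) {K : ℝ} (hK : 0 ≤ K)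
    (hb : ∀ h, 0 < h → h ≤ 1 / 4 → n2 (dq h z) ≤ K) : ∃ z' : L2, HasWeakDeriv 1 z z' ∧ ‖z'‖ ≤ K := by
  have key : ∀ g : ℝ → ℂ, IsTest g → ‖∫ x, z x * deriv g x‖ ≤ K * n2 g := by
    intro g hg
    set h : ℕ → ℝ := fun n => 1 / 4 * (1 / ((n : ℝ) + 1)) with hh
    have h0 : ∀ n, 0 < h n := fun n => by simp only [hh]; positivity
    have h14 : ∀ n, h n ≤ 1 / 4 := fun n => by
      simp only [hh]
      have : 1 / ((n : ℝ) + 1) ≤ 1 := by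
        rw [div_le_one (by positivity)]; linarith [Nat.cast_nonneg (α := ℝ) n]
      linarith
    have hlim : Tendsto h atTop (𝓝 0) := by
      have := (tendsto_one_div_add_atTop_nhds_zero_nat (𝕜 := ℝ)).const_mul (1 / 4)
      rwa [mul_zero] at this
    have hq : ∀ n x, deriv (avg (h n) g) x = ((h n : ℝ) : ℂ)⁻¹ * (g x - g (x - h n)) := fun n x =>
      (hasDerivAt_avg hg.smooth.continuous _ x).deriv
    have hdg : ∀ x, HasDerivAt g (deriv g x) x := fun x =>
      ((hg.smooth.differentiable (by norm_num)) x).hasDerivAt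
    obtain ⟨M, hM⟩ := hg.deriv.smooth.continuous.bounded_above_of_compact_support hg.deriv.compact
    obtain ⟨L, hL⟩ := hg.deriv.compact.isBounded.exists_norm_le
    have hM0 : 0 ≤ M := (norm_nonneg _).trans (hM 0)
    have hpt : ∀ x, Tendsto (fun n => deriv (avg (h n) g) x) atTop (𝓝 (deriv g x)) := by
      intro x
      have h1 := (hasDerivAt_iff_tendsto_slope.1 (hdg x))
      have h2 : Tendsto (fun n => x - h n) atTop (𝓝[≠] x) := by
        refine tendsto_nhdsWithin_iff.2 ⟨by simpa using hlim.const_sub x, Eventually.of_forall fun n => ?_⟩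
        simp [(h0 n).ne']
      refine (h1.comp h2).congr fun n => ?_
      have hn := (h0 n).ne'
      rw [Function.comp, slope_def_module, hq, Complex.real_smul]
      push_cast
      have : (h n : ℂ) ≠ 0 := by exact_mod_cast hn
      rw [show (x : ℂ) - h n - x = -(h n) by ring, inv_neg]
      ring
    have hbd : ∀ n x, ‖deriv (avg (h n) g) x‖ ≤ indicator (Icc (-L) (L + 1)) (fun _ => M) x := by
      intro n x
      have hav : deriv (avg (h n) g) x = avg (h n) (deriv g) x := by
        rw [hq, avg, intervalIntegral.integral_deriv_eq_sub
          (fun y _ => (hdg y).differentiableAt) (hg.deriv.smooth.continuous.intervalIntegrable _ _)]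
      by_cases hx : x ∈ Icc (-L) (L + 1)
      · rw [indicator_of_mem hx, hav, avg, norm_mul, norm_inv, Complex.norm_real, Real.norm_of_nonneg (h0 n).le]
        have := intervalIntegral.norm_integral_le_of_norm_le_const (a := x - h n) (b := x) fun y _ => hM y
        rw [sub_sub_cancel, abs_of_pos (h0 n)] at this
        calc _ ≤ (h n)⁻¹ * (M * h n) := mul_le_mul_of_nonneg_left this (inv_nonneg.2 (h0 n).le)
          _ = M := by have := h0 n; field_simp
      · rw [indicator_of_notMem hx, hav]
        by_contra hne
        rw [not_le, norm_pos_iff] at hne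
        obtain ⟨y, hy, h1, h2⟩ := exists_ne_zero_of_avg (h0 n).le hne
        have := hL y (subset_tsupport _ hy)
        rw [Real.norm_eq_abs, abs_le] at this
        exact hx ⟨by linarith, by linarith [h14 n]⟩
    have hdm : ∀ n, MemLp (deriv (avg (h n) g)) 2 volume := fun n =>
      ((hg.avg (h0 n).le).deriv).memLp
    have hG : MemLp (fun x => indicator (Icc (-L) (L + 1)) (fun _ => M) x + ‖deriv g x‖) 2 volume :=
      (memLp_indicator_const 2 measurableSet_Icc M (Or.inr (by simp))).add hg.deriv.memLp.norm
    have t2 : Tendsto (fun n => n2 (fun x => deriv (avg (h n) g) x - deriv g x)) atTop (𝓝 0) := by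
      refine tendsto_n2_zero hG (fun n => ((hdm n).sub hg.deriv.memLp).1)
        (fun n => Eventually.of_forall fun x => (norm_sub_le _ _).trans (by gcongr; exact hbd n x))
        (Eventually.of_forall fun x => ?_)
      simpa using (hpt x).sub_const (deriv g x)
    have t3 := (tendsto_integral_mul_of_n2 (Lp.memLp z) hdm hg.deriv.memLp t2).norm
    refine le_of_tendsto t3 (Eventually.of_forall fun n => ?_)
    have e : ∫ x, z x * deriv (avg (h n) g) x = -∫ x, dq (h n) z x * g x := by
      rw [integral_dq_mul (Lp.memLp z) hg.memLp, neg_neg]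
      congr 1; ext x; rw [hq]
    rw [e, norm_neg]
    exact (norm_integral_mul_le (memLp_dq (Lp.memLp z) _) hg.memLp).trans
      (mul_le_mul_of_nonneg_right (hb _ (h0 n) (h14 n)) (n2_nonneg _))
  refine exists_weakDeriv_of_bound z hK fun f => ?_
  have hs : ContDiff ℝ ∞ f := f.smooth _
  have m0 : MemLp f 2 volume := f.memLp 2
  have e1 : deriv f = SchwartzMap.derivCLM ℂ ℂ f := by ext x; rfl
  have e2 : deriv (deriv f) = SchwartzMap.derivCLM ℂ ℂ (SchwartzMap.derivCLM ℂ ℂ f) := by rw [e1]; ext x; rfl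
  have m1 : MemLp (deriv f) 2 volume := by rw [e1]; exact SchwartzMap.memLp _ 2 volume
  have m2 : MemLp (deriv (deriv f)) 2 volume := by rw [e2]; exact SchwartzMap.memLp _ 2 volume
  obtain ⟨ψ, p1, p2, t0, t1, -⟩ := exists_test_approx hs m0 m1 m2
  have hψ : ∀ n, IsTest (ψ n) := fun n => ⟨p1 n, p2 n⟩
  have l1 := (tendsto_integral_mul_of_n2 (Lp.memLp z) (fun n => (hψ n).deriv.memLp) m1 t1).norm
  have l2 : Tendsto (fun n => K * (n2 f + n2 (fun x => ψ n x - f x))) atTop (𝓝 (K * (n2 f + 0))) :=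
    (tendsto_const_nhds.add t0).const_mul K
  rw [add_zero] at l2
  refine le_of_tendsto_of_tendsto' l1 l2 fun n => (key _ (hψ n)).trans ?_
  gcongr
  have : n2 (fun x => f x + (ψ n x - f x)) ≤ n2 f + n2 (fun x => ψ n x - f x) :=
    n2_add_le m0 ((hψ n).memLp.sub m0)
  simpa only [add_sub_cancel] using this

theorem IsTest.eq_zero_of_n2 {g : ℝ → ℂ} (hg : IsTest g) (h : n2 g = 0) : g = fun _ => 0 := by
  have h1 : eLpNorm g 2 volume = 0 := by
    rcases (ENNReal.toReal_eq_zero_iff _).1 h with h | h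
    · exact h
    · exact absurd h hg.memLp.2.ne
  have h2 := (eLpNorm_eq_zero_iff hg.memLp.1 two_ne_zero).1 h1
  exact (hg.smooth.continuous.ae_eq_iff_eq volume continuous_const).1 h2

theorem IsTest.n2_pos {g : ℝ → ℂ} (hg : IsTest g) (h : g ≠ fun _ => 0) : 0 < n2 g :=
  lt_of_le_of_ne (n2_nonneg g) fun h0 => h (hg.eq_zero_of_n2 h0.symm)

theorem sources_dq_bound {σ C K A h : ℝ} {n k : ℕ} {𝒮 : Set L2} (hσ : 1 ≤ σ) (hC : 0 ≤ C) (hk : k < n)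
    (hreg : ∀ z ∈ 𝒮, Diff k z ∧ ∀ i ≤ k, ‖wd^[i] z‖ ≤ K) (hKA : K ≤ A) (hh : 0 < h) (hh1 : h ≤ 1)
    (hA : ∀ z ∈ 𝒮, n2 (dq h (wd^[k] z)) ≤ A) {G : L2} (hG : G ∈ sources σ C n 𝒮 k) :
    MemLp (wt σ (dq h G)) 2 volume ∧
      n2 (wt σ (dq h G)) ≤ 2 ^ k * (C * 2 ^ σ * A + C * 2 ^ σ * K) := by
  obtain ⟨W, hW, z, hz, hGe⟩ := hG
  have hCs : 0 ≤ C * 2 ^ σ := by positivity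
  have := dq_prodD_bound σ h k (B := C * 2 ^ σ * A + C * 2 ^ σ * K) (W := W) (Z := fun j => wd^[j] z)
    fun i j hij => by
      have hb := dq_mul_bound (z := wd^[j] z) hCs (hW.meas i (by omega))
        (hW.norm_shift_le (by linarith) hC (by omega) hh.le hh1) (hW.norm_dq_le hσ hC (by omega) hh hh1)
      refine ⟨hb.1, hb.2.trans ?_⟩
      have h1 : n2 (dq h (wd^[j] z)) ≤ A := by
        rcases Nat.lt_or_ge j k with hj | hj
        · exact (((hreg z hz).1 j hj).n2_dq_le hh).trans (((hreg z hz).2 (j + 1) hj).trans hKA)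
        · obtain rfl : j = k := by omega
          exact hA z hz
      have h2 := (hreg z hz).2 j (by omega)
      gcongr
  have he : wt σ (dq h (prodD k W fun j => wd^[j] z)) =ᵐ[volume] wt σ (dq h G) :=
    (dq_congr h hGe).symm.mono fun x hx => by simp only [wt, hx]
  rw [← n2_congr he]
  exact ⟨this.1.ae_eq he, this.2⟩

theorem exists_diff_succ {σ C : ℝ} (hσ : 2 < σ) (hC : 0 ≤ C) {n k : ℕ} (hk : k < n)
    {𝒮 : Set L2} (hrep : ∀ z ∈ 𝒮, Rep (sources σ C n 𝒮 0) z) {K : ℝ} (hK : 0 ≤ K)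
    (hreg : ∀ z ∈ 𝒮, Diff k z ∧ ∀ i ≤ k, ‖wd^[i] z‖ ≤ K) :
    ∃ K' : ℝ, 0 ≤ K' ∧ ∀ z ∈ 𝒮, ∃ z' : L2, HasWeakDeriv 1 (wd^[k] z) z' ∧ ‖z'‖ ≤ K' := by
  obtain ⟨κ, N, Cg, hκ, hN, hCg, hE, hgain⟩ := exists_gain (a := σ) (a0 := 0) (b := 0) (θ1 := 1 / 2)
    hσ.le le_rfl le_rfl (by norm_num) (by norm_num) (by norm_num) (by linarith)
  obtain ⟨Cw, hCw, hw⟩ := exists_memLp_wt_of_shells 0 le_rfl hκ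
  set A1 := 2 ^ k * (C * K) with hA1
  have hA10 : 0 ≤ A1 := by positivity
  have hsrc : ∀ G ∈ sources σ C n 𝒮 k, MemLp (wt σ G) 2 volume ∧ n2 (wt σ G) ≤ A1 := fun G hG =>
    sources_bound hC hk.le (fun _ => 0)
      (fun z hz j hj => by rw [wt_zero, n2_coe]; exact ⟨Lp.memLp _, (hreg z hz).2 j hj⟩)
      (fun i j _ => by have : (0 : ℝ) ≤ i := i.cast_nonneg
                       linarith) hG
  set Cs := C * 2 ^ σ with hCs
  have hCs0 : 0 ≤ Cs := by positivity
  have step : ∀ h A : ℝ, 0 < h → h ≤ 1 / 4 → K ≤ A → (∀ z ∈ 𝒮, n2 (dq h (wd^[k] z)) ≤ A) →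
      ∀ δ, 0 < δ → δ ≤ 1 → ∀ z ∈ 𝒮, n2 (dq h (wd^[k] z)) ≤
        Cw * (Cg * (K + δ * (Cg * (2 ^ k * (Cs * A + Cs * K))) + δ⁻¹ * A1)) := by
    intro h A hh hh4 hKA hA δ hδ hδ1 z hz
    have hA0 : 0 ≤ A := hK.trans hKA
    set A3 := 2 ^ k * (Cs * A + Cs * K) with hA3
    have hA30 : 0 ≤ A3 := by positivity
    have hzm := memLp_dq (Lp.memLp (wd^[k] z)) h
    have hB : 0 ≤ Cg * (K + δ * (Cg * A3) + δ⁻¹ * A1) := by positivity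
    have := hw (hzm.toLp _) _ hB fun ν hν i g hg hs => by
      have hR : (1 : ℝ) ≤ 2 ^ i := one_le_pow₀ (by norm_num)
      set γ := avg h g with hγ
      have hγt : IsTest γ := hg.avg hh.le
      have hsupp : ShellSupp ν (2 ^ i) γ := fun y hy => by
        obtain ⟨x, hx, h3, h4⟩ := exists_ne_zero_of_avg hh.le hy
        obtain ⟨h1, h2⟩ := shellSupp_of_tsupport hs x hx
        rcases hν with rfl | rfl <;> constructor <;> linarith
      have e : ∫ x, (hzm.toLp _ : L2) x * g x = -∫ x, (wd^[k] z) x * deriv γ x := by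
        rw [integral_congr_ae (hzm.coeFn_toLp.mono fun x hx => by simp only [hx] :
            _ =ᵐ[volume] fun x => dq h (wd^[k] z) x * g x), integral_dq_mul (Lp.memLp _) hg.memLp]
        congr 2; ext x
        rw [hγ, (hasDerivAt_avg hg.smooth.continuous h x).deriv]
      rw [e, norm_neg]
      have hγg : n2 γ ≤ n2 g := hg.n2_avg_le hh
      by_cases hγ0 : γ = fun _ => 0
      · rw [hγ0]
        simp only [deriv_const, mul_zero, integral_zero, norm_zero]
        have := n2_nonneg g
        positivity
      have hγp := hγt.n2_pos hγ0
      have hg0 := n2_nonneg g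
      have h1 := hgain ν (2 ^ i) hν hR γ hγt hsupp (wd^[k] z) (sources σ C n 𝒮 k) K A1
        (Cg * A3 * (n2 g / n2 γ)) δ
        (rep_iterate (by linarith) hC hrep k hk.le (fun z hz => (hreg z hz).1) z hz) hA10 (by positivity)
        hδ hδ1 (by rw [wt_zero]; exact Lp.memLp _) (by rw [wt_zero, n2_coe]; exact (hreg z hz).2 k le_rfl) hsrc
        fun τ hτ s hs' G hG => by
          obtain ⟨p, q⟩ := sources_dq_bound (by linarith) hC hk hreg hKA hh (by linarith) hA hG
          rw [pair_psym_deriv_avg (Lp.memLp G) hg h τ s (by positivity), norm_neg]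
          refine (hE ν τ hν hτ s (2 ^ i) hs'.le hR _ g p hg fun y hy => ?_).trans ?_
          · obtain ⟨h1, h2⟩ := shellSupp_of_tsupport hs y hy
            constructor <;> linarith
          · calc _ ≤ Cg * (2 ^ i) ^ (-0 - κ) * (A3 * n2 g) := by gcongr
              _ = _ := by field_simp
      refine h1.trans ?_
      have e2 : Cg * (K + δ * (Cg * A3 * (n2 g / n2 γ)) + δ⁻¹ * A1) * (2 ^ i) ^ (-0 - κ) * n2 γ
        = Cg * (K * n2 γ + δ * (Cg * A3) * n2 g + δ⁻¹ * A1 * n2 γ) * (2 ^ i) ^ (-0 - κ) := by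
          field_simp
      rw [e2]
      calc _ ≤ Cg * (K * n2 g + δ * (Cg * A3) * n2 g + δ⁻¹ * A1 * n2 g) * (2 ^ i) ^ (-0 - κ) := by gcongr
        _ = _ := by ring
    rw [wt_zero, n2_congr hzm.coeFn_toLp] at this
    exact this.2
  set D := Cw * (Cg * (Cg * (2 ^ k * Cs))) with hD
  have hD0 : 0 ≤ D := by positivity
  set δ := (2 * (D + 1))⁻¹ with hδ
  have hδ0 : 0 < δ := by positivity
  have hδ1 : δ ≤ 1 := inv_le_one_of_one_le₀ (by linarith)
  have hδD : D * δ ≤ 1 / 2 := by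
    rw [hδ, ← div_eq_mul_inv, div_le_div_iff₀ (by positivity) (by norm_num)]; linarith
  set E := Cw * (Cg * (K + δ⁻¹ * A1)) with hEd
  have hE0 : 0 ≤ E := by positivity
  refine ⟨2 * K + 2 * E, by positivity, fun z hz => exists_weakDeriv_of_dq _ (by positivity) fun h hh hh4 => ?_⟩
  set S := (fun z : L2 => n2 (dq h (wd^[k] z))) '' 𝒮 with hS
  have hbdd : BddAbove S := by
    refine ⟨h⁻¹ * (2 * K), ?_⟩
    rintro _ ⟨z, hz, rfl⟩
    refine (n2_dq_le (Lp.memLp _) hh).trans ?_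
    rw [n2_coe]
    have := (hreg z hz).2 k le_rfl
    gcongr
  have hmem : ∀ z ∈ 𝒮, n2 (dq h (wd^[k] z)) ≤ sSup S := fun z hz => le_csSup hbdd ⟨z, hz, rfl⟩
  have hne : S.Nonempty := ⟨_, z, hz, rfl⟩
  have hs0 : 0 ≤ sSup S := (n2_nonneg _).trans (hmem z hz)
  have : sSup S ≤ (sSup S + K + K) * (1 / 2) + E := by
    refine csSup_le hne ?_
    rintro _ ⟨y, hy, rfl⟩
    refine (step h (sSup S + K) hh hh4 (by linarith) (fun y hy => (hmem y hy).trans (by linarith)) δ hδ0 hδ1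
      y hy).trans ?_
    calc _ = (sSup S + K + K) * (D * δ) + E := by rw [hD, hEd]; ring
      _ ≤ _ := by gcongr
  exact (hmem z hz).trans (by linarith)

/-- Bootstrapping regularity: an `L²`-bounded family with the representation property is bounded in `Hⁿ`. -/
theorem exists_diff_bound {σ C : ℝ} (hσ : 2 < σ) (hC : 0 ≤ C) {n : ℕ}
    {𝒮 : Set L2} (hrep : ∀ z ∈ 𝒮, Rep (sources σ C n 𝒮 0) z) {K : ℝ} (hK : ∀ z ∈ 𝒮, ‖z‖ ≤ K) :
    ∀ k ≤ n, ∃ K', 0 ≤ K' ∧ ∀ z ∈ 𝒮, Diff k z ∧ ∀ i ≤ k, ‖wd^[i] z‖ ≤ K' := by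
  intro k
  induction k with
  | zero =>
    intro _
    refine ⟨max K 0, le_max_right _ _, fun z hz => ⟨fun i hi => absurd hi (by omega), fun i hi => ?_⟩⟩
    obtain rfl : i = 0 := by omega
    exact (hK z hz).trans (le_max_left _ _)
  | succ k ih =>
    intro hk
    obtain ⟨K0, hK0, h0⟩ := ih (by omega)
    obtain ⟨K1, hK1, h1⟩ := exists_diff_succ hσ hC hk hrep hK0 h0
    refine ⟨max K0 K1, le_max_of_le_left hK0, fun z hz => ?_⟩
    obtain ⟨z', hz', hb⟩ := h1 z hz
    have e : wd^[k + 1] z = z' := by rw [Function.iterate_succ_apply', hz'.wd_eq]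
    refine ⟨fun i hi => ?_, fun i hi => ?_⟩
    · rcases Nat.lt_or_ge i k with h | h
      · exact (h0 z hz).1 i h
      · obtain rfl : i = k := by omega
        rw [e]; exact hz'
    · rcases Nat.lt_or_ge i (k + 1) with h | h
      · exact ((h0 z hz).2 i (by omega)).trans (le_max_left _ _)
      · obtain rfl : i = k + 1 := by omega
        rw [e]; exact hb.trans (le_max_right _ _)

theorem exists_sym_decay {N : ℕ} (hN : 6 ≤ N) {α ς : ℝ} (hα : 0 < α) (hς : ς = 1 ∨ ς = -1)
    (η : SchwartzMap ℝ ℂ) : ∃ K, 0 ≤ K ∧ ∀ F : ℝ → ℂ, MemLp (wt 2 F) 2 volume → ∀ s : ℝ,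
      ‖pair F (sym s α ς (.X ^ N) η)‖ ≤ K * n2 (wt 2 F) * (1 + s ^ 2)⁻¹ := by
  obtain ⟨C1, hC1, h1⟩ := norm_pair_sym_le (.X ^ N)
  obtain ⟨C2, hC2, h2⟩ := local_decay_two ((1 - .X) * .X ^ (N - 5))
  set y0 := n2 η
  set y1 := n2 (dS η)
  set y2 := n2 (dS (dS η))
  have hy0 : 0 ≤ y0 := n2_nonneg _
  have hy1 : 0 ≤ y1 := n2_nonneg _
  have hy2 : 0 ≤ y2 := n2_nonneg _
  set D := C2 * (α⁻¹ * (y0 + (α⁻¹ * y0 + y1) + (α⁻¹ * (α⁻¹ * y0) + α⁻¹ * y1 + y2))) with hD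
  refine ⟨C1 * y0 + α⁻¹ * D, by positivity, fun F hF s => ?_⟩
  have hm0 : MemLp F 2 volume := memLp_of_wt' (by norm_num) hF
  have hj1 : ∀ x : ℝ, ‖(x : ℂ) * F x‖ ≤ jap x ^ (1 : ℝ) * ‖F x‖ := fun x => by
    rw [norm_mul, Complex.norm_real, Real.rpow_one]
    gcongr; exact abs_le_jap x
  have hj2 : ∀ x : ℝ, ‖(x : ℂ) * (x * F x)‖ ≤ jap x ^ (2 : ℝ) * ‖F x‖ := fun x => by
    rw [norm_mul, norm_mul, Complex.norm_real, ← mul_assoc, Real.rpow_two, sq]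
    gcongr <;> first | exact abs_le_jap x | exact (jap_pos x).le
  have hx1 : AEStronglyMeasurable (fun x : ℝ => (x : ℂ) * F x) (volume : Measure ℝ) :=
    Complex.continuous_ofReal.aestronglyMeasurable.mul hm0.1
  have hx2 : AEStronglyMeasurable (fun x : ℝ => (x : ℂ) * (x * F x)) (volume : Measure ℝ) :=
    Complex.continuous_ofReal.aestronglyMeasurable.mul hx1
  have hm1 := memLp_of_wt (j := 1) (by norm_num) hF hx1 hj1
  have hm2 := memLp_of_wt le_rfl hF hx2 hj2
  have hle : ∀ {G : ℝ → ℂ} {j : ℝ}, j ≤ 2 → (∀ x, ‖G x‖ ≤ jap x ^ j * ‖F x‖) → n2 G ≤ n2 (wt 2 F) := by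
    intro G j hj hG
    refine n2_mono hF (Eventually.of_forall fun x => ?_)
    rw [norm_wt]
    refine (hG x).trans ?_
    gcongr
    exact one_le_jap x
  set X := n2 (wt 2 F)
  have hX : 0 ≤ X := n2_nonneg _
  have b0 : n2 F ≤ X := hle (j := 0) (by norm_num) fun x => by simp
  have b1 := hle (j := 1) (by norm_num) hj1
  have b2 := hle (j := 2) le_rfl hj2
  have k1 : ‖pair F (sym s α ς (.X ^ N) η)‖ ≤ C1 * y0 * X :=
    (h1 s α ς hα F η hm0 (rapidDecay_schwartz η)).trans (by
      calc C1 * (n2 F * n2 η) ≤ C1 * (X * y0) := by gcongr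
        _ = _ := by ring)
  have k2 : s ^ 2 * ‖pair F (sym s α ς (.X ^ N) η)‖ ≤ α⁻¹ * D * X := by
    have e : (.X ^ N : Polynomial ℝ) = .X ^ 2 * .X ^ (N - 2) := by rw [← pow_add]; congr 1; omega
    have e' : (.X * (1 - .X) * .X ^ (N - 2) : Polynomial ℝ) = .X ^ 4 * ((1 - .X) * .X ^ (N - 5)) := by
      rw [show N - 2 = (N - 5) + 3 by omega, pow_add]; ring
    rw [e, pair_sym_div F s hα, e', norm_mul, Complex.norm_real, Real.norm_eq_abs, abs_div, abs_of_sign hς,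
      abs_of_pos hα, one_div]
    have := h2 s α ς hα hς F η hm0 hm1 hm2
    calc _ = α⁻¹ * (s ^ 2 * ‖pair F (symD s α ς (.X ^ 4 * ((1 - .X) * .X ^ (N - 5))) η)‖) := by ring
      _ ≤ α⁻¹ * (C2 * (α⁻¹ * (X * y0 + X * (α⁻¹ * y0 + y1) + X * (α⁻¹ * (α⁻¹ * y0) + α⁻¹ * y1 + y2)))) := by
          refine mul_le_mul_of_nonneg_left (this.trans ?_) (by positivity)
          gcongr
      _ = _ := by rw [hD]; ring
  rw [← div_eq_mul_inv, le_div_iff₀ (by positivity)]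
  calc _ = ‖pair F (sym s α ς (.X ^ N) η)‖ + s ^ 2 * ‖pair F (sym s α ς (.X ^ N) η)‖ := by ring
    _ ≤ C1 * y0 * X + α⁻¹ * D * X := add_le_add k1 k2
    _ = _ := by ring

/-! ### Measurability in time -/

theorem aestronglyMeasurable_bilin_const {V : ℝ → ℝ → ℂ}
    (hV : AEStronglyMeasurable (Function.uncurry V) (timeMeasure.prod (volume : Measure ℝ))) (z w : L2) :
    AEStronglyMeasurable (fun s => ∫ x, V s x * z x * w x) timeMeasure := by
  have : SFinite timeMeasure := by unfold timeMeasure; infer_instance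
  have h1 : AEStronglyMeasurable (fun p : ℝ × ℝ => V p.1 p.2 * z p.2 * w p.2) (timeMeasure.prod (volume : Measure ℝ)) :=
    (hV.mul (Lp.aestronglyMeasurable z).comp_snd).mul (Lp.aestronglyMeasurable w).comp_snd
  exact h1.integral_prod_right'

theorem norm_bilin_le_of_bound {F : ℝ → ℂ} {C : ℝ} (hC : 0 ≤ C)
    (hb : ∀ᵐ x, ‖F x‖ ≤ C) (z w : L2) : ‖∫ x, F x * z x * w x‖ ≤ C * (‖z‖ * ‖w‖) := by
  have h := integral_norm_mul_le (Lp.memLp z) (Lp.memLp w)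
  rw [n2_coe, n2_coe] at h
  calc ‖∫ x, F x * z x * w x‖ ≤ ∫ x, C * ‖z x * w x‖ := by
        refine norm_integral_le_of_norm_le ((integrable_mul_of_memLp (Lp.memLp z) (Lp.memLp w)).norm.const_mul C) ?_
        filter_upwards [hb] with x hx
        rw [mul_assoc, norm_mul]; gcongr
    _ = C * ∫ x, ‖z x * w x‖ := integral_const_mul _ _
    _ ≤ _ := by gcongr

theorem integrable_bilin_of_bound {F : ℝ → ℂ} {C : ℝ} (hF : AEStronglyMeasurable F (volume : Measure ℝ))
    (hb : ∀ᵐ x, ‖F x‖ ≤ C) (z w : L2) : Integrable fun x => F x * z x * w x :=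
  integrable_mul_of_memLp (memLp_bdd_mul hF hb (Lp.memLp z)) (Lp.memLp w)

theorem ae_aestronglyMeasurable_slice {V : ℝ → ℝ → ℂ}
    (hV : AEStronglyMeasurable (Function.uncurry V) (timeMeasure.prod (volume : Measure ℝ))) :
    ∀ᵐ s ∂timeMeasure, AEStronglyMeasurable (V s) (volume : Measure ℝ) := by
  have : SFinite timeMeasure := by unfold timeMeasure; infer_instance
  exact hV.prodMk_left

theorem aestronglyMeasurable_bilin {V : ℝ → ℝ → ℂ}
    (hV : AEStronglyMeasurable (Function.uncurry V) (timeMeasure.prod (volume : Measure ℝ)))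
    {C : ℝ} (hC : 0 ≤ C) (hb : ∀ᵐ s ∂timeMeasure, ∀ᵐ x, ‖V s x‖ ≤ C) {z w : ℝ → L2}
    (hz : ContinuousOn z (Ici 0)) (hw : ContinuousOn w (Ici 0)) :
    AEStronglyMeasurable (fun s => ∫ x, V s x * z s x * w s x) timeMeasure := by
  set q : ℕ → ℝ → ℝ := fun n s => (⌊((n : ℝ) + 1) * s⌋₊ : ℝ) / ((n : ℝ) + 1) with hq
  have hq0 : ∀ n s, 0 ≤ q n s := fun n s => by simp only [hq]; positivity
  have hqt : ∀ s, 0 ≤ s → Tendsto (fun n => q n s) atTop (𝓝 s) := by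
    intro s hs
    have hlim := tendsto_one_div_add_atTop_nhds_zero_nat (𝕜 := ℝ)
    have hlow : Tendsto (fun n : ℕ => s - 1 / ((n : ℝ) + 1)) atTop (𝓝 s) := by simpa using hlim.const_sub s
    refine tendsto_of_tendsto_of_tendsto_of_le_of_le hlow tendsto_const_nhds (fun n => ?_) (fun n => ?_)
    · simp only [hq]
      rw [le_div_iff₀ (by positivity), sub_mul, div_mul_cancel₀ _ (by positivity)]
      have := Nat.lt_floor_add_one (((n : ℝ) + 1) * s)
      linarith
    · simp only [hq]
      rw [div_le_iff₀ (by positivity), mul_comm s]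
      exact Nat.floor_le (by positivity)
  have hpiece : ∀ n, AEStronglyMeasurable (fun s => ∫ x, V s x * z (q n s) x * w (q n s) x) timeMeasure := by
    intro n
    set P : ℕ → Set ℝ := fun k => {s | ⌊((n : ℝ) + 1) * s⌋₊ = k} with hP
    have hPm : ∀ k, MeasurableSet (P k) := fun k =>
      (Nat.measurable_floor.comp (measurable_const.mul measurable_id)) (measurableSet_singleton k)
    have hU : ⋃ k, P k = univ := eq_univ_of_forall fun s => mem_iUnion.2 ⟨_, rfl⟩
    rw [← Measure.restrict_univ (μ := timeMeasure), ← hU, aestronglyMeasurable_iUnion_iff]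
    intro k
    refine ((aestronglyMeasurable_bilin_const hV (z (k / ((n : ℝ) + 1))) (w (k / ((n : ℝ) + 1)))).restrict).congr ?_
    filter_upwards [ae_restrict_mem (hPm k)] with s hs
    have : q n s = k / ((n : ℝ) + 1) := by simp only [hq]; rw [show ⌊((n : ℝ) + 1) * s⌋₊ = k from hs]
    rw [this]
  refine aestronglyMeasurable_of_tendsto_ae atTop hpiece ?_
  have hmem : ∀ᵐ s ∂timeMeasure, s ∈ Ici (0 : ℝ) := ae_restrict_mem measurableSet_Ici
  filter_upwards [hb, ae_aestronglyMeasurable_slice hV, hmem] with s hs hm hs0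
  have tq : Tendsto (fun n => q n s) atTop (𝓝[Ici 0] s) :=
    tendsto_nhdsWithin_iff.2 ⟨hqt s hs0, Eventually.of_forall fun n => hq0 n s⟩
  have tz := (hz s hs0).tendsto.comp tq
  have tw := (hw s hs0).tendsto.comp tq
  have hbd : ∀ n, ‖(∫ x, V s x * z (q n s) x * w (q n s) x) - ∫ x, V s x * z s x * w s x‖
      ≤ C * (‖z (q n s) - z s‖ * ‖w (q n s)‖) + C * (‖z s‖ * ‖w (q n s) - w s‖) := by
    intro n
    have e : (∫ x, V s x * z (q n s) x * w (q n s) x) - ∫ x, V s x * z s x * w s x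
        = (∫ x, V s x * (z (q n s) - z s : L2) x * w (q n s) x)
          + ∫ x, V s x * z s x * (w (q n s) - w s : L2) x := by
      rw [← integral_sub (integrable_bilin_of_bound hm hs _ _) (integrable_bilin_of_bound hm hs _ _),
        ← integral_add (integrable_bilin_of_bound hm hs _ _) (integrable_bilin_of_bound hm hs _ _)]
      refine integral_congr_ae ?_
      filter_upwards [Lp.coeFn_sub (z (q n s)) (z s), Lp.coeFn_sub (w (q n s)) (w s)] with x h1 h2
      simp only [h1, h2, Pi.sub_apply]
      ring
    rw [e]
    exact (norm_add_le _ _).trans (add_le_add (norm_bilin_le_of_bound hC hs _ _) (norm_bilin_le_of_bound hC hs _ _))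
  rw [tendsto_iff_norm_sub_tendsto_zero]
  refine squeeze_zero (fun _ => norm_nonneg _) hbd ?_
  have a1 := (tendsto_iff_norm_sub_tendsto_zero.1 tz).mul tw.norm
  have a2 := (tendsto_iff_norm_sub_tendsto_zero.1 tw).const_mul ‖z s‖
  simpa using (a1.const_mul C).add (a2.const_mul C)

/-- An `H¹`-bounded solution with a decaying potential. -/
structure Flow (σ C M : ℝ) (V : ℝ → ℝ → ℂ) (u : ℝ → L2) : Prop where
  two_lt : 2 < σ
  C_nonneg : 0 ≤ C
  M_nonneg : 0 ≤ M
  meas : AEStronglyMeasurable (Function.uncurry V) (timeMeasure.prod (volume : Measure ℝ))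
  bound : ∀ᵐ s ∂timeMeasure, ∀ᵐ x, ‖V s x‖ ≤ C * jap x ^ (-σ)
  sol : IsSolution V u
  h1 : ∀ t, 0 ≤ t → ∃ g : L2, HasWeakDeriv 1 (u t) g ∧ ‖u t‖ ≤ M ∧ ‖g‖ ≤ M

/-- The source term `V u`. -/
noncomputable def src (V : ℝ → ℝ → ℂ) (u : ℝ → L2) (s x : ℝ) : ℂ := V s x * u s x

/-- The inverse Fourier transform as an element of `L²`. -/
noncomputable def vec {ρ : ℝ → ℂ} (h : RapidDecay ρ) : L2 := h.memLp_fourierInv.toLp _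

theorem norm_vec_sub {ρ η : ℝ → ℂ} (h : RapidDecay ρ) (h' : RapidDecay η) :
    ‖vec h - vec h'‖ = n2 (fun ξ => ρ ξ - η ξ) := by
  rw [vec, vec, ← MemLp.toLp_sub, norm_toLp_eq_n2, ← (h.sub h').n2_fourierInv]
  congr 1
  ext x
  have e : (fun ξ => ρ ξ - η ξ) = fun ξ => ρ ξ + (-1) * η ξ := by ext; ring
  rw [e, fourierInv_add' h.integrable (h'.const_mul _).integrable, Pi.sub_apply, sub_eq_add_neg]
  congr 1
  rw [fourierInv_apply, fourierInv_apply, ← integral_neg]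
  congr 1; ext; ring

theorem norm_exp_sub_one_sub_le (x : ℝ) : ‖Complex.exp (Complex.I * x) - 1 - Complex.I * x‖ ≤ 2 * x ^ 2 := by
  rcases le_or_gt |x| 1 with h | h
  · have := Complex.norm_exp_sub_one_sub_id_le (x := Complex.I * x) (by simpa using h)
    simp only [norm_mul, Complex.norm_I, Complex.norm_real, one_mul, Real.norm_eq_abs, sq_abs] at this
    nlinarith [sq_nonneg x]
  · have h1 := Real.norm_exp_I_mul_ofReal_sub_one_le (x := x)
    have h2 := norm_sub_le (Complex.exp (Complex.I * x) - 1) (Complex.I * x)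
    simp only [norm_mul, Complex.norm_I, Complex.norm_real, one_mul, Real.norm_eq_abs] at h1 h2
    have : |x| ≤ x ^ 2 := by rw [← sq_abs]; nlinarith
    linarith

theorem freeSymbol_eq (t ξ : ℝ) : freeSymbol t ξ = Complex.exp (Complex.I * (4 * π ^ 2 * t * ξ ^ 2 : ℝ)) := by
  rw [freeSymbol]; congr 1; push_cast; ring

theorem freeSymbol_add (s t ξ : ℝ) : freeSymbol (s + t) ξ = freeSymbol s ξ * freeSymbol t ξ := by
  rw [freeSymbol, freeSymbol, freeSymbol, ← Complex.exp_add]; congr 1; push_cast; ring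

theorem norm_freeSymbol_sub_one_le (t ξ : ℝ) : ‖freeSymbol t ξ - 1‖ ≤ 4 * π ^ 2 * |t| * ξ ^ 2 := by
  rw [freeSymbol_eq]
  refine (Real.norm_exp_I_mul_ofReal_sub_one_le).trans_eq ?_
  rw [Real.norm_eq_abs, abs_mul, abs_mul, abs_of_nonneg (by positivity : (0 : ℝ) ≤ 4 * π ^ 2),
    abs_of_nonneg (sq_nonneg ξ)]

theorem norm_freeSymbol_sub_le (s t ξ : ℝ) : ‖freeSymbol s ξ - freeSymbol t ξ‖ ≤ 4 * π ^ 2 * |s - t| * ξ ^ 2 := by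
  have e : freeSymbol s ξ - freeSymbol t ξ = (freeSymbol (s - t) ξ - 1) * freeSymbol t ξ := by
    rw [sub_mul, ← freeSymbol_add, sub_add_cancel, one_mul]
  rw [e, norm_mul, norm_freeSymbol, mul_one]
  exact norm_freeSymbol_sub_one_le _ _

/-- `ξ² ρ`. -/
theorem RapidDecay.sq_mul {ρ : ℝ → ℂ} (h : RapidDecay ρ) : RapidDecay fun ξ => (ξ : ℂ) ^ 2 * ρ ξ := by
  have e : (fun ξ : ℝ => (ξ : ℂ) ^ 2 * ρ ξ) = fun ξ : ℝ => (ξ : ℂ) * (ξ * ρ ξ) := by ext; ring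
  rw [e]; exact h.id_mul.id_mul

theorem n2_freeSymbol_sub_le {ρ : ℝ → ℂ} (h : RapidDecay ρ) (s t : ℝ) :
    n2 (fun ξ => freeSymbol s ξ * ρ ξ - freeSymbol t ξ * ρ ξ)
      ≤ 4 * π ^ 2 * |s - t| * n2 (fun ξ => (ξ : ℂ) ^ 2 * ρ ξ) := by
  refine n2_le_of_ae_le h.sq_mul.memLp (by positivity) (Eventually.of_forall fun ξ => ?_)
  rw [← sub_mul, norm_mul, norm_mul, norm_pow, Complex.norm_real, Real.norm_eq_abs, sq_abs]
  have := norm_freeSymbol_sub_le s t ξ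
  calc _ ≤ (4 * π ^ 2 * |s - t| * ξ ^ 2) * ‖ρ ξ‖ := by gcongr
    _ = _ := by ring

theorem n2_freeSymbol_mul {ρ : ℝ → ℂ} (t : ℝ) : n2 (fun ξ => freeSymbol t ξ * ρ ξ) = n2 ρ := by
  unfold n2
  congr 1
  exact eLpNorm_congr_norm_ae (Eventually.of_forall fun ξ => by rw [norm_mul, norm_freeSymbol, one_mul])

theorem continuous_vec {ρ : ℝ → ℂ} (h : RapidDecay ρ) {c : ℝ → ℝ} (hc : Continuous c) :
    Continuous fun s => vec (h.freeSymbol_mul (c s)) := by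
  rw [continuous_iff_continuousAt]
  intro s
  rw [ContinuousAt, tendsto_iff_norm_sub_tendsto_zero]
  refine squeeze_zero (fun _ => norm_nonneg _) (fun r => ?_)
    (g := fun r => 4 * π ^ 2 * |c r - c s| * n2 (fun ξ => (ξ : ℂ) ^ 2 * ρ ξ)) ?_
  · rw [norm_vec_sub]; exact n2_freeSymbol_sub_le h _ _
  · have : Continuous fun r => 4 * π ^ 2 * |c r - c s| * n2 (fun ξ => (ξ : ℂ) ^ 2 * ρ ξ) := by fun_prop
    simpa using this.tendsto s

theorem eq_of_quadratic_bound {φ : ℝ → ℂ} {a b K : ℝ} (hab : a ≤ b)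
    (h : ∀ s s', a ≤ s → s ≤ s' → s' ≤ b → ‖φ s' - φ s‖ ≤ K * (s' - s) ^ 2) : φ b = φ a := by
  have step : ∀ n : ℕ, 0 < n → ‖φ b - φ a‖ ≤ K * (b - a) ^ 2 * (1 / n) := by
    intro n hn
    have hn' : (0 : ℝ) < n := by exact_mod_cast hn
    set d := (b - a) / n with hd
    have hd0 : 0 ≤ d := div_nonneg (by linarith) hn'.le
    have hk : ∀ k : ℕ, k ≤ n → ‖φ (a + k * d) - φ a‖ ≤ k * (K * d ^ 2) := by
      intro k
      induction k with
      | zero => simp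
      | succ k ih =>
        intro hk
        have h1 := ih (by omega)
        have hkn : ((k : ℝ) + 1) * d ≤ b - a := by
          have : ((k : ℝ) + 1) ≤ n := by exact_mod_cast hk
          calc _ ≤ n * d := by gcongr
            _ = b - a := by rw [hd]; field_simp
        have h2 := h (a + k * d) (a + (k + 1 : ℕ) * d) (by have : 0 ≤ (k : ℝ) * d := by positivity
                                                           linarith)
          (by push_cast; linarith) (by push_cast; linarith)
        rw [show a + ((k + 1 : ℕ) : ℝ) * d - (a + k * d) = d by push_cast; ring] at h2
        calc _ = ‖(φ (a + (k + 1 : ℕ) * d) - φ (a + k * d)) + (φ (a + k * d) - φ a)‖ := by congr 1; ring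
          _ ≤ K * d ^ 2 + k * (K * d ^ 2) := (norm_add_le _ _).trans (add_le_add h2 h1)
          _ = _ := by push_cast; ring
    have := hk n le_rfl
    rw [show a + n * d = b by rw [hd]; field_simp; ring] at this
    refine this.trans_eq ?_
    rw [hd]; field_simp
  have hlim : Tendsto (fun n : ℕ => K * (b - a) ^ 2 * (1 / (n : ℝ))) atTop (𝓝 0) := by
    simpa using (tendsto_one_div_atTop_nhds_zero_nat (𝕜 := ℝ)).const_mul (K * (b - a) ^ 2)
  have := ge_of_tendsto hlim ((eventually_gt_atTop 0).mono fun n hn => step n hn)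
  exact sub_eq_zero.1 (norm_le_zero_iff.1 this)

namespace Flow
variable {σ C M : ℝ} {V : ℝ → ℝ → ℂ} {u : ℝ → L2}

theorem norm_le (hf : Flow σ C M V u) {t : ℝ} (ht : 0 ≤ t) : ‖u t‖ ≤ M := by
  obtain ⟨g, -, h, -⟩ := hf.h1 t ht; exact h

theorem bound' (hf : Flow σ C M V u) : ∀ᵐ s ∂timeMeasure, ∀ᵐ x, ‖V s x‖ ≤ C := by
  filter_upwards [hf.bound] with s hs
  filter_upwards [hs] with x hx
  refine hx.trans (mul_le_of_le_one_right hf.C_nonneg ?_)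
  exact Real.rpow_le_one_of_one_le_of_nonpos (one_le_jap x) (by linarith [hf.two_lt])

theorem slice (hf : Flow σ C M V u) : ∀ᵐ s ∂timeMeasure, AEStronglyMeasurable (V s) (volume : Measure ℝ) :=
  ae_aestronglyMeasurable_slice hf.meas

theorem memLp_src (hf : Flow σ C M V u) : ∀ᵐ s ∂timeMeasure, MemLp (src V u s) 2 volume ∧
    n2 (src V u s) ≤ C * M := by
  have hmem : ∀ᵐ s ∂timeMeasure, s ∈ Ici (0 : ℝ) := ae_restrict_mem measurableSet_Ici
  filter_upwards [hf.slice, hf.bound', hmem] with s h1 h2 h3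
  refine ⟨memLp_bdd_mul h1 h2 (Lp.memLp _), (n2_bdd_mul_le hf.C_nonneg h2 (Lp.memLp _)).trans ?_⟩
  rw [n2_coe]
  exact mul_le_mul_of_nonneg_left (hf.norm_le h3) hf.C_nonneg

theorem norm_pair_src_le (hf : Flow σ C M V u) : ∀ᵐ s ∂timeMeasure, ∀ ρ, RapidDecay ρ →
    ‖pair (src V u s) ρ‖ ≤ C * M * n2 ρ := by
  filter_upwards [hf.memLp_src] with s hs ρ hρ
  exact (norm_pair_le hs.1 hρ).trans (mul_le_mul_of_nonneg_right hs.2 (n2_nonneg _))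

theorem measurable_pair_src (hf : Flow σ C M V u) {ρ : ℝ → ℝ → ℂ} (h : ∀ s, RapidDecay (ρ s))
    (hc : ContinuousOn (fun s => vec (h s)) (Ici 0)) :
    AEStronglyMeasurable (fun s => pair (src V u s) (ρ s)) timeMeasure := by
  refine (aestronglyMeasurable_bilin hf.meas hf.C_nonneg hf.bound' hf.sol.1 hc).congr
    (Eventually.of_forall fun s => ?_)
  exact integral_congr_ae ((h s).memLp_fourierInv.coeFn_toLp.mono fun x hx => by
    simp only [vec, src, hx])

theorem measurable_pair_src_free (hf : Flow σ C M V u) {ρ : ℝ → ℂ} (h : RapidDecay ρ) {c : ℝ → ℝ}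
    (hc : Continuous c) :
    AEStronglyMeasurable (fun s => pair (src V u s) (fun ξ => freeSymbol (c s) ξ * ρ ξ)) timeMeasure :=
  hf.measurable_pair_src (fun s => h.freeSymbol_mul (c s)) (continuous_vec h hc).continuousOn

theorem restrict_le {a b : ℝ} (ha : 0 ≤ a) (hb : 0 ≤ b) :
    (volume : Measure ℝ).restrict (uIoc a b) ≤ timeMeasure :=
  Measure.restrict_mono (fun x hx => by
    rw [mem_uIoc] at hx
    rw [mem_Ici]
    rcases hx with h | h <;> linarith [h.1]) le_rfl

theorem intervalIntegrable_of_bdd {f : ℝ → ℂ} (hm : AEStronglyMeasurable f timeMeasure) {K : ℝ}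
    (hK : ∀ᵐ s ∂timeMeasure, ‖f s‖ ≤ K) {a b : ℝ} (ha : 0 ≤ a) (hb : 0 ≤ b) :
    IntervalIntegrable f volume a b := by
  rw [intervalIntegrable_iff]
  have hle := restrict_le ha hb
  have : IsFiniteMeasure ((volume : Measure ℝ).restrict (uIoc a b)) := ⟨by simp [uIoc]⟩
  exact Integrable.of_bound (hm.mono_measure hle) K (ae_mono hle hK)

theorem ae_uIoc {P : ℝ → Prop} {a b : ℝ} (ha : 0 ≤ a) (hb : 0 ≤ b) (h : ∀ᵐ s ∂timeMeasure, P s) :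
    ∀ᵐ s, s ∈ uIoc a b → P s :=
  (ae_restrict_iff' measurableSet_uIoc).1 (ae_mono (restrict_le ha hb) h)

theorem continuousOn_pair (hf : Flow σ C M V u) {ρ : ℝ → ℂ} (h : RapidDecay ρ) :
    ContinuousOn (fun s => pair (u s) ρ) (Ici 0) := by
  have e : (fun s => pair (u s) ρ) = fun s => ∫ x, (u s) x * (vec h) x := funext fun s => pair_eq_bilin _ h
  rw [e]
  exact continuous_bilin.comp_continuousOn (hf.sol.1.prodMk continuousOn_const)

theorem aesm_of_continuousOn {f : ℝ → ℂ} (h : ContinuousOn f (Ici 0)) : AEStronglyMeasurable f timeMeasure :=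
  h.aestronglyMeasurable measurableSet_Ici

theorem ae_nonneg : ∀ᵐ s ∂timeMeasure, (0 : ℝ) ≤ s := ae_restrict_mem measurableSet_Ici

/-- The weak formulation tested against inverse Fourier transforms. -/
theorem weak_form_zero (hf : Flow σ C M V u) {ρ : ℝ → ℂ} (h : RapidDecay ρ) {t : ℝ} (ht : 0 ≤ t) :
    pair (u t) ρ - pair (u 0) ρ = Complex.I * ∫ s in (0 : ℝ)..t,
      (4 * π ^ 2 * pair (u s) (fun ξ => (ξ : ℂ) ^ 2 * ρ ξ) + pair (src V u s) ρ) := by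
  set φ := 𝓕⁻ ρ with hφ
  set ρ1 : ℝ → ℂ := fun ξ => 2 * π * Complex.I * ((ξ : ℂ) * ρ ξ) with hρ1
  have hr1 : RapidDecay ρ1 := h.id_mul.const_mul _
  have d1 : deriv φ = 𝓕⁻ ρ1 := h.deriv_fourierInv
  have d2 : deriv (deriv φ) = 𝓕⁻ (fun ξ : ℝ => 2 * π * Complex.I * ((ξ : ℂ) * ρ1 ξ)) := by
    rw [d1]; exact hr1.deriv_fourierInv
  have hr2 : RapidDecay (fun ξ : ℝ => 2 * π * Complex.I * ((ξ : ℂ) * ρ1 ξ)) := hr1.id_mul.const_mul _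
  have m0 : MemLp φ 2 volume := h.memLp_fourierInv
  have m1 : MemLp (deriv φ) 2 volume := by rw [d1]; exact hr1.memLp_fourierInv
  have m2 : MemLp (deriv (deriv φ)) 2 volume := by rw [d2]; exact hr2.memLp_fourierInv
  obtain ⟨ψ, p1, p2, t0, -, t2⟩ := exists_test_approx h.contDiff_fourierInv m0 m1 m2
  have hψ : ∀ n, IsTest (ψ n) := fun n => ⟨p1 n, p2 n⟩
  have hL2 : ∀ {g : ℝ → ℂ}, (hg : MemLp g 2 volume) → ∀ z : L2,
      ∫ x, z x * (hg.toLp g : L2) x = ∫ x, z x * g x := fun hg z =>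
    integral_congr_ae (hg.coeFn_toLp.mono fun x hx => by simp only [hx])
  have lim1 : Tendsto (fun n => Complex.I * ((∫ x, u t x * ψ n x) - ∫ x, u 0 x * ψ n x)) atTop
      (𝓝 (Complex.I * (pair (u t) ρ - pair (u 0) ρ))) :=
    ((tendsto_integral_mul_of_n2 (Lp.memLp _) (fun n => (hψ n).memLp) m0 t0).sub
      (tendsto_integral_mul_of_n2 (Lp.memLp _) (fun n => (hψ n).memLp) m0 t0)).const_mul _
  have hle := restrict_le le_rfl ht
  have lim2 : Tendsto (fun n => ∫ s in (0 : ℝ)..t, ((∫ x, u s x * iteratedDeriv 2 (ψ n) x)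
      - ∫ x, V s x * u s x * ψ n x)) atTop
      (𝓝 (∫ s in (0 : ℝ)..t, ((∫ x, u s x * deriv (deriv φ) x) - pair (src V u s) ρ))) := by
    refine intervalIntegral.tendsto_integral_filter_of_dominated_convergence
      (fun _ => M * (n2 (deriv (deriv φ)) + 1) + C * M * (n2 φ + 1)) ?_ ?_ (by simp) ?_
    · refine Eventually.of_forall fun n => (AEStronglyMeasurable.mono_measure ?_ hle)
      refine AEStronglyMeasurable.sub (aesm_of_continuousOn ?_) ?_
      · have e : (fun s => ∫ x, u s x * iteratedDeriv 2 (ψ n) x)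
            = fun s => ∫ x, u s x * ((hψ n).deriv.deriv.memLp.toLp _ : L2) x := by
          ext s; rw [hL2, iteratedDeriv_two']
        rw [e]
        exact continuous_bilin.comp_continuousOn (hf.sol.1.prodMk continuousOn_const)
      · refine (aestronglyMeasurable_bilin hf.meas hf.C_nonneg hf.bound' hf.sol.1
          (w := fun _ => ((hψ n).memLp.toLp _ : L2)) continuousOn_const).congr (Eventually.of_forall fun s => ?_)
        exact integral_congr_ae ((hψ n).memLp.coeFn_toLp.mono fun x hx => by simp only [hx])
    · filter_upwards [t0.eventually (gt_mem_nhds one_pos), t2.eventually (gt_mem_nhds one_pos)] with n hn0 hn2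
      have hb0 : n2 (ψ n) ≤ n2 φ + 1 := by
        have : n2 (fun x => φ x + (ψ n x - φ x)) ≤ n2 φ + n2 (fun x => ψ n x - φ x) :=
          n2_add_le m0 ((hψ n).memLp.sub m0)
        simp only [add_sub_cancel] at this
        exact this.trans (by linarith)
      have hb2 : n2 (deriv (deriv (ψ n))) ≤ n2 (deriv (deriv φ)) + 1 := by
        have : n2 (fun x => deriv (deriv φ) x + (deriv (deriv (ψ n)) x - deriv (deriv φ) x)) ≤
            n2 (deriv (deriv φ)) + n2 (fun x => deriv (deriv (ψ n)) x - deriv (deriv φ) x) :=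
          n2_add_le m2 ((hψ n).deriv.deriv.memLp.sub m2)
        simp only [add_sub_cancel] at this
        exact this.trans (by linarith)
      have : ∀ᵐ s ∂timeMeasure, ‖(∫ x, u s x * iteratedDeriv 2 (ψ n) x) - ∫ x, V s x * u s x * ψ n x‖
          ≤ M * (n2 (deriv (deriv φ)) + 1) + C * M * (n2 φ + 1) := by
        filter_upwards [hf.memLp_src, ae_nonneg] with s hs hs0
        refine (norm_sub_le _ _).trans (add_le_add ?_ ?_)
        · rw [iteratedDeriv_two']
          refine (norm_integral_mul_le (Lp.memLp _) (hψ n).deriv.deriv.memLp).trans ?_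
          rw [n2_coe]
          exact mul_le_mul (hf.norm_le hs0) hb2 (n2_nonneg _) hf.M_nonneg
        · exact (norm_integral_mul_le hs.1 (hψ n).memLp).trans
            (mul_le_mul hs.2 hb0 (n2_nonneg _) (mul_nonneg hf.C_nonneg hf.M_nonneg))
      exact ae_uIoc le_rfl ht this
    · have : ∀ᵐ s ∂timeMeasure, Tendsto (fun n => (∫ x, u s x * iteratedDeriv 2 (ψ n) x)
          - ∫ x, V s x * u s x * ψ n x) atTop (𝓝 ((∫ x, u s x * deriv (deriv φ) x) - pair (src V u s) ρ)) := by
        filter_upwards [hf.memLp_src] with s hs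
        refine Tendsto.sub ?_ (tendsto_integral_mul_of_n2 hs.1 (fun n => (hψ n).memLp) m0 t0)
        simp only [iteratedDeriv_two']
        exact tendsto_integral_mul_of_n2 (Lp.memLp _) (fun n => (hψ n).deriv.deriv.memLp) m2 t2
      exact ae_uIoc le_rfl ht this
  have key := tendsto_nhds_unique lim1 (lim2.congr fun n => (hf.sol.2 (ψ n) (p1 n) (p2 n) t ht).symm)
  have e2 : ∀ s, (∫ x, u s x * deriv (deriv φ) x) = -(4 * π ^ 2 * pair (u s) (fun ξ => (ξ : ℂ) ^ 2 * ρ ξ)) := by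
    intro s
    rw [d2]
    have e : (fun ξ : ℝ => 2 * π * Complex.I * ((ξ : ℂ) * ρ1 ξ))
        = fun ξ : ℝ => (-(4 * π ^ 2) : ℂ) * ((ξ : ℂ) ^ 2 * ρ ξ) := by
      ext ξ; simp only [hρ1]; ring_nf; simp only [Complex.I_sq]; ring
    rw [e]
    exact (pair_const_mul _ _ _).trans (by ring)
  have e3 : (∫ s in (0 : ℝ)..t, ((∫ x, u s x * deriv (deriv φ) x) - pair (src V u s) ρ))
      = -∫ s in (0 : ℝ)..t, (4 * π ^ 2 * pair (u s) (fun ξ => (ξ : ℂ) ^ 2 * ρ ξ) + pair (src V u s) ρ) := by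
    rw [← intervalIntegral.integral_neg]
    congr 1; ext s; rw [e2]; ring
  rw [e3] at key
  have := congrArg (fun z => -Complex.I * z) key
  simp only [← mul_assoc, neg_mul, Complex.I_mul_I, neg_neg, one_mul, mul_neg] at this
  exact this

end Flow

namespace Flow
variable {σ C M : ℝ} {V : ℝ → ℝ → ℂ} {u : ℝ → L2}

theorem norm_pair_le (hf : Flow σ C M V u) {ρ : ℝ → ℂ} (h : RapidDecay ρ) {s : ℝ} (hs : 0 ≤ s) :
    ‖pair (u s) ρ‖ ≤ M * n2 ρ :=
  (norm_pair_le' _ h).trans (mul_le_mul_of_nonneg_right (hf.norm_le hs) (n2_nonneg _))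

theorem intervalIntegrable_pair_src (hf : Flow σ C M V u) {ρ : ℝ → ℂ} (h : RapidDecay ρ) {c : ℝ → ℝ}
    (hc : Continuous c) {a b : ℝ} (ha : 0 ≤ a) (hb : 0 ≤ b) :
    IntervalIntegrable (fun s => pair (src V u s) (fun ξ => freeSymbol (c s) ξ * ρ ξ)) volume a b := by
  refine intervalIntegrable_of_bdd (hf.measurable_pair_src_free h hc) (K := C * M * n2 ρ) ?_ ha hb
  filter_upwards [hf.norm_pair_src_le] with s hs
  refine (hs _ (h.freeSymbol_mul _)).trans_eq ?_
  rw [n2_freeSymbol_mul]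

theorem intervalIntegrable_pair_src_const (hf : Flow σ C M V u) {ρ : ℝ → ℂ} (h : RapidDecay ρ)
    {a b : ℝ} (ha : 0 ≤ a) (hb : 0 ≤ b) :
    IntervalIntegrable (fun s => pair (src V u s) ρ) volume a b := by
  simpa [freeSymbol_zero] using hf.intervalIntegrable_pair_src h (c := fun _ => 0) continuous_const ha hb

theorem intervalIntegrable_pair (hf : Flow σ C M V u) {ρ : ℝ → ℂ} (h : RapidDecay ρ)
    {a b : ℝ} (ha : 0 ≤ a) (hb : 0 ≤ b) :
    IntervalIntegrable (fun s => pair (u s) ρ) volume a b := by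
  refine intervalIntegrable_of_bdd (aesm_of_continuousOn (hf.continuousOn_pair h)) (K := M * n2 ρ) ?_ ha hb
  filter_upwards [ae_nonneg] with s hs
  exact hf.norm_pair_le h hs

theorem weak_form (hf : Flow σ C M V u) {ρ : ℝ → ℂ} (h : RapidDecay ρ) {a b : ℝ} (ha : 0 ≤ a) (hb : 0 ≤ b) :
    pair (u b) ρ - pair (u a) ρ = Complex.I * ∫ s in a..b,
      (4 * π ^ 2 * pair (u s) (fun ξ => (ξ : ℂ) ^ 2 * ρ ξ) + pair (src V u s) ρ) := by
  have hi : ∀ {a b : ℝ}, 0 ≤ a → 0 ≤ b → IntervalIntegrable (fun s =>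
      4 * π ^ 2 * pair (u s) (fun ξ => (ξ : ℂ) ^ 2 * ρ ξ) + pair (src V u s) ρ) volume a b := fun ha hb =>
    ((hf.intervalIntegrable_pair h.sq_mul ha hb).const_mul _).add (hf.intervalIntegrable_pair_src_const h ha hb)
  rw [← intervalIntegral.integral_interval_sub_left (hi le_rfl hb) (hi le_rfl ha), mul_sub,
    ← hf.weak_form_zero h hb, ← hf.weak_form_zero h ha]
  ring

theorem norm_pair_sub_le (hf : Flow σ C M V u) {ρ : ℝ → ℂ} (h : RapidDecay ρ) {a b : ℝ} (ha : 0 ≤ a) (hb : 0 ≤ b) :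
    ‖pair (u b) ρ - pair (u a) ρ‖ ≤ (4 * π ^ 2 * (M * n2 (fun ξ : ℝ => (ξ : ℂ) ^ 2 * ρ ξ)) + C * M * n2 ρ) * |b - a| := by
  rw [hf.weak_form h ha hb, norm_mul, Complex.norm_I, one_mul]
  refine intervalIntegral.norm_integral_le_of_norm_le_const_ae ?_
  refine ae_uIoc ha hb ?_
  filter_upwards [hf.norm_pair_src_le, ae_nonneg] with s hs hs0
  refine (norm_add_le _ _).trans (add_le_add ?_ (hs _ h))
  rw [norm_mul]
  have : ‖(4 * π ^ 2 : ℂ)‖ = 4 * π ^ 2 := by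
    simp [abs_of_pos Real.pi_pos]
  rw [this]
  gcongr
  exact hf.norm_pair_le h.sq_mul hs0


/-- Duhamel's formula, tested against a freely evolved symbol. -/
theorem duhamel (hf : Flow σ C M V u) {ρ : ℝ → ℂ} (h : RapidDecay ρ) (T : ℝ) {a b : ℝ} (ha : 0 ≤ a) (hab : a ≤ b) :
    pair (u b) (fun ξ => freeSymbol (T - b) ξ * ρ ξ) - pair (u a) (fun ξ => freeSymbol (T - a) ξ * ρ ξ)
      = Complex.I * ∫ s in a..b, pair (src V u s) (fun ξ => freeSymbol (T - s) ξ * ρ ξ) := by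
  have hct : Continuous fun s : ℝ => T - s := by fun_prop
  set ρ2 : ℝ → ℂ := fun ξ => (ξ : ℂ) ^ 2 * ρ ξ with hρ2
  have h2 : RapidDecay ρ2 := h.sq_mul
  set ρ4 : ℝ → ℂ := fun ξ => (ξ : ℂ) ^ 2 * ρ2 ξ with hρ4
  have h4 : RapidDecay ρ4 := h2.sq_mul
  have hII : ∀ {s s' : ℝ}, 0 ≤ s → 0 ≤ s' → IntervalIntegrable
      (fun r => pair (src V u r) (fun ξ => freeSymbol (T - r) ξ * ρ ξ)) volume s s' := fun hs hs' =>
    hf.intervalIntegrable_pair_src h hct hs hs'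
  set φ : ℝ → ℂ := fun s => pair (u s) (fun ξ => freeSymbol (T - s) ξ * ρ ξ)
    - Complex.I * ∫ r in a..s, pair (src V u r) (fun ξ => freeSymbol (T - r) ξ * ρ ξ) with hφ
  set k : ℝ := 4 * π ^ 2 with hk
  have hk0 : 0 ≤ k := by positivity
  have hkc : ‖(4 * π ^ 2 : ℂ)‖ = k := by simp [hk, abs_of_pos Real.pi_pos]
  set D := k * (M * n2 ρ4) + C * M * n2 ρ2 with hD
  set E := M * (2 * k ^ 2 * n2 ρ4) with hE
  have hquad : ∀ s s', a ≤ s → s ≤ s' → s' ≤ b →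
      ‖φ s' - φ s‖ ≤ (k * D + C * M * (k * n2 ρ2) + E) * (s' - s) ^ 2 := by
    intro s s' hs hss' hs'
    have hs0 : 0 ≤ s := ha.trans hs
    have hs0' : 0 ≤ s' := hs0.trans hss'
    set d := s' - s with hd
    have hd0 : 0 ≤ d := by linarith
    set e : ℝ → ℂ := freeSymbol (T - s') with he
    have hη : RapidDecay fun ξ => e ξ * ρ ξ := h.freeSymbol_mul _
    have hη2 : RapidDecay fun ξ => e ξ * ρ2 ξ := h2.freeSymbol_mul _
    have hη4 : RapidDecay fun ξ => e ξ * ρ4 ξ := h4.freeSymbol_mul _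
    have hcomm : (fun ξ : ℝ => (ξ : ℂ) ^ 2 * (e ξ * ρ ξ)) = fun ξ => e ξ * ρ2 ξ := by
      ext ξ; simp only [hρ2]; ring
    have hcomm2 : (fun ξ : ℝ => (ξ : ℂ) ^ 2 * (e ξ * ρ2 ξ)) = fun ξ => e ξ * ρ4 ξ := by
      ext ξ; simp only [hρ4]; ring
    have hw := hf.weak_form hη hs0 hs0'
    rw [hcomm] at hw
    have i1 := hf.intervalIntegrable_pair hη2 hs0 hs0'
    have i2 := hf.intervalIntegrable_pair_src_const hη hs0 hs0'
    have i3 := hII hs0 hs0'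
    have i0 : IntervalIntegrable (fun _ : ℝ => pair (u s) fun ξ => e ξ * ρ2 ξ) volume s s' := intervalIntegrable_const
    set R1 : ℂ := ∫ r in s..s', (4 * π ^ 2 * (pair (u r) (fun ξ => e ξ * ρ2 ξ) - pair (u s) fun ξ => e ξ * ρ2 ξ))
      with hR1
    set R2 : ℂ := ∫ r in s..s', (pair (src V u r) (fun ξ => e ξ * ρ ξ)
      - pair (src V u r) (fun ξ => freeSymbol (T - r) ξ * ρ ξ)) with hR2
    set κ : ℝ → ℂ := fun ξ => (e ξ * ρ ξ - freeSymbol (T - s) ξ * ρ ξ) + (Complex.I * (k * d : ℝ)) * (e ξ * ρ2 ξ) with hκ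
    have hκd : RapidDecay κ := (hη.sub (h.freeSymbol_mul _)).add (hη2.const_mul _)
    have hsplit : φ s' - φ s = Complex.I * R1 + Complex.I * R2 + pair (u s) κ := by
      have e1 : φ s' - φ s = (pair (u s') (fun ξ => e ξ * ρ ξ) - pair (u s) (fun ξ => e ξ * ρ ξ))
          + (pair (u s) (fun ξ => e ξ * ρ ξ) - pair (u s) (fun ξ => freeSymbol (T - s) ξ * ρ ξ))
          - Complex.I * ∫ r in s..s', pair (src V u r) (fun ξ => freeSymbol (T - r) ξ * ρ ξ) := by
        rw [← intervalIntegral.integral_interval_sub_left (hII ha hs0') (hII ha hs0)]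
        simp only [hφ, he]; ring
      have e2 : pair (u s) κ = pair (u s) (fun ξ => e ξ * ρ ξ) - pair (u s) (fun ξ => freeSymbol (T - s) ξ * ρ ξ)
          + Complex.I * (k * d : ℝ) * pair (u s) (fun ξ => e ξ * ρ2 ξ) := by
        have e3 : κ = fun ξ => (e ξ * ρ ξ + (-1) * (freeSymbol (T - s) ξ * ρ ξ))
            + (Complex.I * (k * d : ℝ)) * (e ξ * ρ2 ξ) := by ext ξ; simp only [hκ]; ring
        rw [e3, pair_add (Lp.memLp _) (hη.add ((h.freeSymbol_mul _).const_mul _)) (hη2.const_mul _),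
          pair_add (Lp.memLp _) hη ((h.freeSymbol_mul _).const_mul _), pair_const_mul, pair_const_mul]
        ring
      rw [e1, e2, hw, intervalIntegral.integral_add (i1.const_mul _) i2, hR1, hR2,
        intervalIntegral.integral_sub i2 i3, intervalIntegral.integral_const_mul,
        intervalIntegral.integral_const_mul, intervalIntegral.integral_sub i1 i0,
        intervalIntegral.integral_const, Complex.real_smul, ← hd]
      push_cast [hk]
      ring
    have b1 : ‖R1‖ ≤ k * (D * d) * d := by
      have : ‖R1‖ ≤ k * (D * d) * |s' - s| := by
        refine intervalIntegral.norm_integral_le_of_norm_le_const fun r hr => ?_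
        rw [uIoc_of_le hss'] at hr
        rw [norm_mul, hkc]
        refine mul_le_mul_of_nonneg_left ?_ hk0
        have := hf.norm_pair_sub_le hη2 hs0 (hs0.trans hr.1.le)
        rw [hcomm2, n2_freeSymbol_mul, n2_freeSymbol_mul, abs_of_nonneg (by linarith [hr.1])] at this
        refine this.trans ?_
        have hD0 : 0 ≤ D := by
          have := n2_nonneg ρ4; have := n2_nonneg ρ2; have := hf.M_nonneg; have := hf.C_nonneg
          positivity
        exact mul_le_mul_of_nonneg_left (by linarith [hr.2]) hD0
      rwa [abs_of_nonneg hd0] at this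
    have b2 : ‖R2‖ ≤ (C * M * (k * n2 ρ2) * d) * d := by
      have : ‖R2‖ ≤ (C * M * (k * n2 ρ2) * d) * |s' - s| := by
        refine intervalIntegral.norm_integral_le_of_norm_le_const_ae ?_
        have : ∀ᵐ r, r ∈ uIoc s s' → MemLp (src V u r) 2 volume ∧ n2 (src V u r) ≤ C * M :=
          ae_uIoc hs0 hs0' hf.memLp_src
        filter_upwards [this] with r hr hmem
        obtain ⟨m, hb⟩ := hr hmem
        rw [uIoc_of_le hss'] at hmem
        have e1 : pair (src V u r) (fun ξ => e ξ * ρ ξ) - pair (src V u r) (fun ξ => freeSymbol (T - r) ξ * ρ ξ)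
            = pair (src V u r) (fun ξ => e ξ * ρ ξ - freeSymbol (T - r) ξ * ρ ξ) := by
          have e3 : (fun ξ => e ξ * ρ ξ - freeSymbol (T - r) ξ * ρ ξ)
            = fun ξ => e ξ * ρ ξ + (-1) * (freeSymbol (T - r) ξ * ρ ξ) := by ext ξ; ring
          rw [e3, pair_add m hη ((h.freeSymbol_mul _).const_mul _), pair_const_mul]
          ring
        rw [e1]
        refine (WeaklyBound.norm_pair_le m (hη.sub (h.freeSymbol_mul _))).trans ?_
        have h3 := n2_freeSymbol_sub_le h (T - s') (T - r)
        rw [show T - s' - (T - r) = -(s' - r) by ring, abs_neg, abs_of_nonneg (by linarith [hmem.2])] at h3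
        have h5 := n2_nonneg ρ2
        have h6 := mul_nonneg hf.C_nonneg hf.M_nonneg
        calc _ ≤ C * M * (k * (s' - r) * n2 ρ2) := mul_le_mul hb h3 (n2_nonneg _) h6
          _ ≤ C * M * (k * d * n2 ρ2) := by gcongr; linarith [hmem.1]
          _ = _ := by ring
      rwa [abs_of_nonneg hd0] at this
    have b3 : ‖pair (u s) κ‖ ≤ E * d ^ 2 := by
      refine (hf.norm_pair_le hκd hs0).trans ?_
      have : n2 κ ≤ 2 * k ^ 2 * d ^ 2 * n2 ρ4 := by
        refine n2_le_of_ae_le h4.memLp (by positivity) (Eventually.of_forall fun ξ => ?_)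
        have e1 : κ ξ = -(e ξ * (Complex.exp (Complex.I * (k * d * ξ ^ 2 : ℝ)) - 1 - Complex.I * (k * d * ξ ^ 2 : ℝ)) * ρ ξ) := by
          have : freeSymbol (T - s) ξ = e ξ * freeSymbol d ξ := by
            rw [he, ← freeSymbol_add]; congr 1; rw [hd]; ring
          simp only [hκ, this, hρ2, freeSymbol_eq d ξ, hk]
          push_cast; ring
        have e2 : ‖e ξ‖ = 1 := norm_freeSymbol _ _
        have e3 := norm_exp_sub_one_sub_le (k * d * ξ ^ 2)
        have e4 : ‖ρ4 ξ‖ = ξ ^ 4 * ‖ρ ξ‖ := by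
          simp only [hρ4, hρ2, norm_mul, norm_pow, Complex.norm_real, Real.norm_eq_abs, sq_abs]; ring
        rw [e1, norm_neg, norm_mul, norm_mul, e2, one_mul, e4]
        calc _ ≤ 2 * (k * d * ξ ^ 2) ^ 2 * ‖ρ ξ‖ := by gcongr
          _ = _ := by ring
      calc M * n2 κ ≤ M * (2 * k ^ 2 * d ^ 2 * n2 ρ4) := mul_le_mul_of_nonneg_left this hf.M_nonneg
        _ = _ := by rw [hE]; ring
    rw [hsplit]
    refine (norm_add_le _ _).trans ((add_le_add_left (norm_add_le _ _) _).trans ?_)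
    rw [norm_mul, norm_mul, Complex.norm_I, one_mul, one_mul]
    calc _ ≤ k * (D * d) * d + (C * M * (k * n2 ρ2) * d) * d + E * d ^ 2 := by linarith
      _ = _ := by ring
  have := eq_of_quadratic_bound hab hquad
  simp only [hφ, intervalIntegral.integral_same, mul_zero, sub_zero] at this
  rw [← this]; ring

end Flow

/-- The free pull-back of `u` converges weakly to `up`. -/
def Scatters (u : ℝ → L2) (up : L2) : Prop := ∀ f : SchwartzMap ℝ ℂ,
  Tendsto (fun t => ∫ x, (freeProp (-t) (u t)) x * f x) atTop (𝓝 (∫ x, up x * f x))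

/-- The source term, extended by zero to negative times. -/
noncomputable def srcE (V : ℝ → ℝ → ℂ) (u : ℝ → L2) (s x : ℝ) : ℂ := if 0 ≤ s then src V u s x else 0

theorem srcE_of_nonneg {V : ℝ → ℝ → ℂ} {u : ℝ → L2} {s : ℝ} (hs : 0 ≤ s) : srcE V u s = src V u s := by
  ext x; simp [srcE, hs]

theorem srcE_of_neg {V : ℝ → ℝ → ℂ} {u : ℝ → L2} {s : ℝ} (hs : s < 0) : srcE V u s = fun _ => 0 := by
  ext x; simp [srcE, not_le.2 hs]

theorem pair_zero_left (ρ : ℝ → ℂ) : pair (fun _ => 0) ρ = 0 := by simp [pair]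

theorem quasi_affine {τ : ℝ} (hτ : τ = 1 ∨ τ = -1) (t : ℝ) :
    Measure.QuasiMeasurePreserving (fun s : ℝ => t + τ * s) volume volume := by
  rcases hτ with rfl | rfl
  · simpa using (measurePreserving_add_left volume t).quasiMeasurePreserving
  · have := (Measure.measurePreserving_sub_left volume t).quasiMeasurePreserving
    simpa [sub_eq_add_neg] using this

theorem psym_eq (τ s α ς : ℝ) (N : ℕ) (g : ℝ → ℂ) :
    psym τ s α ς N g = fun ξ => freeSymbol (-τ * s) ξ * (cutPoly α ς (.X ^ N) ξ * 𝓕 g ξ) := rfl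

theorem exists_tendsto_of_approx {P : ℝ → ℂ} (h : ∀ ε > 0, ∃ (Q : ℝ → ℂ) (l : ℂ), Tendsto Q atTop (𝓝 l) ∧
    ∀ᶠ t in atTop, ‖P t - Q t‖ ≤ ε) : ∃ l, Tendsto P atTop (𝓝 l) := by
  refine cauchySeq_tendsto_of_complete (Metric.cauchySeq_iff.2 fun ε hε => ?_)
  obtain ⟨Q, l, hQ, hP⟩ := h (ε / 5) (by positivity)
  obtain ⟨T, hT⟩ := eventually_atTop.1 (hP.and (Metric.tendsto_nhds.1 hQ (ε / 5) (by positivity)))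
  refine ⟨T, fun m hm n hn => ?_⟩
  obtain ⟨a1, a2⟩ := hT m hm
  obtain ⟨b1, b2⟩ := hT n hn
  rw [← dist_eq_norm] at a1 b1
  calc dist (P m) (P n) ≤ dist (P m) (Q m) + dist (Q m) l + dist l (Q n) + dist (Q n) (P n) := by
        have h1 := dist_triangle4 (P m) (Q m) l (Q n)
        have h2 := dist_triangle (P m) (Q n) (P n)
        linarith
    _ < ε := by linarith [dist_comm l (Q n), dist_comm (Q n) (P n)]

theorem tendsto_n2_lowCut {ρ : ℝ → ℂ} (h : RapidDecay ρ) {N : ℕ} (hN : N ≠ 0) :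
    Tendsto (fun n : ℕ => n2 fun ξ => lowCut (1 / ((n : ℝ) + 1)) N ξ * ρ ξ) atTop (𝓝 0) := by
  have hα : ∀ n : ℕ, 0 < 1 / ((n : ℝ) + 1) := fun n => by positivity
  refine tendsto_n2_zero (G := fun ξ => N * ‖ρ ξ‖) (h.memLp.norm.const_mul _)
    (fun n => (h.lowCut_mul (hα n) hN).memLp.1) (fun n => Eventually.of_forall fun ξ => ?_) ?_
  · rw [norm_mul]; gcongr; exact norm_lowCut_le_nat (hα n) hN ξ
  · filter_upwards [compl_mem_ae_iff.2 (measure_singleton (0 : ℝ))] with ξ hξ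
    have hξ' : 0 < |ξ| := abs_pos.2 hξ
    refine squeeze_zero_norm (a := fun n : ℕ => N * (1 / ((n : ℝ) + 1) / |ξ|) * ‖ρ ξ‖) (fun n => ?_) ?_
    · rw [norm_mul]
      gcongr
      refine (norm_lowCut_le (hα n) hN ξ).trans ?_
      gcongr
      linarith [hα n]
    · have := (((tendsto_one_div_add_atTop_nhds_zero_nat (𝕜 := ℝ)).div_const |ξ|).const_mul (N : ℝ)).mul_const ‖ρ ξ‖
      simpa using this

theorem exists_weighted_approx (h : L2) {ε : ℝ} (hε : 0 < ε) :
    ∃ z : L2, ‖h - z‖ ≤ ε ∧ ∀ a, MemLp (wt a z) 2 volume := by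
  obtain ⟨g, hg, hle, hc, hm⟩ := (Lp.memLp h).exists_hasCompactSupport_eLpNorm_sub_le ENNReal.ofNat_ne_top
    (ε := ENNReal.ofReal ε) (by simpa using hε)
  refine ⟨hm.toLp g, ?_, fun a => ?_⟩
  · rw [← n2_sub_coe]
    have e : (fun x => h x - (hm.toLp g : L2) x) =ᵐ[volume] ⇑h - g :=
      hm.coeFn_toLp.mono fun x hx => by simp only [hx, Pi.sub_apply]
    rw [n2_congr e]
    exact ENNReal.toReal_le_of_le_ofReal hε.le hle
  · have hcw : Continuous (wt a g) := (Complex.continuous_ofReal.comp (continuous_jap_rpow a)).mul hc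
    have : MemLp (wt a g) 2 volume := memLp_of_test hcw hg.mul_left
    exact this.ae_eq (hm.coeFn_toLp.mono fun x hx => by simp only [wt, hx])

namespace Flow
variable {σ C M : ℝ} {V : ℝ → ℝ → ℂ} {u : ℝ → L2}

theorem ae_of_time {P : ℝ → Prop} (h : ∀ᵐ s ∂timeMeasure, P s) : ∀ᵐ s : ℝ, 0 ≤ s → P s :=
  (ae_restrict_iff' measurableSet_Ici).1 h

theorem wt_srcE (hf : Flow σ C M V u) {a : ℝ} (ha : a ≤ σ) : ∀ᵐ s : ℝ, MemLp (wt a (srcE V u s)) 2 volume ∧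
    n2 (wt a (srcE V u s)) ≤ C * M := by
  filter_upwards [ae_of_time hf.slice, ae_of_time hf.bound] with s h1 h2
  rcases le_or_gt 0 s with hs | hs
  · rw [srcE_of_nonneg hs]
    exact wt_mul_bound (σ := σ) (r := 0) (i := 0) (z := u s) (h1 hs) (by simpa using h2 hs) hf.C_nonneg
      (by rw [wt_zero]; exact Lp.memLp _) (by rw [wt_zero, n2_coe]; exact hf.norm_le hs) (by simpa using ha)
  · rw [srcE_of_neg hs]
    have : wt a (fun _ => 0) = fun _ => 0 := by ext; simp [wt]
    rw [this, n2_zero]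
    exact ⟨MemLp.zero, mul_nonneg hf.C_nonneg hf.M_nonneg⟩

theorem measurable_pair_srcE (hf : Flow σ C M V u) {ρ : ℝ → ℂ} (h : RapidDecay ρ) {c : ℝ → ℝ}
    (hc : Continuous c) :
    AEStronglyMeasurable (fun s => pair (srcE V u s) (fun ξ => freeSymbol (c s) ξ * ρ ξ)) (volume : Measure ℝ) := by
  have e : (fun s => pair (srcE V u s) (fun ξ => freeSymbol (c s) ξ * ρ ξ))
      = indicator (Ici 0) (fun s => pair (src V u s) (fun ξ => freeSymbol (c s) ξ * ρ ξ)) := by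
    ext s
    by_cases hs : 0 ≤ s
    · rw [indicator_of_mem (mem_Ici.2 hs), srcE_of_nonneg hs]
    · rw [indicator_of_notMem (s := Ici (0 : ℝ)) hs, srcE_of_neg (not_le.1 hs), pair_zero_left]
  rw [e, aestronglyMeasurable_indicator_iff measurableSet_Ici]
  exact hf.measurable_pair_src_free h hc

theorem measurable_pair_srcE_affine (hf : Flow σ C M V u) {ρ : ℝ → ℂ} (h : RapidDecay ρ) {τ : ℝ}
    (hτ : τ = 1 ∨ τ = -1) (t : ℝ) :
    AEStronglyMeasurable (fun s => pair (srcE V u (t + τ * s)) (fun ξ => freeSymbol (-τ * s) ξ * ρ ξ))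
      (volume : Measure ℝ) := by
  have h1 := (hf.measurable_pair_srcE h (c := fun s => t - s) (by fun_prop)).comp_quasiMeasurePreserving
    (quasi_affine hτ t)
  refine h1.congr (Eventually.of_forall fun s => ?_)
  simp only [Function.comp]
  congr 2
  ext ξ
  congr 2
  ring

theorem exists_srcE_decay (hf : Flow σ C M V u) {N : ℕ} (hN : 6 ≤ N) {α ς : ℝ} (hα : 0 < α) (hς : ς = 1 ∨ ς = -1)
    (η : SchwartzMap ℝ ℂ) : ∃ K, 0 ≤ K ∧ ∀ᵐ s : ℝ, ∀ r : ℝ,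
      ‖pair (srcE V u s) (sym r α ς (.X ^ N) η)‖ ≤ K * (1 + r ^ 2)⁻¹ := by
  obtain ⟨K, hK, h⟩ := exists_sym_decay hN hα hς η
  refine ⟨K * (C * M), mul_nonneg hK (mul_nonneg hf.C_nonneg hf.M_nonneg), ?_⟩
  filter_upwards [hf.wt_srcE hf.two_lt.le] with s hs r
  refine (h _ hs.1 r).trans ?_
  have := hs.2
  gcongr

theorem integrable_pair_srcE (hf : Flow σ C M V u) {N : ℕ} (hN : 6 ≤ N) {α ς : ℝ} (hα : 0 < α)
    (hς : ς = 1 ∨ ς = -1) (η : SchwartzMap ℝ ℂ) {τ : ℝ} (hτ : τ = 1 ∨ τ = -1) (t : ℝ) :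
    Integrable (fun s => pair (srcE V u (t + τ * s)) (sym (-τ * s) α ς (.X ^ N) η)) := by
  obtain ⟨K, hK, h⟩ := hf.exists_srcE_decay hN hα hς η
  refine (integrable_inv_one_add_sq.const_mul K).mono'
    (hf.measurable_pair_srcE_affine ((rapidDecay_schwartz η).cutPoly_mul hα ς _) hτ t) ?_
  filter_upwards [(quasi_affine hτ t).ae h] with s hs
  refine (hs (-τ * s)).trans_eq ?_
  rcases hτ with rfl | rfl <;> simp

theorem tendsto_pair_pullback (hf : Flow σ C M V u) (f : SchwartzMap ℝ ℂ) :
    ∃ l, Tendsto (fun t => ∫ x, (freeProp (-t) (u t)) x * f x) atTop (𝓝 l) := by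
  set η : SchwartzMap ℝ ℂ := 𝓕 f with hη
  have hr : RapidDecay η := rapidDecay_schwartz η
  have e : ∀ t, ∫ x, (freeProp (-t) (u t)) x * f x = pair (freeProp (-t) (u t)) η := fun t => by
    rw [pair, hη, fourierInv_fourier_schwartz]
  simp only [e]
  refine exists_tendsto_of_approx fun ε hε => ?_
  have hM := hf.M_nonneg
  obtain ⟨n, hn⟩ := ((tendsto_n2_lowCut hr (N := 6) (by norm_num)).eventually
    (gt_mem_nhds (show 0 < ε / (M + 1) by positivity))).exists
  set α := 1 / ((n : ℝ) + 1)
  have hα : 0 < α := by positivity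
  have hside : ∀ ς : ℝ, (ς = 1 ∨ ς = -1) → ∃ l, Tendsto (fun t =>
      pair (freeProp (-t) (u t)) (fun ξ => cutPoly α ς (.X ^ 6) ξ * η ξ)) atTop (𝓝 l) := by
    intro ς hς
    have hΘ : RapidDecay fun ξ => cutPoly α ς (.X ^ 6) ξ * η ξ := hr.cutPoly_mul hα ς _
    have hint := hf.integrable_pair_srcE le_rfl hα hς η (Or.inl rfl : (1 : ℝ) = 1 ∨ (1 : ℝ) = -1) 0
    have := intervalIntegral_tendsto_integral_Ioi 0 hint.integrableOn tendsto_id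
    refine ⟨_, ((this.const_mul Complex.I).const_add (pair (u 0) fun ξ => cutPoly α ς (.X ^ 6) ξ * η ξ)).congr' ?_⟩
    filter_upwards [eventually_ge_atTop 0] with t ht
    have hd := hf.duhamel hΘ 0 le_rfl ht
    rw [pair_freeProp _ _ hΘ]
    simp only [zero_sub, neg_zero, freeSymbol_zero, one_mul, id] at hd ⊢
    rw [eq_comm, ← sub_eq_iff_eq_add', hd]
    congr 1
    refine intervalIntegral.integral_congr fun s hs => ?_
    rw [uIcc_of_le ht] at hs
    simp only [one_mul, zero_add, srcE_of_nonneg hs.1, neg_mul]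
    rfl
  obtain ⟨l1, h1⟩ := hside 1 (Or.inl rfl)
  obtain ⟨l2, h2⟩ := hside (-1) (Or.inr rfl)
  refine ⟨_, _, h1.add h2, (eventually_ge_atTop 0).mono fun t ht => ?_⟩
  rw [pair_cutPoly_decomp _ hr hα (N := 6) (by norm_num), add_sub_cancel_right]
  refine (norm_pair_le' _ (hr.lowCut_mul hα (by norm_num))).trans ?_
  rw [norm_freeProp]
  calc _ ≤ M * (ε / (M + 1)) := mul_le_mul (hf.norm_le ht) hn.le (n2_nonneg _) hM
    _ ≤ ε := by rw [mul_div_assoc', div_le_iff₀ (by positivity)]; nlinarith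

/-- The asymptotic free state. -/
theorem exists_scattering_state (hf : Flow σ C M V u) : ∃ up up' : L2, HasWeakDeriv 1 up up' ∧ ‖up‖ ≤ M ∧ ‖up'‖ ≤ M ∧
    Scatters u up := by
  choose ℓ hℓ using hf.tendsto_pair_pullback
  have hint : ∀ (z : L2) (f : SchwartzMap ℝ ℂ), Integrable fun x => z x * f x := fun z f =>
    integrable_mul_of_memLp (Lp.memLp z) (f.memLp 2)
  let L : SchwartzMap ℝ ℂ →ₗ[ℂ] ℂ :=
    { toFun := ℓ
      map_add' := fun f g => by
        refine tendsto_nhds_unique (hℓ (f + g)) (((hℓ f).add (hℓ g)).congr fun t => ?_)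
        rw [← integral_add (hint _ _) (hint _ _)]
        congr 1; ext x; rw [add_apply]; ring
      map_smul' := fun c f => by
        refine tendsto_nhds_unique (hℓ (c • f)) (((hℓ f).const_mul c).congr fun t => ?_)
        rw [← integral_const_mul]
        congr 1; ext x; rw [smul_apply, smul_eq_mul]; ring }
  have hb : ∀ f, ‖L f‖ ≤ M * n2 f := fun f => by
    refine le_of_tendsto (hℓ f).norm ((eventually_ge_atTop 0).mono fun t ht => ?_)
    refine (norm_integral_mul_le (Lp.memLp _) (f.memLp 2)).trans ?_
    rw [n2_coe, norm_freeProp]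
    exact mul_le_mul_of_nonneg_right (hf.norm_le ht) (n2_nonneg _)
  obtain ⟨up, hup, hupf⟩ := exists_L2_of_bound L hf.M_nonneg hb
  have hlim : Scatters u up :=
    fun f => by rw [← hupf]; exact hℓ f
  obtain ⟨up', h1, h2⟩ := exists_weakDeriv_of_bound up hf.M_nonneg fun f => by
    have := (hlim (SchwartzMap.derivCLM ℂ ℂ f)).norm
    refine le_of_tendsto this ((eventually_ge_atTop 0).mono fun t ht => ?_)
    obtain ⟨g, hg, -, hgM⟩ := hf.h1 t ht
    have hd := hg.freeProp (-t)
    have e1 : ∫ x, (freeProp (-t) (u t)) x * (SchwartzMap.derivCLM ℂ ℂ f) x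
        = -∫ x, (freeProp (-t) g) x * f x := by
      have e2 : deriv (deriv f) = SchwartzMap.derivCLM ℂ ℂ (SchwartzMap.derivCLM ℂ ℂ f) := by
        have e1 : deriv f = SchwartzMap.derivCLM ℂ ℂ f := by ext x; rfl
        rw [e1]; ext x; rfl
      refine hd.integral_mul_deriv (f.smooth _) (f.memLp 2) ?_ ?_
      · exact (SchwartzMap.derivCLM ℂ ℂ f).memLp 2 volume
      · rw [e2]; exact SchwartzMap.memLp _ 2 volume
    rw [e1, norm_neg]
    refine (norm_integral_mul_le (Lp.memLp _) (f.memLp 2)).trans ?_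
    rw [n2_coe, norm_freeProp]
    exact mul_le_mul_of_nonneg_right hgM (n2_nonneg _)
  exact ⟨up, up', h1, hup, h2, hlim⟩

/-- Propagation from `t = ∞` and from `t = 0`. -/
theorem norm_pair_sub_free_le (hf : Flow σ C M V u) {up : L2} (hup : ‖up‖ ≤ M)
    (hlim : Scatters u up)
    {N : ℕ} (hN : 6 ≤ N) {α ς : ℝ} (hα : 0 < α) (hς : ς = 1 ∨ ς = -1) {g : ℝ → ℂ} (hg : IsTest g)
    {τ : ℝ} (hτ : τ = 1 ∨ τ = -1) {t : ℝ} (ht : 0 ≤ t) :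
    ‖pair (u t - freeProp t (if τ = 1 then up else u 0) : L2) (fun ξ => cutPoly α ς (.X ^ N) ξ * 𝓕 g ξ)‖
      ≤ ∫ s in Ioi (0 : ℝ), ‖pair (srcE V u (t + τ * s)) (psym τ s α ς N g)‖ := by
  set Θ : ℝ → ℂ := fun ξ => cutPoly α ς (.X ^ N) ξ * 𝓕 g ξ with hΘd
  have hΘ : RapidDecay Θ := hg.rapidDecay.cutPoly_mul hα ς _
  have hint : Integrable (fun s => pair (srcE V u (t + τ * s)) (psym τ s α ς N g)) := by
    have := hf.integrable_pair_srcE hN hα hς hg.hat hτ t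
    rwa [hg.coe_hat] at this
  rw [pair_sub _ _ hΘ, pair_freeProp _ _ hΘ]
  rcases hτ with rfl | rfl
  · rw [if_pos rfl]
    have hT : Tendsto (fun T => pair (u T) (fun ξ => freeSymbol (t - T) ξ * Θ ξ)) atTop
        (𝓝 (pair up (fun ξ => freeSymbol t ξ * Θ ξ))) := by
      have h1 : Tendsto (fun T : ℝ => ∫ x, (freeProp (-(max T 0)) (u (max T 0))) x * (vec (hΘ.freeSymbol_mul t)) x) atTop
          (𝓝 (∫ x, up x * (vec (hΘ.freeSymbol_mul t)) x)) := by
        refine tendsto_bilin_of_test (M := M) (fun T => ?_) hup (fun f => ?_) _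
        · rw [norm_freeProp]; exact hf.norm_le (le_max_right _ _)
        · refine (hlim f).congr' ?_
          filter_upwards [eventually_ge_atTop 0] with T hT
          rw [max_eq_left hT]
      rw [pair_eq_bilin _ (hΘ.freeSymbol_mul t)]
      refine h1.congr' ?_
      filter_upwards [eventually_ge_atTop 0] with T hT
      rw [max_eq_left hT, vec, ← pair_eq_bilin _ (hΘ.freeSymbol_mul t), pair_freeProp _ _ (hΘ.freeSymbol_mul t)]
      congr 1; ext ξ
      rw [← mul_assoc, ← freeSymbol_add]
      congr 2; ring
    refine le_of_tendsto (hT.const_sub (pair (u t) Θ)).norm ?_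
    filter_upwards [eventually_ge_atTop t] with T htT
    have hd := hf.duhamel hΘ t ht htT
    simp only [sub_self, freeSymbol_zero, one_mul] at hd
    rw [norm_sub_rev, hd, norm_mul, Complex.norm_I, one_mul]
    have e : ∫ s in t..T, pair (src V u s) (fun ξ => freeSymbol (t - s) ξ * Θ ξ)
        = ∫ s in (0 : ℝ)..(T - t), pair (srcE V u (t + 1 * s)) (psym 1 s α ς N g) := by
      have hsub := intervalIntegral.integral_comp_add_left
        (fun s => pair (src V u s) (fun ξ => freeSymbol (t - s) ξ * Θ ξ)) t (a := 0) (b := T - t)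
      rw [add_zero, add_sub_cancel] at hsub
      rw [← hsub]
      refine intervalIntegral.integral_congr fun s hs => ?_
      rw [uIcc_of_le (by linarith)] at hs
      simp only [one_mul]
      rw [srcE_of_nonneg (by linarith [hs.1]), psym_eq]
      congr 1; ext ξ; congr 2; ring
    rw [e, intervalIntegral.integral_of_le (by linarith)]
    refine (norm_integral_le_integral_norm _).trans ?_
    exact setIntegral_mono_set hint.norm.integrableOn (Eventually.of_forall fun _ => norm_nonneg _)
      Ioc_subset_Ioi_self.eventuallyLE
  · rw [if_neg (by norm_num)]
    have hd := hf.duhamel hΘ t le_rfl ht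
    simp only [sub_self, freeSymbol_zero, one_mul, sub_zero] at hd
    rw [hd, norm_mul, Complex.norm_I, one_mul]
    have e : ∫ s in (0 : ℝ)..t, pair (src V u s) (fun ξ => freeSymbol (t - s) ξ * Θ ξ)
        = ∫ s in (0 : ℝ)..t, pair (srcE V u (t + (-1) * s)) (psym (-1) s α ς N g) := by
      have hsub := intervalIntegral.integral_comp_sub_left
        (fun s => pair (src V u s) (fun ξ => freeSymbol (t - s) ξ * Θ ξ)) t (a := 0) (b := t)
      rw [sub_self, sub_zero] at hsub
      rw [← hsub]
      refine intervalIntegral.integral_congr fun s hs => ?_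
      rw [uIcc_of_le ht] at hs
      simp only [neg_mul, one_mul, ← sub_eq_add_neg]
      rw [srcE_of_nonneg (by linarith [hs.2]), psym_eq]
      congr 1; ext ξ; congr 2; ring
    rw [e, intervalIntegral.integral_of_le ht]
    refine (norm_integral_le_integral_norm _).trans ?_
    exact setIntegral_mono_set hint.norm.integrableOn (Eventually.of_forall fun _ => norm_nonneg _)
      Ioc_subset_Ioi_self.eventuallyLE

/-- Freely evolving states disappear locally in phase space. -/
theorem _root_.WeaklyBound.tendsto_pair_freeProp_zero (h : L2) {N : ℕ} (hN : 6 ≤ N) {α ς : ℝ} (hα : 0 < α)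
    (hς : ς = 1 ∨ ς = -1) (η : SchwartzMap ℝ ℂ) :
    Tendsto (fun t => pair (freeProp t h) (fun ξ => cutPoly α ς (.X ^ N) ξ * η ξ)) atTop (𝓝 0) := by
  obtain ⟨K, hK, hdec⟩ := exists_sym_decay hN hα hς η
  have hΘ : RapidDecay fun ξ => cutPoly α ς (.X ^ N) ξ * η ξ := (rapidDecay_schwartz η).cutPoly_mul hα ς _
  set B := n2 fun ξ => cutPoly α ς (.X ^ N) ξ * η ξ
  have hB : 0 ≤ B := n2_nonneg _
  rw [Metric.tendsto_nhds]
  intro ε hε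
  obtain ⟨z, hz, hzw⟩ := exists_weighted_approx h (ε := ε / (2 * (B + 1))) (by positivity)
  have hf1 : ‖h - z‖ * B < ε / 2 := by
    calc _ ≤ ε / (2 * (B + 1)) * B := by gcongr
      _ < ε / 2 := by
        rw [div_mul_eq_mul_div, div_lt_div_iff₀ (by positivity) (by positivity)]
        nlinarith
  have hw : MemLp (wt 2 z) 2 volume := hzw 2
  have hlim : Tendsto (fun t : ℝ => K * n2 (wt 2 z) * (1 + t ^ 2)⁻¹) atTop (𝓝 0) := by
    have : Tendsto (fun t : ℝ => (1 + t ^ 2)⁻¹) atTop (𝓝 0) :=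
      tendsto_inv_atTop_zero.comp (tendsto_atTop_add_const_left _ _ (tendsto_pow_atTop two_ne_zero))
    simpa using this.const_mul (K * n2 (wt 2 z))
  filter_upwards [hlim.eventually (gt_mem_nhds (half_pos hε))] with t ht
  rw [dist_zero_right]
  have e : pair (freeProp t h) (fun ξ => cutPoly α ς (.X ^ N) ξ * η ξ)
      = pair (freeProp t (h - z)) (fun ξ => cutPoly α ς (.X ^ N) ξ * η ξ) + pair z (sym t α ς (.X ^ N) η) := by
    have : pair (freeProp t z) (fun ξ => cutPoly α ς (.X ^ N) ξ * η ξ) = pair z (sym t α ς (.X ^ N) η) :=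
      pair_freeProp t z hΘ
    rw [← this, freeProp_sub, pair_sub _ _ hΘ]
    ring
  rw [e]
  refine (norm_add_le _ _).trans_lt ?_
  have h1 := norm_pair_le' (freeProp t (h - z)) hΘ
  rw [norm_freeProp] at h1
  have h2 := hdec z hw t
  linarith

end Flow

/-- The Fourier multiplier with symbol `m` (on the side of `𝓕⁻`). -/
noncomputable def mult (m : ℝ → ℂ) (z : L2) : L2 :=
  open scoped Classical in
  if h : MemLp (fun ξ => m ξ * (𝓕⁻ z : L2) ξ) 2 volume then 𝓕 (h.toLp _ : L2) else 0

theorem memLp_mult {m : ℝ → ℂ} (hm : Continuous m) {K : ℝ} (hK : ∀ ξ, ‖m ξ‖ ≤ K) (z : L2) :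
    MemLp (fun ξ => m ξ * (𝓕⁻ z : L2) ξ) 2 volume :=
  memLp_bdd_mul hm.aestronglyMeasurable (ae_of_all _ hK) (Lp.memLp _)

theorem fourierInv_mult {m : ℝ → ℂ} (hm : Continuous m) {K : ℝ} (hK : ∀ ξ, ‖m ξ‖ ≤ K) (z : L2) :
    (𝓕⁻ (mult m z) : L2) = (memLp_mult hm hK z).toLp _ := by
  rw [mult, dif_pos (memLp_mult hm hK z)]
  exact FourierTransform.fourierInv_fourier_eq _

theorem fourierInv_mult_ae {m : ℝ → ℂ} (hm : Continuous m) {K : ℝ} (hK : ∀ ξ, ‖m ξ‖ ≤ K) (z : L2) :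
    (𝓕⁻ (mult m z) : L2) =ᵐ[volume] fun ξ => m ξ * (𝓕⁻ z : L2) ξ := by
  rw [fourierInv_mult hm hK]
  exact MemLp.coeFn_toLp _

theorem norm_mult_le {m : ℝ → ℂ} (hm : Continuous m) {K : ℝ} (hK : ∀ ξ, ‖m ξ‖ ≤ K) (z : L2) :
    ‖mult m z‖ ≤ K * ‖z‖ := by
  have hK0 : 0 ≤ K := (norm_nonneg _).trans (hK 0)
  rw [← norm_fourierInv_L2, fourierInv_mult hm hK, norm_toLp_eq_n2, ← norm_fourierInv_L2 z, ← n2_coe]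
  exact n2_bdd_mul_le hK0 (ae_of_all _ hK) (Lp.memLp _)

theorem pair_mult {m : ℝ → ℂ} (hm : Continuous m) {K : ℝ} (hK : ∀ ξ, ‖m ξ‖ ≤ K) (z : L2) {ρ : ℝ → ℂ}
    (h : RapidDecay ρ) : pair (mult m z) ρ = pair z (fun ξ => m ξ * ρ ξ) := by
  rw [pair_eq_fourierInv _ h, pair_eq_fourierInv _ (h.mul_bdd hm hK)]
  refine integral_congr_ae ?_
  filter_upwards [fourierInv_mult_ae hm hK z] with ξ e
  rw [e]; ring

theorem exists_weak_subseq {z : ℕ → L2} {M : ℝ} (hM : ∀ j, ‖z j‖ ≤ M) :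
    ∃ (Z : L2) (φ : ℕ → ℕ), StrictMono φ ∧ ‖Z‖ ≤ M ∧
      ∀ f : L2, Tendsto (fun j => ∫ x, z (φ j) x * f x) atTop (𝓝 (∫ x, Z x * f x)) := by
  have hM0 : 0 ≤ M := (norm_nonneg _).trans (hM 0)
  have : Fact ((2 : ℝ≥0∞) ≠ ⊤) := ⟨ENNReal.ofNat_ne_top⟩
  have hc := WeakDual.isSeqCompact_closedBall ℂ L2 0 M
  have hmem : ∀ j, StrongDual.toWeakDual (bilinL (z j)) ∈ WeakDual.toStrongDual ⁻¹' Metric.closedBall (0 : StrongDual ℂ L2) M := by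
    intro j
    rw [mem_preimage, Metric.mem_closedBall, dist_zero_right]
    refine ContinuousLinearMap.opNorm_le_bound _ hM0 fun f => ?_
    have h1 := norm_bilin_le (z j) f
    rw [← bilinL_apply] at h1
    exact h1.trans (mul_le_mul_of_nonneg_right (hM j) (norm_nonneg _))
  obtain ⟨T, hT, φ, hφ, hlim⟩ := hc hmem
  obtain ⟨Z, hZ, hrep⟩ := exists_bilin_rep (WeakDual.toStrongDual T)
  rw [mem_preimage, Metric.mem_closedBall, dist_zero_right] at hT
  refine ⟨Z, φ, hφ, hZ.trans hT, fun f => ?_⟩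
  rw [← hrep f]
  have h2 := (WeakBilin.eval_continuous (topDualPairing ℂ L2) f).tendsto T |>.comp hlim
  exact h2.congr fun j => bilinL_apply (z (φ j)) f

theorem n2_comp_neg {f : ℝ → ℂ} (hf : AEStronglyMeasurable f (volume : Measure ℝ)) : n2 (fun x => f (-x)) = n2 f := by
  unfold n2
  rw [← eLpNorm_comp_measurePreserving hf measurePreserving_neg_real]
  rfl

theorem jap_neg (x : ℝ) : jap (-x) = jap x := by simp [jap]

/-- Square integrable multipliers turn weak convergence into local strong convergence. -/
theorem tendsto_wt_mult {m : ℝ → ℂ} (hm : Continuous m) {K : ℝ} (hK : ∀ ξ, ‖m ξ‖ ≤ K)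
    (hm2 : MemLp m 2 volume) {y : ℕ → L2} {M : ℝ} (hM : ∀ j, ‖y j‖ ≤ M)
    (hy : ∀ f : L2, Tendsto (fun j => ∫ x, y j x * f x) atTop (𝓝 0)) :
    Tendsto (fun j => n2 (wt (-1) (mult m (y j)))) atTop (𝓝 0) := by
  set k : ℕ → ℝ → ℂ := fun j => 𝓕⁻ (fun ξ => m ξ * (𝓕⁻ (y j) : L2) ξ) with hk
  have hint : ∀ j, Integrable (fun ξ => m ξ * (𝓕⁻ (y j) : L2) ξ) := fun j =>
    integrable_mul_of_memLp hm2 (Lp.memLp _)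
  have hae : ∀ j, (fun x => (mult m (y j)) (-x)) =ᵐ[volume] k j := by
    intro j
    refine (reflL_ae _).symm.trans ?_
    rw [← fourierInv_fourierInv_L2, fourierInv_mult hm hK]
    exact fourierInv_toLp_ae (hint j) _
  have hcont : ∀ j, Continuous (k j) := fun j => continuous_fourierInv (hint j)
  have he : ∀ j, n2 (wt (-1) (mult m (y j))) = n2 (wt (-1) (k j)) := by
    intro j
    rw [← n2_comp_neg (aestronglyMeasurable_wt _ (Lp.aestronglyMeasurable _))]
    refine n2_congr ?_
    filter_upwards [hae j] with x hx
    simp only [wt, jap_neg, hx]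
  simp only [he]
  have hκ : ∀ x : ℝ, MemLp (fun ξ : ℝ => Complex.exp (2 * π * Complex.I * x * ξ) * m ξ) 2 volume :=
    fun x => memLp_bdd_mul (C := 1) (Continuous.aestronglyMeasurable (by fun_prop))
      (ae_of_all _ fun ξ => (norm_expI x ξ).le) hm2
  have hkx : ∀ j x, k j x = ∫ ξ, (𝓕⁻ (y j) : L2) ξ * ((hκ x).toLp _ : L2) ξ := by
    intro j x
    simp only [hk]
    rw [fourierInv_apply]
    refine integral_congr_ae ?_
    filter_upwards [(hκ x).coeFn_toLp] with ξ h
    rw [h]; ring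
  have hlim : ∀ x, Tendsto (fun j => k j x) atTop (𝓝 0) := by
    intro x
    refine (hy (𝓕⁻ ((hκ x).toLp _ : L2))).congr fun j => ?_
    rw [hkx, integral_fourierInv_mul_L2]
  have hb : ∀ j x, ‖k j x‖ ≤ M * n2 m := by
    intro j x
    rw [hkx]
    refine (norm_bilin_le _ _).trans ?_
    rw [norm_fourierInv_L2, norm_toLp_eq_n2]
    have : n2 (fun ξ : ℝ => Complex.exp (2 * π * Complex.I * x * ξ) * m ξ) ≤ 1 * n2 m :=
      n2_bdd_mul_le zero_le_one (ae_of_all _ fun ξ => (norm_expI x ξ).le) hm2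
    rw [one_mul] at this
    exact mul_le_mul (hM j) this (n2_nonneg _) ((norm_nonneg _).trans (hM j))
  refine tendsto_n2_zero (G := fun x => M * n2 m * jap x ^ (-1 : ℝ)) ((memLp_jap_rpow le_rfl).const_mul _)
    (fun j => aestronglyMeasurable_wt _ (hcont j).aestronglyMeasurable) (fun j => ae_of_all _ fun x => ?_)
    (ae_of_all _ fun x => ?_)
  · rw [norm_wt, mul_comm]
    have := jap_pos x
    gcongr
    exact hb j x
  · simpa [wt] using (hlim x).const_mul (((jap x ^ (-1 : ℝ) : ℝ)) : ℂ)

theorem memLp_lowCut {α : ℝ} (hα : 0 < α) {N : ℕ} (hN : N ≠ 0) : MemLp (lowCut α N) 2 volume := by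
  have h := memLp_jap_rpow (σ := 1) le_rfl
  refine h.of_le_mul (c := N * (α * (1 + α⁻¹))) (continuous_lowCut hα N).aestronglyMeasurable (ae_of_all _ fun ξ => ?_)
  have hj := jap_pos ξ
  rw [Real.norm_of_nonneg (by positivity), Real.rpow_neg_one, mul_assoc]
  refine (norm_lowCut_le hα hN ξ).trans (mul_le_mul_of_nonneg_left ?_ (by positivity))
  rw [← div_eq_mul_inv, div_le_div_iff₀ (by positivity) hj]
  have hle : jap ξ ≤ 1 + |ξ| := by
    rw [jap]
    refine Real.sqrt_le_iff.2 ⟨by positivity, ?_⟩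
    nlinarith [abs_nonneg ξ, sq_abs ξ]
  have e : α * (1 + α⁻¹) * (|ξ| + α) = α * (|ξ| + α + α⁻¹ * |ξ| + 1) := by field_simp; ring
  rw [e]
  refine mul_le_mul_of_nonneg_left ?_ hα.le
  have : 0 ≤ α⁻¹ * |ξ| := by positivity
  linarith

theorem norm_one_sub_lowCut_le {α : ℝ} (hα : 0 < α) {N : ℕ} (hN : N ≠ 0) (ξ : ℝ) :
    ‖1 - lowCut α N ξ‖ ≤ 2 * (|ξ| / α) := by
  have hc : ∀ ς : ℝ, (ς = 1 ∨ ς = -1) → ‖cutPoly α ς (.X ^ N) ξ‖ ≤ |ξ| / α := by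
    intro ς hς
    have h0 := halfCut_nonneg hα ς ξ
    rw [cutPoly, Complex.norm_real, Polynomial.eval_pow, Polynomial.eval_X, Real.norm_of_nonneg (by positivity)]
    refine (pow_le_of_le_one h0 (halfCut_le_one hα ς ξ) hN).trans ?_
    rw [halfCut]
    have h1 : max (ς * ξ) 0 ≤ |ξ| := by
      refine max_le ((le_abs_self _).trans_eq ?_) (abs_nonneg _)
      rw [abs_mul, abs_of_sign hς, one_mul]
    have h2 : 0 ≤ max (ς * ξ) 0 := le_max_right _ _
    gcongr
    linarith
  have e : 1 - lowCut α N ξ = cutPoly α 1 (.X ^ N) ξ + cutPoly α (-1) (.X ^ N) ξ := by rw [lowCut]; ring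
  rw [e]
  refine (norm_add_le _ _).trans ?_
  linarith [hc 1 (Or.inl rfl), hc (-1) (Or.inr rfl)]

theorem HasWeakDeriv.norm_sub_mult_lowCut_le {y y' : L2} (h : HasWeakDeriv 1 y y') {α : ℝ} (hα : 0 < α) {N : ℕ}
    (hN : N ≠ 0) : ‖y - mult (lowCut α N) y‖ ≤ α⁻¹ * ‖y'‖ := by
  have hm := continuous_lowCut hα N
  have hK := norm_lowCut_le_nat hα hN
  rw [← norm_fourierInv_L2, ← norm_fourierInv_L2 y', ← n2_coe, ← n2_coe]
  refine n2_le_of_ae_le (Lp.memLp _) (by positivity) ?_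
  filter_upwards [fourierInv_sub_ae y (mult (lowCut α N) y), fourierInv_mult_ae hm hK y, fourierInv_weakDeriv h]
    with ξ h1 h2 h3
  rw [h1, h2, h3, ← one_sub_mul, norm_mul, norm_mul, norm_neg]
  have e : ‖(2 * π * Complex.I * ξ : ℂ)‖ = 2 * π * |ξ| := by
    simp [abs_of_pos Real.pi_pos]
  rw [e]
  calc _ ≤ 2 * (|ξ| / α) * ‖(𝓕⁻ y : L2) ξ‖ := by gcongr; exact norm_one_sub_lowCut_le hα hN ξ
    _ ≤ π * (2 * (|ξ| / α) * ‖(𝓕⁻ y : L2) ξ‖) := le_mul_of_one_le_left (by positivity) (by linarith [Real.pi_gt_three])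
    _ = _ := by ring

theorem n2_wt_neg_one_le (z : L2) : n2 (wt (-1) z) ≤ ‖z‖ := by
  rw [← n2_coe]
  refine n2_mono (Lp.memLp z) (ae_of_all _ fun x => ?_)
  rw [norm_wt]
  exact mul_le_of_le_one_left (norm_nonneg _) (Real.rpow_le_one_of_one_le_of_nonpos (one_le_jap x) (by norm_num))

theorem memLp_wt_neg_one (z : L2) : MemLp (wt (-1) z) 2 volume :=
  (Lp.memLp z).of_le (aestronglyMeasurable_wt _ (Lp.aestronglyMeasurable z)) (ae_of_all _ fun x => by
    rw [norm_wt]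
    exact mul_le_of_le_one_left (norm_nonneg _) (Real.rpow_le_one_of_one_le_of_nonpos (one_le_jap x) (by norm_num)))

/-- Rellich's theorem on the line. -/
theorem tendsto_wt_of_weak {y y' : ℕ → L2} (hd : ∀ j, HasWeakDeriv 1 (y j) (y' j)) {M : ℝ} (hM : ∀ j, ‖y j‖ ≤ M)
    (hM' : ∀ j, ‖y' j‖ ≤ M) (hy : ∀ f : L2, Tendsto (fun j => ∫ x, y j x * f x) atTop (𝓝 0)) :
    Tendsto (fun j => n2 (wt (-1) (y j))) atTop (𝓝 0) := by
  have hM0 : 0 ≤ M := (norm_nonneg _).trans (hM 0)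
  rw [Metric.tendsto_nhds]
  intro ε hε
  set α := 2 * (M + 1) / ε with hαd
  have hα : 0 < α := by positivity
  have h1 := tendsto_wt_mult (continuous_lowCut hα 1) (norm_lowCut_le_nat hα one_ne_zero)
    (memLp_lowCut hα one_ne_zero) hM hy
  filter_upwards [h1.eventually (gt_mem_nhds (half_pos hε))] with j hj
  rw [dist_zero_right, Real.norm_of_nonneg (n2_nonneg _)]
  set z := mult (lowCut α 1) (y j)
  have e : n2 (wt (-1) (y j)) = n2 (fun x => wt (-1) (y j - z : L2) x + wt (-1) z x) := by
    refine n2_congr ?_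
    filter_upwards [Lp.coeFn_sub (y j) z] with x hx
    simp only [wt, hx, Pi.sub_apply]; ring
  rw [e]
  refine (n2_add_le (memLp_wt_neg_one _) (memLp_wt_neg_one _)).trans_lt ?_
  have h2 := (n2_wt_neg_one_le (y j - z)).trans ((hd j).norm_sub_mult_lowCut_le hα one_ne_zero)
  have h3 : α⁻¹ * ‖y' j‖ ≤ ε / 2 := by
    calc α⁻¹ * ‖y' j‖ ≤ α⁻¹ * (M + 1) := by gcongr; linarith [hM' j]
      _ = ε / 2 := by rw [hαd]; field_simp
  linarith

theorem exists_weakDeriv_of_weak_limit {ι : Type*} {l : Filter ι} [l.NeBot] {z z' : ι → L2} {Z : L2} {M : ℝ} (hM0 : 0 ≤ M)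
    (hd : ∀ᶠ j in l, HasWeakDeriv 1 (z j) (z' j) ∧ ‖z' j‖ ≤ M)
    (hz : ∀ f : L2, Tendsto (fun j => ∫ x, z j x * f x) l (𝓝 (∫ x, Z x * f x))) :
    ∃ Z' : L2, HasWeakDeriv 1 Z Z' ∧ ‖Z'‖ ≤ M := by
  refine exists_weakDeriv_of_bound Z hM0 fun f => ?_
  have e1 : deriv f = SchwartzMap.derivCLM ℂ ℂ f := by ext x; rfl
  have e2 : deriv (deriv f) = SchwartzMap.derivCLM ℂ ℂ (SchwartzMap.derivCLM ℂ ℂ f) := by rw [e1]; ext x; rfl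
  have m1 : MemLp (deriv f) 2 volume := by rw [e1]; exact SchwartzMap.memLp _ 2 volume
  have m2 : MemLp (deriv (deriv f)) 2 volume := by rw [e2]; exact SchwartzMap.memLp _ 2 volume
  have hL : ∀ z : L2, ∫ x, z x * (m1.toLp _ : L2) x = ∫ x, z x * deriv f x := fun z =>
    integral_congr_ae (m1.coeFn_toLp.mono fun x hx => by simp only [hx])
  have := (hz (m1.toLp _)).norm
  rw [hL] at this
  refine le_of_tendsto this (hd.mono fun j hj => ?_)
  rw [hL, hj.1.integral_mul_deriv (f.smooth _) (f.memLp 2) m1 m2, norm_neg]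
  refine (norm_integral_mul_le (Lp.memLp _) (f.memLp 2)).trans ?_
  rw [n2_coe]
  exact mul_le_mul_of_nonneg_right hj.2 (n2_nonneg _)

/-- Weak limits of `u(t)` as `t → ∞`. -/
def omegaSet (u : ℝ → L2) : Set L2 := {Z | ∃ t : ℕ → ℝ, (∀ j, 0 ≤ t j) ∧ Tendsto t atTop atTop ∧
  ∀ f : L2, Tendsto (fun j => ∫ x, u (t j) x * f x) atTop (𝓝 (∫ x, Z x * f x))}

theorem n2_decay_mul_le {σ C : ℝ} (hσ : 1 ≤ σ) (hC : 0 ≤ C) {F : ℝ → ℂ} (hb : ∀ᵐ x, ‖F x‖ ≤ C * jap x ^ (-σ)) (y : L2) :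
    n2 (fun x => F x * y x) ≤ C * n2 (wt (-1) y) := by
  refine n2_le_of_ae_le (memLp_wt_neg_one y) hC ?_
  filter_upwards [hb] with x hx
  rw [norm_mul, norm_wt, ← mul_assoc]
  gcongr
  refine hx.trans ?_
  gcongr
  exact one_le_jap x

namespace Flow
variable {σ C M : ℝ} {V : ℝ → ℝ → ℂ} {u : ℝ → L2}

theorem exists_deriv_of_mem_omegaSet (hf : Flow σ C M V u) {Z : L2} (hZ : Z ∈ omegaSet u) :
    ‖Z‖ ≤ M ∧ ∃ Z' : L2, HasWeakDeriv 1 Z Z' ∧ ‖Z'‖ ≤ M := by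
  obtain ⟨t, ht0, ht, hlim⟩ := hZ
  choose g hg hgM hgM' using fun j => hf.h1 (t j) (ht0 j)
  refine ⟨?_, exists_weakDeriv_of_weak_limit hf.M_nonneg (Eventually.of_forall fun j => ⟨hg j, hgM' j⟩) hlim⟩
  have h1 := n2_indicator_le_of_dual Z isOpen_univ hf.M_nonneg fun g hg _ => by
    have h2 := (hlim (hg.memLp.toLp _)).norm
    have hL : ∀ z : L2, ∫ x, z x * (hg.memLp.toLp _ : L2) x = ∫ x, z x * g x := fun z =>
      integral_congr_ae (hg.memLp.coeFn_toLp.mono fun x hx => by simp only [hx])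
    simp only [hL] at h2
    refine le_of_tendsto h2 (Eventually.of_forall fun j => ?_)
    refine (norm_integral_mul_le (Lp.memLp _) hg.memLp).trans ?_
    rw [n2_coe]
    exact mul_le_mul_of_nonneg_right (hgM j) (n2_nonneg _)
  rwa [indicator_univ, n2_coe] at h1

theorem tendsto_wt_sub (hf : Flow σ C M V u) {r : ℕ → ℝ} (hr : ∀ j, 0 ≤ r j) {Z : L2} (hZ : Z ∈ omegaSet u)
    (hlim : ∀ f : L2, Tendsto (fun j => ∫ x, u (r j) x * f x) atTop (𝓝 (∫ x, Z x * f x))) :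
    Tendsto (fun j => n2 (wt (-1) (u (r j) - Z : L2))) atTop (𝓝 0) := by
  obtain ⟨hZM, Z', hZd, hZM'⟩ := hf.exists_deriv_of_mem_omegaSet hZ
  choose g hg hgM hgM' using fun j => hf.h1 (r j) (hr j)
  refine tendsto_wt_of_weak (M := M + M) (fun j => (hg j).sub hZd)
    (fun j => (norm_sub_le _ _).trans (add_le_add (hgM j) hZM))
    (fun j => (norm_sub_le _ _).trans (add_le_add (hgM' j) hZM')) fun f => ?_
  have := (hlim f).sub_const (∫ x, Z x * f x)
  rw [sub_self] at this
  refine this.congr fun j => ?_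
  rw [← integral_sub (integrable_mul_of_memLp (Lp.memLp _) (Lp.memLp _)) (integrable_mul_of_memLp (Lp.memLp _) (Lp.memLp _))]
  refine integral_congr_ae ?_
  filter_upwards [Lp.coeFn_sub (u (r j)) Z] with x hx
  rw [hx, Pi.sub_apply]; ring

/-- Every sequence of times tending to infinity has a subsequence along which `u` converges weakly. -/
theorem exists_omega_subseq (hf : Flow σ C M V u) {r : ℕ → ℝ} (hr : Tendsto r atTop atTop) :
    ∃ (Z : L2) (ms : ℕ → ℕ), Z ∈ omegaSet u ∧ Tendsto ms atTop atTop ∧ (∀ j, 0 ≤ r (ms j)) ∧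
      ∀ f : L2, Tendsto (fun j => ∫ x, u (r (ms j)) x * f x) atTop (𝓝 (∫ x, Z x * f x)) := by
  obtain ⟨J, hJ⟩ := eventually_atTop.1 (hr.eventually_ge_atTop 0)
  have h0 : ∀ i, 0 ≤ r (i + J) := fun i => hJ _ (by omega)
  obtain ⟨Z, φ, hφ, -, hlim⟩ := exists_weak_subseq (z := fun i => u (r (i + J))) fun i => hf.norm_le (h0 i)
  have hms : Tendsto (fun i => φ i + J) atTop atTop := tendsto_atTop_mono (fun i => Nat.le_add_right _ _) hφ.tendsto_atTop
  exact ⟨Z, fun i => φ i + J, ⟨fun i => r (φ i + J), fun i => h0 _, hr.comp hms, hlim⟩, hms, fun i => h0 _, hlim⟩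

/-- The weak limits inherit the two-sided Duhamel representation. -/
theorem rep_of_mem_omegaSet (hf : Flow σ C M V u) {n : ℕ}
    (hchain : ∀ᵐ r ∂timeMeasure, ∃ W, PotChain σ C n W ∧ W 0 = V r) {up : L2} (hup : ‖up‖ ≤ M)
    (hlim : Scatters u up)
    {Z : L2} (hZ : Z ∈ omegaSet u) : Rep (sources σ C n (omegaSet u) 0) Z := by
  intro τ hτ N hN α hα ς hς g hg b hbint hb
  obtain ⟨t, ht0, ht, hZlim⟩ := hZ
  set Θ : ℝ → ℂ := fun ξ => cutPoly α ς (.X ^ N) ξ * 𝓕 g ξ with hΘd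
  have hΘ : RapidDecay Θ := hg.rapidDecay.cutPoly_mul hα ς _
  set F : ℕ → ℝ → ℂ := fun j s => pair (srcE V u (t j + τ * s)) (psym τ s α ς N g) with hF
  set m : ℕ → ℝ → ℝ := fun j s => max (‖F j s‖ - b s) 0 with hm
  have hFint : ∀ j, Integrable (F j) := fun j => by
    have := hf.integrable_pair_srcE hN hα hς hg.hat hτ (t j)
    rwa [hg.coe_hat] at this
  have hmint : ∀ j, IntegrableOn (m j) (Ioi 0) := fun j =>
    ((hFint j).norm.integrableOn.sub hbint).pos_part
  obtain ⟨K, hK, hdec⟩ := hf.exists_srcE_decay hN hα hς hg.hat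
  have hdec' : ∀ᵐ s : ℝ, ∀ j, ‖F j s‖ ≤ K * (1 + s ^ 2)⁻¹ := by
    rw [ae_all_iff]
    intro j
    filter_upwards [(quasi_affine hτ (t j)).ae hdec] with s hs
    have := hs (-τ * s)
    rw [hg.coe_hat] at this
    refine this.trans_eq ?_
    rcases hτ with rfl | rfl <;> simp
  have hpos : ∀ᵐ s ∂(volume : Measure ℝ).restrict (Ioi 0), (0 : ℝ) < s := ae_restrict_mem measurableSet_Ioi
  have hb0 : ∀ᵐ s ∂(volume : Measure ℝ).restrict (Ioi 0), 0 ≤ b s := by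
    have hZn : ∃ G : L2, G ∈ sources σ C n (omegaSet u) 0 := by
      obtain ⟨r, W, hW, -⟩ : ∃ r W, PotChain σ C n W ∧ W 0 = V r := by
        have : (ae timeMeasure).NeBot := by
          rw [ae_neBot, timeMeasure]
          intro h
          have := congrArg (fun μ : Measure ℝ => μ univ) h
          simp at this
        exact hchain.exists
      have hm0 : MemLp (fun x => W 0 x * Z x) 2 volume :=
        memLp_bdd_mul (hW.meas 0 (Nat.zero_le _))
          (hW.bound_const (by linarith [hf.two_lt]) hf.C_nonneg (Nat.zero_le _)) (Lp.memLp _)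
      exact ⟨hm0.toLp _, W, hW, Z, ⟨t, ht0, ht, hZlim⟩, hm0.coeFn_toLp⟩
    obtain ⟨G, hG⟩ := hZn
    filter_upwards [hpos] with s hs
    exact (norm_nonneg _).trans (hb s hs G hG)
  have hmlim : Tendsto (fun j => ∫ s in Ioi (0 : ℝ), m j s) atTop (𝓝 0) := by
    suffices h : Tendsto (fun j => ∫ s in Ioi (0 : ℝ), m j s) atTop (𝓝 (∫ s in Ioi (0 : ℝ), (0 : ℝ))) by
      rwa [integral_zero] at h
    refine tendsto_integral_of_dominated_convergence (fun s => K * (1 + s ^ 2)⁻¹) (fun j => (hmint j).1)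
      (integrable_inv_one_add_sq.const_mul K).integrableOn (fun j => ?_) ?_
    · filter_upwards [ae_restrict_of_ae hdec', hb0] with s hs hbs
      rw [Real.norm_of_nonneg (le_max_right _ _)]
      refine max_le ?_ ((norm_nonneg _).trans (hs j))
      linarith [hs j]
    · have hch : ∀ᵐ s : ℝ, ∀ j, 0 ≤ t j + τ * s → ∃ W, PotChain σ C n W ∧ W 0 = V (t j + τ * s) := by
        rw [ae_all_iff]
        exact fun j => (quasi_affine hτ (t j)).ae (ae_of_time hchain)
      filter_upwards [ae_restrict_of_ae hch, hpos] with s hs hs0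
      refine tendsto_of_subseq_tendsto fun ns hns => ?_
      have hr : Tendsto (fun i => t (ns i) + τ * s) atTop atTop :=
        tendsto_atTop_add_const_right _ _ (ht.comp hns)
      obtain ⟨Y, ms, hY, -, hr0, hYlim⟩ := hf.exists_omega_subseq hr
      refine ⟨ms, ?_⟩
      have hq := hf.tendsto_wt_sub hr0 hY hYlim
      have hps : RapidDecay (psym τ s α ς N g) := hg.psym τ s hα ς N
      have hq' : Tendsto (fun i => C * n2 (wt (-1) (u (t (ns (ms i)) + τ * s) - Y : L2)) * n2 (psym τ s α ς N g))
          atTop (𝓝 0) := by simpa using (hq.const_mul C).mul_const (n2 (psym τ s α ς N g))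
      refine squeeze_zero (fun i => le_max_right _ _) (fun i => ?_) hq'
      obtain ⟨W, hW, hW0⟩ := hs (ns (ms i)) (hr0 i)
      set r := t (ns (ms i)) + τ * s with hrd
      have hC := hf.C_nonneg
      refine max_le ?_ (by have := n2_nonneg (wt (-1) (u r - Y : L2)); have := n2_nonneg (psym τ s α ς N g); positivity)
      have hWb := hW.bound_const (by linarith [hf.two_lt]) hC (Nat.zero_le n)
      have hWd : ∀ᵐ x, ‖W 0 x‖ ≤ C * jap x ^ (-σ) := by simpa using hW.bound 0 (Nat.zero_le n)
      have hWm := hW.meas 0 (Nat.zero_le n)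
      have hm0 : MemLp (fun x => W 0 x * Y x) 2 volume := memLp_bdd_mul hWm hWb (Lp.memLp _)
      have hm1 : MemLp (fun x => W 0 x * (u r - Y : L2) x) 2 volume := memLp_bdd_mul hWm hWb (Lp.memLp _)
      have h1 := hb s hs0 (hm0.toLp _) ⟨W, hW, Y, hY, hm0.coeFn_toLp⟩
      have e1 : pair (hm0.toLp _ : L2) (psym τ s α ς N g) = pair (fun x => W 0 x * Y x) (psym τ s α ς N g) :=
        integral_congr_ae (hm0.coeFn_toLp.mono fun x hx => by simp only [hx])
      have e2 : F (ns (ms i)) s = pair (fun x => W 0 x * Y x) (psym τ s α ς N g)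
          + pair (fun x => W 0 x * (u r - Y : L2) x) (psym τ s α ς N g) := by
        simp only [hF, pair]
        rw [← integral_add (integrable_mul_of_memLp hm0 hps.memLp_fourierInv) (integrable_mul_of_memLp hm1 hps.memLp_fourierInv)]
        refine integral_congr_ae ?_
        filter_upwards [Lp.coeFn_sub (u r) Y] with x hx
        rw [srcE_of_nonneg (hr0 i), src, ← hrd, hW0, hx, Pi.sub_apply]
        ring
      have h2 := (WeaklyBound.norm_pair_le hm1 hps).trans (mul_le_mul_of_nonneg_right
        (n2_decay_mul_le (by linarith [hf.two_lt]) hC hWd (u r - Y)) (n2_nonneg _))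
      rw [e1] at h1
      rw [e2]
      linarith [norm_add_le (pair (fun x => W 0 x * Y x) (psym τ s α ς N g))
        (pair (fun x => W 0 x * (u r - Y : L2) x) (psym τ s α ς N g))]
  have hfree := (tendsto_pair_freeProp_zero (if τ = 1 then up else u 0) hN hα hς hg.hat).comp ht
  rw [hg.coe_hat] at hfree
  have hZΘ : Tendsto (fun j => ‖pair (u (t j)) Θ‖) atTop (𝓝 ‖pair Z Θ‖) := by
    simp only [pair_eq_bilin _ hΘ]
    exact (hZlim _).norm
  have hupper := (hfree.norm.add_const (∫ s in Ioi (0 : ℝ), b s)).add hmlim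
  rw [norm_zero, zero_add, add_zero] at hupper
  refine le_of_tendsto_of_tendsto' hZΘ hupper fun j => ?_
  have h1 := hf.norm_pair_sub_free_le hup hlim hN hα hς hg hτ (ht0 j)
  rw [← hΘd, pair_sub _ _ hΘ] at h1
  have h2 : ∫ s in Ioi (0 : ℝ), ‖F j s‖ ≤ ∫ s in Ioi (0 : ℝ), (b s + m j s) :=
    integral_mono (hFint j).norm.integrableOn (hbint.add (hmint j)) fun s => by
      have := le_max_left (‖F j s‖ - b s) 0
      simp only [hm]
      linarith
  rw [integral_add hbint (hmint j)] at h2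
  have h3 := norm_sub_norm_le (pair (u (t j)) Θ) (pair (freeProp (t j) (if τ = 1 then up else u 0)) Θ)
  simp only [Function.comp]
  have h4 : ∫ s in Ioi (0 : ℝ), ‖pair (srcE V u (t j + τ * s)) (psym τ s α ς N g)‖ = ∫ s in Ioi (0 : ℝ), ‖F j s‖ := rfl
  linarith

end Flow

/-- An integrable majorant for the Duhamel integrand on a shell. -/
theorem exists_majorant {σ : ℝ} (hσ : 2 < σ) : ∃ C0 κ : ℝ, 0 ≤ C0 ∧ 0 < κ ∧
    ∀ ν τ : ℝ, (ν = 1 ∨ ν = -1) → (τ = 1 ∨ τ = -1) → ∀ (α δ A : ℝ) (i : ℕ), 0 < α → 1 ≤ α * 2 ^ i → 0 < δ → δ ≤ 1 →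
      0 ≤ A → ∀ g : ℝ → ℂ, IsTest g → tsupport g ⊆ shell ν i →
      ∃ b : ℝ → ℝ, IntegrableOn b (Ioi 0) ∧ (∀ s, 0 < s → 0 ≤ b s) ∧
        ∫ s in Ioi 0, b s ≤ C0 * A * (δ + δ⁻¹ * (α⁻¹ + α⁻¹ ^ 6)) * ((2 : ℝ) ^ i) ^ (-κ) * n2 g ∧
        ∀ s, 0 < s → ∀ G G' : L2, HasWeakDeriv 1 G G' →
          MemLp (wt σ G) 2 volume → n2 (wt σ G) ≤ A →
          MemLp (wt σ G') 2 volume → n2 (wt σ G') ≤ A →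
          ‖pair G (psym τ s α (ν * τ) 6 (deriv g))‖ ≤ b s := by
  obtain ⟨Cs, hCs, hs⟩ := exists_shell_bound (a := σ) (by linarith) (N := 6) (by norm_num)
  obtain ⟨Cd, hCd, hd⟩ := exists_shell_bound_deriv (a := σ) hσ.le (N := 6) (by norm_num)
  refine ⟨Cs + 4 * Cd, min (σ - 2) 1, by positivity, lt_min (by linarith) one_pos, ?_⟩
  intro ν τ hν hτ α δ A i hα hαR hδ hδ1 hA g hg hsupp
  set κ := min (σ - 2) 1 with hκ
  have hκ1 : κ ≤ σ - 2 := min_le_left _ _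
  have hκ2 : κ ≤ 1 := min_le_right _ _
  set R : ℝ := 2 ^ i with hR
  have hR1 : 1 ≤ R := one_le_pow₀ (by norm_num)
  have hR0 : 0 < R := by positivity
  have hshell : ShellSupp ν R g := fun y hy => by
    obtain ⟨h1, h2⟩ := shellSupp_of_tsupport hsupp y hy
    constructor <;> linarith
  have hn := n2_nonneg g
  set X := A * n2 g with hX
  have hX0 : 0 ≤ X := by positivity
  have hr1 : R ^ (-σ) ≤ R ^ (-κ) := Real.rpow_le_rpow_of_exponent_le hR1 (by linarith)
  have hr2 : R ^ (2 - σ) ≤ R ^ (-κ) := Real.rpow_le_rpow_of_exponent_le hR1 (by linarith)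
  have hr3 : R ^ 5 * (α * R)⁻¹ ^ 6 ≤ α⁻¹ ^ 6 * R ^ (-κ) := by
    have e : R ^ 5 * (α * R)⁻¹ ^ 6 = α⁻¹ ^ 6 * R ^ (-1 : ℝ) := by
      rw [Real.rpow_neg_one, mul_inv]; field_simp
    rw [e]
    gcongr
  set e := Cs * (R ^ (-σ) + R ^ 5 * (α * R)⁻¹ ^ 6) * X with he
  set c := Cd * (α⁻¹ * R ^ (2 - σ)) * X with hc
  set d := Cd * (R ^ 5 * (α * R)⁻¹ ^ 6) * X with hdd
  have he0 : 0 ≤ e := by positivity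
  have hc0 : 0 ≤ c := by positivity
  have hd0 : 0 ≤ d := by positivity
  set b : ℝ → ℝ := fun s => if s ≤ δ then e else c * s ^ (-1 - (1 : ℝ)) + d * (1 + s ^ 2)⁻¹ with hb
  have hU : Ioi (0 : ℝ) = Ioc 0 δ ∪ Ioi δ := (Ioc_union_Ioi_eq_Ioi hδ.le).symm
  have hb1 : EqOn b (fun _ => e) (Ioc 0 δ) := fun s hs => if_pos hs.2
  have hb2 : EqOn b (fun s => c * s ^ (-1 - (1 : ℝ)) + d * (1 + s ^ 2)⁻¹) (Ioi δ) := fun s hs =>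
    if_neg (not_le.2 hs)
  have i1 : IntegrableOn b (Ioc 0 δ) :=
    (integrableOn_const (by simp)).congr_fun (fun s hs => (hb1 hs).symm) measurableSet_Ioc
  have i2 : IntegrableOn b (Ioi δ) :=
    (integrableOn_tail hδ one_pos c d).congr_fun (fun s hs => (hb2 hs).symm) measurableSet_Ioi
  refine ⟨b, by rw [hU]; exact i1.union i2, fun s hs => ?_, ?_, ?_⟩
  · simp only [hb]
    split_ifs <;> positivity
  · rw [hU, setIntegral_union (Ioc_disjoint_Ioi le_rfl) measurableSet_Ioi i1 i2,
      setIntegral_congr_fun measurableSet_Ioc hb1, setIntegral_congr_fun measurableSet_Ioi hb2]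
    have h1 : ∫ _ in Ioc 0 δ, e = δ * e := by
      rw [setIntegral_const]; simp [Measure.real, hδ.le]
    have h2 := integral_tail_le hδ hδ1 one_pos le_rfl hc0 hd0
    rw [h1]
    have hδδ : δ ≤ δ⁻¹ := hδ1.trans ((one_le_inv₀ hδ).2 hδ1)
    set r := R ^ (-κ) with hr
    have hr0 : 0 ≤ r := by positivity
    have k1 : δ * e ≤ Cs * X * r * (δ + δ⁻¹ * α⁻¹ ^ 6) := by
      calc δ * e ≤ δ * (Cs * (r + α⁻¹ ^ 6 * r) * X) := by rw [he]; gcongr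
        _ = Cs * X * r * (δ + δ * α⁻¹ ^ 6) := by ring
        _ ≤ _ := by gcongr
    have k2 : (c * (1 : ℝ)⁻¹ + d * 4) * δ⁻¹ ≤ 4 * Cd * X * r * (δ⁻¹ * (α⁻¹ + α⁻¹ ^ 6)) := by
      calc (c * (1 : ℝ)⁻¹ + d * 4) * δ⁻¹ ≤ (Cd * (α⁻¹ * r) * X * 1⁻¹ + Cd * (α⁻¹ ^ 6 * r) * X * 4) * δ⁻¹ := by
            rw [hc, hdd]; gcongr
        _ ≤ (4 * (Cd * (α⁻¹ * r) * X) + Cd * (α⁻¹ ^ 6 * r) * X * 4) * δ⁻¹ := by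
            have : 0 ≤ Cd * (α⁻¹ * r) * X := by positivity
            refine mul_le_mul_of_nonneg_right ?_ (by positivity)
            rw [inv_one]; linarith
        _ = _ := by ring
    have p1 : 0 ≤ α⁻¹ := by positivity
    have p2 : 0 ≤ Cs * X * r * (δ⁻¹ * α⁻¹) := by positivity
    have p3 : 0 ≤ 4 * Cd * X * r * δ := by positivity
    calc _ ≤ Cs * X * r * (δ + δ⁻¹ * α⁻¹ ^ 6) + 4 * Cd * X * r * (δ⁻¹ * (α⁻¹ + α⁻¹ ^ 6)) := by linarith
      _ ≤ (Cs + 4 * Cd) * X * (δ + δ⁻¹ * (α⁻¹ + α⁻¹ ^ 6)) * r := by linarith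
      _ = _ := by rw [hX]; ring
  · intro s hs0 G G' hG m0 b0 m1 b1
    simp only [hb]
    split_ifs with hsδ
    · rw [pair_weakDeriv_psym hG hg τ s hα, norm_neg]
      refine (hs ν τ hν hτ s α R hs0.le hα hR1 G' g m1 hg hshell).trans ?_
      rw [he, hX]
      gcongr
    · refine (hd ν τ hν hτ s α R hs0 hα hR1 hαR G g m0 hg hshell).trans ?_
      have hpow : s ^ (-1 - (1 : ℝ)) = (s ^ 2)⁻¹ := by
        rw [show (-1 - (1 : ℝ)) = -(2 : ℕ) by norm_num, Real.rpow_neg hs0.le, Real.rpow_natCast]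
      rw [hpow, hc, hdd, hX]
      calc _ ≤ Cd * (α⁻¹ * R ^ (2 - σ) * (s ^ 2)⁻¹ + R ^ 5 * (α * R)⁻¹ ^ 6 * (1 + s ^ 2)⁻¹) * (A * n2 g) := by
            have hnn := mul_nonneg (n2_nonneg (wt σ G)) hn
            have := min_le_right (R ^ (1 - σ) * s⁻¹) (α⁻¹ * R ^ (2 - σ) * (s ^ 2)⁻¹)
            refine mul_le_mul (mul_le_mul_of_nonneg_left (add_le_add_left this _) hCd) ?_ hnn (by positivity)
            gcongr
        _ = _ := by ring

/-- Control of an `L²` function far out on one side by its shells. -/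
theorem exists_tail_bound {κ : ℝ} (hκ : 0 < κ) : ∃ S, 0 ≤ S ∧ ∀ (F : L2) (ν B : ℝ) (i0 : ℕ), (ν = 1 ∨ ν = -1) → 0 ≤ B →
    (∀ i, i0 ≤ i → ∀ g, IsTest g → tsupport g ⊆ shell ν i → ‖∫ x, F x * g x‖ ≤ B * ((2 : ℝ) ^ i) ^ (-κ) * n2 g) →
    n2 (indicator {x | 2 ^ i0 - 1 < ν * x} F) ≤ S * B * ((2 : ℝ) ^ i0) ^ (-(κ / 2)) := by
  have hpow : ∀ (r : ℝ) (i : ℕ), ((2 : ℝ) ^ i) ^ r = ((2 : ℝ) ^ r) ^ i := fun r i => by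
    rw [← Real.rpow_natCast, ← Real.rpow_mul (by norm_num), mul_comm, Real.rpow_mul (by norm_num), Real.rpow_natCast]
  have hsum : Summable fun i : ℕ => ((2 : ℝ) ^ i) ^ (-(κ / 2)) := by
    simp only [hpow]
    exact summable_geometric_of_lt_one (by positivity) (Real.rpow_lt_one_of_one_lt_of_neg (by norm_num) (by linarith))
  refine ⟨2 * ∑' i : ℕ, ((2 : ℝ) ^ i) ^ (-(κ / 2)), by positivity, fun F ν B i0 hν hB h => ?_⟩
  set X : Set ℝ := {x | 2 ^ i0 - 1 < ν * x} with hX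
  have hXm : MeasurableSet X := measurableSet_lt measurable_const (by fun_prop)
  have hFm : MemLp (indicator X F) 2 volume := (Lp.memLp F).indicator hXm
  set E := B * ((2 : ℝ) ^ i0) ^ (-(κ / 2)) with hE
  have hE0 : 0 ≤ E := by positivity
  have key := n2_le_of_shells hFm.1 (c := fun i => E * ((2 : ℝ) ^ i) ^ (-(κ / 2))) (hsum.mul_left _)
    (fun i => by positivity) (fun ν' _ i => hFm.indicator (isOpen_shell ν' i).measurableSet) fun ν' hν' i => by
      by_cases hcase : ν' = ν ∧ i0 ≤ i
      · obtain ⟨rfl, hi⟩ := hcase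
        have e : indicator (shell ν' i) (indicator X F) = indicator (shell ν' i) F := by
          rw [indicator_indicator]
          congr 1
          refine inter_eq_left.2 fun x hx => ?_
          have : (2 : ℝ) ^ i0 ≤ 2 ^ i := pow_le_pow_right₀ (by norm_num) hi
          show (2 : ℝ) ^ i0 - 1 < ν' * x
          linarith [hx.1]
        rw [e]
        refine n2_indicator_le_of_dual F (isOpen_shell ν' i) (by positivity) fun g hg hsupp => ?_
        refine (h i hi g hg hsupp).trans (mul_le_mul_of_nonneg_right ?_ (n2_nonneg g))
        rw [hE, mul_assoc]
        refine mul_le_mul_of_nonneg_left ?_ hB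
        have e2 : ((2 : ℝ) ^ i) ^ (-κ) = ((2 : ℝ) ^ i) ^ (-(κ / 2)) * ((2 : ℝ) ^ i) ^ (-(κ / 2)) := by
          rw [← Real.rpow_add (by positivity)]; congr 1; ring
        rw [e2]
        refine mul_le_mul_of_nonneg_right ?_ (by positivity)
        exact Real.rpow_le_rpow_of_nonpos (by positivity) (pow_le_pow_right₀ (by norm_num) hi) (by linarith)
      · have e : indicator (shell ν' i) (indicator X F) = fun _ => 0 := by
          rw [indicator_indicator]
          have : shell ν' i ∩ X = ∅ := by
            rw [eq_empty_iff_forall_notMem]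
            rintro x ⟨hx1, hx2⟩
            have hx2' : (2 : ℝ) ^ i0 - 1 < ν * x := hx2
            have p1 : (1 : ℝ) ≤ 2 ^ i0 := one_le_pow₀ (by norm_num)
            have p2 : (1 : ℝ) ≤ 2 ^ i := one_le_pow₀ (by norm_num)
            by_cases hνν : ν' = ν
            · subst hνν
              have hlt : i < i0 := by
                by_contra hc
                exact hcase ⟨rfl, not_lt.1 hc⟩
              have : (2 : ℝ) ^ (i + 1) ≤ 2 ^ i0 := pow_le_pow_right₀ (by norm_num) hlt
              linarith [hx1.2]
            · have : ν' = -ν := by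
                rcases hν with rfl | rfl <;> rcases hν' with rfl | rfl <;> first | exact absurd rfl hνν | norm_num
              subst this
              linarith [hx1.1]
          rw [this, indicator_empty]
        rw [e, n2_zero]
        positivity
  refine key.2.trans_eq ?_
  rw [tsum_mul_left, hE]; ring

theorem n2_indicator_add_le {X : Set ℝ} (hX : MeasurableSet X) (a b : L2) :
    n2 (indicator X (a + b : L2)) ≤ n2 (indicator X a) + n2 (indicator X b) := by
  refine (n2_congr ?_).trans_le (n2_add_le ((Lp.memLp a).indicator hX) ((Lp.memLp b).indicator hX))
  filter_upwards [Lp.coeFn_add a b] with x hx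
  by_cases hxX : x ∈ X
  · simp only [indicator_of_mem hxX, hx, Pi.add_apply]
  · simp only [indicator_of_notMem hxX, add_zero]

theorem norm_cutPoly_X_pow_le {α : ℝ} (hα : 0 < α) (ς : ℝ) (N : ℕ) (ξ : ℝ) : ‖cutPoly α ς (.X ^ N) ξ‖ ≤ 1 := by
  have h0 := halfCut_nonneg hα ς ξ
  rw [cutPoly, Complex.norm_real, Polynomial.eval_pow, Polynomial.eval_X, Real.norm_of_nonneg (by positivity)]
  exact pow_le_one₀ h0 (halfCut_le_one hα ς ξ)

theorem mult_sub {m : ℝ → ℂ} (hm : Continuous m) {K : ℝ} (hK : ∀ ξ, ‖m ξ‖ ≤ K) (z w : L2) :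
    mult m (z - w) = mult m z - mult m w := by
  refine fourierInv_injective (Lp.ext ?_)
  filter_upwards [fourierInv_mult_ae hm hK (z - w), fourierInv_mult_ae hm hK z, fourierInv_mult_ae hm hK w,
    fourierInv_sub_ae z w, fourierInv_sub_ae (mult m z) (mult m w)] with ξ h1 h2 h3 h4 h5
  rw [h1, h4, h5, h2, h3]; ring

theorem HasWeakDeriv.exists_test_deriv_approx {h h' : L2} (hd : HasWeakDeriv 1 h h') {ε : ℝ} (hε : 0 < ε) :
    ∃ φ, ∃ hφ : IsTest φ, ‖h' - hφ.deriv.memLp.toLp _‖ ≤ ε := by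
  obtain ⟨ρ, hρ, -, h1⟩ := exists_smooth_approx hd (half_pos hε)
  set ρ1 : ℝ → ℂ := fun ξ => 2 * π * Complex.I * ((ξ : ℂ) * ρ ξ)
  have hr1 : RapidDecay ρ1 := hρ.id_mul.const_mul _
  have d1 : deriv (𝓕⁻ ρ) = 𝓕⁻ ρ1 := hρ.deriv_fourierInv
  have m1 : MemLp (deriv (𝓕⁻ ρ)) 2 volume := hρ.memLp_deriv_fourierInv
  have m2 : MemLp (deriv (deriv (𝓕⁻ ρ))) 2 volume := by rw [d1]; exact hr1.memLp_deriv_fourierInv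
  obtain ⟨ψ, p1, p2, -, t1, -⟩ := exists_test_approx hρ.contDiff_fourierInv hρ.memLp_fourierInv m1 m2
  obtain ⟨n, hn⟩ := (t1.eventually (gt_mem_nhds (half_pos hε))).exists
  have hψ : IsTest (ψ n) := ⟨p1 n, p2 n⟩
  refine ⟨ψ n, hψ, ?_⟩
  rw [← n2_sub_coe]
  have e : n2 (fun x => h' x - (hψ.deriv.memLp.toLp _ : L2) x)
      = n2 (fun x => (h' x - deriv (𝓕⁻ ρ) x) + (deriv (𝓕⁻ ρ) x - deriv (ψ n) x)) := by
    refine n2_congr ?_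
    filter_upwards [hψ.deriv.memLp.coeFn_toLp] with x hx
    rw [hx]; ring
  rw [e]
  refine (n2_add_le ((Lp.memLp h').sub m1) (m1.sub hψ.deriv.memLp)).trans ?_
  have a := n2_sub_comm h' (deriv (𝓕⁻ ρ))
  have b := n2_sub_comm (deriv (𝓕⁻ ρ)) (deriv (ψ n))
  change n2 (fun x => h' x - deriv (𝓕⁻ ρ) x) + n2 (fun x => deriv (𝓕⁻ ρ) x - deriv (ψ n) x) ≤ ε
  linarith

theorem IsTest.hasWeakDeriv {φ : ℝ → ℂ} (hφ : IsTest φ) :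
    HasWeakDeriv 1 (hφ.memLp.toLp φ : L2) (hφ.deriv.memLp.toLp _ : L2) := by
  refine hasWeakDeriv_toLp _ _ ?_
  have h := hφ.rapidDecay.hasWeakDeriv_fourierInv
  rwa [hφ.fourierInv_fourier] at h

theorem IsTest.memLp_wt {φ : ℝ → ℂ} (hφ : IsTest φ) (a : ℝ) : MemLp (wt a φ) 2 volume :=
  memLp_of_test ((Complex.continuous_ofReal.comp (continuous_jap_rpow a)).mul hφ.smooth.continuous) hφ.compact.mul_left

/-- The incoming part of a free wave leaves every half line. -/
theorem tendsto_incoming_free {h h' : L2} (hd : HasWeakDeriv 1 h h') {ν : ℝ} (hν : ν = 1 ∨ ν = -1) {α : ℝ} (hα : 0 < α)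
    {i0 : ℕ} (hα0 : 1 ≤ α * 2 ^ i0) :
    Tendsto (fun t => n2 (indicator {x | 2 ^ i0 - 1 < ν * x} (mult (cutPoly α (-ν) (.X ^ 6)) (freeProp t h')))) atTop (𝓝 0) := by
  obtain ⟨S, hS, htail⟩ := exists_tail_bound one_pos
  obtain ⟨Cd, hCd, hsb⟩ := exists_shell_bound_deriv (a := 3) (by norm_num) (N := 6) (by norm_num)
  have hm := continuous_cutPoly hα (-ν) (.X ^ 6)
  have hK := norm_cutPoly_X_pow_le hα (-ν) 6
  set X : Set ℝ := {x | 2 ^ i0 - 1 < ν * x} with hX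
  rw [Metric.tendsto_nhds]
  intro ε hε
  obtain ⟨φ, hφ, hφε⟩ := hd.exists_test_deriv_approx (half_pos hε)
  set p : L2 := hφ.memLp.toLp φ with hp
  set p' : L2 := hφ.deriv.memLp.toLp _ with hp'
  have hpd : HasWeakDeriv 1 p p' := hφ.hasWeakDeriv
  have hpw : MemLp (wt 3 p) 2 volume := (hφ.memLp_wt 3).ae_eq
    (hφ.memLp.coeFn_toLp.mono fun x hx => by simp only [wt, hp, hx])
  set A := n2 (wt 3 p) with hA
  have hA0 : 0 ≤ A := n2_nonneg _
  set B := Cd * (1 + α⁻¹ ^ 6) * A with hB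
  have hB0 : 0 ≤ B := by positivity
  have hbound : ∀ t : ℝ, 0 < t → n2 (indicator X (mult (cutPoly α (-ν) (.X ^ 6)) (freeProp t p')))
      ≤ S * (B * t⁻¹) * ((2 : ℝ) ^ i0) ^ (-((1 : ℝ) / 2)) := by
    intro t ht
    refine htail _ ν (B * t⁻¹) i0 hν (by positivity) fun i hi g hg hsupp => ?_
    set R : ℝ := 2 ^ i with hR
    have hR1 : 1 ≤ R := one_le_pow₀ (by norm_num)
    have hR0 : 0 < R := by positivity
    have hαR : 1 ≤ α * R := hα0.trans (mul_le_mul_of_nonneg_left (pow_le_pow_right₀ (by norm_num) hi) hα.le)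
    have hshell : ShellSupp ν R g := fun y hy => by
      obtain ⟨h1, h2⟩ := shellSupp_of_tsupport hsupp y hy
      constructor <;> linarith
    have hr : RapidDecay fun ξ => cutPoly α (-ν) (.X ^ 6) ξ * 𝓕 g ξ := hg.rapidDecay.cutPoly_mul hα _ _
    have e : ∫ x, (mult (cutPoly α (-ν) (.X ^ 6)) (freeProp t p')) x * g x = -pair p (psym (-1) t α (ν * (-1)) 6 (deriv g)) := by
      rw [← hg.pair_fourier, pair_mult hm hK _ hg.rapidDecay, pair_freeProp _ _ hr, pair_weakDeriv_psym hpd hg _ _ hα,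
        neg_neg, psym_eq]
      simp
    rw [e, norm_neg]
    refine (hsb ν (-1) hν (Or.inr rfl) t α R ht hα hR1 hαR p g hpw hg hshell).trans ?_
    have hn := n2_nonneg g
    have k1 : min (R ^ (1 - (3 : ℝ)) * t⁻¹) (α⁻¹ * R ^ (2 - (3 : ℝ)) * (t ^ 2)⁻¹) ≤ R ^ (-1 : ℝ) * t⁻¹ := by
      refine (min_le_left _ _).trans ?_
      gcongr
      norm_num
    have k2 : R ^ 5 * (α * R)⁻¹ ^ 6 * (1 + t ^ 2)⁻¹ ≤ α⁻¹ ^ 6 * R ^ (-1 : ℝ) * t⁻¹ := by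
      have e2 : R ^ 5 * (α * R)⁻¹ ^ 6 = α⁻¹ ^ 6 * R ^ (-1 : ℝ) := by
        rw [Real.rpow_neg_one, mul_inv]; field_simp
      rw [e2]
      gcongr
      nlinarith [sq_nonneg (t - 1)]
    calc _ ≤ Cd * (R ^ (-1 : ℝ) * t⁻¹ + α⁻¹ ^ 6 * R ^ (-1 : ℝ) * t⁻¹) * (A * n2 g) := by gcongr
      _ = _ := by rw [hB]; ring
  have hlim : Tendsto (fun t : ℝ => S * (B * t⁻¹) * ((2 : ℝ) ^ i0) ^ (-((1 : ℝ) / 2))) atTop (𝓝 0) := by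
    simpa using ((tendsto_inv_atTop_zero.const_mul B).const_mul S).mul_const (((2 : ℝ) ^ i0) ^ (-((1 : ℝ) / 2)))
  filter_upwards [hlim.eventually (gt_mem_nhds (half_pos hε)), eventually_gt_atTop 0] with t ht ht0
  rw [dist_zero_right, Real.norm_of_nonneg (n2_nonneg _)]
  have hsplit : mult (cutPoly α (-ν) (.X ^ 6)) (freeProp t h')
      = mult (cutPoly α (-ν) (.X ^ 6)) (freeProp t (h' - p')) + mult (cutPoly α (-ν) (.X ^ 6)) (freeProp t p') := by
    rw [freeProp_sub, mult_sub hm hK, sub_add_cancel]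
  have hXm : MeasurableSet X := measurableSet_lt measurable_const (by fun_prop)
  rw [hsplit]
  refine (n2_indicator_add_le hXm _ _).trans_lt ?_
  have h1 := n2_indicator_le (Lp.memLp (mult (cutPoly α (-ν) (.X ^ 6)) (freeProp t (h' - p')))) X
  rw [n2_coe] at h1
  have h2 := norm_mult_le hm hK (freeProp t (h' - p'))
  rw [norm_freeProp, one_mul] at h2
  linarith [hbound t ht0]

/-- Sources built from functions bounded in `H¹` have a weak derivative with the full decay. -/
theorem sources_regular {σ C M : ℝ} (hσ : 0 ≤ σ) (hC : 0 ≤ C) (hM : 0 ≤ M) {n : ℕ} (hn : 1 ≤ n) {𝒮 : Set L2}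
    (h : ∀ z ∈ 𝒮, ‖z‖ ≤ M ∧ ∃ z' : L2, HasWeakDeriv 1 z z' ∧ ‖z'‖ ≤ M) {G : L2} (hG : G ∈ sources σ C n 𝒮 0) :
    ∃ G' : L2, HasWeakDeriv 1 G G' ∧ MemLp (wt σ G) 2 volume ∧ n2 (wt σ G) ≤ 2 * (C * M) ∧
      MemLp (wt σ G') 2 volume ∧ n2 (wt σ G') ≤ 2 * (C * M) := by
  have hreg : ∀ z ∈ 𝒮, Diff 1 z := fun z hz i hi => by
    obtain rfl : i = 0 := by omega
    obtain ⟨-, z', hd, -⟩ := h z hz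
    rw [Function.iterate_one, Function.iterate_zero, id, hd.wd_eq]
    exact hd
  have hr : ∀ z ∈ 𝒮, ∀ j ≤ 1, MemLp (wt ((fun _ : ℕ => (0 : ℝ)) j) (wd^[j] z)) 2 volume ∧
      n2 (wt ((fun _ : ℕ => (0 : ℝ)) j) (wd^[j] z)) ≤ M := fun z hz j hj => by
    obtain ⟨hzM, z', hd, hz'⟩ := h z hz
    rw [wt_zero, n2_coe]
    refine ⟨Lp.memLp _, ?_⟩
    interval_cases j
    · exact hzM
    · rwa [Function.iterate_one, hd.wd_eq]
  obtain ⟨G', hG', hd⟩ := sources_succ hσ hC (k := 0) hn hreg hG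
  obtain ⟨m0, b0⟩ := sources_bound (a := σ) hC (Nat.zero_le n) (fun _ => 0) (fun z hz j hj => hr z hz j (by omega))
    (fun i j _ => by simp) hG
  obtain ⟨m1, b1⟩ := sources_bound (a := σ) hC hn (fun _ => 0) hr (fun i j _ => by simp) hG'
  refine ⟨G', hd, m0, b0.trans ?_, m1, b1.trans_eq (by norm_num)⟩
  have : 0 ≤ C * M := by positivity
  norm_num
  linarith

namespace Flow
variable {σ C M : ℝ} {V : ℝ → ℝ → ℂ} {u : ℝ → L2}

/-- Shell bounds for the outgoing part of the distance between the flow and its weak limits. -/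
theorem exists_shell_bound_sub (hf : Flow σ C M V u) {n : ℕ} (hn : 1 ≤ n)
    (hchain : ∀ᵐ r ∂timeMeasure, ∃ W, PotChain σ C n W ∧ W 0 = V r) {up : L2} (hup : ‖up‖ ≤ M)
    (hlim : Scatters u up) :
    ∃ C0 κ : ℝ, 0 ≤ C0 ∧ 0 < κ ∧ ∀ ν τ : ℝ, (ν = 1 ∨ ν = -1) → (τ = 1 ∨ τ = -1) →
      ∀ (α δ : ℝ) (i : ℕ), 0 < α → 1 ≤ α * 2 ^ i → 0 < δ → δ ≤ 1 →
      ∀ g : ℝ → ℂ, IsTest g → tsupport g ⊆ shell ν i → ∀ t, 0 ≤ t → ∀ Z ∈ omegaSet u, ∀ w : L2,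
      HasWeakDeriv 1 (u t - freeProp t (if τ = 1 then up else u 0) - Z : L2) w →
      ‖∫ x, (mult (cutPoly α (ν * τ) (.X ^ 6)) w) x * g x‖
        ≤ C0 * (δ + δ⁻¹ * (α⁻¹ + α⁻¹ ^ 6)) * ((2 : ℝ) ^ i) ^ (-κ) * n2 g := by
  obtain ⟨C0, κ, hC0, hκ, hmaj⟩ := exists_majorant hf.two_lt
  have hM := hf.M_nonneg
  have hC := hf.C_nonneg
  have hσ := hf.two_lt
  refine ⟨2 * (C0 * (2 * (C * M))), κ, by positivity, hκ, ?_⟩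
  intro ν τ hν hτ α δ i hα hαR hδ hδ1 g hg hsupp t ht Z hZ w hw
  obtain ⟨b, hbint, hb0, hbI, hb⟩ := hmaj ν τ hν hτ α δ (2 * (C * M)) i hα hαR hδ hδ1 (by positivity) g hg hsupp
  have hς : ν * τ = 1 ∨ ν * τ = -1 := by rcases hν with rfl | rfl <;> rcases hτ with rfl | rfl <;> norm_num
  have hm := continuous_cutPoly hα (ν * τ) (.X ^ 6)
  have hK := norm_cutPoly_X_pow_le hα (ν * τ) 6
  have hΘ : RapidDecay fun ξ => cutPoly α (ν * τ) (.X ^ 6) ξ * 𝓕 (deriv g) ξ := hg.deriv.rapidDecay.cutPoly_mul hα _ _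
  have e : ∫ x, (mult (cutPoly α (ν * τ) (.X ^ 6)) w) x * g x
      = -(pair (u t - freeProp t (if τ = 1 then up else u 0) : L2) (fun ξ => cutPoly α (ν * τ) (.X ^ 6) ξ * 𝓕 (deriv g) ξ)
        - pair Z (fun ξ => cutPoly α (ν * τ) (.X ^ 6) ξ * 𝓕 (deriv g) ξ)) := by
    rw [← hg.pair_fourier, pair_mult hm hK _ hg.rapidDecay, ← pair_sub _ _ hΘ,
      pair_weakDeriv_cut hw hg (hg.rapidDecay.cutPoly_mul hα _ _), neg_neg]
  have h1 := hf.norm_pair_sub_free_le hup hlim le_rfl hα hς hg.deriv hτ ht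
  have h2 : ∫ s in Ioi (0 : ℝ), ‖pair (srcE V u (t + τ * s)) (psym τ s α (ν * τ) 6 (deriv g))‖ ≤ ∫ s in Ioi 0, b s := by
    have hint := hf.integrable_pair_srcE le_rfl hα hς hg.deriv.hat hτ t
    rw [hg.deriv.coe_hat] at hint
    refine integral_mono_ae hint.norm.integrableOn hbint ?_
    have hch : ∀ᵐ s : ℝ, 0 ≤ t + τ * s → ∃ W, PotChain σ C n W ∧ W 0 = V (t + τ * s) :=
      (quasi_affine hτ t).ae (ae_of_time hchain)
    filter_upwards [ae_restrict_of_ae hch, ae_restrict_mem measurableSet_Ioi] with s hs hs0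
    rcases le_or_gt 0 (t + τ * s) with hpos | hneg
    · obtain ⟨W, hW, hW0⟩ := hs hpos
      have hWb := hW.bound_const (by linarith) hC (Nat.zero_le n)
      have hm0 : MemLp (fun x => W 0 x * u (t + τ * s) x) 2 volume :=
        memLp_bdd_mul (hW.meas 0 (Nat.zero_le n)) hWb (Lp.memLp _)
      obtain ⟨z', hd, hz, hz'⟩ := hf.h1 _ hpos
      obtain ⟨G', hG'd, m0, b0, m1, b1⟩ := sources_regular (by linarith) hC hM hn (𝒮 := {u (t + τ * s)})
        (fun z hz0 => by rw [mem_singleton_iff.1 hz0]; exact ⟨hz, z', hd, hz'⟩)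
        (show hm0.toLp _ ∈ sources σ C n {u (t + τ * s)} 0 from ⟨W, hW, _, rfl, hm0.coeFn_toLp⟩)
      have e1 : pair (srcE V u (t + τ * s)) (psym τ s α (ν * τ) 6 (deriv g))
          = pair (hm0.toLp _ : L2) (psym τ s α (ν * τ) 6 (deriv g)) :=
        integral_congr_ae (hm0.coeFn_toLp.mono fun x hx => by
          simp only [hx, srcE_of_nonneg hpos, src]; rw [hW0])
      rw [e1]
      exact hb s hs0 _ G' hG'd m0 b0 m1 b1
    · rw [srcE_of_neg hneg, pair_zero_left, norm_zero]
      exact hb0 s hs0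
  have h3 := hf.rep_of_mem_omegaSet hchain hup hlim hZ τ hτ 6 le_rfl α hα _ hς _ hg.deriv b hbint fun s hs G hG => by
    obtain ⟨G', hG'd, m0, b0, m1, b1⟩ := sources_regular (by linarith) hC hM hn
      (fun z hz => hf.exists_deriv_of_mem_omegaSet hz) hG
    exact hb s hs G G' hG'd m0 b0 m1 b1
  rw [e, norm_neg]
  refine (norm_sub_le _ _).trans ?_
  calc _ ≤ 2 * ∫ s in Ioi 0, b s := by linarith
    _ ≤ 2 * (C0 * (2 * (C * M)) * (δ + δ⁻¹ * (α⁻¹ + α⁻¹ ^ 6)) * ((2 : ℝ) ^ i) ^ (-κ) * n2 g) := by linarith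
    _ = _ := by ring

/-- Away from low frequencies, `u(t) - e^{-itΔ}u_+ - Z` is small in `Ḣ¹` far out. -/
theorem exists_tail_estimate (hf : Flow σ C M V u) {n : ℕ} (hn : 1 ≤ n)
    (hchain : ∀ᵐ r ∂timeMeasure, ∃ W, PotChain σ C n W ∧ W 0 = V r) {up up' : L2} (hup : ‖up‖ ≤ M)
    (hupd : HasWeakDeriv 1 up up')
    (hlim : Scatters u up) :
    ∃ S κ : ℝ, 0 ≤ S ∧ 0 < κ ∧ ∀ ν : ℝ, (ν = 1 ∨ ν = -1) →
      ∀ (α δ : ℝ) (i : ℕ), 0 < α → 1 ≤ α * 2 ^ i → 0 < δ → δ ≤ 1 → ∀ ε > 0, ∀ᶠ t in atTop,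
      ∀ Z ∈ omegaSet u, ∀ z : L2, HasWeakDeriv 1 (u t - freeProp t up - Z : L2) z →
      n2 (indicator {x | 2 ^ i - 1 < ν * x} (z - mult (lowCut α 6) z : L2))
        ≤ S * (δ + δ⁻¹ * (α⁻¹ + α⁻¹ ^ 6)) * ((2 : ℝ) ^ i) ^ (-κ) + ε := by
  obtain ⟨C0, κ, hC0, hκ, hsh⟩ := hf.exists_shell_bound_sub hn hchain hup hlim
  obtain ⟨S, hS, htail⟩ := exists_tail_bound hκ
  refine ⟨S * (2 * C0), κ / 2, by positivity, by positivity, ?_⟩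
  intro ν hν α δ i0 hα hαR hδ hδ1 ε hε
  set Λ := δ + δ⁻¹ * (α⁻¹ + α⁻¹ ^ 6) with hΛ
  have hΛ0 : 0 ≤ Λ := by positivity
  obtain ⟨g0, hg0, -, -⟩ := hf.h1 0 le_rfl
  have hfree := tendsto_incoming_free (hg0.sub hupd) hν hα hαR
  filter_upwards [hfree.eventually (gt_mem_nhds hε), eventually_ge_atTop 0] with t htε ht Z hZ z hz
  set P : L2 := freeProp t (g0 - up') with hP
  have hcp := continuous_cutPoly hα ν (.X ^ 6)
  have hcn := continuous_cutPoly hα (-ν) (.X ^ 6)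
  have hkp := norm_cutPoly_X_pow_le hα ν 6
  have hkn := norm_cutPoly_X_pow_le hα (-ν) 6
  have hz2 : HasWeakDeriv 1 (u t - freeProp t (u 0) - Z : L2) (z - P : L2) := by
    have h := hz.sub ((hg0.sub hupd).freeProp t)
    have e : (u t - freeProp t up - Z - freeProp t (u 0 - up) : L2) = u t - freeProp t (u 0) - Z := by
      rw [freeProp_sub]; abel
    rwa [e] at h
  set F : L2 := mult (cutPoly α ν (.X ^ 6)) z + mult (cutPoly α (-ν) (.X ^ 6)) (z - P) with hF
  have hFt := htail F ν (2 * C0 * Λ) i0 hν (by positivity) fun i hi g hg hsupp => by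
    have hαi : 1 ≤ α * 2 ^ i := hαR.trans (mul_le_mul_of_nonneg_left (pow_le_pow_right₀ (by norm_num) hi) hα.le)
    have a1 := hsh ν 1 hν (Or.inl rfl) α δ i hα hαi hδ hδ1 g hg hsupp t ht Z hZ z (by simpa using hz)
    have a2 := hsh ν (-1) hν (Or.inr rfl) α δ i hα hαi hδ hδ1 g hg hsupp t ht Z hZ (z - P)
      (by rw [if_neg (by norm_num)]; exact hz2)
    rw [mul_one] at a1
    rw [mul_neg_one] at a2
    have e : ∫ x, F x * g x = (∫ x, (mult (cutPoly α ν (.X ^ 6)) z) x * g x)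
        + ∫ x, (mult (cutPoly α (-ν) (.X ^ 6)) (z - P)) x * g x := by
      rw [← integral_add (integrable_mul_of_memLp (Lp.memLp _) hg.memLp) (integrable_mul_of_memLp (Lp.memLp _) hg.memLp)]
      refine integral_congr_ae ?_
      filter_upwards [Lp.coeFn_add (mult (cutPoly α ν (.X ^ 6)) z) (mult (cutPoly α (-ν) (.X ^ 6)) (z - P))] with x hx
      rw [hF, hx, Pi.add_apply]; ring
    rw [e]
    refine (norm_add_le _ _).trans ((add_le_add a1 a2).trans_eq ?_)
    ring
  have hdecomp : z - mult (lowCut α 6) z = F + mult (cutPoly α (-ν) (.X ^ 6)) P := by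
    rw [hF, mult_sub hcn hkn, add_assoc, sub_add_cancel]
    refine fourierInv_injective (Lp.ext ?_)
    have hadd : (𝓕⁻ (mult (cutPoly α ν (.X ^ 6)) z + mult (cutPoly α (-ν) (.X ^ 6)) z : L2) : L2)
        = 𝓕⁻ (mult (cutPoly α ν (.X ^ 6)) z) + 𝓕⁻ (mult (cutPoly α (-ν) (.X ^ 6)) z) :=
      FourierTransform.fourierInv_add _ _
    rw [hadd]
    filter_upwards [fourierInv_sub_ae z (mult (lowCut α 6) z),
      fourierInv_mult_ae (continuous_lowCut hα 6) (norm_lowCut_le_nat hα (by norm_num)) z,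
      fourierInv_mult_ae hcp hkp z, fourierInv_mult_ae hcn hkn z,
      Lp.coeFn_add (𝓕⁻ (mult (cutPoly α ν (.X ^ 6)) z) : L2) (𝓕⁻ (mult (cutPoly α (-ν) (.X ^ 6)) z))] with ξ h1 h2 h3 h4 h5
    rw [h1, h2, h5, Pi.add_apply, h3, h4, lowCut]
    rcases hν with rfl | rfl
    · ring
    · rw [neg_neg]; ring
  have hXm : MeasurableSet {x : ℝ | (2 : ℝ) ^ i0 - 1 < ν * x} := measurableSet_lt measurable_const (by fun_prop)
  rw [hdecomp]
  refine (n2_indicator_add_le hXm _ _).trans (add_le_add (hFt.trans_eq ?_) htε.le)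
  ring

end Flow

theorem tendsto_pair_freeProp (h : L2) (η : SchwartzMap ℝ ℂ) :
    Tendsto (fun t => pair (freeProp t h) η) atTop (𝓝 0) := by
  have hr := rapidDecay_schwartz η
  rw [Metric.tendsto_nhds]
  intro ε hε
  obtain ⟨n, hn⟩ := ((tendsto_n2_lowCut hr (N := 6) (by norm_num)).eventually
    (gt_mem_nhds (show 0 < ε / (2 * (‖h‖ + 1)) by positivity))).exists
  set α := 1 / ((n : ℝ) + 1)
  have hα : 0 < α := by positivity
  have h1 := tendsto_pair_freeProp_zero h le_rfl hα (Or.inl rfl : (1 : ℝ) = 1 ∨ (1 : ℝ) = -1) η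
  have h2 := tendsto_pair_freeProp_zero h le_rfl hα (Or.inr rfl : (-1 : ℝ) = 1 ∨ (-1 : ℝ) = -1) η
  have h3 := (h1.add h2).norm
  rw [add_zero, norm_zero] at h3
  filter_upwards [h3.eventually (gt_mem_nhds (half_pos hε))] with t ht
  rw [dist_zero_right, pair_cutPoly_decomp _ hr hα (N := 6) (by norm_num)]
  have h4 := norm_pair_le' (freeProp t h) (hr.lowCut_mul hα (N := 6) (by norm_num))
  rw [norm_freeProp] at h4
  have h5 : ‖h‖ * n2 (fun ξ => lowCut α 6 ξ * η ξ) ≤ ε / 2 := by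
    calc _ ≤ ‖h‖ * (ε / (2 * (‖h‖ + 1))) := by gcongr
      _ ≤ (‖h‖ + 1) * (ε / (2 * (‖h‖ + 1))) := by gcongr; linarith
      _ = ε / 2 := by field_simp
  refine (norm_add_le _ _).trans_lt ?_
  linarith

theorem schwartz_integral_eq_pair (z : L2) (f : SchwartzMap ℝ ℂ) :
    ∫ x, z x * f x = pair z (𝓕 f : SchwartzMap ℝ ℂ) := by
  rw [pair, fourierInv_fourier_schwartz]

theorem integral_zero_L2_mul (f : ℝ → ℂ) : ∫ x, (0 : L2) x * f x = 0 := by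
  refine integral_eq_zero_of_ae ?_
  filter_upwards [Lp.coeFn_zero ℂ 2 volume] with x hx
  rw [hx, Pi.zero_apply, zero_mul]

/-- Free waves tend weakly to zero. -/
theorem tendsto_freeProp_weak (h f : L2) : Tendsto (fun t => ∫ x, (freeProp t h) x * f x) atTop (𝓝 0) := by
  have h0 := integral_zero_L2_mul
  have := tendsto_bilin_of_test (l := atTop) (z := fun t => freeProp t h) (z0 := 0) (M := ‖h‖)
    (fun t => (norm_freeProp t h).le) (by simp) (fun f => by
      simp only [schwartz_integral_eq_pair]
      have e : pair (0 : L2) (𝓕 f : SchwartzMap ℝ ℂ) = 0 := h0 _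
      rw [e]
      exact tendsto_pair_freeProp h _) f
  rwa [h0] at this

theorem HasWeakDeriv.norm_mult_lowCut_le {y z : L2} (h : HasWeakDeriv 1 y z) {α : ℝ} (hα : 0 < α) {N : ℕ} (hN : N ≠ 0) :
    ‖mult (lowCut α N) z‖ ≤ 2 * π * (N * α) * ‖y‖ := by
  rw [← norm_fourierInv_L2, ← norm_fourierInv_L2 y, ← n2_coe, ← n2_coe]
  refine n2_le_of_ae_le (Lp.memLp _) (by positivity) ?_
  filter_upwards [fourierInv_mult_ae (continuous_lowCut hα N) (norm_lowCut_le_nat hα hN) z, fourierInv_weakDeriv h]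
    with ξ h1 h2
  have e : lowCut α N ξ * (-(2 * π * Complex.I * ξ) * (𝓕⁻ y : L2) ξ)
      = -(2 * π * Complex.I) * ((ξ : ℂ) * lowCut α N ξ) * (𝓕⁻ y : L2) ξ := by ring
  rw [h1, h2, e, norm_mul, norm_mul]
  gcongr
  · simp [abs_of_pos Real.pi_pos]
  · exact norm_id_mul_lowCut_le hα hN ξ

theorem tendsto_weakDeriv {y z : ℕ → L2} (hd : ∀ j, HasWeakDeriv 1 (y j) (z j)) {M : ℝ} (hM0 : 0 ≤ M)
    (hM : ∀ j, ‖z j‖ ≤ M) (hy : ∀ f : L2, Tendsto (fun j => ∫ x, y j x * f x) atTop (𝓝 0)) (f : L2) :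
    Tendsto (fun j => ∫ x, z j x * f x) atTop (𝓝 0) := by
  have h0 := integral_zero_L2_mul
  have := tendsto_bilin_of_test (l := atTop) (z := z) (z0 := 0) (M := M) hM (by simpa using hM0) (fun f => by
    rw [h0]
    have hr := rapidDecay_schwartz (𝓕 f : SchwartzMap ℝ ℂ)
    have e : ∀ j, ∫ x, z j x * f x
        = -pair (y j) (fun ξ : ℝ => 2 * π * Complex.I * ((ξ : ℂ) * (𝓕 f : SchwartzMap ℝ ℂ) ξ)) := fun j => by
      rw [pair_weakDeriv (hd j) hr, neg_neg, schwartz_integral_eq_pair]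
    simp only [e, pair_eq_bilin _ (hr.id_mul.const_mul (2 * π * Complex.I))]
    simpa using (hy _).neg) f
  rwa [h0] at this

theorem n2_le_indicator_add {X Y : Set ℝ} (hX : MeasurableSet X) (hY : MeasurableSet Y) {f : ℝ → ℂ}
    (hf : MemLp f 2 volume) {T : Set ℝ} (hT : ∀ᵐ x : ℝ, x ∈ T → x ∈ X ∪ Y) :
    n2 (indicator T f) ≤ n2 (indicator X f) + n2 (indicator Y f) := by
  have hYX := hY.diff hX
  have h1 : n2 (indicator T f) ≤ n2 (fun x => indicator X f x + indicator (Y \ X) f x) := by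
    refine n2_mono ((hf.indicator hX).add (hf.indicator hYX)) ?_
    filter_upwards [hT] with x hx
    by_cases hxT : x ∈ T
    · by_cases hxX : x ∈ X
      · rw [indicator_of_mem hxT, indicator_of_mem hxX, indicator_of_notMem (fun h => h.2 hxX), add_zero]
      · have hxY : x ∈ Y \ X := ⟨(hx hxT).resolve_left hxX, hxX⟩
        rw [indicator_of_mem hxT, indicator_of_notMem hxX, indicator_of_mem hxY, zero_add]
    · rw [indicator_of_notMem hxT, norm_zero]
      positivity
  have h2 : n2 (indicator (Y \ X) f) ≤ n2 (indicator Y f) :=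
    n2_mono (hf.indicator hY) (ae_of_all _ fun x => norm_indicator_le_of_subset sdiff_subset f x)
  have h3 := n2_add_le (hf.indicator hX) (hf.indicator hYX)
  linarith

namespace Flow
variable {σ C M : ℝ} {V : ℝ → ℝ → ℂ} {u : ℝ → L2}

/-- Along a weakly convergent sequence of times, `u(t) - e^{-itΔ}u_+ - Z` tends to zero in `Ḣ¹`. -/
theorem tendsto_deriv_sub (hf : Flow σ C M V u) {n : ℕ} (hn : 1 ≤ n)
    (hchain : ∀ᵐ r ∂timeMeasure, ∃ W, PotChain σ C n W ∧ W 0 = V r) {up up' : L2} (hup : ‖up‖ ≤ M)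
    (hupd : HasWeakDeriv 1 up up') (hup' : ‖up'‖ ≤ M)
    (hlim : Scatters u up)
    {r : ℕ → ℝ} (hr0 : ∀ j, 0 ≤ r j) (hr : Tendsto r atTop atTop) {Z : L2} (hZ : Z ∈ omegaSet u)
    (hZlim : ∀ f : L2, Tendsto (fun j => ∫ x, u (r j) x * f x) atTop (𝓝 (∫ x, Z x * f x)))
    {z : ℕ → L2} (hz : ∀ j, HasWeakDeriv 1 (u (r j) - freeProp (r j) up - Z : L2) (z j)) :
    Tendsto (fun j => ‖z j‖) atTop (𝓝 0) := by
  obtain ⟨S, κ, hS, hκ, htail⟩ := hf.exists_tail_estimate hn hchain hup hupd hlim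
  have hM := hf.M_nonneg
  obtain ⟨hZM, Z', hZd, hZM'⟩ := hf.exists_deriv_of_mem_omegaSet hZ
  set y : ℕ → L2 := fun j => u (r j) - freeProp (r j) up - Z with hy
  have hyM : ∀ j, ‖y j‖ ≤ 3 * M := fun j => by
    have h1 := norm_sub_le (u (r j) - freeProp (r j) up) Z
    have h2 := norm_sub_le (u (r j)) (freeProp (r j) up)
    rw [norm_freeProp] at h2
    have h3 := hf.norm_le (hr0 j)
    simp only [hy]
    linarith
  have hzM : ∀ j, ‖z j‖ ≤ 3 * M := fun j => by
    obtain ⟨g, hg, hgM, hgM'⟩ := hf.h1 (r j) (hr0 j)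
    have e := (hz j).unique ((hg.sub (hupd.freeProp (r j))).sub hZd)
    have h1 := norm_sub_le (g - freeProp (r j) up') Z'
    have h2 := norm_sub_le g (freeProp (r j) up')
    rw [norm_freeProp] at h2
    rw [e]
    linarith
  have hyw : ∀ f : L2, Tendsto (fun j => ∫ x, y j x * f x) atTop (𝓝 0) := fun f => by
    have h1 := ((hZlim f).sub ((tendsto_freeProp_weak up f).comp hr)).sub_const (∫ x, Z x * f x)
    rw [sub_zero, sub_self] at h1
    refine h1.congr fun j => ?_
    have i : ∀ a : L2, Integrable fun x => a x * f x := fun a => integrable_mul_of_memLp (Lp.memLp _) (Lp.memLp _)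
    simp only [Function.comp]
    have i2 : Integrable fun x => u (r j) x * f x - (freeProp (r j) up) x * f x := (i _).sub (i _)
    rw [← integral_sub (i _) (i _), ← integral_sub i2 (i _)]
    refine integral_congr_ae ?_
    filter_upwards [Lp.coeFn_sub (u (r j) - freeProp (r j) up) Z, Lp.coeFn_sub (u (r j)) (freeProp (r j) up)] with x h2 h3
    simp only [hy]
    rw [h2, Pi.sub_apply, h3, Pi.sub_apply]; ring
  have hzw := tendsto_weakDeriv hz (by positivity) hzM hyw
  have hsq : ∀ ν : ℝ, (ν = 1 ∨ ν = -1) → ∀ i : ℕ, MeasurableSet {x : ℝ | (2 : ℝ) ^ i - 1 < ν * x} := fun ν _ i =>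
    measurableSet_lt measurable_const (by fun_prop)
  have h1p : (1 : ℝ) = 1 ∨ (1 : ℝ) = -1 := Or.inl rfl
  have h1n : (-1 : ℝ) = 1 ∨ (-1 : ℝ) = -1 := Or.inr rfl
  rw [Metric.tendsto_nhds]
  intro ε hε
  set e := ε / 16 with he
  have he0 : 0 < e := by positivity
  -- far out
  obtain ⟨α, hα, hα1⟩ : ∃ α : ℝ, 0 < α ∧ 2 * π * ((6 : ℕ) * α) * (3 * M) ≤ e := by
    refine ⟨e / (2 * π * 6 * (3 * M) + 1), by positivity, ?_⟩
    rw [show 2 * π * (((6 : ℕ) : ℝ) * (e / (2 * π * 6 * (3 * M) + 1))) * (3 * M)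
      = e * ((2 * π * 6 * (3 * M)) / (2 * π * 6 * (3 * M) + 1)) by push_cast; ring]
    refine mul_le_of_le_one_right he0.le ?_
    rw [div_le_one (by positivity)]
    linarith
  obtain ⟨i, hi1, hi2⟩ : ∃ i : ℕ, 1 ≤ α * 2 ^ i ∧ S * (1 + (1 : ℝ)⁻¹ * (α⁻¹ + α⁻¹ ^ 6)) * ((2 : ℝ) ^ i) ^ (-κ) ≤ e := by
    have hp : Tendsto (fun i : ℕ => (2 : ℝ) ^ i) atTop atTop := tendsto_pow_atTop_atTop_of_one_lt (by norm_num)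
    have l1 := (hp.const_mul_atTop hα).eventually_ge_atTop 1
    have l2 := ((tendsto_rpow_neg_atTop hκ).comp hp).const_mul (S * (1 + (1 : ℝ)⁻¹ * (α⁻¹ + α⁻¹ ^ 6)))
    rw [mul_zero] at l2
    obtain ⟨i, h1, h2⟩ := (l1.and (l2.eventually (gt_mem_nhds he0))).exists
    exact ⟨i, h1, h2.le⟩
  -- everywhere, high frequencies
  obtain ⟨δ, hδ, hδ1, hδS⟩ : ∃ δ : ℝ, 0 < δ ∧ δ ≤ 1 ∧ S * δ ≤ e / 2 := by
    refine ⟨min 1 (e / (2 * (S + 1))), by positivity, min_le_left _ _, ?_⟩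
    calc S * min 1 (e / (2 * (S + 1))) ≤ (S + 1) * (e / (2 * (S + 1))) :=
          mul_le_mul (by linarith) (min_le_right _ _) (by positivity) (by positivity)
      _ = e / 2 := by field_simp
  obtain ⟨β, hβ1, hβ2⟩ : ∃ β : ℝ, 1 ≤ β ∧ S * (δ⁻¹ * (β⁻¹ + β⁻¹ ^ 6)) < e / 2 := by
    have l1 : Tendsto (fun β : ℝ => S * (δ⁻¹ * (β⁻¹ + β⁻¹ ^ 6))) atTop (𝓝 0) := by
      have := tendsto_inv_atTop_zero (𝕜 := ℝ)
      simpa using ((this.add (this.pow 6)).const_mul δ⁻¹).const_mul S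
    obtain ⟨β, h1, h2⟩ := ((eventually_ge_atTop 1).and (l1.eventually (gt_mem_nhds (half_pos he0)))).exists
    exact ⟨β, h1, h2⟩
  have hβ : 0 < β := by linarith
  have q1 := hr.eventually (htail 1 h1p α 1 i hα hi1 one_pos le_rfl e he0)
  have q2 := hr.eventually (htail (-1) h1n α 1 i hα hi1 one_pos le_rfl e he0)
  have q3 := hr.eventually (htail 1 h1p β δ 0 hβ (by simpa using hβ1) hδ hδ1 e he0)
  have q4 := hr.eventually (htail (-1) h1n β δ 0 hβ (by simpa using hβ1) hδ hδ1 e he0)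
  set L : ℝ := 2 ^ i with hL
  have hloc := (tendsto_wt_mult (continuous_lowCut hβ 6) (norm_lowCut_le_nat hβ (by norm_num))
    (memLp_lowCut hβ (by norm_num)) hzM hzw).const_mul (jap L)
  rw [mul_zero] at hloc
  filter_upwards [q1, q2, q3, q4, hloc.eventually (gt_mem_nhds he0)] with j w1 w2 w3 w4 w5
  replace w1 := (w1 Z hZ (z j) (hz j)).trans (add_le_add_left hi2 e)
  replace w2 := (w2 Z hZ (z j) (hz j)).trans (add_le_add_left hi2 e)
  have hΛ : S * (δ + δ⁻¹ * (β⁻¹ + β⁻¹ ^ 6)) * ((2 : ℝ) ^ 0) ^ (-κ) ≤ e := by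
    rw [pow_zero, Real.one_rpow, mul_one, mul_add]
    linarith
  replace w3 := (w3 Z hZ (z j) (hz j)).trans (add_le_add_left hΛ e)
  replace w4 := (w4 Z hZ (z j) (hz j)).trans (add_le_add_left hΛ e)
  have hlow : ‖mult (lowCut α 6) (z j)‖ ≤ e :=
    ((hz j).norm_mult_lowCut_le hα (N := 6) (by norm_num)).trans
      ((mul_le_mul_of_nonneg_left (hyM j) (by positivity)).trans hα1)
  set X : Set ℝ := {x | x ≤ L ∧ -L ≤ x} with hX
  have hXm : MeasurableSet X := (measurableSet_le measurable_id measurable_const).inter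
    (measurableSet_le measurable_const measurable_id)
  have hfar : n2 (indicator Xᶜ (z j)) ≤ 5 * e := by
    have k1 : n2 (indicator Xᶜ (z j - mult (lowCut α 6) (z j) : L2)) ≤ 4 * e := by
      refine (n2_le_indicator_add (hsq 1 h1p i) (hsq (-1) h1n i) (Lp.memLp _) (ae_of_all _ fun x hx => ?_)).trans
        ((add_le_add w1 w2).trans_eq (by ring))
      rw [hX, mem_compl_iff, mem_ofPred_eq, not_and_or, not_le, not_le] at hx
      rcases hx with hx | hx
      · left
        show (2 : ℝ) ^ i - 1 < 1 * x
        linarith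
      · right
        show (2 : ℝ) ^ i - 1 < -1 * x
        linarith
    have k2 : n2 (indicator Xᶜ (mult (lowCut α 6) (z j))) ≤ e := by
      refine le_trans ?_ hlow
      rw [← n2_coe]
      exact n2_mono (Lp.memLp _) (ae_of_all _ fun x => norm_indicator_le_norm_self _ x)
    have k3 := n2_indicator_add_le hXm.compl (z j - mult (lowCut α 6) (z j)) (mult (lowCut α 6) (z j))
    rw [sub_add_cancel] at k3
    linarith
  have hnear : n2 (indicator X (z j)) ≤ 5 * e := by
    have k1 : n2 (indicator X (z j - mult (lowCut β 6) (z j) : L2)) ≤ 4 * e := by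
      refine (n2_le_indicator_add (hsq 1 h1p 0) (hsq (-1) h1n 0) (Lp.memLp _) ?_).trans
        ((add_le_add w3 w4).trans_eq (by ring))
      filter_upwards [compl_mem_ae_iff.2 (measure_singleton (0 : ℝ))] with x hx _
      rcases lt_or_gt_of_ne hx with h | h
      · right
        show (2 : ℝ) ^ 0 - 1 < -1 * x
        linarith
      · left
        show (2 : ℝ) ^ 0 - 1 < 1 * x
        linarith
    have k2 : n2 (indicator X (mult (lowCut β 6) (z j))) ≤ e := by
      refine le_trans ?_ w5.le
      refine n2_le_of_ae_le (memLp_wt_neg_one _) (jap_pos L).le (ae_of_all _ fun x => ?_)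
      by_cases hxX : x ∈ X
      · rw [indicator_of_mem hxX, norm_wt, ← mul_assoc]
        refine le_mul_of_one_le_left (norm_nonneg _) ?_
        rw [Real.rpow_neg_one, ← div_eq_mul_inv, one_le_div (jap_pos x)]
        refine Real.sqrt_le_sqrt ?_
        have : x ^ 2 ≤ L ^ 2 := sq_le_sq' hxX.2 hxX.1
        linarith
      · rw [indicator_of_notMem hxX, norm_zero]
        have := (jap_pos L).le
        positivity
    have k3 := n2_indicator_add_le hXm (z j - mult (lowCut β 6) (z j)) (mult (lowCut β 6) (z j))
    rw [sub_add_cancel] at k3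
    linarith
  rw [dist_zero_right, norm_norm, ← n2_coe, ← indicator_univ (z j : ℝ → ℂ)]
  have := n2_le_indicator_add hXm hXm.compl (Lp.memLp (z j)) (T := univ) (ae_of_all _ fun x _ => by simp)
  linarith

/-- The flow minus its free part approaches the set of weak limits in `Ḣ¹`. -/
theorem eventually_close (hf : Flow σ C M V u) {n : ℕ} (hn : 1 ≤ n)
    (hchain : ∀ᵐ r ∂timeMeasure, ∃ W, PotChain σ C n W ∧ W 0 = V r) {up up' : L2} (hup : ‖up‖ ≤ M)
    (hupd : HasWeakDeriv 1 up up') (hup' : ‖up'‖ ≤ M)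
    (hlim : Scatters u up)
    {ε : ℝ} (hε : 0 < ε) :
    ∀ᶠ t in atTop, ∃ Z ∈ omegaSet u, ∀ z : L2, HasWeakDeriv 1 (u t - freeProp t up - Z : L2) z → ‖z‖ < ε := by
  by_contra hcon
  rw [not_eventually] at hcon
  have hfr : ∀ j : ℕ, ∃ t : ℝ, (j : ℝ) ≤ t ∧
      ¬ ∃ Z ∈ omegaSet u, ∀ z : L2, HasWeakDeriv 1 (u t - freeProp t up - Z : L2) z → ‖z‖ < ε := fun j => by
    obtain ⟨t, h1, h2⟩ := (frequently_atTop.1 hcon) (j : ℝ)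
    exact ⟨t, h1, h2⟩
  choose r hrj hr using hfr
  have hrt : Tendsto r atTop atTop := tendsto_atTop_mono hrj tendsto_natCast_atTop_atTop
  obtain ⟨Z, ms, hZ, hms, hr0, hZlim⟩ := hf.exists_omega_subseq hrt
  have hbad : ∀ j, ∃ z : L2, HasWeakDeriv 1 (u (r (ms j)) - freeProp (r (ms j)) up - Z : L2) z ∧ ε ≤ ‖z‖ := fun j => by
    have := hr (ms j)
    push Not at this
    exact this Z hZ
  choose z hz hzε using hbad
  have := hf.tendsto_deriv_sub hn hchain hup hupd hup' hlim hr0 (hrt.comp hms) hZ hZlim hz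
  obtain ⟨j, hj⟩ := (this.eventually (gt_mem_nhds hε)).exists
  linarith [hzε j]

end Flow

theorem HasWeakDeriv.succ {k : ℕ} {f g h : ℝ → ℂ} (h1 : HasWeakDeriv k f g) (h2 : HasWeakDeriv 1 g h) :
    HasWeakDeriv (k + 1) f h := by
  refine ⟨h1.1, h2.2.1, fun φ hφ hc => ?_⟩
  have e1 := h1.2.2 (deriv φ) (contDiff_infty_iff_deriv.1 hφ).2 hc.deriv
  have e2 := h2.2.2 φ hφ hc
  rw [iteratedDeriv_one] at e2
  rw [iteratedDeriv_succ', e1, e2]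
  ring

theorem HasWeakDeriv.of_succ {k : ℕ} {f g h : ℝ → ℂ} (h1 : HasWeakDeriv k f g) (h2 : HasWeakDeriv (k + 1) f h) :
    HasWeakDeriv 1 g h := by
  refine ⟨h1.2.1, h2.2.1, fun φ hφ hc => ?_⟩
  have e1 := h1.2.2 (deriv φ) (contDiff_infty_iff_deriv.1 hφ).2 hc.deriv
  have e2 := h2.2.2 φ hφ hc
  rw [iteratedDeriv_succ', e1] at e2
  rw [iteratedDeriv_one]
  have h0 : ((-1 : ℂ)) ^ k ≠ 0 := pow_ne_zero _ (by norm_num)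
  refine mul_left_cancel₀ h0 ?_
  rw [e2]; ring

theorem HasWeakDeriv.zero_self {f : ℝ → ℂ} (hf : LocallyIntegrable f) : HasWeakDeriv 0 f f :=
  ⟨hf, hf, fun φ _ _ => by simp⟩

theorem Diff.hasWeakDeriv {n : ℕ} {z : L2} (h : Diff n z) : ∀ k ≤ n, HasWeakDeriv k z (wd^[k] z) := by
  intro k
  induction k with
  | zero => exact fun _ => HasWeakDeriv.zero_self ((Lp.memLp _).locallyIntegrable (by norm_num))
  | succ k ih => exact fun hk => (ih (by omega)).succ (h k (by omega))

instance : SecondCountableTopology L2 := by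
  have : Fact ((2 : ℝ≥0∞) ≠ ⊤) := ⟨by simp⟩
  exact Lp.SecondCountableTopology

/-- The norm of a weak derivative depends measurably on the function. -/
theorem measurable_norm_weakDeriv_sub {w A : ℝ → L2} (hd : ∀ t, HasWeakDeriv 1 (w t) (A t))
    (hw : ∀ g : ℝ → ℂ, IsTest g → Continuous fun t => ∫ x, w t x * g x) (c : L2) :
    Measurable fun t => ‖A t - c‖ := by
  refine measurable_of_Iic fun ρ => ?_
  rcases lt_or_ge ρ 0 with hρ | hρ
  · have : (fun t => ‖A t - c‖) ⁻¹' Iic ρ = ∅ := by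
      rw [eq_empty_iff_forall_notMem]
      intro t ht
      have : ‖A t - c‖ ≤ ρ := ht
      linarith [norm_nonneg (A t - c)]
    rw [this]
    exact MeasurableSet.empty
  have hi : ∀ (z : L2) (g : ℝ → ℂ), IsTest g → Integrable fun x => z x * g x := fun z g hg =>
    integrable_mul_of_memLp (Lp.memLp _) hg.memLp
  have hsub : ∀ (t : ℝ) (g : ℝ → ℂ), IsTest g → ∫ x, (A t - c : L2) x * g x
      = -(∫ x, w t x * deriv g x) - ∫ x, c x * g x := fun t g hg => by
    rw [(hd t).integral_deriv_test hg, neg_neg, ← integral_sub (hi _ _ hg) (hi _ _ hg)]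
    refine integral_congr_ae ?_
    filter_upwards [Lp.coeFn_sub (A t) c] with x hx
    rw [hx, Pi.sub_apply]; ring
  have heq : (fun t => ‖A t - c‖) ⁻¹' Iic ρ
      = ⋂ (g : ℝ → ℂ) (_ : IsTest g), {t | ‖-(∫ x, w t x * deriv g x) - ∫ x, c x * g x‖ ≤ ρ * n2 g} := by
    ext t
    simp only [mem_iInter, mem_preimage, mem_Iic]
    constructor
    · intro h g hg
      show ‖_‖ ≤ _
      rw [← hsub t g hg]
      refine (norm_integral_mul_le (Lp.memLp _) hg.memLp).trans ?_
      rw [n2_coe]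
      exact mul_le_mul_of_nonneg_right h (n2_nonneg _)
    · intro h
      have := n2_indicator_le_of_dual (A t - c) isOpen_univ hρ fun g hg _ => by
        rw [hsub t g hg]
        exact h g hg
      rwa [indicator_univ, n2_coe] at this
  rw [heq]
  refine IsClosed.measurableSet (isClosed_iInter fun g => isClosed_iInter fun hg => ?_)
  exact isClosed_le (((hw _ hg.deriv).neg.sub continuous_const).norm) continuous_const

namespace Flow
variable {σ C M : ℝ} {V : ℝ → ℝ → ℂ} {u : ℝ → L2}

theorem mono (hf : Flow σ C M V u) {C' : ℝ} (h : C ≤ C') : Flow σ C' M V u :=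
  { hf with
    C_nonneg := hf.C_nonneg.trans h
    bound := by
      filter_upwards [hf.bound] with s hs
      filter_upwards [hs] with x hx
      have := jap_pos x
      exact hx.trans (by gcongr) }

theorem continuous_pair_sub_free (hf : Flow σ C M V u) (up : L2) {g : ℝ → ℂ} (hg : IsTest g) :
    Continuous fun t : ℝ => ∫ x, (u (max t 0) - freeProp (max t 0) up : L2) x * g x := by
  have hr := hg.rapidDecay
  have hmax : Continuous fun t : ℝ => max t 0 := continuous_id.max continuous_const
  have e : ∀ t : ℝ, ∫ x, (u (max t 0) - freeProp (max t 0) up : L2) x * g x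
      = pair (u (max t 0)) (𝓕 g) - ∫ x, up x * (vec (hr.freeSymbol_mul (max t 0))) x := fun t => by
    rw [← hg.pair_fourier, pair_sub _ _ hr, pair_freeProp _ _ hr]
    congr 1
    refine integral_congr_ae ?_
    filter_upwards [(hr.freeSymbol_mul (max t 0)).memLp_fourierInv.coeFn_toLp] with x hx
    rw [vec, hx]
  simp only [e]
  have h1 : Continuous fun t : ℝ => pair (u (max t 0)) (𝓕 g) :=
    (hf.continuousOn_pair hr).comp_continuous hmax fun t => le_max_right t 0
  have h2 : Continuous fun t : ℝ => ∫ x, up x * (vec (hr.freeSymbol_mul (max t 0))) x :=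
    continuous_bilin.comp (continuous_const.prodMk (continuous_vec hr hmax))
  exact h1.sub h2

/-- Decomposition of the flow into a free wave, a localised regular part and a vanishing remainder. -/
theorem exists_local_part (hf : Flow σ C M V u) {θ : ℝ} (hθ0 : 0 < θ) (hθ1 : θ < 1) {n : ℕ} (hn : 1 ≤ n)
    (hchain : ∀ᵐ r ∂timeMeasure, ∃ W, PotChain σ C n W ∧ W 0 = V r) {up up' : L2} (hup : ‖up‖ ≤ M)
    (hupd : HasWeakDeriv 1 up up') (hup' : ‖up'‖ ≤ M)
    (hlim : Scatters u up) :
    ∃ uloc : ℝ → L2, IsLittleOHdot1 (fun t => u t - freeProp t up - uloc t) ∧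
      ∀ k : ℕ, 1 ≤ k → k ≤ n → WeightedDerivBounded (θ * k) k uloc := by
  set 𝒮 := omegaSet u with h𝒮
  have hrep : ∀ z ∈ 𝒮, Rep (sources σ C n 𝒮 0) z := fun z hz => hf.rep_of_mem_omegaSet hchain hup hlim hz
  obtain ⟨K1, hK1, hreg⟩ := exists_diff_bound hf.two_lt hf.C_nonneg hrep
    (fun z hz => (hf.exists_deriv_of_mem_omegaSet hz).1) n le_rfl
  obtain ⟨K2, hK2, hwt⟩ := exists_weighted_bounds hf.two_lt hf.C_nonneg hθ0 hθ1 hrep hreg n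
  have hne : (wd '' 𝒮).Nonempty := by
    obtain ⟨Z, -, hZ, -⟩ := hf.exists_omega_subseq tendsto_natCast_atTop_atTop
    exact ⟨_, Z, hZ, rfl⟩
  have : Nonempty (wd '' 𝒮) := hne.to_subtype
  have hex : ∀ i : ℕ, ∃ Z ∈ 𝒮, wd Z = (TopologicalSpace.denseSeq (wd '' 𝒮) i : L2) := fun i =>
    (TopologicalSpace.denseSeq (wd '' 𝒮) i).2
  choose e he hed using hex
  have hdense : ∀ Z ∈ 𝒮, ∀ ε > 0, ∃ i, ‖wd Z - wd (e i)‖ < ε := fun Z hZ ε hε => by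
    obtain ⟨i, hi⟩ := (TopologicalSpace.denseRange_denseSeq (wd '' 𝒮)).exists_dist_lt ⟨wd Z, Z, hZ, rfl⟩ hε
    refine ⟨i, ?_⟩
    rw [hed, ← dist_eq_norm]
    exact hi
  have hderiv : ∀ Z ∈ 𝒮, HasWeakDeriv 1 Z (wd Z) := fun Z hZ => by
    obtain ⟨-, Z', hd, -⟩ := hf.exists_deriv_of_mem_omegaSet hZ
    rwa [hd.wd_eq]
  have hA : ∀ t : ℝ, ∃ a : L2, HasWeakDeriv 1 (u (max t 0) - freeProp (max t 0) up : L2) a := fun t => by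
    obtain ⟨g, hg, -⟩ := hf.h1 (max t 0) (le_max_right _ _)
    exact ⟨_, hg.sub (hupd.freeProp _)⟩
  choose A hAd using hA
  have hmeas : ∀ i, Measurable fun t => ‖A t - wd (e i)‖ := fun i =>
    measurable_norm_weakDeriv_sub hAd (fun g hg => hf.continuous_pair_sub_free up hg) _
  set d : ℝ → ℝ := fun t => ⨅ i, ‖A t - wd (e i)‖ with hd
  have hdm : Measurable d := Measurable.iInf hmeas
  have hdle : ∀ t i, d t ≤ ‖A t - wd (e i)‖ := fun t i =>
    ciInf_le ⟨0, by rintro _ ⟨i, rfl⟩; exact norm_nonneg _⟩ i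
  have hfind : ∀ t, ∃ i, ‖A t - wd (e i)‖ < d t + (1 + |t|)⁻¹ := fun t =>
    exists_lt_of_ciInf_lt (lt_add_of_pos_right _ (by positivity))
  classical
  set ι : ℝ → ℕ := fun t => Nat.find (hfind t) with hι
  have hιm : Measurable ι := measurable_find hfind fun i =>
    measurableSet_lt (hmeas i) (hdm.add (by fun_prop))
  have hιs : ∀ t, ‖A t - wd (e (ι t))‖ < d t + (1 + |t|)⁻¹ := fun t => Nat.find_spec (hfind t)
  refine ⟨fun t => e (ι t), ⟨fun t => A t - wd (e (ι t)), fun t ht => ?_, ?_⟩, fun k hk1 hkn => ?_⟩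
  · have := hAd t
    rw [max_eq_left ht] at this
    exact this.sub (hderiv _ (he _))
  · rw [Metric.tendsto_nhds]
    intro ε hε
    have hε3 : 0 < ε / 3 := by positivity
    have hinv : Tendsto (fun t : ℝ => (1 + |t|)⁻¹) atTop (𝓝 0) :=
      tendsto_inv_atTop_zero.comp (tendsto_atTop_add_const_left _ _ tendsto_abs_atTop_atTop)
    filter_upwards [hf.eventually_close hn hchain hup hupd hup' hlim hε3, hinv.eventually (gt_mem_nhds hε3),
      eventually_ge_atTop 0] with t ⟨Z, hZ, hcl⟩ ht1 ht0
    have hAt := hAd t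
    rw [max_eq_left ht0] at hAt
    have h1 := hcl _ (hAt.sub (hderiv Z hZ))
    obtain ⟨i, hi⟩ := hdense Z hZ _ hε3
    have h2 := norm_sub_le_norm_sub_add_norm_sub (A t) (wd Z) (wd (e i))
    have h3 := hdle t i
    have h4 := hιs t
    rw [dist_zero_right, norm_norm]
    linarith
  · have hmin : min k n = k := by omega
    have hw : ∀ i, MemLp (wt (θ * k) (wd^[k] (e i))) 2 volume ∧ n2 (wt (θ * k) (wd^[k] (e i))) ≤ K2 := fun i => by
      have := hwt (e i) (he i) k hkn
      rwa [hmin] at this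
    refine ⟨fun t => wd^[k] (e (ι t)), fun t => (hw (ι t)).1.toLp _, fun t _ => ⟨?_, ?_⟩, ?_⟩
    · exact (hreg _ (he _)).1.hasWeakDeriv k hkn
    · exact (hw (ι t)).1.coeFn_toLp
    · refine memLp_top_of_bound ?_ K2 (ae_of_all _ fun t => ?_)
      · exact ((StronglyMeasurable.of_discrete (f := fun i => ((hw i).1.toLp _ : L2))).comp_measurable hιm).aestronglyMeasurable
      · rw [norm_toLp_eq_n2]
        exact (hw (ι t)).2

end Flow

theorem H1NormLE.exists_deriv {f : L2} {C : ℝ} (h : H1NormLE f C) :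
    ∃ g : L2, HasWeakDeriv 1 f g ∧ ‖f‖ ≤ C ∧ ‖g‖ ≤ C := by
  obtain ⟨g, hg, hC⟩ := h
  refine ⟨g, hg, le_trans (Real.le_sqrt_of_sq_le ?_) hC, le_trans (Real.le_sqrt_of_sq_le ?_) hC⟩
  · linarith [sq_nonneg ‖g‖]
  · linarith [sq_nonneg ‖f‖]

theorem le_rpow_of_jap_pow_mul_le {σ C x y : ℝ} {k : ℕ} (h : jap x ^ k * y ≤ C * jap x ^ (-σ)) :
    y ≤ C * jap x ^ (-σ - k) := by
  have hj := jap_pos x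
  rw [Real.rpow_sub hj, Real.rpow_natCast, mul_div_assoc', le_div_iff₀ (by positivity)]
  linarith

theorem PotentialDecay.exists_chain {σ : ℝ} {V : ℝ → ℝ → ℂ} (h : PotentialDecay σ V) :
    ∃ C, 0 ≤ C ∧ ∀ᵐ t ∂timeMeasure, ∃ W, PotChain σ C 1 W ∧ W 0 = V t := by
  obtain ⟨C, V', h⟩ := h
  refine ⟨max C 0, le_max_right _ _, ?_⟩
  filter_upwards [h] with t ⟨hd, hb⟩
  refine ⟨fun i => if i = 0 then V t else V' t, ⟨fun i _ => ?_, fun i hi => ?_, fun i hi => ?_⟩, rfl⟩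
  · split_ifs
    · exact hd.1.aestronglyMeasurable
    · exact hd.2.1.aestronglyMeasurable
  · obtain rfl : i = 0 := by omega
    exact hd
  · filter_upwards [hb] with x hx
    have hj := jap_pos x
    have hp : 0 < jap x ^ (-σ) := by positivity
    have hC : C * jap x ^ (-σ) ≤ max C 0 * jap x ^ (-σ) := by gcongr; exact le_max_left _ _
    refine le_rpow_of_jap_pow_mul_le (hx.trans' ?_ |>.trans hC)
    interval_cases i
    · simp only [pow_zero, one_mul, if_true]
      exact le_add_of_nonneg_right (by positivity)
    · simp only [pow_one, one_ne_zero, if_false]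
      exact le_add_of_nonneg_left (norm_nonneg _)

theorem SymbolBounds.exists_chain {σ : ℝ} {n : ℕ} {V : ℝ → ℝ → ℂ} (h : SymbolBounds σ n V) {C : ℝ}
    (hV : ∀ᵐ t ∂timeMeasure, ∃ W, PotChain σ C 1 W ∧ W 0 = V t) :
    ∃ C', C ≤ C' ∧ ∀ᵐ t ∂timeMeasure, ∃ W, PotChain σ C' n W ∧ W 0 = V t := by
  obtain ⟨C1, h⟩ := h
  choose! W hW using h
  refine ⟨max C C1, le_max_left _ _, ?_⟩
  have hall : ∀ᵐ t ∂timeMeasure, ∀ k, 1 ≤ k → k ≤ n → HasWeakDeriv k (V t) (W k t) ∧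
      ∀ᵐ x, jap x ^ k * ‖W k t x‖ ≤ C1 * jap x ^ (-σ) := by
    simp only [ae_all_iff]
    exact hW
  filter_upwards [hV, hall] with t ⟨U, hU, hU0⟩ ht
  have hloc : LocallyIntegrable (V t) := by
    rw [← hU0]
    exact (hU.deriv 0 one_pos).1
  have hd : ∀ k ≤ n, HasWeakDeriv k (V t) (if k = 0 then V t else W k t) := fun k hk => by
    split_ifs with h0
    · rw [h0]
      exact HasWeakDeriv.zero_self hloc
    · exact (ht k (by omega) hk).1
  refine ⟨fun k => if k = 0 then V t else W k t, ⟨fun k hk => (hd k hk).2.1.aestronglyMeasurable,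
    fun k hk => (hd k hk.le).of_succ (hd (k + 1) hk), fun k hk => ?_⟩, rfl⟩
  by_cases h0 : k = 0
  · subst h0
    filter_upwards [hU.bound 0 (Nat.zero_le 1)] with x hx
    have := jap_pos x
    rw [if_pos rfl, ← hU0]
    refine hx.trans ?_
    gcongr
    exact le_max_left _ _
  · filter_upwards [(ht k (by omega) hk).2] with x hx
    have := jap_pos x
    rw [if_neg h0]
    refine le_rpow_of_jap_pow_mul_le (hx.trans ?_)
    gcongr
    exact le_max_right _ _

end WeaklyBound

theorem theorem1p1 (σ : ℝ) (hσ : 2 < σ) (V : ℝ → ℝ → ℂ)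
    (hVmeas : AEStronglyMeasurable (Function.uncurry V)
      (WeaklyBound.timeMeasure.prod (volume : Measure ℝ)))
    (hV : WeaklyBound.PotentialDecay σ V)
    (u : ℝ → WeaklyBound.L2) (hu : WeaklyBound.IsSolution V u)
    (huH1 : ∃ M : ℝ, ∀ t : ℝ, 0 ≤ t → WeaklyBound.H1NormLE (u t) M)
    (θ : ℝ) (hθ0 : 0 < θ) (hθ1 : θ < 1) :
    ∃ uplus : WeaklyBound.L2, WeaklyBound.MemH1 uplus ∧
      (∃ uloc : ℝ → WeaklyBound.L2,
        WeaklyBound.IsLittleOHdot1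
          (fun t => u t - WeaklyBound.freeProp t uplus - uloc t) ∧
        WeaklyBound.WeightedDerivBounded θ 1 uloc) ∧
      (∀ n : ℕ, 1 < n → WeaklyBound.SymbolBounds σ n V →
        ∃ uloc : ℝ → WeaklyBound.L2,
          WeaklyBound.IsLittleOHdot1
            (fun t => u t - WeaklyBound.freeProp t uplus - uloc t) ∧
          ∀ k : ℕ, 1 ≤ k → k ≤ n → WeaklyBound.WeightedDerivBounded (θ * k) k uloc) := by
  obtain ⟨C, hC, hchain⟩ := hV.exists_chain
  obtain ⟨M, hM⟩ := huH1
  have h1 := fun t ht => (hM t ht).exists_deriv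
  have hf : WeaklyBound.Flow σ C M V u :=
    { two_lt := hσ
      C_nonneg := hC
      M_nonneg := by
        obtain ⟨g, -, h, -⟩ := h1 0 le_rfl
        exact (norm_nonneg _).trans h
      meas := hVmeas
      bound := by
        filter_upwards [hchain] with t ⟨W, hW, hW0⟩
        rw [← hW0]
        simpa using hW.bound 0 (Nat.zero_le 1)
      sol := hu
      h1 := h1 }
  obtain ⟨up, up', hupd, hup, hup', hlim⟩ := hf.exists_scattering_state
  refine ⟨up, ⟨_, up', hupd, le_rfl⟩, ?_, fun n hn hS => ?_⟩
  · obtain ⟨uloc, hr, hw⟩ := hf.exists_local_part hθ0 hθ1 le_rfl hchain hup hupd hup' hlim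
    exact ⟨uloc, hr, by simpa using hw 1 le_rfl le_rfl⟩
  · obtain ⟨C', hCC, hchain'⟩ := hS.exists_chain hchain
    exact (hf.mono hCC).exists_local_part hθ0 hθ1 hn.le hchain' hup hupd hup' hlim
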